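/- Let $p,q\in\mathbb{C}^*$ with $|p|<1$, $|q|<1$ and $|p|<|q|^{9}$. Put $(u;q)_\infty=\prod_{\nu\ge 0}(1-q^\nu u)$, $(u;p,q)_\infty=\prod_{\mu,\nu\ge 0}(1-p^\mu q^\nu u)$, and let $\Gamma(u)=\Gamma(u;p,q)=(pq/u;p,q)_\infty/(u;p,q)_\infty$ be the Ruijsenaars elliptic gamma function, with $\Gamma(u_1,\ldots,u_m)=\Gamma(u_1)\cdots\Gamma(u_m)$. For $a=(a_1,\ldots,a_5)\in(\mathbb{C}^*)^5$ and $z=(z_1,z_2)\in(\mathbb{C}^*)^2$ let $$\Phi_+(a;z)=\frac{\prod_{k=1}^5\Gamma(a_kz_2,\,a_kz_1z_2,\,a_kz_1z_2^2)}{\Gamma(z_2,\,z_1z_2,\,z_1z_2^2,\,z_1,\,z_1z_2^3,\,z_1^2z_2^3)},\qquad \Phi(a;z)=\Phi_+(a;z)\,\Phi_+(a;z^{-1}),$$ where $z^{-1}=(z_1^{-1},z_2^{-1})$, and, when $|a_1|,\ldots,|a_5|<1$, $$I(a)=\frac{1}{(2\pi\sqrt{-1})^2}\iint_{|z_1|=|z_2|=1}\Phi(a;z)\,\frac{dz_1}{z_1}\frac{dz_2}{z_2}.$$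 Let $$J(a)=\prod_{i=1}^5\frac{\Gamma(a_i^2)}{\Gamma(a_i)}\prod_{1\le i<j\le5}\Gamma(a_ia_j)\prod_{1\le i<j<k\le5}\Gamma(a_ia_ja_k)\prod_{1\le i<j<k<l\le5}\Gamma(a_ia_ja_ka_l)$$ and $$U_0=\{(a_1,\ldots,a_4)\in(\mathbb{C}^*)^4 : |a_1|<1,\ldots,|a_4|<1,\ |a_1a_2a_3a_4|>|p|^{1/2}|q|^{1/2}\}.$$ Then there is a constant $b\in\mathbb{C}$, independent of $a_1,\ldots,a_5$, namely $$b=\frac{12}{(p;p)_\infty^2(q;q)_\infty^2},$$ such that the following holds for each of the two square roots $c$ of $pq$. Under the balancing condition $(a_1a_2a_3a_4a_5)^2=pq$, with $a_5=c/(a_1a_2a_3a_4)$ regarded as a function of $(a_1,\ldots,a_4)$, the integral $I(a_1,\ldots,a_5)$ converges and is holomorphic on $U_0$, and $$I(a_1,\ldots,a_5)=b\,J(a_1,\ldots,a_5)\qquad\text{for all }(a_1,\ldots,a_4)\in U_0.$$ In particular, $I(a_1,\ldots,a_5)$, as a function of $(a_1,\ldots,a_4)\in U_0$, is continued to a meromorphic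 function on $(\mathbb{C}^*)^4$. -/

import Mathlib

namespace EllipticG2

open scoped BigOperators Real

noncomputable section

/-- The `q`-shifted factorial `(u; q)_∞ = ∏_{ν ≥ 0} (1 - q^ν u)`. -/
def qPoch (u q : ℂ) : ℂ := ∏' ν : ℕ, (1 - q ^ ν * u)

/-- The double shifted factorial `(u; p, q)_∞ = ∏_{μ, ν ≥ 0} (1 - p^μ q^ν u)`. -/
def pqPoch (u p q : ℂ) : ℂ := ∏' m : ℕ × ℕ, (1 - p ^ m.1 * q ^ m.2 * u)

/-- The Ruijsenaars elliptic gamma function `Γ(u; p, q) = (p q u⁻¹; p, q)_∞ / (u; p, q)_∞`.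
At a pole the Lean value is `0`; as `0⁻¹ = 0`, the expression `1 / Γ(u; p, q)` then still has
its correct value `0`. -/
def ellGamma (p q u : ℂ) : ℂ := pqPoch (p * q * u⁻¹) p q / pqPoch u p q

/-- The factor `Φ₊(a; z)` of the integrand, with `z = (z 0, z 1)` the coordinates attached to the
simple roots (`z 0` to the long one). -/
def PhiPlus (p q : ℂ) (a : Fin 5 → ℂ) (z : Fin 2 → ℂ) : ℂ :=
  (∏ k, ellGamma p q (a k * z 1) * ellGamma p q (a k * (z 0 * z 1)) *
      ellGamma p q (a k * (z 0 * z 1 ^ 2))) /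
    (ellGamma p q (z 1) * ellGamma p q (z 0 * z 1) * ellGamma p q (z 0 * z 1 ^ 2) *
      ellGamma p q (z 0) * ellGamma p q (z 0 * z 1 ^ 3) * ellGamma p q (z 0 ^ 2 * z 1 ^ 3))

/-- The integrand `Φ(a; z) = Φ₊(a; z) Φ₊(a; z⁻¹)`. -/
def Phi (p q : ℂ) (a : Fin 5 → ℂ) (z : Fin 2 → ℂ) : ℂ :=
  PhiPlus p q a z * PhiPlus p q a (fun i => (z i)⁻¹)

/-- The density `Φ(a; z) / (z₁ z₂)` of `Φ(a; z) (dz₁ / z₁) (dz₂ / z₂)` against `dz₁ dz₂`. -/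
def density (p q : ℂ) (a : Fin 5 → ℂ) (z : Fin 2 → ℂ) : ℂ :=
  Phi p q a z / (z 0 * z 1)

/-- The integral `I(a) = (2πi)⁻² ∬_{|z₁| = |z₂| = 1} Φ(a; z) (dz₁ / z₁) (dz₂ / z₂)`. -/
def integralI (p q : ℂ) (a : Fin 5 → ℂ) : ℂ :=
  1 / (2 * (π : ℂ) * Complex.I) ^ 2 * torusIntegral (density p q a) 0 1

/-- The product of `Γ(a_{i₁} ⋯ a_{i_m}; p, q)` over all `i₁ < ⋯ < i_m`. -/
def subsetGamma (p q : ℂ) (a : Fin 5 → ℂ) (m : ℕ) : ℂ :=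
  ∏ s ∈ Finset.powersetCard m (Finset.univ : Finset (Fin 5)), ellGamma p q (∏ i ∈ s, a i)

/-- The elliptic gamma product `J(a)`. -/
def productJ (p q : ℂ) (a : Fin 5 → ℂ) : ℂ :=
  (∏ i, ellGamma p q (a i ^ 2) / ellGamma p q (a i)) *
    subsetGamma p q a 2 * subsetGamma p q a 3 * subsetGamma p q a 4

/-- `(a₁, …, a₅)` as a function of `(a₁, …, a₄)` through `a₁ a₂ a₃ a₄ a₅ = c`. -/
def withLast (c : ℂ) (a : Fin 4 → ℂ) : Fin 5 → ℂ :=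
  ![a 0, a 1, a 2, a 3, c / (a 0 * a 1 * a 2 * a 3)]

/-- The algebraic torus `(ℂ*)⁴`. -/
def torusC4 : Set (Fin 4 → ℂ) := {a | ∀ i, a i ≠ 0}

/-- The domain `U₀ ⊆ (ℂ*)⁴`. -/
def domainU0 (p q : ℂ) : Set (Fin 4 → ℂ) :=
  {a | a ∈ torusC4 ∧ (∀ i, ‖a i‖ < 1) ∧ √‖p‖ * √‖q‖ < ‖∏ i, a i‖}

/-- `F` is (represents) a meromorphic function of several variables on the open set `U`: near each
point of `U` it is a quotient `g / h` of holomorphic functions, where `h` vanishes identically on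
no nonempty open set. No condition is put on the values of `F` at the zeros of `h`. -/
def IsMeromorphicOn {n : ℕ} (F : (Fin n → ℂ) → ℂ) (U : Set (Fin n → ℂ)) : Prop :=
  ∀ x ∈ U, ∃ V : Set (Fin n → ℂ), IsOpen V ∧ x ∈ V ∧ ∃ g h : (Fin n → ℂ) → ℂ,
    DifferentiableOn ℂ g V ∧ DifferentiableOn ℂ h V ∧ V ⊆ closure {y | y ∈ V ∧ h y ≠ 0} ∧
      ∀ y ∈ V, h y ≠ 0 → F y = g y / h y

end

end EllipticG2

/-!
The integral and the product side satisfy the same first order `q`-difference equations, their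
quotient is therefore constant, and the constant is found by letting parameters tend to the unit
circle.

In the coordinates `x, y, w` with `x y w = 1` given by the short roots of `G₂`, the integral is the
mean `torusMean` over a compact torus of `kernel`, a product of gamma functions over the short roots
times the Weyl denominators of theta functions in `p` and in `q` (`integralI_eq`).

For the `q`-difference equation of the integral, consider the function `seed`, which a contour shift
`x ↦ q x`, `y ↦ y / q` carries to minus its own reflection, so that its mean vanishes
(`torusMean_seed`). Up to gamma functions its antisymmetrization over the Weyl group is the theta
function `symNum`, which is identified in `symNum_eq` as a combination of the factors by which the
integrand changes when one parameter is multiplied by `q`. Both sides of that identity are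
antisymmetric theta functions of a fixed degree. Such a function vanishes on a line as soon as it
vanishes at three generic points of it (`IsAltTheta.eq_zero_on_line`), because the symmetries supply
the remaining zeros, and vanishes identically if it vanishes on two lines
(`IsAltTheta.eq_zero_of_lines`); at the test points most terms drop out and Weierstrass' relation
`theta_weierstrass` settles the rest. The product side satisfies the same equation
(`productJ_update`), so that the quotient `ratioIJ` is unchanged when one parameter is multiplied by
`q` and another one is divided by it (`ratioIJ_update`).

As a function of the coordinate of smallest modulus the quotient is holomorphic in an annulus, whose
ratio of radii is less than `|q|` because `|p| < |q| ^ 9`. Invariance under multiplication by `q`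
and the maximum principle make it constant (`eq_of_q_periodic`), and moving one coordinate at a time
gives constancy on `U₀` (`ratioIJ_withLast_eq`).

To find the constant, three parameters `r α₀, r α₁, r α₂` with `α₀ α₁ α₂ = 1` approach the unit
circle. Then six poles in each variable approach the torus, and the mean grows like
`1 / (1 - r ^ 3)` times the sum of the residues at the triples of poles that meet on it
(`tendsto_torusMean_poles`). For suitable roots of unity `αₖ` these triples form a single orbit of
the Weyl group, of order `12`. The product side has the factor `Γ(r ^ 3)` and grows at the same rate
(`tendsto_productJ`). Comparison gives the value in `ratioIJ_withLast`.

Finally, the product side is a quotient of products of entire functions of monomials in the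
parameters, none of whose denominators vanishes on an open set, so that it is meromorphic on the
whole torus (`isMeromorphicOn_productJ`).
-/

open scoped BigOperators Real
open Filter Topology

namespace EllipticG2

/-! ### Infinite products and the theta function -/

/-- The product `∏ (1 - c i * u)` over an index type `ι`, the common shape of `(u; q)_∞` and
`(u; p, q)_∞`. -/
noncomputable def linProd {ι : Type*} (c : ι → ℂ) (u : ℂ) : ℂ := ∏' i, (1 - c i * u)

section linProd

variable {ι : Type*} {c : ι → ℂ}

lemma multipliable_linProd (hc : Summable fun i => ‖c i‖) (u : ℂ) :
    Multipliable fun i => 1 - c i * u := by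
  have : Summable fun i => ‖-(c i * u)‖ := by
    simpa [norm_mul] using hc.mul_right ‖u‖
  simpa [sub_eq_add_neg] using multipliable_one_add_of_summable this

lemma linProd_ne_zero (hc : Summable fun i => ‖c i‖) {u : ℂ} (h : ∀ i, c i * u ≠ 1) :
    linProd c u ≠ 0 := by
  have : Summable fun i => ‖-(c i * u)‖ := by
    simpa [norm_mul] using hc.mul_right ‖u‖
  have := tprod_one_add_ne_zero_of_summable (f := fun i => -(c i * u))
    (fun i => by rw [← sub_eq_add_neg, sub_ne_zero]; exact (h i).symm) this
  simpa [linProd, sub_eq_add_neg] using this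

lemma linProd_eq_zero {u : ℂ} {i : ι} (h : c i * u = 1) : linProd c u = 0 := by
  apply tprod_of_exists_eq_zero
  exact ⟨i, by rw [h, sub_self]⟩

lemma linProd_eq_zero_iff (hc : Summable fun i => ‖c i‖) {u : ℂ} :
    linProd c u = 0 ↔ ∃ i, c i * u = 1 := by
  refine ⟨fun h => ?_, fun ⟨i, h⟩ => linProd_eq_zero h⟩
  by_contra! hn
  exact linProd_ne_zero hc hn h

lemma differentiable_linProd (hc : Summable fun i => ‖c i‖) : Differentiable ℂ (linProd c) := by
  intro u
  have hR : u ∈ Metric.ball (0 : ℂ) (‖u‖ + 1) := by simp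
  have h1 := Summable.hasProdLocallyUniformlyOn_one_add (f := fun i (u : ℂ) => -(c i * u))
    (K := Metric.ball (0 : ℂ) (‖u‖ + 1)) Metric.isOpen_ball (hc.mul_right (‖u‖ + 1))
    (Eventually.of_forall fun i x hx => by
      rw [norm_neg, norm_mul]
      exact mul_le_mul_of_nonneg_left (by simpa using (Metric.mem_ball.1 hx).le) (norm_nonneg _))
    (fun i => by fun_prop)
  rw [hasProdLocallyUniformlyOn_iff_tendstoLocallyUniformlyOn] at h1
  have h2 := h1.differentiableOn (Eventually.of_forall fun s => by fun_prop) Metric.isOpen_ball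
  have h3 := h2.differentiableAt (Metric.isOpen_ball.mem_nhds hR)
  have h4 : linProd c = fun x => ∏' i, (1 + -(c i * x)) := by
    funext x; simp [linProd, sub_eq_add_neg]
  rw [h4]
  exact h3

end linProd

variable {p q u : ℂ}

lemma summable_pow_norm (hq : ‖q‖ < 1) : Summable fun n : ℕ => ‖q ^ n‖ := by
  simpa using summable_geometric_of_lt_one (norm_nonneg q) hq

lemma summable_pow_mul_pow_norm (hp : ‖p‖ < 1) (hq : ‖q‖ < 1) :
    Summable fun m : ℕ × ℕ => ‖p ^ m.1 * q ^ m.2‖ :=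
  (summable_pow_norm hp).mul_norm (summable_pow_norm hq)

lemma qPoch_eq_zero_iff (hq : ‖q‖ < 1) : qPoch u q = 0 ↔ ∃ n : ℕ, q ^ n * u = 1 :=
  linProd_eq_zero_iff (summable_pow_norm hq)

lemma pqPoch_eq_zero_iff (hp : ‖p‖ < 1) (hq : ‖q‖ < 1) :
    pqPoch u p q = 0 ↔ ∃ m : ℕ × ℕ, p ^ m.1 * q ^ m.2 * u = 1 :=
  linProd_eq_zero_iff (summable_pow_mul_pow_norm hp hq)

lemma differentiable_qPoch (hq : ‖q‖ < 1) : Differentiable ℂ fun u => qPoch u q :=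
  differentiable_linProd (summable_pow_norm hq)

lemma differentiable_pqPoch (hp : ‖p‖ < 1) (hq : ‖q‖ < 1) :
    Differentiable ℂ fun u => pqPoch u p q :=
  differentiable_linProd (summable_pow_mul_pow_norm hp hq)

lemma qPoch_ne_zero (hq : ‖q‖ < 1) (hu : ‖u‖ < 1) : qPoch u q ≠ 0 := by
  rw [Ne, qPoch_eq_zero_iff hq]
  rintro ⟨n, hn⟩
  have h1 := congrArg norm hn
  rw [norm_mul, norm_pow, norm_one] at h1
  have : ‖q‖ ^ n ≤ 1 := pow_le_one₀ (norm_nonneg _) hq.le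
  nlinarith [norm_nonneg u]

lemma pqPoch_ne_zero (hp : ‖p‖ < 1) (hq : ‖q‖ < 1) (hu : ‖u‖ < 1) : pqPoch u p q ≠ 0 := by
  rw [Ne, pqPoch_eq_zero_iff hp hq]
  rintro ⟨m, hm⟩
  have h1 := congrArg norm hm
  rw [norm_mul, norm_mul, norm_pow, norm_pow, norm_one] at h1
  have : ‖p‖ ^ m.1 * ‖q‖ ^ m.2 ≤ 1 :=
    mul_le_one₀ (pow_le_one₀ (norm_nonneg _) hp.le) (by positivity)
      (pow_le_one₀ (norm_nonneg _) hq.le)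
  nlinarith [norm_nonneg u]

/-- `(u; q)_∞ = (1 - u) (q u; q)_∞`. -/
lemma qPoch_step (hq : ‖q‖ < 1) (u : ℂ) : qPoch u q = (1 - u) * qPoch (q * u) q := by
  have h := (multipliable_linProd (summable_pow_norm hq) (q * u))
  unfold qPoch
  rw [tprod_eq_zero_mul' (by simpa [pow_succ, mul_assoc] using h)]
  simp [pow_succ, mul_assoc]

lemma multipliable_row (hq : ‖q‖ < 1) (v : ℂ) (m : ℕ) :
    Multipliable fun n : ℕ => 1 - p ^ m * q ^ n * v := by
  refine (multipliable_linProd (summable_pow_norm hq) (p ^ m * v)).congr fun n => ?_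
  ring

lemma tprod_row (p q v : ℂ) (m : ℕ) : ∏' n : ℕ, (1 - p ^ m * q ^ n * v) = qPoch (p ^ m * v) q :=
  tprod_congr fun n => by ring

lemma hasProd_rows (hp : ‖p‖ < 1) (hq : ‖q‖ < 1) (v : ℂ) :
    HasProd (fun m : ℕ => qPoch (p ^ m * v) q) (pqPoch v p q) := by
  have h1 := (multipliable_linProd (summable_pow_mul_pow_norm hp hq) v).hasProd
  refine h1.prod_fiberwise fun m => ?_
  rw [← tprod_row]
  exact (multipliable_row hq v m).hasProd

/-- `(u; p, q)_∞ = (u; q)_∞ (p u; p, q)_∞`. -/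
lemma pqPoch_step_left (hp : ‖p‖ < 1) (hq : ‖q‖ < 1) (u : ℂ) :
    pqPoch u p q = qPoch u q * pqPoch (p * u) p q := by
  have h2 : HasProd (fun m : ℕ => qPoch (p ^ (m + 1) * u) q) (pqPoch (p * u) p q) := by
    simpa only [pow_succ, mul_assoc] using hasProd_rows hp hq (p * u)
  have h3 := h2.zero_mul (f := fun m : ℕ => qPoch (p ^ m * u) q)
  rw [pow_zero, one_mul] at h3
  exact (hasProd_rows hp hq u).unique h3

lemma pqPoch_comm (u p q : ℂ) : pqPoch u p q = pqPoch u q p := by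
  unfold pqPoch
  rw [← (Equiv.prodComm ℕ ℕ).tprod_eq]
  exact tprod_congr fun m => by simp [mul_comm (q ^ _)]

/-- `(u; p, q)_∞ = (u; p)_∞ (q u; p, q)_∞`. -/
lemma pqPoch_step_right (hp : ‖p‖ < 1) (hq : ‖q‖ < 1) (u : ℂ) :
    pqPoch u p q = qPoch u p * pqPoch (q * u) p q := by
  rw [pqPoch_comm, pqPoch_step_left hq hp, pqPoch_comm]

/-- The multiplicative theta function `θ(u; p) = (u; p)_∞ (p / u; p)_∞`. -/
noncomputable def theta (p u : ℂ) : ℂ := qPoch u p * qPoch (p * u⁻¹) p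

lemma theta_inv (hp : ‖p‖ < 1) (hu : u ≠ 0) : theta p u⁻¹ = -u⁻¹ * theta p u := by
  unfold theta
  rw [inv_inv, qPoch_step hp u, qPoch_step hp u⁻¹]
  field_simp
  ring

lemma theta_p_mul (hp : ‖p‖ < 1) (hp0 : p ≠ 0) (hu : u ≠ 0) :
    theta p (p * u) = -u⁻¹ * theta p u := by
  rw [← theta_inv hp hu]
  unfold theta
  rw [inv_inv, mul_inv, mul_inv_cancel_left₀ hp0, mul_comm]

lemma theta_one (hp : ‖p‖ < 1) : theta p 1 = 0 := by
  rw [theta, qPoch_step hp]; simp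

lemma theta_eq_zero (hp : ‖p‖ < 1) (hu : u ≠ 0) (h : theta p u = 0) : ∃ k : ℤ, u = p ^ k := by
  rcases mul_eq_zero.1 h with h | h
  · obtain ⟨n, hn⟩ := (qPoch_eq_zero_iff hp).1 h
    refine ⟨-n, ?_⟩
    rw [zpow_neg, zpow_natCast]
    exact (inv_eq_of_mul_eq_one_right hn).symm
  · obtain ⟨n, hn⟩ := (qPoch_eq_zero_iff hp).1 h
    refine ⟨n + 1, ?_⟩
    have : p ^ (n + 1) = u := by
      rw [← mul_assoc, mul_inv_eq_one₀ hu] at hn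
      rw [pow_succ, hn]
    rw [← this]; norm_cast

lemma differentiableAt_theta (hp : ‖p‖ < 1) (hu : u ≠ 0) : DifferentiableAt ℂ (theta p) u := by
  unfold theta
  have h := differentiable_qPoch hp
  have h2 : DifferentiableAt ℂ (fun u : ℂ => p * u⁻¹) u := by fun_prop (disch := assumption)
  exact (h u).mul (DifferentiableAt.comp (g := fun u => qPoch u p) u (h (p * u⁻¹)) h2)

/-! ### The elliptic gamma function -/

/-- `Γ(q u) = θ(u; p) Γ(u)`, inside the unit disc. -/
lemma ellGamma_q_mul (hp : ‖p‖ < 1) (hq : ‖q‖ < 1) (hq0 : q ≠ 0) (hu : ‖u‖ < 1) :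
    ellGamma p q (q * u) = theta p u * ellGamma p q u := by
  have h0 := qPoch_ne_zero hp hu
  have e1 : pqPoch (p * q * (q * u)⁻¹) p q
      = qPoch (p * u⁻¹) p * pqPoch (p * q * u⁻¹) p q := by
    rw [mul_inv, show p * q * (q⁻¹ * u⁻¹) = p * u⁻¹ by field_simp,
      pqPoch_step_right hp hq, show q * (p * u⁻¹) = p * q * u⁻¹ by ring]
  rw [ellGamma, ellGamma, e1, theta, pqPoch_step_right hp hq u]
  field_simp

/-- The product `1 / (Γ(u) Γ(1 / u))`, which by the reflection formula is the theta product
`θ(u; p) θ(1 / u; q)`. -/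
lemma inv_ellGamma_mul_inv (hp : ‖p‖ < 1) (hq : ‖q‖ < 1)
    (h1 : pqPoch (p * q * u⁻¹) p q ≠ 0) (h2 : pqPoch (p * q * u) p q ≠ 0) :
    (ellGamma p q u * ellGamma p q u⁻¹)⁻¹ = theta p u * theta q u⁻¹ := by
  have e1 : pqPoch u p q = qPoch u p * (qPoch (q * u) q * pqPoch (p * q * u) p q) := by
    rw [pqPoch_step_right hp hq, pqPoch_step_left hp hq (q * u), mul_assoc p q u]
  have e2 : pqPoch u⁻¹ p q
      = qPoch u⁻¹ q * (qPoch (p * u⁻¹) p * pqPoch (p * q * u⁻¹) p q) := by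
    rw [pqPoch_step_left hp hq, pqPoch_step_right hp hq (p * u⁻¹),
      show q * (p * u⁻¹) = p * q * u⁻¹ by ring]
  rw [ellGamma, ellGamma, inv_inv, div_mul_div_comm, inv_div, e1, e2, theta, theta, inv_inv]
  generalize pqPoch (p * q * u) p q = A at *
  generalize pqPoch (p * q * u⁻¹) p q = B at *
  rw [div_eq_iff (mul_ne_zero h1 h2)]
  ring

/-- The reflection formula `Γ(u) Γ(p q / u) = 1`. -/
lemma ellGamma_reflect (hpq : p * q ≠ 0) (h1 : pqPoch (p * q * u⁻¹) p q ≠ 0)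
    (h2 : pqPoch u p q ≠ 0) : ellGamma p q u * ellGamma p q (p * q * u⁻¹) = 1 := by
  rw [ellGamma, ellGamma, mul_inv, inv_inv, mul_inv_cancel_left₀ hpq]
  exact div_mul_div_cancel₀' h1 _ _ |>.trans (div_self h2)

lemma differentiableAt_ellGamma (hp : ‖p‖ < 1) (hq : ‖q‖ < 1) (hu : u ≠ 0)
    (h : pqPoch u p q ≠ 0) : DifferentiableAt ℂ (ellGamma p q) u := by
  unfold ellGamma
  have hd := differentiable_pqPoch hp hq
  have h2 : DifferentiableAt ℂ (fun u : ℂ => p * q * u⁻¹) u := by fun_prop (disch := assumption)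
  exact (DifferentiableAt.comp (g := fun u => pqPoch u p q) u (hd (p * q * u⁻¹)) h2).div (hd u) h

lemma ellGamma_ne_zero (h1 : pqPoch (p * q * u⁻¹) p q ≠ 0) (h2 : pqPoch u p q ≠ 0) :
    ellGamma p q u ≠ 0 := div_ne_zero h1 h2

/-- The elliptic gamma function with its pole at `u = 1` removed: `(1 - u) Γ(u)`, written so that
it is holomorphic there. -/
noncomputable def regGamma (p q u : ℂ) : ℂ :=
  pqPoch (p * q * u⁻¹) p q / (qPoch (q * u) q * pqPoch (p * u) p q)

lemma ellGamma_eq_regGamma (hp : ‖p‖ < 1) (hq : ‖q‖ < 1) (u : ℂ) :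
    ellGamma p q u = regGamma p q u * (1 - u)⁻¹ := by
  rw [ellGamma, regGamma, pqPoch_step_left hp hq u, qPoch_step hq u]
  rw [div_eq_mul_inv, div_eq_mul_inv, mul_inv, mul_inv, mul_inv]
  ring

lemma norm_mul_lt_one {p u : ℂ} (hp : ‖p‖ < 1) (hu : ‖u‖ ≤ 1) : ‖p * u‖ < 1 := by
  rw [norm_mul]; nlinarith [norm_nonneg p, norm_nonneg u]

lemma differentiableAt_regGamma (hp : ‖p‖ < 1) (hq : ‖q‖ < 1) (hu : u ≠ 0) (hu1 : ‖u‖ ≤ 1) :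
    DifferentiableAt ℂ (regGamma p q) u := by
  unfold regGamma
  have hd := differentiable_pqPoch hp hq
  have h2 : DifferentiableAt ℂ (fun u : ℂ => p * q * u⁻¹) u := by fun_prop (disch := assumption)
  refine (DifferentiableAt.comp (g := fun u => pqPoch u p q) u (hd (p * q * u⁻¹)) h2).div ?_
    (mul_ne_zero (qPoch_ne_zero hq (norm_mul_lt_one hq hu1))
    (pqPoch_ne_zero hp hq (norm_mul_lt_one hp hu1)))
  have a1 : DifferentiableAt ℂ (fun u : ℂ => qPoch (q * u) q) u :=
    ((differentiable_qPoch hq) (q * u)).comp (f := fun u => q * u) u (by fun_prop)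
  have a2 : DifferentiableAt ℂ (fun u : ℂ => pqPoch (p * u) p q) u :=
    (hd (p * u)).comp (f := fun u => p * u) u (by fun_prop)
  exact a1.mul a2

lemma regGamma_one (hp : ‖p‖ < 1) (hq : ‖q‖ < 1) :
    regGamma p q 1 = (qPoch p p * qPoch q q)⁻¹ := by
  have h1 : pqPoch (p * q) p q ≠ 0 := pqPoch_ne_zero hp hq (norm_mul_lt_one hp hq.le)
  rw [regGamma, mul_one, mul_one, inv_one, mul_one, pqPoch_step_right hp hq p, mul_comm q p]
  field_simp

end EllipticG2

namespace EllipticG2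

/-! ### Zeros of quasi-periodic functions -/

variable {p : ℂ}

/-- A holomorphic function that vanishes at the zeros of `t`, all of which are simple, is a
holomorphic multiple of `t`. -/
lemma exists_holomorphic_quotient {f t : ℂ → ℂ} {U : Set ℂ} (hU : IsOpen U)
    (hf : DifferentiableOn ℂ f U) (ht : DifferentiableOn ℂ t U)
    (hz : ∀ x ∈ U, t x = 0 → f x = 0 ∧ deriv t x ≠ 0) :
    ∃ g : ℂ → ℂ, DifferentiableOn ℂ g U ∧ ∀ x ∈ U, f x = t x * g x := by
  classical
  refine ⟨fun x => if t x = 0 then deriv f x / deriv t x else f x / t x, ?_, ?_⟩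
  · intro x hx
    apply DifferentiableAt.differentiableWithinAt
    have hUx := hU.mem_nhds hx
    by_cases h0 : t x = 0
    · obtain ⟨hfx, hdx⟩ := hz x hx h0
      have df := (Complex.differentiableOn_dslope hUx).2 hf
      have dt := (Complex.differentiableOn_dslope hUx).2 ht
      have hne : dslope t x x ≠ 0 := by rwa [dslope_same]
      have hq : DifferentiableAt ℂ (fun y => dslope f x y / dslope t x y) x :=
        (df.differentiableAt hUx).div (dt.differentiableAt hUx) hne
      refine hq.congr_of_eventuallyEq ?_
      have hev := (dt.differentiableAt hUx).continuousAt.eventually_ne hne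
      filter_upwards [hev] with y hy
      by_cases hyx : y = x
      · subst hyx
        simp [h0]
      · have hyx' : y - x ≠ 0 := sub_ne_zero.2 hyx
        rw [dslope_of_ne _ hyx, slope_def_field, h0, sub_zero] at hy
        have hty : t y ≠ 0 := fun h => hy (by simp [h])
        rw [if_neg hty, dslope_of_ne _ hyx, dslope_of_ne _ hyx, slope_def_field, slope_def_field,
          h0, hfx, sub_zero, sub_zero]
        field_simp
    · have hq : DifferentiableAt ℂ (fun y => f y / t y) x :=
        (hf.differentiableAt hUx).div (ht.differentiableAt hUx) h0
      refine hq.congr_of_eventuallyEq ?_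
      filter_upwards [(ht.differentiableAt hUx).continuousAt.eventually_ne h0] with y hy
      rw [if_neg hy]
  · intro x hx
    by_cases h0 : t x = 0
    · simp [h0, (hz x hx h0).1]
    · simp only [if_neg h0]
      field_simp

lemma theta_p_inv_mul (hp : ‖p‖ < 1) (hp0 : p ≠ 0) {u : ℂ} (hu : u ≠ 0) :
    theta p (p⁻¹ * u) = -(p⁻¹ * u) * theta p u := by
  have h := theta_p_mul hp hp0 (u := p⁻¹ * u) (by positivity)
  rw [mul_inv_cancel_left₀ hp0] at h
  rw [h]
  field_simp

/-- The zeros `p ^ k` of the theta function are simple. -/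
lemma exists_hasDerivAt_theta_zpow (hp : ‖p‖ < 1) (hp0 : p ≠ 0) (k : ℤ) :
    theta p (p ^ k) = 0 ∧ ∃ d, d ≠ 0 ∧ HasDerivAt (theta p) d (p ^ k) := by
  induction k with
  | zero =>
    refine ⟨by simpa using theta_one hp, ?_⟩
    have h1 : qPoch (p * 1) p ≠ 0 := qPoch_ne_zero hp (by simpa using hp)
    have h2 : qPoch (p * 1⁻¹) p ≠ 0 := qPoch_ne_zero hp (by simpa using hp)
    have e : theta p = fun u => (1 - u) * (qPoch (p * u) p * qPoch (p * u⁻¹) p) := by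
      funext u; rw [theta, qPoch_step hp u]; ring
    have hd := differentiable_qPoch hp
    have d1 : DifferentiableAt ℂ (fun u => qPoch (p * u) p) 1 :=
      DifferentiableAt.comp (g := fun u => qPoch u p) (1 : ℂ) (hd _) (by fun_prop)
    have d2 : DifferentiableAt ℂ (fun u => qPoch (p * u⁻¹) p) 1 :=
      DifferentiableAt.comp (g := fun u => qPoch u p) (1 : ℂ) (hd _)
        (by fun_prop (disch := norm_num))
    have := ((hasDerivAt_id (1 : ℂ)).const_sub 1).mul (d1.mul d2).hasDerivAt
    refine ⟨_, ?_, by rw [zpow_zero, e]; exact this⟩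
    simpa using h1
  | succ n ih =>
    obtain ⟨h0, d, hd, h⟩ := ih
    set u : ℂ := p ^ (n : ℤ) with hu
    have hu0 : u ≠ 0 := zpow_ne_zero _ hp0
    have e1 : p ^ ((n : ℤ) + 1) = p * u := by rw [zpow_add_one₀ hp0, mul_comm]
    rw [e1]
    refine ⟨by rw [theta_p_mul hp hp0 hu0, h0, mul_zero], -u⁻¹ * d * p⁻¹, by
      simp [hd, hu0, hp0], ?_⟩
    have e2 : ∀ v : ℂ, v ≠ 0 → theta p v = -(p⁻¹ * v)⁻¹ * theta p (p⁻¹ * v) := fun v hv => by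
      rw [← theta_p_mul hp hp0 (by positivity), mul_inv_cancel_left₀ hp0]
    have hpu : p * u ≠ 0 := mul_ne_zero hp0 hu0
    have hl : HasDerivAt (fun v : ℂ => p⁻¹ * v) (p⁻¹) (p * u) := by
      simpa using (hasDerivAt_id (p * u)).const_mul p⁻¹
    have ee : p⁻¹ * (p * u) = u := inv_mul_cancel_left₀ hp0 u
    have hc : HasDerivAt (fun v : ℂ => theta p (p⁻¹ * v)) (d * p⁻¹) (p * u) :=
      HasDerivAt.comp (h₂ := theta p) (p * u) (by rwa [ee]) hl
    have hi : HasDerivAt (fun v : ℂ => -(p⁻¹ * v)⁻¹) _ (p * u) :=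
      (hl.inv (by rw [ee]; exact hu0)).neg
    have := hi.mul hc
    rw [ee, h0, mul_zero, zero_add, ← mul_assoc] at this
    refine this.congr_of_eventuallyEq ?_
    filter_upwards [eventually_ne_nhds hpu] with v hv using e2 v hv
  | pred n ih =>
    obtain ⟨h0, d, hd, h⟩ := ih
    set u : ℂ := p ^ (-(n : ℤ)) with hu
    have hu0 : u ≠ 0 := zpow_ne_zero _ hp0
    have e1 : p ^ (-(n : ℤ) - 1) = p⁻¹ * u := by rw [zpow_sub_one₀ hp0, mul_comm]
    rw [e1]
    have hpu : p⁻¹ * u ≠ 0 := mul_ne_zero (inv_ne_zero hp0) hu0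
    refine ⟨by rw [theta_p_inv_mul hp hp0 hu0, h0, mul_zero], -(p⁻¹ * u) * d * p, by
      simp [hd, hu0, hp0], ?_⟩
    have e2 : ∀ v : ℂ, v ≠ 0 → theta p v = -v * theta p (p * v) := fun v hv => by
      rw [theta_p_mul hp hp0 hv]; field_simp
    have ee : p * (p⁻¹ * u) = u := mul_inv_cancel_left₀ hp0 u
    have hl : HasDerivAt (fun v : ℂ => p * v) p (p⁻¹ * u) := by
      simpa using (hasDerivAt_id (p⁻¹ * u)).const_mul p
    have hc : HasDerivAt (fun v : ℂ => theta p (p * v)) (d * p) (p⁻¹ * u) :=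
      HasDerivAt.comp (h₂ := theta p) (p⁻¹ * u) (by rwa [ee]) hl
    have := (hasDerivAt_id (p⁻¹ * u)).neg.mul hc
    rw [ee, h0, mul_zero, zero_add, ← mul_assoc] at this
    refine this.congr_of_eventuallyEq ?_
    filter_upwards [eventually_ne_nhds hpu] with v hv using e2 v hv

/-- A holomorphic function on `ℂ*` with `f (p x) = C x ^ k f x`, `k ≥ 1`, vanishes: it is bounded
near the origin, and comparing leading terms there in the functional equation gives a
contradiction. -/
lemma eq_zero_of_quasiperiodic_pos (hp : ‖p‖ < 1) (hp0 : p ≠ 0) {f : ℂ → ℂ} {C : ℂ} {k : ℕ}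
    (hk : k ≠ 0) (hf : DifferentiableOn ℂ f {0}ᶜ)
    (hq : ∀ x, x ≠ 0 → f (p * x) = C * x ^ k * f x) : ∀ x, x ≠ 0 → f x = 0 := by
  obtain ⟨ρ, hρ, hρC⟩ : ∃ ρ : ℝ, 0 < ρ ∧ ∀ x : ℂ, ‖x‖ ≤ ρ → ‖C * x ^ k‖ ≤ 1 := by
    have hc : Tendsto (fun x : ℂ => ‖C * x ^ k‖) (𝓝 0) (𝓝 0) := by
      have : Continuous fun x : ℂ => ‖C * x ^ k‖ := by fun_prop
      simpa [hk] using this.tendsto 0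
    obtain ⟨ε, hε, h⟩ := Metric.eventually_nhds_iff.1 (hc.eventually (gt_mem_nhds one_pos))
    exact ⟨ε / 2, by positivity, fun x hx => (h (by rw [dist_zero_right]; linarith)).le⟩
  have hpn : 0 < ‖p‖ := norm_pos_iff.2 hp0
  set A : Set ℂ := Metric.closedBall 0 ρ \ Metric.ball 0 (‖p‖ * ρ)
  have hA : IsCompact A := (isCompact_closedBall 0 ρ).diff Metric.isOpen_ball
  have hAf : ContinuousOn f A := hf.continuousOn.mono fun x hx h0 => by
    rw [Set.mem_singleton_iff] at h0
    subst h0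
    exact hx.2 (by simp; positivity)
  obtain ⟨B, hB⟩ := hA.exists_bound_of_continuousOn hAf
  have hdec : ∀ (m : ℕ) (x : ℂ), x ≠ 0 → ‖x‖ ≤ ρ → ‖f (p ^ m * x)‖ ≤ ‖f x‖ := by
    intro m
    induction m with
    | zero => intro x _ _; simp
    | succ m ih =>
      intro x hx hxρ
      have h1 : ‖p * x‖ ≤ ρ := by rw [norm_mul]; nlinarith [norm_nonneg x]
      have h2 := ih (p * x) (mul_ne_zero hp0 hx) h1
      rw [hq x hx, norm_mul, ← mul_assoc, ← pow_succ] at h2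
      exact h2.trans (mul_le_of_le_one_left (norm_nonneg _) (hρC x hxρ))
  have hbd : ∀ y : ℂ, y ≠ 0 → ‖y‖ ≤ ρ → ‖f y‖ ≤ B := by
    intro y hy hyρ
    obtain ⟨m, hm1, hm2⟩ := exists_nat_pow_near_of_lt_one (x := ‖y‖ / ρ)
      (by positivity) ((div_le_one hρ).2 hyρ) hpn hp
    have hx0 : (p ^ m)⁻¹ * y ≠ 0 := by positivity
    have hxn : ‖(p ^ m)⁻¹ * y‖ = ‖y‖ / ‖p‖ ^ m := by
      rw [norm_mul, norm_inv, norm_pow, div_eq_inv_mul]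
    have hpm : 0 < ‖p‖ ^ m := by positivity
    have hxρ : ‖(p ^ m)⁻¹ * y‖ ≤ ρ := by
      rw [hxn, div_le_iff₀ hpm]
      rwa [div_le_iff₀ hρ, mul_comm] at hm2
    have hxA : (p ^ m)⁻¹ * y ∈ A := by
      refine ⟨by simpa using hxρ, ?_⟩
      rw [Metric.mem_ball, dist_zero_right, not_lt, hxn, le_div_iff₀ hpm]
      rw [lt_div_iff₀ hρ, pow_succ] at hm1
      nlinarith
    have := hdec m _ hx0 hxρ
    rw [mul_inv_cancel_left₀ (pow_ne_zero _ hp0)] at this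
    exact this.trans (hB _ hxA)
  have hball : Metric.ball (0 : ℂ) ρ ∈ 𝓝 (0 : ℂ) := Metric.ball_mem_nhds _ hρ
  have hrem := Complex.differentiableOn_update_limUnder_of_bddAbove (f := f) hball
    (hf.mono fun x hx => hx.2) ⟨B, by
      rintro _ ⟨x, hx, rfl⟩
      exact hbd x hx.2 (by simpa using (Metric.mem_ball.1 hx.1).le)⟩
  set F := Function.update f 0 (limUnder (𝓝[≠] 0) f)
  have hF : ∀ x, x ≠ 0 → F x = f x := fun x hx => Function.update_of_ne hx _ _
  have hFd : Differentiable ℂ F := fun x => by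
    by_cases hx : x = 0
    · subst hx; exact hrem.differentiableAt hball
    · refine (hf.differentiableAt (isOpen_compl_singleton.mem_nhds hx)).congr_of_eventuallyEq ?_
      filter_upwards [eventually_ne_nhds hx] with y hy using hF y hy
  have hFa : AnalyticAt ℂ F 0 := hFd.analyticAt 0
  have hev : ∀ᶠ z in 𝓝 (0 : ℂ), F z = 0 := by
    by_contra hne
    obtain ⟨n, g, hg, hg0, hgz⟩ := (hFa.exists_eventuallyEq_pow_smul_nonzero_iff).2 hne
    simp only [sub_zero, smul_eq_mul] at hgz
    have hmul : Tendsto (fun z : ℂ => p * z) (𝓝 0) (𝓝 0) := by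
      have : Continuous fun z : ℂ => p * z := by fun_prop
      simpa using this.tendsto 0
    -- the leading coefficient satisfies `p ^ n g(0) = C 0 ^ k g(0) = 0`
    have hlim : ∀ᶠ z in 𝓝[≠] (0 : ℂ), p ^ n * g (p * z) = C * z ^ k * g z := by
      have h1 := hgz.filter_mono (nhdsWithin_le_nhds (s := {0}ᶜ))
      have h2 := (hmul.eventually hgz).filter_mono (nhdsWithin_le_nhds (s := {0}ᶜ))
      filter_upwards [h1, h2, self_mem_nhdsWithin] with z hz1 hz2 hz0
      have hz0 : z ≠ 0 := hz0
      rw [hF z hz0] at hz1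
      rw [hF _ (mul_ne_zero hp0 hz0), hq z hz0, hz1] at hz2
      have hzn : z ^ n ≠ 0 := pow_ne_zero _ hz0
      apply mul_left_cancel₀ hzn
      rw [mul_pow] at hz2
      linear_combination -hz2
    have hgc := hg.continuousAt
    have t1 : Tendsto (fun z => p ^ n * g (p * z)) (𝓝[≠] 0) (𝓝 (p ^ n * g 0)) :=
      ((hgc.tendsto.comp hmul).const_mul _).mono_left nhdsWithin_le_nhds
    have t2 : Tendsto (fun z => C * z ^ k * g z) (𝓝[≠] 0) (𝓝 (C * 0 ^ k * g 0)) := by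
      have hz : Tendsto (fun z : ℂ => C * z ^ k) (𝓝 0) (𝓝 (C * 0 ^ k)) := by
        have : Continuous fun z : ℂ => C * z ^ k := by fun_prop
        exact this.tendsto 0
      exact (hz.mul hgc.tendsto).mono_left nhdsWithin_le_nhds
    have := tendsto_nhds_unique (t1.congr' hlim) t2
    rw [zero_pow hk, mul_zero, zero_mul] at this
    exact mul_ne_zero (pow_ne_zero _ hp0) hg0 this
  intro x hx
  have hall := (hFd.differentiableOn (s := Set.univ)).analyticOnNhd isOpen_univ
  have := hall.eqOn_zero_of_preconnected_of_eventuallyEq_zero isPreconnected_univ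
    (Set.mem_univ 0) hev (Set.mem_univ x)
  rw [← hF x hx]; exact this

lemma quasiperiodic_zero_zpow (hp0 : p ≠ 0) {f : ℂ → ℂ} {C : ℂ} {n : ℤ} (hC : C ≠ 0)
    (hq : ∀ x, x ≠ 0 → f (p * x) = C * x ^ (-n) * f x) {r : ℂ} (hr : r ≠ 0) (h : f r = 0)
    (k : ℤ) : f (p ^ k * r) = 0 := by
  induction k with
  | zero => simpa using h
  | succ m ih =>
    rw [zpow_add_one₀ hp0, mul_comm (p ^ (m : ℤ)), mul_assoc, hq _ (by positivity), ih, mul_zero]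
  | pred m ih =>
    have h1 := hq (p ^ (-(m : ℤ) - 1) * r) (by positivity)
    rw [← mul_assoc, ← zpow_one_add₀ hp0, add_sub_cancel, ih] at h1
    have : C * (p ^ (-(m : ℤ) - 1) * r) ^ (-n) ≠ 0 := by positivity
    exact (mul_eq_zero.1 h1.symm).resolve_left this

/-- A holomorphic function on `ℂ*` with `f (p x) = C x ^ (-n) f x` that has more than `n` zeros
modulo `p ^ ℤ` vanishes identically. The zeros are divided out one by one with theta functions. -/
theorem eq_zero_of_quasiperiodic (hp : ‖p‖ < 1) (hp0 : p ≠ 0) (R : List ℂ) :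
    ∀ {f : ℂ → ℂ} {C : ℂ} {n : ℤ}, C ≠ 0 → DifferentiableOn ℂ f {0}ᶜ →
      (∀ x, x ≠ 0 → f (p * x) = C * x ^ (-n) * f x) → n < R.length →
      (∀ r ∈ R, r ≠ 0 ∧ f r = 0) → R.Pairwise (fun r s => ∀ k : ℤ, s ≠ p ^ k * r) →
      ∀ x, x ≠ 0 → f x = 0 := by
  induction R with
  | nil =>
    intro f C n hC hf hq hn _ _
    simp only [List.length_nil, Nat.cast_zero] at hn
    obtain ⟨k, hk⟩ := Int.eq_ofNat_of_zero_le (show 0 ≤ -n by omega)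
    refine eq_zero_of_quasiperiodic_pos hp hp0 (C := C) (k := k) (by omega) hf fun x hx => ?_
    rw [hq x hx, hk]; simp
  | cons r R ih =>
    intro f C n hC hf hq hn hR hpw
    rw [List.pairwise_cons] at hpw
    obtain ⟨hr0, hfr⟩ := hR r List.mem_cons_self
    have hne : ∀ x : ℂ, x ∈ ({0}ᶜ : Set ℂ) → x * r⁻¹ ≠ 0 := fun x hx =>
      mul_ne_zero hx (inv_ne_zero hr0)
    obtain ⟨g, hg, hfg⟩ := exists_holomorphic_quotient (f := f)
      (t := fun x => theta p (x * r⁻¹)) isOpen_compl_singleton hf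
      (fun x hx => (DifferentiableAt.comp (g := theta p) x (differentiableAt_theta hp (hne x hx))
        (by fun_prop)).differentiableWithinAt)
      (fun x hx h0 => by
        obtain ⟨k, hk⟩ := theta_eq_zero hp (hne x hx) h0
        have hx' : x = p ^ k * r := by rw [← hk]; field_simp
        refine ⟨by rw [hx']; exact quasiperiodic_zero_zpow hp0 hC hq hr0 hfr k, ?_⟩
        obtain ⟨-, d, hd, h⟩ := exists_hasDerivAt_theta_zpow hp hp0 k
        have hl : HasDerivAt (fun x : ℂ => x * r⁻¹) r⁻¹ x := by
          simpa using (hasDerivAt_id x).mul_const r⁻¹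
        have := HasDerivAt.comp (h₂ := theta p) x (by rw [hk]; exact h) hl
        rw [show (fun x => theta p (x * r⁻¹)) = theta p ∘ fun x => x * r⁻¹ from rfl, this.deriv]
        exact mul_ne_zero hd (inv_ne_zero hr0))
    have hgz : ∀ x, x ≠ 0 → g x = 0 := by
      refine ih (C := -C * r⁻¹) (n := n - 1) (by simp [hC, hr0]) hg ?_
        (by simp only [List.length_cons, Nat.cast_add, Nat.cast_one] at hn; omega) ?_ hpw.2
      · -- off the zeros of the theta factor this is a division; at the zeros this follows
        -- by continuity
        have key : ∀ x, x ≠ 0 → theta p (x * r⁻¹) ≠ 0 →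
            g (p * x) = -C * r⁻¹ * x ^ (-(n - 1)) * g x := by
          intro x hx ht
          have h1 := hq x hx
          rw [hfg x hx, hfg (p * x) (mul_ne_zero hp0 hx), mul_assoc p,
            theta_p_mul hp hp0 (hne x hx)] at h1
          have h2 : theta p (x * r⁻¹) * (x * r⁻¹)⁻¹ ≠ 0 := by
            have := hne x hx
            positivity
          apply mul_left_cancel₀ h2
          have h3 : x ^ (-(n - 1)) = x ^ (-n) * x := by
            rw [← zpow_add_one₀ hx]; congr 1; ring
          rw [h3]
          have h4 : (x * r⁻¹)⁻¹ * r⁻¹ * x = 1 := by field_simp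
          linear_combination -h1 + C * x ^ (-n) * theta p (x * r⁻¹) * g x * h4
        intro x hx
        have hgc : ∀ y, y ≠ 0 → ContinuousAt g y := fun y hy =>
          (hg.differentiableAt (isOpen_compl_singleton.mem_nhds hy)).continuousAt
        by_cases ht : theta p (x * r⁻¹) = 0
        · have hnz : ∀ᶠ y in 𝓝[≠] x, theta p (y * r⁻¹) ≠ 0 := by
            obtain ⟨k, hk⟩ := theta_eq_zero hp (hne x hx) ht
            obtain ⟨-, d, hd, h⟩ := exists_hasDerivAt_theta_zpow hp hp0 k
            have hl : HasDerivAt (fun x : ℂ => x * r⁻¹) r⁻¹ x := by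
              simpa using (hasDerivAt_id x).mul_const r⁻¹
            have := HasDerivAt.comp (h₂ := theta p) x (by rw [hk]; exact h) hl
            exact this.eventually_ne (mul_ne_zero hd (inv_ne_zero hr0))
          have hev : ∀ᶠ y in 𝓝[≠] x, g (p * y) = -C * r⁻¹ * y ^ (-(n - 1)) * g y := by
            filter_upwards [hnz, (eventually_ne_nhds hx).filter_mono nhdsWithin_le_nhds]
              with y hy1 hy2 using key y hy2 hy1
          have t1 : Tendsto (fun y => g (p * y)) (𝓝[≠] x) (𝓝 (g (p * x))) := by
            have : ContinuousAt (fun y => g (p * y)) x :=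
              ContinuousAt.comp (g := g) (hgc _ (mul_ne_zero hp0 hx)) (by fun_prop)
            exact this.tendsto.mono_left nhdsWithin_le_nhds
          have t2 : Tendsto (fun y => -C * r⁻¹ * y ^ (-(n - 1)) * g y) (𝓝[≠] x)
              (𝓝 (-C * r⁻¹ * x ^ (-(n - 1)) * g x)) := by
            have : ContinuousAt (fun y => -C * r⁻¹ * y ^ (-(n - 1)) * g y) x :=
              (continuousAt_const.mul (continuousAt_zpow₀ _ _ (Or.inl hx))).mul (hgc x hx)
            exact this.tendsto.mono_left nhdsWithin_le_nhds
          exact tendsto_nhds_unique (t1.congr' hev) t2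
        · exact key x hx ht
      · intro s hs
        obtain ⟨hs0, hfs⟩ := hR s (List.mem_cons_of_mem _ hs)
        refine ⟨hs0, ?_⟩
        rw [hfg s hs0] at hfs
        refine (mul_eq_zero.1 hfs).resolve_left fun h => ?_
        obtain ⟨k, hk⟩ := theta_eq_zero hp (hne s hs0) h
        exact hpw.1 s hs k (by rw [← hk]; field_simp)
    intro x hx
    rw [hfg x hx, hgz x hx, mul_zero]

/-- Weierstrass' three-term relation for theta functions. -/
theorem theta_weierstrass (hp : ‖p‖ < 1) (hp0 : p ≠ 0) {x y u v : ℂ} (hx : x ≠ 0) (hy : y ≠ 0)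
    (hu : u ≠ 0) (hv : v ≠ 0) (h1 : ∀ k : ℤ, u⁻¹ ≠ p ^ k * u) (h2 : ∀ k : ℤ, y ≠ p ^ k * u)
    (h3 : ∀ k : ℤ, y ≠ p ^ k * u⁻¹) :
    theta p (x * y) * theta p (x * y⁻¹) * theta p (u * v) * theta p (u * v⁻¹)
      - theta p (x * v) * theta p (x * v⁻¹) * theta p (u * y) * theta p (u * y⁻¹)
      = u * y⁻¹ * (theta p (y * v) * theta p (y * v⁻¹) * theta p (x * u) * theta p (x * u⁻¹)) := by
  have hd : ∀ a : ℂ, a ≠ 0 → DifferentiableOn ℂ (fun x => theta p (x * a)) {0}ᶜ :=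
    fun a ha x hx => (DifferentiableAt.comp (g := theta p) (f := fun x => x * a) x
      (differentiableAt_theta hp (mul_ne_zero (Set.mem_compl_singleton_iff.1 hx) ha))
      (by fun_prop)).differentiableWithinAt
  have key := eq_zero_of_quasiperiodic hp hp0 [u, u⁻¹, y] (n := 2) (C := 1)
    (f := fun x => theta p (x * y) * theta p (x * y⁻¹) * theta p (u * v) * theta p (u * v⁻¹)
      - theta p (x * v) * theta p (x * v⁻¹) * theta p (u * y) * theta p (u * y⁻¹)
      - u * y⁻¹ * (theta p (y * v) * theta p (y * v⁻¹) * theta p (x * u) * theta p (x * u⁻¹)))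
    one_ne_zero ?_ ?_ (by norm_num) ?_ ?_ x hx
  · exact sub_eq_zero.1 key
  · have := hd y hy
    have := hd _ (inv_ne_zero hy)
    have := hd v hv
    have := hd _ (inv_ne_zero hv)
    have := hd u hu
    have := hd _ (inv_ne_zero hu)
    fun_prop
  · intro x hx
    have e : ∀ a : ℂ, a ≠ 0 → theta p (p * x * a) = -(x * a)⁻¹ * theta p (x * a) := fun a ha => by
      rw [mul_assoc, theta_p_mul hp hp0 (mul_ne_zero hx ha)]
    simp only [e y hy, e _ (inv_ne_zero hy), e v hv, e _ (inv_ne_zero hv), e u hu,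
      e _ (inv_ne_zero hu)]
    have hz : x ^ (-2 : ℤ) = (x ^ 2)⁻¹ := by rw [zpow_neg]; norm_cast
    rw [hz]
    field_simp
  · have i1 : theta p (u⁻¹ * v⁻¹) = -(u * v)⁻¹ * theta p (u * v) := by
      rw [← mul_inv, theta_inv hp (mul_ne_zero hu hv)]
    have i2 : theta p (u⁻¹ * y⁻¹) = -(u * y)⁻¹ * theta p (u * y) := by
      rw [← mul_inv, theta_inv hp (mul_ne_zero hu hy)]
    have i3 : theta p (u⁻¹ * v) = -(u * v⁻¹)⁻¹ * theta p (u * v⁻¹) := by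
      rw [← theta_inv hp (by positivity), mul_inv, inv_inv]
    have i4 : theta p (u⁻¹ * y) = -(u * y⁻¹)⁻¹ * theta p (u * y⁻¹) := by
      rw [← theta_inv hp (by positivity), mul_inv, inv_inv]
    have i5 : theta p (y * u⁻¹) = -(u * y⁻¹)⁻¹ * theta p (u * y⁻¹) := by
      rw [← theta_inv hp (by positivity), mul_inv, inv_inv, mul_comm]
    simp only [List.mem_cons, List.not_mem_nil, or_false, forall_eq_or_imp, forall_eq]
    refine ⟨⟨hu, ?_⟩, ⟨inv_ne_zero hu, ?_⟩, hy, ?_⟩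
    · simp only [mul_inv_cancel₀ hu, theta_one hp]; ring
    · simp only [inv_mul_cancel₀ hu, theta_one hp, i1, i2, i3, i4]; field_simp; ring
    · simp only [mul_inv_cancel₀ hy, theta_one hp, i5, mul_comm y u]; field_simp; ring
  · simp only [List.pairwise_cons, List.mem_cons, List.not_mem_nil, or_false, forall_eq_or_imp,
      forall_eq, false_implies, implies_true, List.Pairwise.nil, and_true]
    exact ⟨⟨h1, h2⟩, h3⟩

end EllipticG2

namespace EllipticG2

/-! ### Weyl-antisymmetric theta functions of type `G₂` -/

variable {p : ℂ}

/-- A function of `(x, y, w)`, thought of on `x y w = 1`, that is antisymmetric under permutations,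
invariant under inversion (so antisymmetric under the Weyl group of `G₂`), holomorphic, and
quasi-periodic of degree `12` in each direction of the lattice. -/
structure IsAltTheta (p : ℂ) (E : ℂ → ℂ → ℂ → ℂ) : Prop where
  swap12 : ∀ x y w, x ≠ 0 → y ≠ 0 → w ≠ 0 → E y x w = -E x y w
  swap23 : ∀ x y w, x ≠ 0 → y ≠ 0 → w ≠ 0 → E x w y = -E x y w
  inv : ∀ x y w, x ≠ 0 → y ≠ 0 → w ≠ 0 → x * y * w = 1 → E x⁻¹ y⁻¹ w⁻¹ = E x y w
  shift : ∀ x y w, x ≠ 0 → y ≠ 0 → w ≠ 0 → E x (p * y) (p⁻¹ * w) = (w * (p * y)⁻¹) ^ 6 * E x y w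
  diff : ∀ x, x ≠ 0 → DifferentiableOn ℂ (fun y => E x y (x * y)⁻¹) {0}ᶜ

/-- Data recording that `‖x‖² = ‖w‖ ^ i ‖u‖ ^ j ‖v‖ ^ l ‖p‖ ^ e`, in logarithmic form. -/
def HasExponents (p w u v x : ℂ) (i j l e : ℤ) : Prop :=
  2 * Real.log ‖x‖ = i * Real.log ‖w‖ + j * Real.log ‖u‖ + l * Real.log ‖v‖ + e * Real.log ‖p‖

/-- The moduli of `w`, `u`, `v`, `p` are multiplicatively independent relative to `p`: no nontrivial
monomial in `w`, `u`, `v` has the modulus of a power of `p`. -/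
def IsGeneric (p w u v : ℂ) : Prop :=
  ∀ i j l k : ℤ, i * Real.log ‖w‖ + j * Real.log ‖u‖ + l * Real.log ‖v‖ = k * Real.log ‖p‖ →
    i = 0 ∧ j = 0 ∧ l = 0

lemma log_norm_ne_zero (hp : ‖p‖ < 1) (hp0 : p ≠ 0) : Real.log ‖p‖ ≠ 0 :=
  (Real.log_neg (norm_pos_iff.2 hp0) hp).ne

lemma ne_zpow_mul_of_exponents (hp : ‖p‖ < 1) (hp0 : p ≠ 0) {w u v x y : ℂ}
    (hg : IsGeneric p w u v) (hx0 : x ≠ 0) {i j l e i' j' l' e' : ℤ}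
    (hx : HasExponents p w u v x i j l e) (hy : HasExponents p w u v y i' j' l' e')
    (h : ¬(i = i' ∧ j = j' ∧ l = l') ∨ (e - e') % 2 ≠ 0) (k : ℤ) : y ≠ p ^ k * x := by
  intro hk
  have hpk : p ^ k ≠ 0 := zpow_ne_zero _ hp0
  have h1 : Real.log ‖y‖ = k * Real.log ‖p‖ + Real.log ‖x‖ := by
    rw [hk, norm_mul, Real.log_mul (norm_ne_zero_iff.2 hpk) (norm_ne_zero_iff.2 hx0), norm_zpow,
      Real.log_zpow]
  unfold HasExponents at hx hy
  obtain ⟨a1, a2, a3⟩ := hg (i' - i) (j' - j) (l' - l) (2 * k + e - e')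
    (by push_cast; linear_combination hx - hy + 2 * h1)
  have h2 : ((2 * k + e - e' : ℤ) : ℝ) * Real.log ‖p‖ = 0 := by
    have b1 : (i : ℝ) = i' := by exact_mod_cast (by omega : i = i')
    have b2 : (j : ℝ) = j' := by exact_mod_cast (by omega : j = j')
    have b3 : (l : ℝ) = l' := by exact_mod_cast (by omega : l = l')
    rw [b1, b2, b3] at hx
    push_cast
    linear_combination hx * (-1) + hy - 2 * h1
  have h3 : (2 * k + e - e' : ℤ) = 0 := by
    have := (mul_eq_zero.1 h2).resolve_right (log_norm_ne_zero hp hp0)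
    exact_mod_cast this
  omega

lemma neg_ne_zpow_mul (hp : ‖p‖ < 1) (hp0 : p ≠ 0) {x : ℂ} (hx : x ≠ 0) (k : ℤ) :
    -x ≠ p ^ k * x := by
  intro h
  have h1 : p ^ k = -1 := mul_right_cancel₀ hx (by linear_combination -h)
  have h2 := congrArg (fun z => Real.log ‖z‖) h1
  simp only [norm_zpow, Real.log_zpow, norm_neg, norm_one, Real.log_one] at h2
  have h3 : (k : ℝ) = 0 := (mul_eq_zero.1 h2).resolve_right (log_norm_ne_zero hp hp0)
  have h4 : k = 0 := by exact_mod_cast h3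
  rw [h4, zpow_zero] at h1
  norm_num at h1

lemma IsAltTheta.eq_zero_of_eq {E : ℂ → ℂ → ℂ → ℂ} (hE : IsAltTheta p E) {x y : ℂ} (hx : x ≠ 0)
    (hy : y ≠ 0) : E x y y = 0 := by
  have := hE.swap23 x y y hx hy hy
  exact self_eq_neg.1 this

/-- An antisymmetric theta function vanishing at three generic points of the line `x = w` vanishes
on the whole line. -/
theorem IsAltTheta.eq_zero_on_line (hp : ‖p‖ < 1) (hp0 : p ≠ 0) {E : ℂ → ℂ → ℂ → ℂ}
    (hE : IsAltTheta p E) {w u v : ℂ} (hw : w ≠ 0) (hu : u ≠ 0) (hv : v ≠ 0)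
    (hg : IsGeneric p w u v) (h1 : E w u (w * u)⁻¹ = 0) (h2 : E w u⁻¹ (w * u⁻¹)⁻¹ = 0)
    (h3 : E w v (w * v)⁻¹ = 0) : ∀ y, y ≠ 0 → E w y (w * y)⁻¹ = 0 := by
  obtain ⟨s, hs⟩ := IsAlgClosed.exists_pow_nat_eq w⁻¹ (n := 2) two_pos
  obtain ⟨t, ht⟩ := IsAlgClosed.exists_pow_nat_eq (p * w⁻¹) (n := 2) two_pos
  have hw' := inv_ne_zero hw
  have hs0 : s ≠ 0 := fun h => hw' (by rw [← hs, h]; simp)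
  have ht0 : t ≠ 0 := fun h => mul_ne_zero hp0 hw' (by rw [← ht, h]; simp)
  -- the zeros pair up under the reflection `y ↦ (w y)⁻¹` of the line
  have pair : ∀ r, r ≠ 0 → E w r (w * r)⁻¹ = 0 → E w (w * r)⁻¹ (w * (w * r)⁻¹)⁻¹ = 0 := by
    intro r hr h
    rw [show (w * (w * r)⁻¹)⁻¹ = r by field_simp,
      hE.swap23 w r (w * r)⁻¹ hw hr (by positivity), h, neg_zero]
  have swap13 : ∀ x y z, x ≠ 0 → y ≠ 0 → z ≠ 0 → E z y x = -E x y z := by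
    intro x y z hx hy hz
    rw [hE.swap12 y z x hy hz hx, hE.swap23 y x z hy hx hz, hE.swap12 x y z hx hy hz, neg_neg]
  have zs : ∀ s : ℂ, s ^ 2 = w⁻¹ → s ≠ 0 → E w s (w * s)⁻¹ = 0 := by
    intro s hs hs0
    have : (w * s)⁻¹ = s := by
      rw [inv_eq_of_mul_eq_one_left]; linear_combination w * hs + mul_inv_cancel₀ hw
    rw [this]; exact hE.eq_zero_of_eq hw hs0
  have zt : ∀ t : ℂ, t ^ 2 = p * w⁻¹ → t ≠ 0 → E w t (w * t)⁻¹ = 0 := by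
    intro t ht ht0
    have h4 := hE.shift w (p⁻¹ * t) t hw (by positivity) ht0
    rw [mul_inv_cancel_left₀ hp0, mul_inv_cancel₀ ht0, one_pow, one_mul,
      hE.swap23 w t (p⁻¹ * t) hw ht0 (by positivity)] at h4
    have : (w * t)⁻¹ = p⁻¹ * t := by
      apply inv_eq_of_mul_eq_one_left
      rw [show p⁻¹ * t * (w * t) = p⁻¹ * w * t ^ 2 by ring, ht]
      field_simp
    rw [this]; exact self_eq_neg.1 h4
  refine eq_zero_of_quasiperiodic hp hp0
    [1, w⁻¹, w, (w * w)⁻¹, s, -s, t, -t, u, (w * u)⁻¹, u⁻¹, (w * u⁻¹)⁻¹, v]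
    (f := fun y => E w y (w * y)⁻¹) (C := ((p * w)⁻¹) ^ 6) (n := 12) (by positivity) (hE.diff w hw)
    ?_ (by norm_num) ?_ ?_
  · intro y hy
    have := hE.shift w y (w * y)⁻¹ hw hy (by positivity)
    rw [show (w * (p * y))⁻¹ = p⁻¹ * (w * y)⁻¹ by field_simp, this]
    have hz : y ^ (-12 : ℤ) = (y ^ 12)⁻¹ := by rw [zpow_neg]; norm_cast
    rw [hz]
    field_simp
  · simp only [List.mem_cons, List.not_mem_nil, or_false, forall_eq_or_imp, forall_eq]
    have h11 : E w 1 (w * 1)⁻¹ = 0 := by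
      have a := hE.inv w 1 w⁻¹ hw one_ne_zero hw' (by field_simp)
      rw [inv_inv, inv_one, swap13 w 1 w⁻¹ hw one_ne_zero hw'] at a
      rw [mul_one]; exact self_eq_neg.1 a.symm
    have h12 : E w w (w * w)⁻¹ = 0 := self_eq_neg.1 (hE.swap12 w w (w * w)⁻¹ hw hw (by positivity))
    have h13 := pair 1 one_ne_zero h11
    rw [mul_one] at h13
    refine ⟨⟨one_ne_zero, h11⟩, ⟨hw', h13⟩, ⟨hw, h12⟩, ⟨by positivity, pair w hw h12⟩,
      ⟨hs0, zs s hs hs0⟩, ⟨neg_ne_zero.2 hs0, zs _ (by rw [neg_sq, hs]) (neg_ne_zero.2 hs0)⟩,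
      ⟨ht0, zt t ht ht0⟩, ⟨neg_ne_zero.2 ht0, zt _ (by rw [neg_sq, ht]) (neg_ne_zero.2 ht0)⟩,
      ⟨hu, h1⟩, ⟨by positivity, pair u hu h1⟩, ⟨inv_ne_zero hu, h2⟩,
      ⟨by positivity, pair _ (inv_ne_zero hu) h2⟩, hv, h3⟩
  · have ls : 2 * Real.log ‖s‖ = -Real.log ‖w‖ := by
      have := congrArg (fun z => Real.log ‖z‖) hs
      simpa using this
    have lt : 2 * Real.log ‖t‖ = Real.log ‖p‖ - Real.log ‖w‖ := by
      have := congrArg (fun z => Real.log ‖z‖) ht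
      simp only [norm_pow, Real.log_pow, norm_mul, norm_inv] at this
      rw [Real.log_mul (by simpa using hp0) (by simpa using hw), Real.log_inv] at this
      simpa [sub_eq_add_neg] using this
    have lm : ∀ a b : ℂ, a ≠ 0 → b ≠ 0 → Real.log ‖a * b‖ = Real.log ‖a‖ + Real.log ‖b‖ :=
      fun a b ha hb => by
        rw [norm_mul, Real.log_mul (norm_ne_zero_iff.2 ha) (norm_ne_zero_iff.2 hb)]
    have li : ∀ a : ℂ, Real.log ‖a⁻¹‖ = -Real.log ‖a‖ := fun a => by rw [norm_inv, Real.log_inv]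
    have hui := inv_ne_zero hu
    have e1 : HasExponents p w u v 1 0 0 0 0 := by simp [HasExponents]
    have e2 : HasExponents p w u v w⁻¹ (-2) 0 0 0 := by
      simp only [HasExponents, li]; push_cast; ring
    have e3 : HasExponents p w u v w 2 0 0 0 := by simp [HasExponents]
    have e4 : HasExponents p w u v (w * w)⁻¹ (-4) 0 0 0 := by
      simp only [HasExponents, li, lm w w hw hw]; push_cast; ring
    have e5 : HasExponents p w u v s (-1) 0 0 0 := by
      simp only [HasExponents, ls]; push_cast; ring
    have e6 : HasExponents p w u v (-s) (-1) 0 0 0 := by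
      simp only [HasExponents, norm_neg, ls]; push_cast; ring
    have e7 : HasExponents p w u v t (-1) 0 0 1 := by
      simp only [HasExponents, lt]; push_cast; ring
    have e8 : HasExponents p w u v (-t) (-1) 0 0 1 := by
      simp only [HasExponents, norm_neg, lt]; push_cast; ring
    have e9 : HasExponents p w u v u 0 2 0 0 := by simp [HasExponents]
    have e10 : HasExponents p w u v (w * u)⁻¹ (-2) (-2) 0 0 := by
      simp only [HasExponents, li, lm w u hw hu]; push_cast; ring
    have e11 : HasExponents p w u v u⁻¹ 0 (-2) 0 0 := by
      simp only [HasExponents, li]; push_cast; ring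
    have e12 : HasExponents p w u v (w * u⁻¹)⁻¹ (-2) 2 0 0 := by
      simp only [HasExponents, li, lm w _ hw hui]; push_cast; ring
    have e13 : HasExponents p w u v v 0 0 2 0 := by simp [HasExponents]
    have hu1 : (w * u)⁻¹ ≠ 0 := by positivity
    have hu2 : (w * u⁻¹)⁻¹ ≠ 0 := by positivity
    have hww : (w * w)⁻¹ ≠ 0 := by positivity
    have ns := neg_ne_zero.2 hs0
    have nt := neg_ne_zero.2 ht0
    have N := fun {x y : ℂ} {i j l e i' j' l' e' : ℤ} (hx0 : x ≠ 0)
      (hx : HasExponents p w u v x i j l e) (hy : HasExponents p w u v y i' j' l' e')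
      (h : ¬(i = i' ∧ j = j' ∧ l = l') ∨ (e - e') % 2 ≠ 0) =>
        ne_zpow_mul_of_exponents hp hp0 hg hx0 hx hy h
    simp only [List.pairwise_cons, List.mem_cons, List.not_mem_nil, or_false, forall_eq_or_imp,
      forall_eq, false_implies, implies_true, List.Pairwise.nil, and_true]
    have o1 := one_ne_zero (α := ℂ)
    refine ⟨⟨N o1 e1 e2 (by decide), N o1 e1 e3 (by decide), N o1 e1 e4 (by decide),
        N o1 e1 e5 (by decide), N o1 e1 e6 (by decide), N o1 e1 e7 (by decide),
        N o1 e1 e8 (by decide), N o1 e1 e9 (by decide), N o1 e1 e10 (by decide),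
        N o1 e1 e11 (by decide), N o1 e1 e12 (by decide), N o1 e1 e13 (by decide)⟩,
      ⟨N hw' e2 e3 (by decide), N hw' e2 e4 (by decide), N hw' e2 e5 (by decide),
        N hw' e2 e6 (by decide), N hw' e2 e7 (by decide), N hw' e2 e8 (by decide),
        N hw' e2 e9 (by decide), N hw' e2 e10 (by decide), N hw' e2 e11 (by decide),
        N hw' e2 e12 (by decide), N hw' e2 e13 (by decide)⟩,
      ⟨N hw e3 e4 (by decide), N hw e3 e5 (by decide), N hw e3 e6 (by decide),
        N hw e3 e7 (by decide), N hw e3 e8 (by decide), N hw e3 e9 (by decide),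
        N hw e3 e10 (by decide), N hw e3 e11 (by decide), N hw e3 e12 (by decide),
        N hw e3 e13 (by decide)⟩,
      ⟨N hww e4 e5 (by decide), N hww e4 e6 (by decide), N hww e4 e7 (by decide),
        N hww e4 e8 (by decide), N hww e4 e9 (by decide), N hww e4 e10 (by decide),
        N hww e4 e11 (by decide), N hww e4 e12 (by decide), N hww e4 e13 (by decide)⟩,
      ⟨neg_ne_zpow_mul hp hp0 hs0, N hs0 e5 e7 (by decide), N hs0 e5 e8 (by decide),
        N hs0 e5 e9 (by decide), N hs0 e5 e10 (by decide), N hs0 e5 e11 (by decide),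
        N hs0 e5 e12 (by decide), N hs0 e5 e13 (by decide)⟩,
      ⟨N ns e6 e7 (by decide), N ns e6 e8 (by decide), N ns e6 e9 (by decide),
        N ns e6 e10 (by decide), N ns e6 e11 (by decide), N ns e6 e12 (by decide),
        N ns e6 e13 (by decide)⟩,
      ⟨neg_ne_zpow_mul hp hp0 ht0, N ht0 e7 e9 (by decide), N ht0 e7 e10 (by decide),
        N ht0 e7 e11 (by decide), N ht0 e7 e12 (by decide), N ht0 e7 e13 (by decide)⟩,
      ⟨N nt e8 e9 (by decide), N nt e8 e10 (by decide), N nt e8 e11 (by decide),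
        N nt e8 e12 (by decide), N nt e8 e13 (by decide)⟩,
      ⟨N hu e9 e10 (by decide), N hu e9 e11 (by decide), N hu e9 e12 (by decide),
        N hu e9 e13 (by decide)⟩,
      ⟨N hu1 e10 e11 (by decide), N hu1 e10 e12 (by decide), N hu1 e10 e13 (by decide)⟩,
      ⟨N hui e11 e12 (by decide), N hui e11 e13 (by decide)⟩, N hu2 e12 e13 (by decide)⟩

end EllipticG2

namespace EllipticG2

/-! ### The theta functions in the exact form -/

variable {p q : ℂ}

lemma DifferentiableAt.theta {V : Type*} [NormedAddCommGroup V] [NormedSpace ℂ V] (hp : ‖p‖ < 1)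
    {f : V → ℂ} {v : V} (hf : DifferentiableAt ℂ f v) (h0 : f v ≠ 0) :
    DifferentiableAt ℂ (fun v => theta p (f v)) v :=
  DifferentiableAt.comp (g := EllipticG2.theta p) v (differentiableAt_theta hp h0) hf

/-- The product `∏ θ(b_k / x) θ(b_k y)`. -/
noncomputable def thetaProd (p : ℂ) (b : Fin 5 → ℂ) (x y : ℂ) : ℂ :=
  ∏ k, theta p (b k * x⁻¹) * theta p (b k * y)

/-- The factor of `num` that distinguishes the parameters `b 0` and `b 1`. Its theta functions in
`w` are chosen so that most terms of `symNum` vanish on the lines `x = b 0` and `x = b 1`. -/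
noncomputable def numRest (p q : ℂ) (b : Fin 5 → ℂ) (x y w : ℂ) : ℂ :=
  theta p (b 0 * x) * theta p (q * b 0 * y) *
    (theta p (b 0 * w) * theta p ((b 0)⁻¹ * w) * theta p (b 1 * w) * theta p ((b 1)⁻¹ * w) *
      theta p (b 0 * (b 1)⁻¹ * w) * theta p (b 1 * (∏ k, b k)⁻¹ * w)) *
    (x ^ 2 * (y ^ 2)⁻¹ * (w ^ 3)⁻¹)

/-- The seed of the exact form: multiplied by the rest of the integrand, it is carried to minus its
reflection by the shift `x ↦ q x`, `y ↦ y / q`. -/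
noncomputable def num (p q : ℂ) (b : Fin 5 → ℂ) (x y w : ℂ) : ℂ :=
  thetaProd p b x y * numRest p q b x y w

/-- The antisymmetrization of `num` over permutations of `(x, y, w)`. -/
noncomputable def altNum (p q : ℂ) (b : Fin 5 → ℂ) (x y w : ℂ) : ℂ :=
  num p q b x y w + num p q b y w x + num p q b w x y
    - num p q b y x w - num p q b x w y - num p q b w y x

/-- The antisymmetrization of `num` over the Weyl group of `G₂`. -/
noncomputable def symNum (p q : ℂ) (b : Fin 5 → ℂ) (x y w : ℂ) : ℂ :=
  altNum p q b x y w + altNum p q b x⁻¹ y⁻¹ w⁻¹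

/-- `∏ θ(u z^ω)` over the short roots `ω`. -/
noncomputable def shortTheta (p u x y w : ℂ) : ℂ :=
  theta p (u * x) * theta p (u * x⁻¹) * (theta p (u * y) * theta p (u * y⁻¹)) *
    (theta p (u * w) * theta p (u * w⁻¹))

/-- The Weyl denominator `∏ θ(z^α)` over positive roots, with the monomial that makes it
antisymmetric. -/
noncomputable def deltaTheta (p x y w : ℂ) : ℂ :=
  theta p x * theta p y * theta p w *
    (theta p (x * y⁻¹) * theta p (x * w⁻¹) * theta p (y * w⁻¹)) * (w * x⁻¹)

lemma differentiableAt_numRest {V : Type*} [NormedAddCommGroup V] [NormedSpace ℂ V] (hp : ‖p‖ < 1)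
    (hq0 : q ≠ 0) {b : Fin 5 → ℂ} (hb : ∀ k, b k ≠ 0) {x y w : V → ℂ} {v : V}
    (hx : DifferentiableAt ℂ x v) (hy : DifferentiableAt ℂ y v) (hw : DifferentiableAt ℂ w v)
    (hx0 : x v ≠ 0) (hy0 : y v ≠ 0) (hw0 : w v ≠ 0) :
    DifferentiableAt ℂ (fun v => numRest p q b (x v) (y v) (w v)) v := by
  have hβ : ∏ k, b k ≠ 0 := Finset.prod_ne_zero_iff.2 fun k _ => hb k
  have h0 := hb 0
  have h1 := hb 1
  have T := fun (f : V → ℂ) (hf : DifferentiableAt ℂ f v) (h : f v ≠ 0) =>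
    DifferentiableAt.theta (p := p) hp hf h
  unfold numRest
  have t1 := T (fun v => b 0 * x v) (hx.const_mul _) (by positivity)
  have t2 := T (fun v => q * b 0 * y v) (hy.const_mul _) (by positivity)
  have t3 := T (fun v => b 0 * w v) (hw.const_mul _) (by positivity)
  have t4 := T (fun v => (b 0)⁻¹ * w v) (hw.const_mul _) (by positivity)
  have t5 := T (fun v => b 1 * w v) (hw.const_mul _) (by positivity)
  have t6 := T (fun v => (b 1)⁻¹ * w v) (hw.const_mul _) (by positivity)
  have t7 := T (fun v => b 0 * (b 1)⁻¹ * w v) (hw.const_mul _) (by positivity)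
  have t8 := T (fun v => b 1 * (∏ k, b k)⁻¹ * w v) (hw.const_mul _) (by positivity)
  have m1 : DifferentiableAt ℂ (fun v => (y v ^ 2)⁻¹) v :=
    (hy.fun_pow 2).fun_inv (pow_ne_zero _ hy0)
  have m2 : DifferentiableAt ℂ (fun v => (w v ^ 3)⁻¹) v :=
    (hw.fun_pow 3).fun_inv (pow_ne_zero _ hw0)
  exact ((t1.mul t2).mul (((((t3.mul t4).mul t5).mul t6).mul t7).mul t8)).mul
    (((hx.fun_pow 2).mul m1).mul m2)

lemma differentiableAt_num {V : Type*} [NormedAddCommGroup V] [NormedSpace ℂ V] (hp : ‖p‖ < 1)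
    (hq0 : q ≠ 0) {b : Fin 5 → ℂ} (hb : ∀ k, b k ≠ 0) {x y w : V → ℂ} {v : V}
    (hx : DifferentiableAt ℂ x v) (hy : DifferentiableAt ℂ y v) (hw : DifferentiableAt ℂ w v)
    (hx0 : x v ≠ 0) (hy0 : y v ≠ 0) (hw0 : w v ≠ 0) :
    DifferentiableAt ℂ (fun v => num p q b (x v) (y v) (w v)) v := by
  unfold num
  refine DifferentiableAt.mul ?_ (differentiableAt_numRest hp hq0 hb hx hy hw hx0 hy0 hw0)
  have T := fun (f : V → ℂ) (hf : DifferentiableAt ℂ f v) (h : f v ≠ 0) =>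
    DifferentiableAt.theta (p := p) hp hf h
  unfold thetaProd
  have t := fun k => (T (fun v => b k * (x v)⁻¹) ((hx.inv hx0).const_mul _)
    (mul_ne_zero (hb k) (inv_ne_zero hx0))).mul
    (T (fun v => b k * y v) (hy.const_mul _) (mul_ne_zero (hb k) hy0))
  simp only [Fin.prod_univ_five]
  exact ((((t 0).mul (t 1)).mul (t 2)).mul (t 3)).mul (t 4)

lemma theta_mul_p_mul (hp : ‖p‖ < 1) (hp0 : p ≠ 0) {c y : ℂ} (hc : c ≠ 0) (hy : y ≠ 0) :
    theta p (c * (p * y)) = -(c * y)⁻¹ * theta p (c * y) := by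
  rw [mul_left_comm, theta_p_mul hp hp0 (mul_ne_zero hc hy)]

lemma theta_mul_p_inv_mul (hp : ‖p‖ < 1) (hp0 : p ≠ 0) {c y : ℂ} (hc : c ≠ 0) (hy : y ≠ 0) :
    theta p (c * (p⁻¹ * y)) = -(p⁻¹ * (c * y)) * theta p (c * y) := by
  rw [mul_left_comm, theta_p_inv_mul hp hp0 (mul_ne_zero hc hy)]

lemma theta_mul_inv_p_mul (hp : ‖p‖ < 1) (hp0 : p ≠ 0) {c y : ℂ} (hc : c ≠ 0) (hy : y ≠ 0) :
    theta p (c * (p * y)⁻¹) = -(p⁻¹ * (c * y⁻¹)) * theta p (c * y⁻¹) := by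
  rw [mul_inv, theta_mul_p_inv_mul hp hp0 hc (inv_ne_zero hy)]


lemma thetaProd_shift_left (hp : ‖p‖ < 1) (hp0 : p ≠ 0) {b : Fin 5 → ℂ} (hb : ∀ k, b k ≠ 0)
    {x y : ℂ} (hx : x ≠ 0) :
    thetaProd p b (p * x) y = -((∏ k, b k) * ((p * x) ^ 5)⁻¹) * thetaProd p b x y := by
  unfold thetaProd
  simp only [fun k => theta_mul_inv_p_mul hp hp0 (hb k) hx]
  simp only [Finset.prod_mul_distrib, Finset.prod_neg, Finset.prod_const, Finset.card_univ,
    Fintype.card_fin]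
  generalize ∏ k, theta p (b k * x⁻¹) = A
  generalize ∏ k, theta p (b k * y) = B
  field_simp

lemma thetaProd_shift_right (hp : ‖p‖ < 1) (hp0 : p ≠ 0) {b : Fin 5 → ℂ} (hb : ∀ k, b k ≠ 0)
    {x y : ℂ} (hy : y ≠ 0) :
    thetaProd p b x (p * y) = -((∏ k, b k)⁻¹ * (y ^ 5)⁻¹) * thetaProd p b x y := by
  have hβ : ∏ k, b k ≠ 0 := Finset.prod_ne_zero_iff.2 fun k _ => hb k
  unfold thetaProd
  simp only [fun k => theta_mul_p_mul hp hp0 (hb k) hy]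
  simp only [Finset.prod_mul_distrib, Finset.prod_neg, Finset.prod_const, Finset.card_univ,
    Fintype.card_fin, mul_inv, Finset.prod_inv_distrib]
  ring

lemma thetaProd_shift_right_inv (hp : ‖p‖ < 1) (hp0 : p ≠ 0) {b : Fin 5 → ℂ} (hb : ∀ k, b k ≠ 0)
    {x y : ℂ} (hy : y ≠ 0) :
    thetaProd p b x (p⁻¹ * y) = -((∏ k, b k) * (p ^ 5)⁻¹ * y ^ 5) * thetaProd p b x y := by
  unfold thetaProd
  simp only [fun k => theta_mul_p_inv_mul hp hp0 (hb k) hy]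
  simp only [Finset.prod_mul_distrib, Finset.prod_neg, Finset.prod_const, Finset.card_univ,
    Fintype.card_fin]
  ring

/-- The balancing condition `q (∏ b_k)² = p` makes the multiplier of `num` uniform. -/
lemma num_shift12 (hp : ‖p‖ < 1) (hp0 : p ≠ 0) (hq0 : q ≠ 0) {b : Fin 5 → ℂ}
    (hb : ∀ k, b k ≠ 0) (hβ : q * (∏ k, b k) ^ 2 = p) {x y w : ℂ} (hx : x ≠ 0) (hy : y ≠ 0) :
    num p q b (p * x) (p⁻¹ * y) w = (y * (p * x)⁻¹) ^ 6 * num p q b x y w := by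
  have h0 := hb 0
  unfold num numRest
  rw [thetaProd_shift_left hp hp0 hb hx, thetaProd_shift_right_inv hp hp0 hb hy,
    theta_mul_p_mul hp hp0 h0 hx, theta_mul_p_inv_mul hp hp0 (mul_ne_zero hq0 h0) hy]
  generalize thetaProd p b x y = A
  generalize theta p (b 0 * x) = A1
  generalize theta p (q * b 0 * y) = A2
  generalize theta p (b 0 * w) * theta p ((b 0)⁻¹ * w) * theta p (b 1 * w) *
    theta p ((b 1)⁻¹ * w) * theta p (b 0 * (b 1)⁻¹ * w) * theta p (b 1 * (∏ k, b k)⁻¹ * w) = A3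
  generalize (∏ k, b k) = s at *
  have hqs : q = p * (s ^ 2)⁻¹ := by
    have : s ≠ 0 := by rintro rfl; exact hp0 (by rw [← hβ]; ring)
    rw [← hβ]; field_simp
  have : s ≠ 0 := by rintro rfl; exact hp0 (by rw [← hβ]; ring)
  rw [hqs]
  generalize (w ^ 3)⁻¹ = W
  field_simp

lemma num_shift13 (hp : ‖p‖ < 1) (hp0 : p ≠ 0) {b : Fin 5 → ℂ}
    (hb : ∀ k, b k ≠ 0) {x y w : ℂ} (hx : x ≠ 0) (hw : w ≠ 0) :
    num p q b (p * x) y (p⁻¹ * w) = (w * (p * x)⁻¹) ^ 6 * num p q b x y w := by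
  have h0 := hb 0
  have h1 := hb 1
  have hs : ∏ k, b k ≠ 0 := Finset.prod_ne_zero_iff.2 fun k _ => hb k
  unfold num numRest
  rw [thetaProd_shift_left hp hp0 hb hx, theta_mul_p_mul hp hp0 h0 hx,
    theta_mul_p_inv_mul hp hp0 h0 hw, theta_mul_p_inv_mul hp hp0 (inv_ne_zero h0) hw,
    theta_mul_p_inv_mul hp hp0 h1 hw, theta_mul_p_inv_mul hp hp0 (inv_ne_zero h1) hw,
    theta_mul_p_inv_mul hp hp0 (by positivity : b 0 * (b 1)⁻¹ ≠ 0) hw,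
    theta_mul_p_inv_mul hp hp0 (by positivity : b 1 * (∏ k, b k)⁻¹ ≠ 0) hw]
  generalize (y ^ 2)⁻¹ = W
  field_simp

lemma num_shift23 (hp : ‖p‖ < 1) (hp0 : p ≠ 0) (hq0 : q ≠ 0) {b : Fin 5 → ℂ}
    (hb : ∀ k, b k ≠ 0) (hβ : q * (∏ k, b k) ^ 2 = p) {x y w : ℂ} (hy : y ≠ 0) (hw : w ≠ 0) :
    num p q b x (p * y) (p⁻¹ * w) = (w * (p * y)⁻¹) ^ 6 * num p q b x y w := by
  have h0 := hb 0
  have h1 := hb 1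
  have hs : ∏ k, b k ≠ 0 := Finset.prod_ne_zero_iff.2 fun k _ => hb k
  unfold num numRest
  rw [thetaProd_shift_right hp hp0 hb hy, theta_mul_p_mul hp hp0 (mul_ne_zero hq0 h0) hy,
    theta_mul_p_inv_mul hp hp0 h0 hw, theta_mul_p_inv_mul hp hp0 (inv_ne_zero h0) hw,
    theta_mul_p_inv_mul hp hp0 h1 hw, theta_mul_p_inv_mul hp hp0 (inv_ne_zero h1) hw,
    theta_mul_p_inv_mul hp hp0 (by positivity : b 0 * (b 1)⁻¹ ≠ 0) hw,
    theta_mul_p_inv_mul hp hp0 (by positivity : b 1 * (∏ k, b k)⁻¹ ≠ 0) hw]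
  generalize thetaProd p b x y = A
  generalize theta p (b 0 * w) = A1
  generalize theta p ((b 0)⁻¹ * w) = A2
  generalize theta p (b 1 * w) = A3
  generalize theta p ((b 1)⁻¹ * w) = A4
  generalize theta p (b 0 * (b 1)⁻¹ * w) = A5
  generalize theta p (b 1 * (∏ k, b k)⁻¹ * w) = A6
  generalize theta p (q * b 0 * y) = A7
  generalize (∏ k, b k) = s at *
  have hqs : q = p * (s ^ 2)⁻¹ := by rw [← hβ]; field_simp
  rw [hqs]
  field_simp

lemma altNum_shift (hp : ‖p‖ < 1) (hp0 : p ≠ 0) (hq0 : q ≠ 0) {b : Fin 5 → ℂ}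
    (hb : ∀ k, b k ≠ 0) (hβ : q * (∏ k, b k) ^ 2 = p) {x y w : ℂ}
    (hy : y ≠ 0) (hw : w ≠ 0) :
    altNum p q b x (p * y) (p⁻¹ * w) = (w * (p * y)⁻¹) ^ 6 * altNum p q b x y w := by
  have hw' : p⁻¹ * w ≠ 0 := by positivity
  have hm : (w * (p * y)⁻¹) ^ 6 * (p * y * w⁻¹) ^ 6 = 1 := by field_simp
  -- the shifts in the opposite directions
  have r21 : num p q b (p⁻¹ * w) (p * y) x = (w * (p * y)⁻¹) ^ 6 * num p q b w y x := by
    have := num_shift12 hp hp0 hq0 hb hβ (w := x) hw' (mul_ne_zero hp0 hy)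
    rw [mul_inv_cancel_left₀ hp0, inv_mul_cancel_left₀ hp0] at this
    rw [this]; linear_combination (-num p q b (p⁻¹ * w) (p * y) x) * hm
  have r31 : num p q b (p⁻¹ * w) x (p * y) = (w * (p * y)⁻¹) ^ 6 * num p q b w x y := by
    have := num_shift13 hp hp0 (q := q) hb (y := x) hw' (mul_ne_zero hp0 hy)
    rw [mul_inv_cancel_left₀ hp0, inv_mul_cancel_left₀ hp0] at this
    rw [this]; linear_combination (-num p q b (p⁻¹ * w) x (p * y)) * hm
  have r32 : num p q b x (p⁻¹ * w) (p * y) = (w * (p * y)⁻¹) ^ 6 * num p q b x w y := by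
    have := num_shift23 hp hp0 hq0 hb hβ (x := x) hw' (mul_ne_zero hp0 hy)
    rw [mul_inv_cancel_left₀ hp0, inv_mul_cancel_left₀ hp0] at this
    rw [this]; linear_combination (-num p q b x (p⁻¹ * w) (p * y)) * hm
  unfold altNum
  rw [num_shift23 hp hp0 hq0 hb hβ hy hw, num_shift12 hp hp0 hq0 hb hβ hy hw,
    num_shift13 hp hp0 hb hy hw, r21, r31, r32]
  ring

lemma altNum_swap12 (p q : ℂ) (b : Fin 5 → ℂ) (x y w : ℂ) :
    altNum p q b y x w = -altNum p q b x y w := by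
  unfold altNum; ring

lemma altNum_swap23 (p q : ℂ) (b : Fin 5 → ℂ) (x y w : ℂ) :
    altNum p q b x w y = -altNum p q b x y w := by
  unfold altNum; ring

theorem isAltTheta_symNum (hp : ‖p‖ < 1) (hp0 : p ≠ 0) (hq0 : q ≠ 0) {b : Fin 5 → ℂ}
    (hb : ∀ k, b k ≠ 0) (hβ : q * (∏ k, b k) ^ 2 = p) : IsAltTheta p (symNum p q b) where
  swap12 x y w _ _ _ := by unfold symNum; rw [altNum_swap12, altNum_swap12 p q b x⁻¹]; ring
  swap23 x y w _ _ _ := by unfold symNum; rw [altNum_swap23, altNum_swap23 p q b x⁻¹]; ring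
  inv x y w _ _ _ _ := by unfold symNum; rw [inv_inv, inv_inv, inv_inv, add_comm]
  shift x y w _ hy hw := by
    unfold symNum
    rw [mul_inv, mul_inv p⁻¹, inv_inv, altNum_shift hp hp0 hq0 hb hβ hy hw,
      altNum_swap23 p q b x⁻¹ (p * w⁻¹),
      altNum_shift hp hp0 hq0 hb hβ (inv_ne_zero hw) (inv_ne_zero hy), altNum_swap23]
    rw [show y⁻¹ * (p * w⁻¹)⁻¹ = w * (p * y)⁻¹ by rw [mul_inv, mul_inv, inv_inv]; ring,
      altNum_swap23 p q b x⁻¹ y⁻¹ w⁻¹]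
    ring
  diff x hx := by
    intro y hy
    have hy : y ≠ 0 := hy
    apply DifferentiableAt.differentiableWithinAt
    have d1 : DifferentiableAt ℂ (fun _ : ℂ => x) y := differentiableAt_const x
    have d2 : DifferentiableAt ℂ (fun y : ℂ => y) y := differentiableAt_id
    have d3 : DifferentiableAt ℂ (fun y : ℂ => (x * y)⁻¹) y :=
      (d2.const_mul x).fun_inv (mul_ne_zero hx hy)
    have h3 : (x * y)⁻¹ ≠ 0 := by positivity
    have key : ∀ {f g h : ℂ → ℂ}, DifferentiableAt ℂ f y → DifferentiableAt ℂ g y →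
        DifferentiableAt ℂ h y → f y ≠ 0 → g y ≠ 0 → h y ≠ 0 →
        DifferentiableAt ℂ (fun y => altNum p q b (f y) (g y) (h y)) y := by
      intro f g h df dg dh f0 g0 h0
      unfold altNum
      exact (((((differentiableAt_num hp hq0 hb df dg dh f0 g0 h0).add
        (differentiableAt_num hp hq0 hb dg dh df g0 h0 f0)).add
        (differentiableAt_num hp hq0 hb dh df dg h0 f0 g0)).sub
        (differentiableAt_num hp hq0 hb dg df dh g0 f0 h0)).sub
        (differentiableAt_num hp hq0 hb df dh dg f0 h0 g0)).sub
        (differentiableAt_num hp hq0 hb dh dg df h0 g0 f0)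
    unfold symNum
    exact (key d1 d2 d3 hx hy h3).add (key (d1.fun_inv hx) (d2.fun_inv hy) (d3.fun_inv h3)
      (inv_ne_zero hx) (inv_ne_zero hy) (inv_ne_zero h3))

lemma deltaTheta_swap12 (hp : ‖p‖ < 1) {x y w : ℂ} (hx : x ≠ 0) (hy : y ≠ 0) (hw : w ≠ 0) :
    deltaTheta p y x w = -deltaTheta p x y w := by
  have e1 : theta p (y * x⁻¹) = -(x * y⁻¹)⁻¹ * theta p (x * y⁻¹) := by
    rw [← theta_inv hp (by positivity), mul_inv, inv_inv, mul_comm]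
  unfold deltaTheta
  rw [e1]
  field_simp

lemma deltaTheta_swap23 (hp : ‖p‖ < 1) {x y w : ℂ} (hx : x ≠ 0) (hy : y ≠ 0) (hw : w ≠ 0) :
    deltaTheta p x w y = -deltaTheta p x y w := by
  have e1 : theta p (w * y⁻¹) = -(y * w⁻¹)⁻¹ * theta p (y * w⁻¹) := by
    rw [← theta_inv hp (by positivity), mul_inv, inv_inv, mul_comm]
  unfold deltaTheta
  rw [e1]
  field_simp

lemma deltaTheta_inv (hp : ‖p‖ < 1) {x y w : ℂ} (hx : x ≠ 0) (hy : y ≠ 0) (hw : w ≠ 0)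
    (h : x * y * w = 1) :
    deltaTheta p x⁻¹ y⁻¹ w⁻¹ = deltaTheta p x y w := by
  have e : ∀ x y : ℂ, x ≠ 0 → y ≠ 0 →
      theta p (x⁻¹ * y⁻¹⁻¹) = -(x * y⁻¹)⁻¹ * theta p (x * y⁻¹) := fun x y hx hy => by
    rw [← theta_inv hp (by positivity), mul_inv]
  unfold deltaTheta
  rw [e x y hx hy, e x w hx hw, e y w hy hw, theta_inv hp hx, theta_inv hp hy, theta_inv hp hw]
  have hm : x⁻¹ * y⁻¹ * w⁻¹ = 1 := by rw [← mul_inv, ← mul_inv, h, inv_one]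
  have hm2 : (x * y⁻¹)⁻¹ * (x * w⁻¹)⁻¹ * (y * w⁻¹)⁻¹ * (w⁻¹ * x⁻¹⁻¹) = w * x⁻¹ := by field_simp
  linear_combination (theta p x * theta p y * theta p w * (theta p (x * y⁻¹) * theta p (x * w⁻¹) *
    theta p (y * w⁻¹))) * ((x * y⁻¹)⁻¹ * (x * w⁻¹)⁻¹ * (y * w⁻¹)⁻¹ * (w⁻¹ * x⁻¹⁻¹) * hm + hm2)

lemma shortTheta_swap12 (p u x y w : ℂ) : shortTheta p u y x w = shortTheta p u x y w := by
  unfold shortTheta; ring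

lemma shortTheta_swap23 (p u x y w : ℂ) : shortTheta p u x w y = shortTheta p u x y w := by
  unfold shortTheta; ring

lemma shortTheta_inv (p u x y w : ℂ) : shortTheta p u x⁻¹ y⁻¹ w⁻¹ = shortTheta p u x y w := by
  unfold shortTheta; rw [inv_inv, inv_inv, inv_inv]; ring

lemma shortTheta_mul_deltaTheta_shift (hp : ‖p‖ < 1) (hp0 : p ≠ 0) {u x y w : ℂ} (hu : u ≠ 0)
    (hx : x ≠ 0) (hy : y ≠ 0) (hw : w ≠ 0) :
    shortTheta p u x (p * y) (p⁻¹ * w) * deltaTheta p x (p * y) (p⁻¹ * w)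
      = (w * (p * y)⁻¹) ^ 6 * (shortTheta p u x y w * deltaTheta p x y w) := by
  have e1 : theta p (u * (p⁻¹ * w)⁻¹) = -(u * w⁻¹)⁻¹ * theta p (u * w⁻¹) := by
    rw [mul_inv, inv_inv, theta_mul_p_mul hp hp0 hu (inv_ne_zero hw)]
  have e2 : theta p (x * (p⁻¹ * w)⁻¹) = -(x * w⁻¹)⁻¹ * theta p (x * w⁻¹) := by
    rw [mul_inv, inv_inv, theta_mul_p_mul hp hp0 hx (inv_ne_zero hw)]
  have hyw : y * w⁻¹ ≠ 0 := by positivity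
  have e3 : theta p (p * y * (p⁻¹ * w)⁻¹)
      = (p * (y * w⁻¹))⁻¹ * ((y * w⁻¹)⁻¹ * theta p (y * w⁻¹)) := by
    rw [show p * y * (p⁻¹ * w)⁻¹ = p * (p * (y * w⁻¹)) by field_simp,
      theta_p_mul hp hp0 (by positivity), theta_p_mul hp hp0 hyw]
    ring
  simp only [shortTheta, deltaTheta]
  rw [e1, e2, e3, theta_mul_p_mul hp hp0 hu hy, theta_mul_inv_p_mul hp hp0 hu hy,
    theta_mul_p_inv_mul hp hp0 hu hw, theta_mul_inv_p_mul hp hp0 hx hy, theta_p_mul hp hp0 hy,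
    theta_p_inv_mul hp hp0 hw]
  generalize theta p (u * x) = A1
  generalize theta p (u * x⁻¹) = A2
  generalize theta p (u * y) = A3
  generalize theta p (u * y⁻¹) = A4
  generalize theta p (u * w) = A5
  generalize theta p (u * w⁻¹) = A6
  generalize theta p x = B1
  generalize theta p y = B2
  generalize theta p w = B3
  generalize theta p (x * y⁻¹) = B4
  generalize theta p (x * w⁻¹) = B5
  generalize theta p (y * w⁻¹) = B6
  have hm : (u * y)⁻¹ * (p⁻¹ * (u * y⁻¹)) * (p⁻¹ * (u * w)) * (u * w⁻¹)⁻¹ * (y⁻¹ * (p⁻¹ * w)) *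
      ((p⁻¹ * (x * y⁻¹)) * (x * w⁻¹)⁻¹ * ((p * (y * w⁻¹))⁻¹ * (y * w⁻¹)⁻¹)) * (p⁻¹ * w * x⁻¹)
      = (w * (p * y)⁻¹) ^ 6 * (w * x⁻¹) := by
    field_simp
  linear_combination (A1 * A2 * A3 * A4 * A5 * A6 * B1 * B2 * B3 * B4 * B5 * B6) * hm

lemma differentiableOn_shortTheta_mul_deltaTheta (hp : ‖p‖ < 1) {u x : ℂ} (hu : u ≠ 0)
    (hx : x ≠ 0) : DifferentiableOn ℂ
      (fun y => shortTheta p u x y (x * y)⁻¹ * deltaTheta p x y (x * y)⁻¹) {0}ᶜ := by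
  intro y hy
  have hy : y ≠ 0 := hy
  apply DifferentiableAt.differentiableWithinAt
  have d2 : DifferentiableAt ℂ (fun y : ℂ => y) y := differentiableAt_id
  have d3 : DifferentiableAt ℂ (fun y : ℂ => (x * y)⁻¹) y :=
    (d2.const_mul x).fun_inv (mul_ne_zero hx hy)
  have h3 : (x * y)⁻¹ ≠ 0 := by positivity
  have d2i := d2.fun_inv hy
  have d3i := d3.fun_inv h3
  have T := fun (f : ℂ → ℂ) (hf : DifferentiableAt ℂ f y) (h : f y ≠ 0) =>
    DifferentiableAt.theta (p := p) hp hf h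
  simp only [shortTheta, deltaTheta]
  have hyi := inv_ne_zero hy
  have h3i := inv_ne_zero h3
  have t1 := T _ (d2.const_mul u) (mul_ne_zero hu hy)
  have t2 := T _ (d2i.const_mul u) (mul_ne_zero hu hyi)
  have t3 := T _ (d3.const_mul u) (mul_ne_zero hu h3)
  have t4 := T _ (d3i.const_mul u) (mul_ne_zero hu h3i)
  have t5 := T _ d2 hy
  have t6 := T _ d3 h3
  have t7 := T _ (d2i.const_mul x) (mul_ne_zero hx hyi)
  have t8 := T _ (d3i.const_mul x) (mul_ne_zero hx h3i)
  have t9 := T _ (d2.fun_mul d3i) (mul_ne_zero hy h3i)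
  exact (((t1.mul t2).const_mul _).mul (t3.mul t4)).mul
    ((((t5.const_mul _).mul t6).mul ((t7.mul t8).mul t9)).mul (d3.mul_const _))

theorem isAltTheta_short_mul_delta (hp : ‖p‖ < 1) (hp0 : p ≠ 0) {u : ℂ} (hu : u ≠ 0) :
    IsAltTheta p (fun x y w => shortTheta p u x y w * deltaTheta p x y w) where
  swap12 x y w hx hy hw := by rw [shortTheta_swap12, deltaTheta_swap12 hp hx hy hw]; ring
  swap23 x y w hx hy hw := by rw [shortTheta_swap23, deltaTheta_swap23 hp hx hy hw]; ring
  inv x y w hx hy hw h := by rw [shortTheta_inv, deltaTheta_inv hp hx hy hw h]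
  shift x y w hx hy hw := shortTheta_mul_deltaTheta_shift hp hp0 hu hx hy hw
  diff x hx := differentiableOn_shortTheta_mul_deltaTheta hp hu hx

lemma IsAltTheta.const_mul {E : ℂ → ℂ → ℂ → ℂ} (hE : IsAltTheta p E) (c : ℂ) :
    IsAltTheta p (fun x y w => c * E x y w) where
  swap12 x y w hx hy hw := by rw [hE.swap12 x y w hx hy hw]; ring
  swap23 x y w hx hy hw := by rw [hE.swap23 x y w hx hy hw]; ring
  inv x y w hx hy hw h := by rw [hE.inv x y w hx hy hw h]
  shift x y w hx hy hw := by rw [hE.shift x y w hx hy hw]; ring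
  diff x hx := (hE.diff x hx).const_mul c

lemma IsAltTheta.add {E F : ℂ → ℂ → ℂ → ℂ} (hE : IsAltTheta p E) (hF : IsAltTheta p F) :
    IsAltTheta p (fun x y w => E x y w + F x y w) where
  swap12 x y w hx hy hw := by rw [hE.swap12 x y w hx hy hw, hF.swap12 x y w hx hy hw]; ring
  swap23 x y w hx hy hw := by rw [hE.swap23 x y w hx hy hw, hF.swap23 x y w hx hy hw]; ring
  inv x y w hx hy hw h := by rw [hE.inv x y w hx hy hw h, hF.inv x y w hx hy hw h]
  shift x y w hx hy hw := by rw [hE.shift x y w hx hy hw, hF.shift x y w hx hy hw]; ring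
  diff x hx := (hE.diff x hx).add (hF.diff x hx)

end EllipticG2

namespace EllipticG2

/-! ### Special values of the symmetrized numerator -/

variable {p q : ℂ}

/-- The ratio of `J` at `q u` and `u`, up to factors symmetric in the two parameters that are
compared in the `q`-difference equation; `c`, `d`, `e` are the other three parameters. -/
noncomputable def ratioFactor (p q u c d e : ℂ) : ℂ :=
  theta p (u * u) * theta p (q * (u * u)) * (theta p u)⁻¹ *
    (theta p (u * c) * theta p (u * d) * theta p (u * e)) *
    (theta p (u * c * d) * theta p (u * c * e) * theta p (u * d * e)) * theta p (u * c * d * e)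

section vanish

variable {b : Fin 5 → ℂ} {x y w : ℂ}

lemma num_eq_zero_left (hp : ‖p‖ < 1) (k : Fin 5) (h : b k * x⁻¹ = 1) : num p q b x y w = 0 := by
  rw [num, thetaProd, Finset.prod_eq_zero (Finset.mem_univ k), zero_mul]
  rw [h, theta_one hp, zero_mul]

lemma num_eq_zero_mid (hp : ‖p‖ < 1) (k : Fin 5) (h : b k * y = 1) : num p q b x y w = 0 := by
  rw [num, thetaProd, Finset.prod_eq_zero (Finset.mem_univ k), zero_mul]
  rw [h, theta_one hp, mul_zero]

lemma num_eq_zero_right (hp : ‖p‖ < 1) (h : b 0 * x = 1 ∨ b 0 * w = 1 ∨ (b 0)⁻¹ * w = 1 ∨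
    b 1 * w = 1 ∨ (b 1)⁻¹ * w = 1 ∨ b 0 * (b 1)⁻¹ * w = 1) : num p q b x y w = 0 := by
  rw [num, numRest]
  rcases h with h | h | h | h | h | h <;> rw [h, theta_one hp] <;> ring

end vanish

/-- On the line `x = b 0`, `symNum` vanishes at `y = b 1`. -/
lemma symNum_b0_b1 (hp : ‖p‖ < 1) {b : Fin 5 → ℂ} (hb : ∀ k, b k ≠ 0) :
    symNum p q b (b 0) (b 1) (b 0 * b 1)⁻¹ = 0 := by
  have h0 := hb 0
  have h1 := hb 1
  unfold symNum altNum
  rw [num_eq_zero_left hp 0 (mul_inv_cancel₀ h0),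
    num_eq_zero_left hp 1 (mul_inv_cancel₀ h1),
    num_eq_zero_right hp (w := b 1) (by simp [h1]),
    num_eq_zero_left hp 1 (mul_inv_cancel₀ h1),
    num_eq_zero_left hp 0 (mul_inv_cancel₀ h0),
    num_eq_zero_right hp (w := b 0) (by simp [h0]),
    num_eq_zero_mid hp 1 (mul_inv_cancel₀ h1),
    num_eq_zero_right hp (w := (b 0)⁻¹) (by simp [h0]),
    num_eq_zero_mid hp 0 (mul_inv_cancel₀ h0),
    num_eq_zero_mid hp 0 (mul_inv_cancel₀ h0),
    num_eq_zero_right hp (w := (b 1)⁻¹) (by simp [h1]),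
    num_eq_zero_mid hp 1 (mul_inv_cancel₀ h1)]
  ring

/-- On the line `x = b 0`, `symNum` vanishes at `y = 1 / b 1`. -/
lemma symNum_b0_inv_b1 (hp : ‖p‖ < 1) {b : Fin 5 → ℂ} (hb : ∀ k, b k ≠ 0) :
    symNum p q b (b 0) (b 1)⁻¹ (b 0 * (b 1)⁻¹)⁻¹ = 0 := by
  have h0 := hb 0
  have h1 := hb 1
  have e0 := mul_inv_cancel₀ h0
  have e1 := mul_inv_cancel₀ h1
  have e2 : b 0 * (b 1)⁻¹ * (b 0 * (b 1)⁻¹)⁻¹ = 1 := by field_simp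
  unfold symNum altNum
  rw [num_eq_zero_left hp 0 e0,
    num_eq_zero_right hp (w := b 0) (by simp [h0]),
    num_eq_zero_right hp (w := (b 1)⁻¹) (by simp [h1]),
    num_eq_zero_right hp (w := (b 0 * (b 1)⁻¹)⁻¹) (x := (b 1)⁻¹) (by simp only [e2, or_true]),
    num_eq_zero_left hp 0 e0,
    num_eq_zero_right hp (w := b 0) (by simp [h0]),
    num_eq_zero_right hp (x := (b 0)⁻¹) (by simp [h0]),
    num_eq_zero_left hp 1 (x := (b 1)⁻¹⁻¹) (by simp [h1]),
    num_eq_zero_mid hp 0 e0,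
    num_eq_zero_left hp 1 (x := (b 1)⁻¹⁻¹) (by simp [h1]),
    num_eq_zero_right hp (x := (b 0)⁻¹) (by simp [h0]),
    num_eq_zero_right hp (w := (b 0)⁻¹) (by simp [h0])]
  ring

/-- On the line `x = b 0` a single term of `symNum` survives at `y = b 2`. -/
lemma symNum_b0_b2 (hp : ‖p‖ < 1) {b : Fin 5 → ℂ} (hb : ∀ k, b k ≠ 0) (z : ℂ) :
    symNum p q b (b 0) (b 2) z = num p q b z (b 0) (b 2) := by
  have h0 := hb 0
  have e0 := mul_inv_cancel₀ h0
  have e2 := mul_inv_cancel₀ (hb 2)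
  unfold symNum altNum
  rw [num_eq_zero_left hp 0 e0, num_eq_zero_left hp 2 e2, num_eq_zero_left hp 2 e2,
    num_eq_zero_left hp 0 e0, num_eq_zero_right hp (w := b 0) (by simp [h0]),
    num_eq_zero_mid hp 2 e2, num_eq_zero_right hp (w := (b 0)⁻¹) (by simp [h0]),
    num_eq_zero_mid hp 0 e0, num_eq_zero_mid hp 0 e0,
    num_eq_zero_right hp (x := (b 0)⁻¹) (by simp [h0]), num_eq_zero_mid hp 2 e2]
  ring

/-- On the line `x = b 1` two terms of `symNum` survive at `y = b 2`. -/
lemma symNum_b1_b2 (hp : ‖p‖ < 1) {b : Fin 5 → ℂ} (hb : ∀ k, b k ≠ 0) (z : ℂ) :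
    symNum p q b (b 1) (b 2) z
      = num p q b z (b 1) (b 2) - num p q b (b 1)⁻¹ z⁻¹ (b 2)⁻¹ := by
  have h1 := hb 1
  have e1 := mul_inv_cancel₀ h1
  have e2 := mul_inv_cancel₀ (hb 2)
  unfold symNum altNum
  rw [num_eq_zero_left hp 1 e1, num_eq_zero_left hp 2 e2, num_eq_zero_left hp 2 e2,
    num_eq_zero_left hp 1 e1, num_eq_zero_right hp (w := b 1) (by simp [h1]),
    num_eq_zero_mid hp 2 e2, num_eq_zero_right hp (w := (b 1)⁻¹) (by simp [h1]),
    num_eq_zero_mid hp 1 e1, num_eq_zero_mid hp 1 e1, num_eq_zero_mid hp 2 e2]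
  ring

lemma theta_eq_of_inv (hp : ‖p‖ < 1) {u v : ℂ} (hv : v ≠ 0) (h : u * v = 1) :
    theta p u = -v⁻¹ * theta p v := by
  rw [← theta_inv hp hv, eq_inv_of_mul_eq_one_left h]

/-- The two sides of the theta function identity agree at `x = b 0`, `y = b 2`: only one term of the
symmetrization survives there, and it matches factor by factor. -/
lemma num_b0_b2_eq (hp : ‖p‖ < 1) {b : Fin 5 → ℂ} (hb : ∀ k, b k ≠ 0) (h0 : theta p (b 0) ≠ 0) :
    theta p (b 1 * (b 0)⁻¹) * theta p ((∏ k, b k) * (b 1)⁻¹) *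
        num p q b (b 0 * b 2)⁻¹ (b 0) (b 2)
      = (b 0 * b 1 * ∏ k, b k)⁻¹ * ratioFactor p q (b 0) (b 2) (b 3) (b 4) *
        (shortTheta p (b 1) (b 0) (b 2) (b 0 * b 2)⁻¹ *
          deltaTheta p (b 0) (b 2) (b 0 * b 2)⁻¹) := by
  have ha := hb 0
  have hc := hb 1
  have hd := hb 2
  have he := hb 3
  have hf := hb 4
  simp only [num, thetaProd, numRest, shortTheta, deltaTheta, ratioFactor, Fin.prod_univ_five,
    inv_inv]
  generalize b 0 = a at *
  generalize b 1 = c at *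
  generalize b 2 = d at *
  generalize b 3 = e at *
  generalize b 4 = f at *
  have i1 : theta p (a * (a * d)⁻¹) = -d⁻¹ * theta p d := theta_eq_of_inv hp hd (by field_simp)
  have i2 : theta p (a⁻¹ * d) = -(a * d⁻¹)⁻¹ * theta p (a * d⁻¹) :=
    theta_eq_of_inv hp (by positivity) (by field_simp)
  have i3 : theta p (c⁻¹ * d) = -(c * d⁻¹)⁻¹ * theta p (c * d⁻¹) :=
    theta_eq_of_inv hp (by positivity) (by field_simp)
  have i4 : theta p (c * (a * d)⁻¹) = -(a * c⁻¹ * d)⁻¹ * theta p (a * c⁻¹ * d) :=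
    theta_eq_of_inv hp (by positivity) (by field_simp)
  have i5 : theta p (c * (a * c * d * e * f)⁻¹ * d) = -(a * e * f)⁻¹ * theta p (a * e * f) :=
    theta_eq_of_inv hp (by positivity) (by field_simp)
  have i6 : theta p (a * d)⁻¹ = -(a * d)⁻¹ * theta p (a * d) := theta_inv hp (by positivity)
  rw [i1, i2, i3, i4, i5, i6, show a * c * d * e * f * c⁻¹ = a * d * e * f by field_simp,
    show d * (a * d) = a * d * d by ring, show e * (a * d) = a * d * e by ring,
    show f * (a * d) = a * d * f by ring, show e * a = a * e by ring, show f * a = a * f by ring,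
    show d * a = a * d by ring, show q * a * a = q * (a * a) by ring]
  have hm : d⁻¹ * (a * d⁻¹)⁻¹ * (c * d⁻¹)⁻¹ * (a * e * f)⁻¹ * (((a * d)⁻¹) ^ 2 * (a ^ 2)⁻¹ *
      (d ^ 3)⁻¹) = (a * c * (a * c * d * e * f))⁻¹ * ((a * c⁻¹ * d)⁻¹ * (a * d)⁻¹ *
      ((a * d)⁻¹ * a⁻¹)) := by field_simp
  have ht : (theta p a)⁻¹ * theta p a = 1 := inv_mul_cancel₀ h0
  linear_combination (theta p (c * a⁻¹) * theta p (a * d * e * f) * (theta p (a * (a * d)) *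
    theta p (a * a) * (theta p (c * (a * d)) * theta p (c * a)) * (theta p (a * d * d) *
    theta p (a * d)) * (theta p (a * d * e) * theta p (a * e)) * (theta p (a * d * f) *
    theta p (a * f)) * (theta p d * theta p (q * (a * a)) * (theta p (a * d) *
    theta p (a * d⁻¹) * theta p (c * d) * theta p (c * d⁻¹) * theta p (a * c⁻¹ * d) *
    theta p (a * e * f))))) * (hm - (a * c * (a * c * d * e * f))⁻¹ * ((a * c⁻¹ * d)⁻¹ *
    (a * d)⁻¹ * ((a * d)⁻¹ * a⁻¹)) * ht)

/-- Weierstrass' relation in the form needed at `x = b 1`, `y = b 2`. -/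
lemma theta_weierstrass_balanced (hp : ‖p‖ < 1) (hp0 : p ≠ 0) {a c d s : ℂ} (ha : a ≠ 0)
    (hc : c ≠ 0) (hd : d ≠ 0) (hs : s ≠ 0) (h1 : ∀ k : ℤ, s ^ 3 ≠ p ^ k * (c ^ 2 * a))
    (h2 : ∀ k : ℤ, s ^ 2 ≠ p ^ k * c ^ 2) (h3 : ∀ k : ℤ, a ≠ p ^ k * s) :
    theta p (a * c⁻¹ * d) * theta p (c * s⁻¹ * d) * theta p (a * c * (s ^ 2)⁻¹) *
        (-(c * s⁻¹) * theta p (s * c⁻¹))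
      - theta p (a * d * s⁻¹) * theta p d * theta p (a * s⁻¹) * theta p (c ^ 2 * (s ^ 2)⁻¹)
      = c ^ 2 * (s ^ 2)⁻¹ * (theta p (a * c⁻¹) * theta p (s * c⁻¹) *
        theta p (a * c * d * (s ^ 2)⁻¹) * theta p (d * s * c⁻¹)) := by
  obtain ⟨r, hr⟩ := IsAlgClosed.exists_pow_nat_eq (a * s⁻¹) (n := 2) two_pos
  have hr0 : r ≠ 0 := by
    rintro rfl
    exact mul_ne_zero ha (inv_ne_zero hs) (by rw [← hr]; simp)
  have hrr : r * r = a * s⁻¹ := by rw [← hr, sq]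
  have W := theta_weierstrass hp hp0 (x := d * r) (y := r * s * c⁻¹) (u := c * r * s⁻¹) (v := r)
    (by positivity) (by positivity) (by positivity) hr0
    (fun k h => h1 k (by
      have e : (c * r * s⁻¹)⁻¹ * (c * r * s⁻¹) = 1 := inv_mul_cancel₀ (by positivity)
      rw [h] at e
      have e2 : p ^ k * (c ^ 2 * (r * r)) = s ^ 2 := by
        field_simp at e ⊢; linear_combination e
      rw [hrr] at e2
      field_simp at e2
      linear_combination -e2))
    (fun k h => h2 k (by
      field_simp at h
      linear_combination h))
    (fun k h => h3 k (by
      have e2 : r * r = p ^ k := by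
        field_simp at h
        linear_combination h
      rw [hrr] at e2
      rw [← e2]; field_simp))
  have e1 : d * r * (r * s * c⁻¹) = a * c⁻¹ * d := by
    rw [show d * r * (r * s * c⁻¹) = r * r * (d * s * c⁻¹) by ring, hrr]; field_simp
  have e2 : d * r * (r * s * c⁻¹)⁻¹ = c * s⁻¹ * d := by field_simp
  have e3 : c * r * s⁻¹ * r = a * c * (s ^ 2)⁻¹ := by
    rw [show c * r * s⁻¹ * r = r * r * (c * s⁻¹) by ring, hrr]; field_simp
  have e4 : c * r * s⁻¹ * r⁻¹ = c * s⁻¹ := by field_simp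
  have e5 : d * r * r = a * d * s⁻¹ := by rw [mul_assoc, hrr]; ring
  have e6 : d * r * r⁻¹ = d := by field_simp
  have e7 : c * r * s⁻¹ * (r * s * c⁻¹) = a * s⁻¹ := by rw [← hrr]; field_simp
  have e8 : c * r * s⁻¹ * (r * s * c⁻¹)⁻¹ = c ^ 2 * (s ^ 2)⁻¹ := by field_simp
  have e9 : r * s * c⁻¹ * r = a * c⁻¹ := by
    rw [show r * s * c⁻¹ * r = r * r * (s * c⁻¹) by ring, hrr]; field_simp
  have e10 : r * s * c⁻¹ * r⁻¹ = s * c⁻¹ := by field_simp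
  have e11 : d * r * (c * r * s⁻¹) = a * c * d * (s ^ 2)⁻¹ := by
    rw [show d * r * (c * r * s⁻¹) = r * r * (d * c * s⁻¹) by ring, hrr]; field_simp
  have e12 : d * r * (c * r * s⁻¹)⁻¹ = d * s * c⁻¹ := by field_simp
  rw [e1, e2, e3, e4, e5, e6, e7, e8, e9, e10, e11, e12] at W
  rw [← W, theta_eq_of_inv hp (u := c * s⁻¹) (v := s * c⁻¹) (by positivity) (by field_simp)]
  have : (s * c⁻¹)⁻¹ = c * s⁻¹ := by rw [mul_inv, inv_inv, mul_comm]
  rw [this]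

/-- The two sides of the theta function identity agree at `x = b 1`, `y = b 2`: two terms of the
symmetrization survive there, and Weierstrass' relation adds them up. -/
lemma num_b1_b2_eq (hp : ‖p‖ < 1) (hp0 : p ≠ 0) {b : Fin 5 → ℂ} (hb : ∀ k, b k ≠ 0)
    (hβ : q * (∏ k, b k) ^ 2 = p) (h0 : theta p (b 1) ≠ 0)
    (h1 : ∀ k : ℤ, (∏ k, b k) ^ 3 ≠ p ^ k * (b 1 ^ 2 * b 0))
    (h2 : ∀ k : ℤ, (∏ k, b k) ^ 2 ≠ p ^ k * b 1 ^ 2) (h3 : ∀ k : ℤ, b 0 ≠ p ^ k * ∏ k, b k) :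
    theta p (b 1 * (b 0)⁻¹) * theta p ((∏ k, b k) * (b 1)⁻¹) *
        (num p q b (b 1 * b 2)⁻¹ (b 1) (b 2) - num p q b (b 1)⁻¹ ((b 1 * b 2)⁻¹)⁻¹ (b 2)⁻¹)
      = -((b 0 * b 1 * ∏ k, b k)⁻¹ * ratioFactor p q (b 1) (b 2) (b 3) (b 4) *
        (shortTheta p (b 0) (b 1) (b 2) (b 1 * b 2)⁻¹ *
          deltaTheta p (b 1) (b 2) (b 1 * b 2)⁻¹)) := by
  have ha := hb 0
  have hc := hb 1
  have hd := hb 2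
  have he := hb 3
  have hf := hb 4
  simp only [num, thetaProd, numRest, shortTheta, deltaTheta, ratioFactor, Fin.prod_univ_five,
    inv_inv] at hβ h1 h2 h3 ⊢
  generalize b 0 = a at *
  generalize b 1 = c at *
  generalize b 2 = d at *
  generalize b 3 = e at *
  generalize b 4 = f at *
  obtain ⟨s, hs⟩ : ∃ s, s = a * c * d * e * f := ⟨_, rfl⟩
  rw [← hs] at hβ h1 h2 h3 ⊢
  have hs0 : s ≠ 0 := by rw [hs]; positivity
  have W := theta_weierstrass_balanced hp hp0 ha hc hd hs0 h1 h2 h3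
  have hq : q = p * (s ^ 2)⁻¹ := by rw [← hβ]; field_simp
  have j1 : theta p (q * a * c) = -(a * c * (s ^ 2)⁻¹)⁻¹ * theta p (a * c * (s ^ 2)⁻¹) := by
    rw [← theta_p_mul hp hp0 (by positivity), hq]; congr 1; ring
  have j2 : theta p (q * a * (c * d))
      = -(a * c * d * (s ^ 2)⁻¹)⁻¹ * theta p (a * c * d * (s ^ 2)⁻¹) := by
    rw [← theta_p_mul hp hp0 (by positivity), hq]; congr 1; ring
  have j3 : theta p (q * (c * c)) = -(c ^ 2 * (s ^ 2)⁻¹)⁻¹ * theta p (c ^ 2 * (s ^ 2)⁻¹) := by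
    rw [← theta_p_mul hp hp0 (by positivity), hq]; congr 1; ring
  have i1 : theta p (c * a⁻¹) = -(a * c⁻¹)⁻¹ * theta p (a * c⁻¹) :=
    theta_eq_of_inv hp (by positivity) (by field_simp)
  have i2 : theta p (a⁻¹ * d) = -(a * d⁻¹)⁻¹ * theta p (a * d⁻¹) :=
    theta_eq_of_inv hp (by positivity) (by field_simp)
  have i3 : theta p (c⁻¹ * d) = -(c * d⁻¹)⁻¹ * theta p (c * d⁻¹) :=
    theta_eq_of_inv hp (by positivity) (by field_simp)
  have i4 : theta p (a⁻¹ * d⁻¹) = -(a * d)⁻¹ * theta p (a * d) :=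
    theta_eq_of_inv hp (by positivity) (by field_simp)
  have i5 : theta p (c⁻¹ * d⁻¹) = -(c * d)⁻¹ * theta p (c * d) :=
    theta_eq_of_inv hp (by positivity) (by field_simp)
  have i6 : theta p (c * s⁻¹ * d⁻¹) = -(d * s * c⁻¹)⁻¹ * theta p (d * s * c⁻¹) :=
    theta_eq_of_inv hp (by positivity) (by field_simp)
  have i7 : theta p (c * d)⁻¹ = -(c * d)⁻¹ * theta p (c * d) := theta_inv hp (by positivity)
  have i8 : theta p (c * e * f) = -(a * d * s⁻¹)⁻¹ * theta p (a * d * s⁻¹) :=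
    theta_eq_of_inv hp (by positivity) (by rw [hs]; field_simp)
  have i9 : theta p (c * d * e * f) = -(a * s⁻¹)⁻¹ * theta p (a * s⁻¹) :=
    theta_eq_of_inv hp (by positivity) (by rw [hs]; field_simp)
  have i10 : a * c⁻¹ * d⁻¹ = a * (c * d)⁻¹ := by rw [mul_inv, mul_assoc]
  rw [i1, i2, i3, i4, i5, i6, i7, i8, i9, i10, j1, j2, j3,
    show d * (c * d) = c * d * d by ring, show e * (c * d) = c * d * e by ring,
    show f * (c * d) = c * d * f by ring, show e * c = c * e by ring, show f * c = c * f by ring,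
    show d * c = c * d by ring]
  have ht : (theta p c)⁻¹ * theta p c = 1 := inv_mul_cancel₀ h0
  have hm1 : (a * c⁻¹)⁻¹ * (a * c * (s ^ 2)⁻¹)⁻¹ * (a * d⁻¹)⁻¹ * (c * d⁻¹)⁻¹ *
      ((c * d)⁻¹ ^ 2 * (c ^ 2)⁻¹ * (d ^ 3)⁻¹) = (a * c * s)⁻¹ * (c ^ 2 * (s ^ 2)⁻¹)⁻¹ *
      (a * d * s⁻¹)⁻¹ * (a * s⁻¹)⁻¹ * (c * d)⁻¹ * ((c * d)⁻¹ * c⁻¹) * (c * s⁻¹) := by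
    field_simp
  have hm2 : (a * c⁻¹)⁻¹ * (a * c * d * (s ^ 2)⁻¹)⁻¹ * (a * d)⁻¹ * (c * d)⁻¹ * (d * s * c⁻¹)⁻¹ *
      (c⁻¹ ^ 2 * ((c * d) ^ 2)⁻¹ * (d⁻¹ ^ 3)⁻¹) = (a * c * s)⁻¹ * (c ^ 2 * (s ^ 2)⁻¹)⁻¹ *
      (a * d * s⁻¹)⁻¹ * (a * s⁻¹)⁻¹ * (c * d)⁻¹ * ((c * d)⁻¹ * c⁻¹) *
      (c ^ 2 * (s ^ 2)⁻¹) := by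
    field_simp
  linear_combination (theta p (a * c⁻¹) * (theta p (a * (c * d)) * theta p (a * c) *
    (theta p (c * (c * d)) * theta p (c * c)) * (theta p (c * d * d) * theta p (c * d)) *
    (theta p (c * d * e) * theta p (c * e)) * (theta p (c * d * f) * theta p (c * f))) *
    (theta p (a * (c * d)⁻¹) * theta p (a * d) * theta p (a * d⁻¹) * theta p (c * d) *
    theta p (c * d⁻¹))) * (theta p (a * c⁻¹ * d) * theta p (c * s⁻¹ * d) *
    theta p (a * c * (s ^ 2)⁻¹) * theta p (s * c⁻¹) * hm1 + theta p (a * c⁻¹) *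
    theta p (s * c⁻¹) * theta p (a * c * d * (s ^ 2)⁻¹) * theta p (d * s * c⁻¹) * hm2 +
    (a * c * s)⁻¹ * (c ^ 2 * (s ^ 2)⁻¹)⁻¹ * (a * d * s⁻¹)⁻¹ * (a * s⁻¹)⁻¹ * (c * d)⁻¹ *
    ((c * d)⁻¹ * c⁻¹) * (theta p (a * d * s⁻¹) * theta p d * theta p (a * s⁻¹) *
    theta p (c ^ 2 * (s ^ 2)⁻¹) * ht - W))

end EllipticG2

namespace EllipticG2

/-! ### The theta function identity -/

variable {p q : ℂ}

/-- No nontrivial monomial in `u`, `v`, `w` has the modulus of a product of powers of `p` and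
`q`. -/
def IsGenericPair (p q u v w : ℂ) : Prop :=
  ∀ i j l k m : ℤ, i * Real.log ‖u‖ + j * Real.log ‖v‖ + l * Real.log ‖w‖ =
    k * Real.log ‖p‖ + m * Real.log ‖q‖ → i = 0 ∧ j = 0 ∧ l = 0

/-- Any point can be made generic by a dense set of scalings: the exceptional ones are countable. -/
lemma exists_dense_isGeneric {u v : ℂ} (hg : ∀ j l k : ℤ, j * Real.log ‖u‖ + l * Real.log ‖v‖ =
    k * Real.log ‖p‖ → j = 0 ∧ l = 0) {x : ℂ} (hx : x ≠ 0) :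
    ∃ D : Set ℝ, Dense D ∧ ∀ t ∈ D, IsGeneric p (x * Complex.exp t) u v := by
  refine ⟨(Set.range fun n : ℤ × ℤ × ℤ × ℤ => (n.2.1 * Real.log ‖p‖ - n.2.2.1 * Real.log ‖u‖ -
    n.2.2.2 * Real.log ‖v‖) / n.1 - Real.log ‖x‖)ᶜ, (Set.countable_range _).dense_compl ℝ, ?_⟩
  intro t ht i j l k h
  rw [norm_mul, Complex.norm_exp, Complex.ofReal_re, Real.log_mul (norm_ne_zero_iff.2 hx)
    (Real.exp_pos t).ne', Real.log_exp] at h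
  have hi : i = 0 := by
    by_contra hi
    refine ht ⟨(i, k, j, l), ?_⟩
    have : (i : ℝ) ≠ 0 := by exact_mod_cast hi
    simp only
    field_simp
    linear_combination -h
  subst hi
  refine ⟨rfl, hg j l k ?_⟩
  simpa using h

/-- An antisymmetric theta function vanishing on two generic lines `x = u`, `x = v` vanishes. -/
theorem IsAltTheta.eq_zero_of_lines (hp : ‖p‖ < 1) (hp0 : p ≠ 0) {E : ℂ → ℂ → ℂ → ℂ}
    (hE : IsAltTheta p E) {u v : ℂ} (hu : u ≠ 0) (hv : v ≠ 0)
    (hg : ∀ j l k : ℤ, j * Real.log ‖u‖ + l * Real.log ‖v‖ = k * Real.log ‖p‖ → j = 0 ∧ l = 0)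
    (h1 : ∀ y, y ≠ 0 → E u y (u * y)⁻¹ = 0) (h2 : ∀ y, y ≠ 0 → E v y (v * y)⁻¹ = 0)
    {x y : ℂ} (hx : x ≠ 0) (hy : y ≠ 0) : E x y (x * y)⁻¹ = 0 := by
  have swap : ∀ x y, x ≠ 0 → y ≠ 0 → E x y (x * y)⁻¹ = -E y x (y * x)⁻¹ := by
    intro x y hx hy
    rw [hE.swap12 y x (x * y)⁻¹ hy hx (by positivity), mul_comm x y]
  have main : ∀ x y, x ≠ 0 → y ≠ 0 → IsGeneric p x u v → E x y (x * y)⁻¹ = 0 := by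
    intro x y hx hy hg
    refine hE.eq_zero_on_line hp hp0 hx hu hv hg ?_ ?_ ?_ y hy
    · rw [swap x u hx hu, h1 x hx, neg_zero]
    · have hu' := inv_ne_zero hu
      rw [swap x u⁻¹ hx hu', ← hE.inv u⁻¹ x _ hu' hx (by positivity) (by field_simp), inv_inv,
        inv_inv, show u⁻¹ * x = (u * x⁻¹)⁻¹ by field_simp, h1 _ (inv_ne_zero hx), neg_zero]
    · rw [swap x v hx hv, h2 x hx, neg_zero]
  obtain ⟨D, hD, hDg⟩ := exists_dense_isGeneric hg hx
  have hc : Continuous fun t : ℝ => E y (x * Complex.exp t) (y * (x * Complex.exp t))⁻¹ := by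
    refine (hE.diff y hy).continuousOn.comp_continuous
      (f := fun t : ℝ => x * Complex.exp t) (by fun_prop) fun t => ?_
    exact mul_ne_zero hx (Complex.exp_ne_zero _)
  have h0 := Continuous.ext_on hD hc continuous_const (g := fun _ => (0 : ℂ)) fun t ht => by
    have hxt : x * Complex.exp t ≠ 0 := mul_ne_zero hx (Complex.exp_ne_zero _)
    have := main _ y hxt hy (hDg t ht)
    rw [swap _ _ hxt hy, neg_eq_zero] at this
    exact this
  have := congrFun h0 0
  simp only [Complex.ofReal_zero, Complex.exp_zero, mul_one] at this
  rw [swap x y hx hy, this, neg_zero]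

/-- The symmetrized seed is a combination of two products over short roots: the theta function
identity behind the `q`-difference equation of the integral. -/
theorem symNum_eq (hp : ‖p‖ < 1) (hp0 : p ≠ 0) (hq0 : q ≠ 0) {b : Fin 5 → ℂ} (hb : ∀ k, b k ≠ 0)
    (hβ : q * (∏ k, b k) ^ 2 = p) (hg : IsGenericPair p q (b 0) (b 1) (b 2)) {x y : ℂ}
    (hx : x ≠ 0) (hy : y ≠ 0) :
    theta p (b 1 * (b 0)⁻¹) * theta p ((∏ k, b k) * (b 1)⁻¹) * symNum p q b x y (x * y)⁻¹
      = (b 0 * b 1 * ∏ k, b k)⁻¹ *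
        (ratioFactor p q (b 0) (b 2) (b 3) (b 4) * shortTheta p (b 1) x y (x * y)⁻¹ -
          ratioFactor p q (b 1) (b 2) (b 3) (b 4) * shortTheta p (b 0) x y (x * y)⁻¹) *
        deltaTheta p x y (x * y)⁻¹ := by
  have h0 := hb 0
  have h1 := hb 1
  have h2 := hb 2
  have hs : ∏ k, b k ≠ 0 := Finset.prod_ne_zero_iff.2 fun k _ => hb k
  have hlog : Real.log ‖q‖ + 2 * Real.log ‖∏ k, b k‖ = Real.log ‖p‖ := by
    rw [← hβ, norm_mul, norm_pow, Real.log_mul (by positivity) (by positivity), Real.log_pow]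
    norm_num
  -- genericity and the balancing condition exclude coincidences that Weierstrass' relation forbids
  have n1 : ∀ k : ℤ, (∏ k, b k) ^ 3 ≠ p ^ k * (b 1 ^ 2 * b 0) := by
    intro k h
    have a := congrArg (fun t => Real.log ‖t‖) h
    simp only [norm_mul, norm_pow, norm_zpow] at a
    rw [Real.log_mul (by positivity) (by positivity), Real.log_mul (by positivity) (by positivity),
      Real.log_zpow, Real.log_pow, Real.log_pow] at a
    have := (hg 2 4 0 (3 - 2 * k) (-3) (by push_cast at a ⊢; linear_combination -2 * a + 3 * hlog)).1
    norm_num at this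
  have n2 : ∀ k : ℤ, (∏ k, b k) ^ 2 ≠ p ^ k * b 1 ^ 2 := by
    intro k h
    have a := congrArg (fun t => Real.log ‖t‖) h
    simp only [norm_mul, norm_pow, norm_zpow] at a
    rw [Real.log_mul (by positivity) (by positivity), Real.log_zpow, Real.log_pow,
      Real.log_pow] at a
    have := (hg 0 2 0 (1 - k) (-1) (by push_cast at a ⊢; linear_combination -a + hlog)).2.1
    norm_num at this
  have n3 : ∀ k : ℤ, b 0 ≠ p ^ k * ∏ k, b k := by
    intro k h
    have a := congrArg (fun t => Real.log ‖t‖) h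
    simp only [norm_mul, norm_zpow] at a
    rw [Real.log_mul (by positivity) (by positivity), Real.log_zpow] at a
    have := (hg 2 0 0 (2 * k + 1) (-1) (by push_cast at a ⊢; linear_combination 2 * a + hlog)).1
    norm_num at this
  have t0 : theta p (b 0) ≠ 0 := fun h => by
    obtain ⟨k, hk⟩ := theta_eq_zero hp h0 h
    have := (hg 1 0 0 k 0 (by rw [hk, norm_zpow, Real.log_zpow]; push_cast; ring)).1
    norm_num at this
  have t1 : theta p (b 1) ≠ 0 := fun h => by
    obtain ⟨k, hk⟩ := theta_eq_zero hp h1 h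
    have := (hg 0 1 0 k 0 (by rw [hk, norm_zpow, Real.log_zpow]; push_cast; ring)).2.1
    norm_num at this
  -- the difference of the two sides is an antisymmetric theta function, to be shown to vanish
  set E : ℂ → ℂ → ℂ → ℂ := fun x y w =>
    (theta p (b 1 * (b 0)⁻¹) * theta p ((∏ k, b k) * (b 1)⁻¹) * symNum p q b x y w +
      -((b 0 * b 1 * ∏ k, b k)⁻¹ * ratioFactor p q (b 0) (b 2) (b 3) (b 4)) *
        (shortTheta p (b 1) x y w * deltaTheta p x y w)) +
      (b 0 * b 1 * ∏ k, b k)⁻¹ * ratioFactor p q (b 1) (b 2) (b 3) (b 4) *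
        (shortTheta p (b 0) x y w * deltaTheta p x y w) with hEdef
  have hE : IsAltTheta p E :=
    (((isAltTheta_symNum hp hp0 hq0 hb hβ).const_mul _).add
      ((isAltTheta_short_mul_delta hp hp0 h1).const_mul _)).add
      ((isAltTheta_short_mul_delta hp hp0 h0).const_mul _)
  have s1 : ∀ u y w, u ≠ 0 → shortTheta p u u y w = 0 := fun u y w hu => by
    rw [shortTheta, mul_inv_cancel₀ hu, theta_one hp]; ring
  have s2 : ∀ u x w, u ≠ 0 → shortTheta p u x u w = 0 := fun u x w hu => by
    rw [shortTheta, mul_inv_cancel₀ hu, theta_one hp]; ring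
  have s3 : ∀ u x w, u ≠ 0 → shortTheta p u x u⁻¹ w = 0 := fun u x w hu => by
    rw [shortTheta, mul_inv_cancel₀ hu, theta_one hp]; ring
  -- on each of the lines `x = b 0` and `x = b 1`, three test points suffice
  have line0 : ∀ y, y ≠ 0 → E (b 0) y (b 0 * y)⁻¹ = 0 := by
    refine hE.eq_zero_on_line hp hp0 h0 h1 h2 (fun i j l k h => hg i j l k 0 (by simpa using h))
      ?_ ?_ ?_
    · simp only [hEdef]; rw [symNum_b0_b1 hp hb, s1 _ _ _ h0, s2 _ _ _ h1]; ring
    · simp only [hEdef]; rw [symNum_b0_inv_b1 hp hb, s1 _ _ _ h0, s3 _ _ _ h1]; ring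
    · simp only [hEdef]; rw [symNum_b0_b2 hp hb, num_b0_b2_eq hp hb t0, s1 _ _ _ h0]; ring
  have line1 : ∀ y, y ≠ 0 → E (b 1) y (b 1 * y)⁻¹ = 0 := by
    refine hE.eq_zero_on_line hp hp0 h1 h0 h2
      (fun i j l k h => ?_) ?_ ?_ ?_
    · have := hg j i l k 0 (by push_cast; linear_combination h)
      tauto
    · rw [hE.swap12 (b 0) (b 1) _ h0 h1 (by positivity), mul_comm, line0 _ h1, neg_zero]
    · rw [← hE.inv _ _ _ h1 (inv_ne_zero h0) (by positivity) (by field_simp), inv_inv, inv_inv,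
        hE.swap12 (b 0) (b 1)⁻¹ _ h0 (inv_ne_zero h1) (by positivity),
        show b 1 * (b 0)⁻¹ = (b 0 * (b 1)⁻¹)⁻¹ by field_simp, line0 _ (inv_ne_zero h1), neg_zero]
    · simp only [hEdef]
      rw [symNum_b1_b2 hp hb, num_b1_b2_eq hp hp0 hb hβ t1 n1 n2 n3, s1 _ _ _ h1]; ring
  have := hE.eq_zero_of_lines hp hp0 h0 h1
    (fun j l k h => by
      have := hg j l 0 k 0 (by simpa using h)
      exact ⟨this.1, this.2.1⟩) line0 line1 hx hy
  simp only [hEdef] at this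
  linear_combination this

end EllipticG2

namespace EllipticG2

/-! ### Means over the compact torus -/

open MeasureTheory

variable {E : Type*} [NormedAddCommGroup E] [NormedSpace ℝ E]

set_option linter.unusedSectionVars false

/-- The uniform probability measure on angles. -/
noncomputable def angleMeasure : Measure ℝ :=
  (ENNReal.ofReal (2 * π))⁻¹ • volume.restrict (Set.Ioc 0 (2 * π))

instance : IsProbabilityMeasure angleMeasure := by
  constructor
  have h : ENNReal.ofReal (2 * π) ≠ 0 := by simp [Real.pi_pos]
  rw [angleMeasure, Measure.smul_apply, Measure.restrict_apply_univ, Real.volume_Ioc, sub_zero,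
    smul_eq_mul, ENNReal.inv_mul_cancel h ENNReal.ofReal_ne_top]

lemma integral_angleMeasure (f : ℂ → E) :
    ∫ θ, f (circleMap 0 1 θ) ∂angleMeasure = Real.circleAverage f 0 1 := by
  rw [angleMeasure, integral_smul_measure, Real.circleAverage,
    intervalIntegral.integral_of_le Real.two_pi_pos.le, ENNReal.toReal_inv,
    ENNReal.toReal_ofReal Real.two_pi_pos.le]

/-- The restriction of a function of `(x, y, w)` to the compact torus `|x| = |y| = 1`,
`x y w = 1`, in angular coordinates. -/
noncomputable def onTorus {X : Type*} (F : ℂ → ℂ → ℂ → X) (t : ℝ × ℝ) : X :=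
  F (circleMap 0 1 t.1) (circleMap 0 1 t.2) (circleMap 0 1 t.1 * circleMap 0 1 t.2)⁻¹

/-- The mean of a function of `(x, y, w)` over the compact torus `|x| = |y| = 1`, `x y w = 1`. -/
noncomputable def torusMean (F : ℂ → ℂ → ℂ → E) : E :=
  ∫ t, onTorus F t ∂(angleMeasure.prod angleMeasure)

lemma norm_circleMap (θ : ℝ) : ‖circleMap 0 1 θ‖ = 1 := by simp

lemma circleMap_ne_zero (θ : ℝ) : circleMap 0 1 θ ≠ 0 := by
  simp

lemma circleMap_mul (θ η : ℝ) : circleMap 0 1 θ * circleMap 0 1 η = circleMap 0 1 (θ + η) := by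
  simp [circleMap, add_mul, Complex.exp_add]

lemma circleMap_inv (θ : ℝ) : (circleMap 0 1 θ)⁻¹ = circleMap 0 1 (-θ) := by
  simp [circleMap, ← Complex.exp_neg]

lemma circleAverage_mul_left (f : ℂ → E) {c : ℂ} (hc : ‖c‖ = 1) :
    Real.circleAverage (fun y => f (c * y)) 0 1 = Real.circleAverage f 0 1 := by
  obtain ⟨η, rfl⟩ : ∃ η : ℝ, circleMap 0 1 η = c := by
    refine ⟨Complex.arg c, ?_⟩
    have := Complex.norm_mul_exp_arg_mul_I c
    rw [hc, Complex.ofReal_one, one_mul] at this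
    rw [circleMap, zero_add, Complex.ofReal_one, one_mul, this]
  rw [Real.circleAverage_eq_integral_add (f := f) η, Real.circleAverage]
  simp_rw [circleMap_mul, add_comm η]

lemma continuous_onTorus {X : Type*} [TopologicalSpace X] {F : ℂ → ℂ → ℂ → X}
    (h : ∀ x y : ℂ, ‖x‖ = 1 → ‖y‖ = 1 →
      ContinuousAt (fun z : ℂ × ℂ => F z.1 z.2 (z.1 * z.2)⁻¹) (x, y)) :
    Continuous (onTorus F) := by
  rw [continuous_iff_continuousAt]
  intro t
  exact ContinuousAt.comp (g := fun z : ℂ × ℂ => F z.1 z.2 (z.1 * z.2)⁻¹)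
    (f := fun t : ℝ × ℝ => (circleMap 0 1 t.1, circleMap 0 1 t.2))
    (h _ _ (norm_circleMap _) (norm_circleMap _)) (by fun_prop)

lemma integrable_of_continuous {f : ℝ × ℝ → E} (hf : Continuous f) :
    Integrable f (angleMeasure.prod angleMeasure) := by
  have h : angleMeasure.prod angleMeasure = ((ENNReal.ofReal (2 * π))⁻¹ *
      (ENNReal.ofReal (2 * π))⁻¹) •
      (volume.restrict (Set.Ioc 0 (2 * π) ×ˢ Set.Ioc 0 (2 * π)) : Measure (ℝ × ℝ)) := by
    rw [angleMeasure, Measure.prod_smul_left, Measure.prod_smul_right, Measure.prod_restrict,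
      smul_smul, Measure.volume_eq_prod]
  rw [h]
  have h2 : (ENNReal.ofReal (2 * π))⁻¹ ≠ ⊤ :=
    ENNReal.inv_ne_top.2 (by simp [Real.pi_pos])
  refine Integrable.smul_measure ?_ (ENNReal.mul_ne_top h2 h2)
  exact (hf.continuousOn.integrableOn_compact (isCompact_Icc.prod isCompact_Icc)).mono_set
    (Set.prod_mono Set.Ioc_subset_Icc_self Set.Ioc_subset_Icc_self)

lemma torusMean_congr {F G : ℂ → ℂ → ℂ → E}
    (h : ∀ x y w : ℂ, ‖x‖ = 1 → ‖y‖ = 1 → ‖w‖ = 1 → x * y * w = 1 → F x y w = G x y w) :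
    torusMean F = torusMean G := by
  unfold torusMean
  congr 1
  funext t
  have hxy : circleMap 0 1 t.1 * circleMap 0 1 t.2 ≠ 0 :=
    mul_ne_zero (circleMap_ne_zero _) (circleMap_ne_zero _)
  exact h _ _ _ (norm_circleMap _) (norm_circleMap _)
    (by rw [norm_inv, norm_mul, norm_circleMap, norm_circleMap]; norm_num) (mul_inv_cancel₀ hxy)

lemma torusMean_swap12 (F : ℂ → ℂ → ℂ → E) : torusMean (fun x y w => F y x w) = torusMean F := by
  unfold torusMean
  rw [← integral_prod_swap]
  congr 1
  funext t
  simp [onTorus, mul_comm]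

lemma torusMean_eq_circleAverage {F : ℂ → ℂ → ℂ → E} (hF : Continuous (onTorus F)) :
    torusMean F = Real.circleAverage (fun x =>
      Real.circleAverage (fun y => F x y (x * y)⁻¹) 0 1) 0 1 := by
  unfold torusMean
  rw [integral_prod _ (integrable_of_continuous hF), ← integral_angleMeasure]
  congr 1
  funext θ
  rw [← integral_angleMeasure]
  rfl

lemma onTorus_swap23 {X : Type*} (F : ℂ → ℂ → ℂ → X) (t : ℝ × ℝ) :
    onTorus (fun x y w => F x w y) t = onTorus F (t.1, -(t.1 + t.2)) := by
  simp only [onTorus]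
  simp only [circleMap_mul, circleMap_inv]
  congr 2
  ring

lemma continuous_onTorus_swap23 {X : Type*} [TopologicalSpace X] {F : ℂ → ℂ → ℂ → X}
    (hF : Continuous (onTorus F)) : Continuous (onTorus fun x y w => F x w y) := by
  rw [show onTorus (fun x y w => F x w y) = fun t => onTorus F (t.1, -(t.1 + t.2)) from
    funext (onTorus_swap23 F)]
  exact hF.comp (by fun_prop)

lemma continuous_onTorus_swap12 {X : Type*} [TopologicalSpace X] {F : ℂ → ℂ → ℂ → X}
    (hF : Continuous (onTorus F)) : Continuous (onTorus fun x y w => F y x w) := by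
  rw [show onTorus (fun x y w => F y x w) = fun t => onTorus F t.swap from
    funext fun t => by simp [onTorus, mul_comm]]
  exact hF.comp continuous_swap

lemma continuous_onTorus_inv {X : Type*} [TopologicalSpace X] {F : ℂ → ℂ → ℂ → X}
    (hF : Continuous (onTorus F)) : Continuous (onTorus fun x y w => F x⁻¹ y⁻¹ w⁻¹) := by
  rw [show onTorus (fun x y w => F x⁻¹ y⁻¹ w⁻¹) = fun t => onTorus F (-t.1, -t.2) from
    funext fun t => by simp only [onTorus]; simp only [circleMap_mul, circleMap_inv]; congr 2; ring]
  exact hF.comp (by fun_prop)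

lemma torusMean_swap23 {F : ℂ → ℂ → ℂ → E} (hF : Continuous (onTorus F)) :
    torusMean (fun x y w => F x w y) = torusMean F := by
  rw [torusMean_eq_circleAverage hF, torusMean_eq_circleAverage (continuous_onTorus_swap23 hF)]
  refine Real.circleAverage_congr_sphere fun x hx => ?_
  have hx1 : ‖x‖ = 1 := by simpa using hx
  have hx0 : x ≠ 0 := norm_ne_zero_iff.1 (by rw [hx1]; norm_num)
  rw [← Real.circleAverage_zero_one_congr_inv (f := fun y => F x y (x * y)⁻¹),
    ← circleAverage_mul_left (fun y => F x y⁻¹ (x * y⁻¹)⁻¹) hx1]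
  refine Real.circleAverage_congr_sphere fun y hy => ?_
  have e : (x * (x * y)⁻¹)⁻¹ = y := by
    rw [mul_inv, inv_inv, inv_mul_cancel_left₀ hx0]
  rw [e]

lemma torusMean_inv {F : ℂ → ℂ → ℂ → E} (hF : Continuous (onTorus F)) :
    torusMean (fun x y w => F x⁻¹ y⁻¹ w⁻¹) = torusMean F := by
  rw [torusMean_eq_circleAverage hF, torusMean_eq_circleAverage (continuous_onTorus_inv hF),
    ← Real.circleAverage_zero_one_congr_inv (f := fun x =>
      Real.circleAverage (fun y => F x y (x * y)⁻¹) 0 1)]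
  refine Real.circleAverage_congr_sphere fun x hx => ?_
  rw [← Real.circleAverage_zero_one_congr_inv (f := fun y => F x⁻¹ y (x⁻¹ * y)⁻¹)]
  simp only [mul_inv, inv_inv]

lemma torusMean_add {F G : ℂ → ℂ → ℂ → E} (hF : Continuous (onTorus F))
    (hG : Continuous (onTorus G)) :
    torusMean (fun x y w => F x y w + G x y w) = torusMean F + torusMean G :=
  integral_add (integrable_of_continuous hF) (integrable_of_continuous hG)

lemma torusMean_sub {F G : ℂ → ℂ → ℂ → E} (hF : Continuous (onTorus F))
    (hG : Continuous (onTorus G)) :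
    torusMean (fun x y w => F x y w - G x y w) = torusMean F - torusMean G :=
  integral_sub (integrable_of_continuous hF) (integrable_of_continuous hG)

lemma torusMean_const_mul (c : ℂ) (F : ℂ → ℂ → ℂ → ℂ) :
    torusMean (fun x y w => c * F x y w) = c * torusMean F :=
  integral_const_mul c (onTorus F)

lemma norm_torusMean_le {F : ℂ → ℂ → ℂ → E} {G : ℂ → ℂ → ℂ → ℝ} (hG : Continuous (onTorus G))
    (h : ∀ t, ‖onTorus F t‖ ≤ onTorus G t) : ‖torusMean F‖ ≤ torusMean G :=
  norm_integral_le_of_norm_le (integrable_of_continuous hG) (Eventually.of_forall h)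

/-- The integral `I(a)` is a mean over the torus, in the coordinates given by the short roots. -/
lemma integralI_eq_torusMean (p q : ℂ) (a : Fin 5 → ℂ) {F : ℂ → ℂ → ℂ → ℂ}
    (hF : Continuous (onTorus F)) (h : ∀ z : Fin 2 → ℂ, ‖z 0‖ = 1 → ‖z 1‖ = 1 →
      Phi p q a z = F (z 1) (z 0 * z 1) (z 0 * z 1 ^ 2)⁻¹) :
    TorusIntegrable (density p q a) 0 1 ∧ integralI p q a = torusMean F := by
  have hint : TorusIntegrable (density p q a) 0 1 := by
    unfold TorusIntegrable
    have e : (fun θ : Fin 2 → ℝ => density p q a (torusMap 0 1 θ)) = fun θ =>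
        onTorus F (θ 1, θ 0 + θ 1) / (circleMap 0 1 (θ 0) * circleMap 0 1 (θ 1)) := by
      funext θ
      have e0 : ∀ i, torusMap 0 1 θ i = circleMap 0 1 (θ i) := fun i => by simp [torusMap, circleMap]
      rw [density, h _ (by rw [e0, norm_circleMap]) (by rw [e0, norm_circleMap]), e0, e0, onTorus]
      simp only [← circleMap_mul]
      congr 3
      ring
    rw [e]
    refine ContinuousOn.integrableOn_compact isCompact_Icc ?_
    refine Continuous.continuousOn ?_
    refine (hF.comp (by fun_prop)).div (by fun_prop) fun θ => ?_
    exact mul_ne_zero (circleMap_ne_zero _) (circleMap_ne_zero _)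
  refine ⟨hint, ?_⟩
  rw [integralI, torusIntegral_succAbove hint 1, torusMean_eq_circleAverage hF,
    Real.circleAverage_eq_circleIntegral one_ne_zero]
  have e1 : ∀ x : ℂ, ‖x‖ = 1 → (∯ y in T((0 : Fin 2 → ℂ) ∘ Fin.succAbove 1, (1 : Fin 2 → ℝ) ∘
      Fin.succAbove 1), density p q a (Fin.insertNth 1 x y)) = (2 * π * Complex.I) *
      ((x - 0)⁻¹ • Real.circleAverage (fun y => F x y (x * y)⁻¹) 0 1) := by
    intro x hx
    have hx0 : x ≠ 0 := norm_ne_zero_iff.1 (by rw [hx]; norm_num)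
    rw [torusIntegral_dim1, ← circleAverage_mul_left _ hx,
      Real.circleAverage_eq_circleIntegral one_ne_zero]
    simp only [Function.comp, Pi.zero_apply, Pi.one_apply, smul_eq_mul, sub_zero]
    rw [mul_left_comm, mul_inv_cancel_left₀ (by simp [Real.pi_ne_zero]),
      ← circleIntegral.integral_const_mul]
    refine circleIntegral.integral_congr zero_le_one fun y hy => ?_
    have hy1 : ‖y‖ = 1 := by simpa using hy
    have e0 : (Fin.insertNth 1 x (fun _ => y) : Fin 2 → ℂ) = ![y, x] := by
      funext i; fin_cases i <;> rfl
    rw [e0, density, h _ (by simpa using hy1) (by simpa using hx)]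
    simp only [Matrix.cons_val_zero, Matrix.cons_val_one]
    rw [mul_comm y x, show x * (x * y) = y * x ^ 2 by ring]
    field_simp
  have e2 := circleIntegral.integral_congr (c := 0) zero_le_one
    fun x hx => e1 x (by simpa using hx)
  rw [circleIntegral.integral_const_mul] at e2
  simp only [Pi.zero_apply, Pi.one_apply]
  rw [e2]
  have : (2 * (π : ℂ) * Complex.I) ≠ 0 := by simp [Real.pi_ne_zero]
  simp only [smul_eq_mul]
  field_simp

end EllipticG2

namespace EllipticG2

/-! ### The integrand in the coordinates of the short roots -/

open MeasureTheory

variable {p q : ℂ}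

/-- `∏ Γ(u z^ω)` over the short roots `ω`. -/
noncomputable def shortGamma (p q u x y w : ℂ) : ℂ :=
  ellGamma p q (u * x) * ellGamma p q (u * x⁻¹) * (ellGamma p q (u * y) * ellGamma p q (u * y⁻¹)) *
    (ellGamma p q (u * w) * ellGamma p q (u * w⁻¹))

/-- The integrand on the compact torus, in the coordinates given by the short roots: by the
reflection formula the denominator is a product of theta functions. -/
noncomputable def kernel (p q : ℂ) (a : Fin 5 → ℂ) (x y w : ℂ) : ℂ :=
  (∏ k, shortGamma p q (a k) x y w) * (deltaTheta p x y w * deltaTheta q x y w)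

section differentiable

variable {V : Type*} [NormedAddCommGroup V] [NormedSpace ℂ V] {x y w u : V → ℂ} {v : V}

lemma DifferentiableAt.ellGamma (hp : ‖p‖ < 1) (hq : ‖q‖ < 1) (hu : DifferentiableAt ℂ u v)
    (h0 : u v ≠ 0) (h1 : ‖u v‖ < 1) : DifferentiableAt ℂ (fun v => ellGamma p q (u v)) v :=
  DifferentiableAt.comp (g := EllipticG2.ellGamma p q) v
    (differentiableAt_ellGamma hp hq h0 (pqPoch_ne_zero hp hq h1)) hu

lemma differentiableAt_deltaTheta (hp : ‖p‖ < 1) (hx : DifferentiableAt ℂ x v)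
    (hy : DifferentiableAt ℂ y v) (hw : DifferentiableAt ℂ w v) (hx0 : x v ≠ 0) (hy0 : y v ≠ 0)
    (hw0 : w v ≠ 0) : DifferentiableAt ℂ (fun v => deltaTheta p (x v) (y v) (w v)) v := by
  have hxi := hx.fun_inv hx0
  have hyi := hy.fun_inv hy0
  have hwi := hw.fun_inv hw0
  unfold deltaTheta
  exact ((((DifferentiableAt.theta hp hx hx0).mul (DifferentiableAt.theta hp hy hy0)).mul
    (DifferentiableAt.theta hp hw hw0)).mul
    (((DifferentiableAt.theta hp (hx.fun_mul hyi) (by positivity)).mul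
      (DifferentiableAt.theta hp (hx.fun_mul hwi) (by positivity))).mul
      (DifferentiableAt.theta hp (hy.fun_mul hwi) (by positivity)))).mul (hw.fun_mul hxi)

lemma differentiableAt_shortGamma (hp : ‖p‖ < 1) (hq : ‖q‖ < 1) (hu : DifferentiableAt ℂ u v)
    (hx : DifferentiableAt ℂ x v) (hy : DifferentiableAt ℂ y v) (hw : DifferentiableAt ℂ w v)
    (hu0 : u v ≠ 0) (hu1 : ‖u v‖ < 1) (hx1 : ‖x v‖ = 1) (hy1 : ‖y v‖ = 1) (hw1 : ‖w v‖ = 1) :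
    DifferentiableAt ℂ (fun v => shortGamma p q (u v) (x v) (y v) (w v)) v := by
  have key : ∀ z : V → ℂ, DifferentiableAt ℂ z v → ‖z v‖ = 1 → DifferentiableAt ℂ
      (fun v => EllipticG2.ellGamma p q (u v * z v) * EllipticG2.ellGamma p q (u v * (z v)⁻¹)) v := by
    intro z hz hz1
    have hz0 : z v ≠ 0 := norm_ne_zero_iff.1 (by rw [hz1]; norm_num)
    exact (DifferentiableAt.ellGamma hp hq (hu.fun_mul hz) (by positivity)
      (by rwa [norm_mul, hz1, mul_one])).mul
      (DifferentiableAt.ellGamma hp hq (hu.fun_mul (hz.fun_inv hz0)) (by positivity)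
      (by rwa [norm_mul, norm_inv, hz1, inv_one, mul_one]))
  exact ((key x hx hx1).mul (key y hy hy1)).mul (key w hw hw1)

lemma differentiableAt_kernel (hp : ‖p‖ < 1) (hq : ‖q‖ < 1) {a : V → Fin 5 → ℂ}
    (ha : ∀ k, DifferentiableAt ℂ (fun v => a v k) v)
    (hx : DifferentiableAt ℂ x v) (hy : DifferentiableAt ℂ y v) (hw : DifferentiableAt ℂ w v)
    (ha0 : ∀ k, a v k ≠ 0) (ha1 : ∀ k, ‖a v k‖ < 1) (hx1 : ‖x v‖ = 1) (hy1 : ‖y v‖ = 1)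
    (hw1 : ‖w v‖ = 1) : DifferentiableAt ℂ (fun v => kernel p q (a v) (x v) (y v) (w v)) v := by
  have n0 : ∀ z : ℂ, ‖z‖ = 1 → z ≠ 0 := fun z hz => norm_ne_zero_iff.1 (by rw [hz]; norm_num)
  have t := fun k => differentiableAt_shortGamma hp hq (ha k) hx hy hw (ha0 k) (ha1 k) hx1 hy1 hw1
  unfold kernel
  simp only [Fin.prod_univ_five]
  exact (((((t 0).mul (t 1)).mul (t 2)).mul (t 3)).mul (t 4)).mul
    ((differentiableAt_deltaTheta hp hx hy hw (n0 _ hx1) (n0 _ hy1) (n0 _ hw1)).mul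
    (differentiableAt_deltaTheta hq hx hy hw (n0 _ hx1) (n0 _ hy1) (n0 _ hw1)))

end differentiable

lemma continuous_onTorus_of_differentiableAt {F : ℂ → ℂ → ℂ → ℂ}
    (h : ∀ z : ℂ × ℂ, ‖z.1‖ = 1 → ‖z.2‖ = 1 → ∀ w : ℂ × ℂ → ℂ, DifferentiableAt ℂ w z →
      ‖w z‖ = 1 → DifferentiableAt ℂ (fun z : ℂ × ℂ => F z.1 z.2 (w z)) z) :
    Continuous (onTorus F) := by
  refine continuous_onTorus fun x y hx hy => (h (x, y) hx hy _ ?_ ?_).continuousAt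
  · refine (differentiableAt_fst.fun_mul differentiableAt_snd).fun_inv ?_
    refine norm_ne_zero_iff.1 ?_
    rw [norm_mul, hx, hy]; norm_num
  · rw [norm_inv, norm_mul, hx, hy]; norm_num

lemma continuous_onTorus_kernel (hp : ‖p‖ < 1) (hq : ‖q‖ < 1) {a : Fin 5 → ℂ}
    (ha0 : ∀ k, a k ≠ 0) (ha1 : ∀ k, ‖a k‖ < 1) : Continuous (onTorus (kernel p q a)) :=
  continuous_onTorus_of_differentiableAt fun _ h1 h2 _ hw hw1 =>
    differentiableAt_kernel hp hq (a := fun _ => a) (fun _ => differentiableAt_const _)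
      differentiableAt_fst differentiableAt_snd hw ha0 ha1 h1 h2 hw1

lemma Phi_eq_kernel (hp : ‖p‖ < 1) (hq : ‖q‖ < 1) (a : Fin 5 → ℂ) (z : Fin 2 → ℂ) (h0 : ‖z 0‖ = 1)
    (h1 : ‖z 1‖ = 1) :
    Phi p q a z = kernel p q a (z 1) (z 0 * z 1) (z 0 * z 1 ^ 2)⁻¹ := by
  have n0 : ∀ z : ℂ, ‖z‖ = 1 → z ≠ 0 := fun z hz => norm_ne_zero_iff.1 (by rw [hz]; norm_num)
  have hz0 := n0 _ h0
  have hz1 := n0 _ h1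
  have R : ∀ u : ℂ, ‖u‖ = 1 → (ellGamma p q u)⁻¹ * (ellGamma p q u⁻¹)⁻¹
      = theta p u * theta q u⁻¹ := by
    intro u hu
    have hpq : ‖p * q‖ < 1 := norm_mul_lt_one hp hq.le
    rw [← mul_inv, inv_ellGamma_mul_inv hp hq
      (pqPoch_ne_zero hp hq (norm_mul_lt_one hpq (by rw [norm_inv, hu, inv_one])))
      (pqPoch_ne_zero hp hq (norm_mul_lt_one hpq hu.le))]
  have r1 := R (z 1) h1
  have r2 := R (z 0 * z 1) (by rw [norm_mul, h0, h1, one_mul])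
  have r3 := R (z 0 * z 1 ^ 2) (by rw [norm_mul, norm_pow, h0, h1]; norm_num)
  have r4 := R (z 0) h0
  have r5 := R (z 0 * z 1 ^ 3) (by rw [norm_mul, norm_pow, h0, h1]; norm_num)
  have r6 := R (z 0 ^ 2 * z 1 ^ 3) (by rw [norm_mul, norm_pow, norm_pow, h0, h1]; norm_num)
  have hprod : (∏ k, ellGamma p q (a k * z 1) * ellGamma p q (a k * (z 0 * z 1)) *
      ellGamma p q (a k * (z 0 * z 1 ^ 2))) * (∏ k, ellGamma p q (a k * (z 1)⁻¹) *
      ellGamma p q (a k * (z 0 * z 1)⁻¹) * ellGamma p q (a k * (z 0 * z 1 ^ 2)⁻¹))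
      = ∏ k, shortGamma p q (a k) (z 1) (z 0 * z 1) (z 0 * z 1 ^ 2)⁻¹ := by
    rw [← Finset.prod_mul_distrib]
    refine Finset.prod_congr rfl fun k _ => ?_
    rw [shortGamma, inv_inv]
    ring
  have ei : ∀ i j : ℕ, (z 0)⁻¹ ^ i * (z 1)⁻¹ ^ j = (z 0 ^ i * z 1 ^ j)⁻¹ := fun i j => by
    rw [mul_inv, inv_pow, inv_pow]
  have e1 := ei 1 1
  have e2 := ei 1 2
  have e3 := ei 1 3
  simp only [pow_one] at e1 e2 e3
  rw [Phi, PhiPlus, PhiPlus, e1, e2, e3, ei 2 3, kernel, ← hprod]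
  have hd : ∀ {t : ℂ}, ‖t‖ < 1 → deltaTheta t (z 1) (z 0 * z 1) (z 0 * z 1 ^ 2)⁻¹ =
      theta t (z 1) * theta t (z 0 * z 1) * theta t (z 0 * z 1 ^ 2) * theta t (z 0) *
        theta t (z 0 * z 1 ^ 3) * theta t (z 0 ^ 2 * z 1 ^ 3) *
        (z 0 ^ 3 * z 1 ^ 5)⁻¹ := by
    intro t ht
    rw [deltaTheta, theta_inv ht (by positivity), inv_inv,
      theta_eq_of_inv ht (u := z 1 * (z 0 * z 1)⁻¹) (v := z 0) hz0 (by field_simp),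
      show z 1 * (z 0 * z 1 ^ 2) = z 0 * z 1 ^ 3 by ring,
      show z 0 * z 1 * (z 0 * z 1 ^ 2) = z 0 ^ 2 * z 1 ^ 3 by ring]
    have hm : (z 0 * z 1 ^ 2)⁻¹ * (z 0)⁻¹ * ((z 0 * z 1 ^ 2)⁻¹ * (z 1)⁻¹)
      = (z 0 ^ 3 * z 1 ^ 5)⁻¹ := by field_simp
    linear_combination (theta t (z 1) * theta t (z 0 * z 1) * theta t (z 0 * z 1 ^ 2) *
      theta t (z 0) * theta t (z 0 * z 1 ^ 3) * theta t (z 0 ^ 2 * z 1 ^ 3)) * hm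
  rw [hd hp, hd hq]
  rw [theta_inv hq hz1] at r1
  rw [theta_inv hq (by positivity)] at r2 r3 r4 r5 r6
  have hm : (z 1)⁻¹ * (z 0 * z 1)⁻¹ * (z 0 * z 1 ^ 2)⁻¹ * (z 0)⁻¹ * (z 0 * z 1 ^ 3)⁻¹ *
      (z 0 ^ 2 * z 1 ^ 3)⁻¹ = (z 0 ^ 3 * z 1 ^ 5)⁻¹ * (z 0 ^ 3 * z 1 ^ 5)⁻¹ := by
    field_simp
  rw [div_mul_div_comm, div_eq_mul_inv]
  congr 1
  calc _ = ((ellGamma p q (z 1))⁻¹ * (ellGamma p q (z 1)⁻¹)⁻¹) *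
        ((ellGamma p q (z 0 * z 1))⁻¹ * (ellGamma p q (z 0 * z 1)⁻¹)⁻¹) *
        ((ellGamma p q (z 0 * z 1 ^ 2))⁻¹ * (ellGamma p q (z 0 * z 1 ^ 2)⁻¹)⁻¹) *
        ((ellGamma p q (z 0))⁻¹ * (ellGamma p q (z 0)⁻¹)⁻¹) *
        ((ellGamma p q (z 0 * z 1 ^ 3))⁻¹ * (ellGamma p q (z 0 * z 1 ^ 3)⁻¹)⁻¹) *
        ((ellGamma p q (z 0 ^ 2 * z 1 ^ 3))⁻¹ * (ellGamma p q (z 0 ^ 2 * z 1 ^ 3)⁻¹)⁻¹) := by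
        simp only [mul_inv]; ring
    _ = _ := by
        rw [r1, r2, r3, r4, r5, r6]
        linear_combination (theta p (z 1) * theta p (z 0 * z 1) * theta p (z 0 * z 1 ^ 2) *
          theta p (z 0) * theta p (z 0 * z 1 ^ 3) * theta p (z 0 ^ 2 * z 1 ^ 3) *
          (theta q (z 1) * theta q (z 0 * z 1) * theta q (z 0 * z 1 ^ 2) *
          theta q (z 0) * theta q (z 0 * z 1 ^ 3) * theta q (z 0 ^ 2 * z 1 ^ 3))) * hm

theorem integralI_eq (hp : ‖p‖ < 1) (hq : ‖q‖ < 1) {a : Fin 5 → ℂ} (ha0 : ∀ k, a k ≠ 0)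
    (ha1 : ∀ k, ‖a k‖ < 1) : TorusIntegrable (density p q a) 0 1 ∧
      integralI p q a = torusMean (kernel p q a) :=
  integralI_eq_torusMean p q a (continuous_onTorus_kernel hp hq ha0 ha1) (Phi_eq_kernel hp hq a)

end EllipticG2

namespace EllipticG2

/-! ### The `q`-difference equation of the integral -/

variable {p q : ℂ}

/-- The mean over the unit circle of a function holomorphic on the annulus `|q| ≤ |z| ≤ 1` does not
change under `z ↦ q z`. -/
lemma circleAverage_mul_of_annulus {f : ℂ → ℂ} (hq0 : q ≠ 0) (hq : ‖q‖ < 1)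
    (hf : ∀ z : ℂ, ‖q‖ ≤ ‖z‖ → ‖z‖ ≤ 1 → DifferentiableAt ℂ f z) :
    Real.circleAverage (fun z => f (q * z)) 0 1 = Real.circleAverage f 0 1 := by
  have hq1 : 0 < ‖q‖ := norm_pos_iff.2 hq0
  have hq2 : (‖q‖ : ℂ) ≠ 0 := by exact_mod_cast hq1.ne'
  have e1 : Real.circleAverage f 0 1 = Real.circleAverage f 0 ‖q‖ := by
    rw [Real.circleAverage_eq_circleIntegral one_ne_zero,
      Real.circleAverage_eq_circleIntegral hq1.ne']
    congr 1
    refine Complex.circleIntegral_sub_center_inv_smul_eq_of_differentiable_on_annulus_off_countable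
      hq1 hq.le Set.countable_empty ?_ ?_
    · intro z hz
      refine (hf z ?_ ?_).continuousAt.continuousWithinAt
      · simpa using hz.2
      · simpa using hz.1
    · intro z hz
      refine hf z ?_ ?_
      · have := hz.1.2
        simp only [Metric.mem_closedBall, dist_zero_right, not_le] at this
        exact this.le
      · have := hz.1.1
        simp only [Metric.mem_ball, dist_zero_right] at this
        exact this.le
  rw [e1, Real.circleAverage_eq_circleAverage_zero_one (f := f) (R := ‖q‖),
    ← circleAverage_mul_left (fun z => f (‖q‖ * z + 0)) (c := q * (‖q‖ : ℂ)⁻¹) (by simp [hq1.ne'])]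
  congr 1
  funext z
  congr 1
  field_simp
  ring

/-- The product of elliptic gamma functions in the seed of the exact form. -/
noncomputable def seedGamma (p q u x y w : ℂ) : ℂ :=
  ellGamma p q (u * x) * ellGamma p q (q * u * x⁻¹) *
    (ellGamma p q (q * u * y) * ellGamma p q (u * y⁻¹)) *
    (ellGamma p q (u * w) * ellGamma p q (u * w⁻¹))

/-- A function that the shift `x ↦ q x`, `y ↦ y / q` carries to minus its reflection, so that its
mean over the torus vanishes. -/
noncomputable def seed (p q : ℂ) (b : Fin 5 → ℂ) (x y w : ℂ) : ℂ :=
  (∏ k, seedGamma p q (b k) x y w) * (deltaTheta q x y w * numRest p q b x y w)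

lemma deltaTheta_mul_div (hq0 : q ≠ 0) (hq : ‖q‖ < 1) {x y w : ℂ} (hx : x ≠ 0) (hy : y ≠ 0)
    (hw : w ≠ 0) : deltaTheta q (q * x) (q⁻¹ * y) w
      = (q ^ 4)⁻¹ * (y * x⁻¹) ^ 4 * deltaTheta q x y w := by
  have e1 : theta q (q * x * (q⁻¹ * y)⁻¹)
      = (q * (x * y⁻¹))⁻¹ * (x * y⁻¹)⁻¹ * theta q (x * y⁻¹) := by
    rw [show q * x * (q⁻¹ * y)⁻¹ = q * (q * (x * y⁻¹)) by rw [mul_inv, inv_inv]; ring,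
      theta_p_mul hq hq0 (by positivity), theta_p_mul hq hq0 (by positivity)]
    ring
  unfold deltaTheta
  rw [e1, theta_p_mul hq hq0 hx, theta_p_inv_mul hq hq0 hy, mul_assoc q x w⁻¹,
    theta_p_mul hq hq0 (by positivity), mul_assoc q⁻¹ y w⁻¹, theta_p_inv_mul hq hq0 (by positivity)]
  have hm : x⁻¹ * (q⁻¹ * y) * ((q * (x * y⁻¹))⁻¹ * (x * y⁻¹)⁻¹) * (x * w⁻¹)⁻¹ *
      (q⁻¹ * (y * w⁻¹)) * (w * (q * x)⁻¹) = (q ^ 4)⁻¹ * (y * x⁻¹) ^ 4 * (w * x⁻¹) := by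
    field_simp
  linear_combination (theta q x * theta q y * theta q w * (theta q (x * y⁻¹) * theta q (x * w⁻¹) *
    theta q (y * w⁻¹))) * hm

lemma seed_mul_div (hq0 : q ≠ 0) (hq : ‖q‖ < 1) (b : Fin 5 → ℂ) {x y w : ℂ}
    (hx : x ≠ 0) (hy : y ≠ 0) (hw : w ≠ 0) :
    seed p q b (q * x) (q⁻¹ * y) w = -seed p q b y x w := by
  have e1 : ∀ k, seedGamma p q (b k) (q * x) (q⁻¹ * y) w = seedGamma p q (b k) y x w := by
    intro k
    unfold seedGamma
    rw [show b k * (q * x) = q * b k * x by ring,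
      show q * b k * (q * x)⁻¹ = b k * x⁻¹ by field_simp,
      show q * b k * (q⁻¹ * y) = b k * y by field_simp,
      show b k * (q⁻¹ * y)⁻¹ = q * b k * y⁻¹ by field_simp]
    ring
  unfold seed
  rw [Finset.prod_congr rfl fun k _ => e1 k, deltaTheta_mul_div hq0 hq hx hy hw,
    deltaTheta_swap12 hq hx hy hw, numRest, numRest, show b 0 * (q * x) = q * b 0 * x by ring,
    show q * b 0 * (q⁻¹ * y) = b 0 * y by field_simp]
  have hm : (q ^ 4)⁻¹ * (y * x⁻¹) ^ 4 * ((q * x) ^ 2 * ((q⁻¹ * y) ^ 2)⁻¹ * (w ^ 3)⁻¹)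
      = y ^ 2 * (x ^ 2)⁻¹ * (w ^ 3)⁻¹ := by field_simp
  generalize theta p (b 0 * w) * theta p ((b 0)⁻¹ * w) * theta p (b 1 * w) *
    theta p ((b 1)⁻¹ * w) * theta p (b 0 * (b 1)⁻¹ * w) * theta p (b 1 * (∏ k, b k)⁻¹ * w) = A
  linear_combination ((∏ k, seedGamma p q (b k) y x w) * deltaTheta q x y w *
    (theta p (q * b 0 * x) * theta p (b 0 * y)) * A) * hm

lemma differentiableAt_seed (hp : ‖p‖ < 1) (hq : ‖q‖ < 1) (hq0 : q ≠ 0) {b : Fin 5 → ℂ}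
    (hb0 : ∀ k, b k ≠ 0) (hb1 : ∀ k, ‖b k‖ < 1) {V : Type*} [NormedAddCommGroup V]
    [NormedSpace ℂ V] {x y w : V → ℂ} {v : V}
    (hx : DifferentiableAt ℂ x v) (hy : DifferentiableAt ℂ y v) (hw : DifferentiableAt ℂ w v)
    (hx1 : ‖x v‖ ≤ 1) (hx2 : ‖q‖ ≤ ‖x v‖) (hy1 : ‖q * y v‖ ≤ 1) (hy2 : 1 ≤ ‖y v‖)
    (hw1 : ‖w v‖ = 1) : DifferentiableAt ℂ (fun v => seed p q b (x v) (y v) (w v)) v := by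
  have hqp : 0 < ‖q‖ := norm_pos_iff.2 hq0
  have hx0 : x v ≠ 0 := norm_pos_iff.1 (hqp.trans_le hx2)
  have hy0 : y v ≠ 0 := norm_pos_iff.1 (one_pos.trans_le hy2)
  have hw0 : w v ≠ 0 := norm_pos_iff.1 (by rw [hw1]; exact one_pos)
  have hxi := hx.fun_inv hx0
  have hyi := hy.fun_inv hy0
  have hwi := hw.fun_inv hw0
  have key : ∀ k, DifferentiableAt ℂ (fun v => seedGamma p q (b k) (x v) (y v) (w v)) v := by
    intro k
    have hk := hb0 k
    have hb : ∀ {z : ℂ}, ‖z‖ ≤ 1 → ‖b k * z‖ < 1 := fun hz => norm_mul_lt_one (hb1 k) hz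
    unfold seedGamma
    refine (((DifferentiableAt.ellGamma hp hq (hx.const_mul _) (by positivity) (hb hx1)).mul
      (DifferentiableAt.ellGamma hp hq (hxi.const_mul _) (by positivity) ?_)).mul
      ((DifferentiableAt.ellGamma hp hq (hy.const_mul _) (by positivity) ?_).mul
      (DifferentiableAt.ellGamma hp hq (hyi.const_mul _) (by positivity) (hb ?_)))).mul
      ((DifferentiableAt.ellGamma hp hq (hw.const_mul _) (by positivity) (hb hw1.le)).mul
      (DifferentiableAt.ellGamma hp hq (hwi.const_mul _) (by positivity) (hb ?_)))
    · rw [mul_comm q, mul_assoc]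
      refine hb ?_
      rw [norm_mul, norm_inv]
      exact mul_inv_le_one_of_le₀ hx2 (norm_nonneg _)
    · rw [mul_comm q, mul_assoc]
      exact hb hy1
    · rw [norm_inv]; exact inv_le_one_of_one_le₀ hy2
    · rw [norm_inv, hw1, inv_one]
  unfold seed
  simp only [Fin.prod_univ_five]
  exact (((((key 0).mul (key 1)).mul (key 2)).mul (key 3)).mul (key 4)).mul
    ((differentiableAt_deltaTheta hq hx hy hw hx0 hy0 hw0).mul
      (differentiableAt_numRest hp hq0 hb0 hx hy hw hx0 hy0 hw0))

lemma continuous_onTorus_seed (hp : ‖p‖ < 1) (hq : ‖q‖ < 1) (hq0 : q ≠ 0) {b : Fin 5 → ℂ}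
    (hb0 : ∀ k, b k ≠ 0) (hb1 : ∀ k, ‖b k‖ < 1) : Continuous (onTorus (seed p q b)) :=
  continuous_onTorus_of_differentiableAt fun _ h1 h2 _ hw hw1 =>
    differentiableAt_seed hp hq hq0 hb0 hb1 differentiableAt_fst differentiableAt_snd hw h1.le
      (by rw [h1]; exact hq.le) (norm_mul_lt_one hq h2.le).le h2.ge hw1

/-- For fixed `w`, moving the circle of `x` inwards by `q` does not change the mean, but turns the
seed into minus its reflection, which has the same mean; so the mean is its own negative. -/
theorem torusMean_seed (hp : ‖p‖ < 1) (hq : ‖q‖ < 1) (hq0 : q ≠ 0) {b : Fin 5 → ℂ}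
    (hb0 : ∀ k, b k ≠ 0) (hb1 : ∀ k, ‖b k‖ < 1) : torusMean (seed p q b) = 0 := by
  have hc := continuous_onTorus_seed hp hq hq0 hb0 hb1
  have hc2 := continuous_onTorus_swap23 hc
  rw [← torusMean_swap23 hc, ← torusMean_swap12,
    torusMean_eq_circleAverage (continuous_onTorus_swap12 hc2)]
  have key : ∀ x : ℂ, ‖x‖ = 1 →
      Real.circleAverage (fun y => seed p q b y (x * y)⁻¹ x) 0 1 = 0 := by
    intro x hx
    have hx0 : x ≠ 0 := norm_ne_zero_iff.1 (by rw [hx]; norm_num)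
    have hqp : 0 < ‖q‖ := norm_pos_iff.2 hq0
    have e1 := circleAverage_mul_of_annulus (f := fun y => seed p q b y (x * y)⁻¹ x) hq0 hq
      fun z h1 h2 => by
        have hz0 : z ≠ 0 := norm_pos_iff.1 (hqp.trans_le h1)
        have hz1 := norm_pos_iff.2 hz0
        refine differentiableAt_seed hp hq hq0 hb0 hb1 differentiableAt_id
          ((differentiableAt_id.const_mul x).fun_inv (mul_ne_zero hx0 hz0))
          (differentiableAt_const x) h2 h1 ?_ ?_ hx
        · rw [norm_mul, norm_inv, norm_mul, hx, one_mul]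
          exact mul_inv_le_one_of_le₀ h1 (norm_nonneg _)
        · rw [norm_inv, norm_mul, hx, one_mul]
          exact (one_le_inv₀ hz1).2 h2
    have e2 : Real.circleAverage (fun y => seed p q b (q * y) (x * (q * y))⁻¹ x) 0 1
        = Real.circleAverage (fun y => -seed p q b (x * y)⁻¹ y x) 0 1 := by
      refine Real.circleAverage_congr_sphere fun y hy => ?_
      have hy1 : ‖y‖ = 1 := by simpa using hy
      have hy0 : y ≠ 0 := norm_ne_zero_iff.1 (by rw [hy1]; norm_num)
      rw [show (x * (q * y))⁻¹ = q⁻¹ * (x * y)⁻¹ by field_simp,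
        seed_mul_div hq0 hq b hy0 (by positivity) hx0]
    have e3 : Real.circleAverage (fun y => seed p q b (x * y)⁻¹ y x) 0 1
        = Real.circleAverage (fun y => seed p q b y (x * y)⁻¹ x) 0 1 := by
      rw [← circleAverage_mul_left _ (c := x⁻¹) (by rw [norm_inv, hx, inv_one]),
        ← Real.circleAverage_zero_one_congr_inv]
      refine Real.circleAverage_congr_sphere fun y hy => ?_
      rw [mul_inv_cancel_left₀ hx0, inv_inv, mul_inv]
    have e4 : Real.circleAverage (fun y => -seed p q b (x * y)⁻¹ y x) 0 1
        = -Real.circleAverage (fun y => seed p q b (x * y)⁻¹ y x) 0 1 := by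
      rw [Real.circleAverage, Real.circleAverage, intervalIntegral.integral_neg, smul_neg]
    rw [e2, e4, e3] at e1
    exact self_eq_neg.1 e1.symm
  rw [Real.circleAverage_congr_sphere (f₂ := fun _ => (0 : ℂ)) fun x hx => key x (by simpa using hx)]
  simp [Real.circleAverage]

/-- A function on the compact torus is null if it is continuous with mean `0`. -/
def IsNull (F : ℂ → ℂ → ℂ → ℂ) : Prop := Continuous (onTorus F) ∧ torusMean F = 0

lemma IsNull.swap12 {F : ℂ → ℂ → ℂ → ℂ} (h : IsNull F) : IsNull fun x y w => F y x w :=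
  ⟨continuous_onTorus_swap12 h.1, by rw [torusMean_swap12, h.2]⟩

lemma IsNull.swap23 {F : ℂ → ℂ → ℂ → ℂ} (h : IsNull F) : IsNull fun x y w => F x w y :=
  ⟨continuous_onTorus_swap23 h.1, by rw [torusMean_swap23 h.1, h.2]⟩

lemma IsNull.inv {F : ℂ → ℂ → ℂ → ℂ} (h : IsNull F) : IsNull fun x y w => F x⁻¹ y⁻¹ w⁻¹ :=
  ⟨continuous_onTorus_inv h.1, by rw [torusMean_inv h.1, h.2]⟩

lemma IsNull.add {F G : ℂ → ℂ → ℂ → ℂ} (hF : IsNull F) (hG : IsNull G) :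
    IsNull fun x y w => F x y w + G x y w :=
  ⟨hF.1.add hG.1, by rw [torusMean_add hF.1 hG.1, hF.2, hG.2, add_zero]⟩

lemma shortGamma_swap12 (p q u x y w : ℂ) : shortGamma p q u y x w = shortGamma p q u x y w := by
  unfold shortGamma; ring

lemma shortGamma_swap23 (p q u x y w : ℂ) : shortGamma p q u x w y = shortGamma p q u x y w := by
  unfold shortGamma; ring

lemma shortGamma_inv (p q u x y w : ℂ) :
    shortGamma p q u x⁻¹ y⁻¹ w⁻¹ = shortGamma p q u x y w := by
  unfold shortGamma; rw [inv_inv, inv_inv, inv_inv]; ring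

/-- Averaging the seed over the Weyl group: the numerator may be antisymmetrized. -/
lemma torusMean_symNum (hp : ‖p‖ < 1) (hq : ‖q‖ < 1) (hq0 : q ≠ 0) {b : Fin 5 → ℂ}
    (hb0 : ∀ k, b k ≠ 0) (hb1 : ∀ k, ‖b k‖ < 1) : torusMean (fun x y w =>
      (∏ k, shortGamma p q (b k) x y w) * deltaTheta q x y w * symNum p q b x y w) = 0 := by
  have h0 : IsNull (seed p q b) :=
    ⟨continuous_onTorus_seed hp hq hq0 hb0 hb1, torusMean_seed hp hq hq0 hb0 hb1⟩
  have h1 := h0.swap12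
  have h2 := h0.swap23
  have h3 := h1.swap23
  have h4 := h2.swap12
  have h5 := h3.swap12
  have h6 := ((((h0.add h1).add h2).add h3).add h4).add h5
  rw [← (h6.add h6.inv).2]
  have key : ∀ x y w : ℂ, ‖x‖ = 1 → ‖y‖ = 1 → ‖w‖ = 1 → seed p q b x y w =
      (∏ k, shortGamma p q (b k) x y w) * deltaTheta q x y w * num p q b x y w := by
    intro x y w hx hy hw
    have e : ∀ k, seedGamma p q (b k) x y w = shortGamma p q (b k) x y w *
        (theta p (b k * x⁻¹) * theta p (b k * y)) := by
      intro k
      unfold seedGamma shortGamma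
      rw [mul_assoc q, mul_assoc q, ellGamma_q_mul hp hq hq0
        (norm_mul_lt_one (hb1 k) (by rw [norm_inv, hx, inv_one])), ellGamma_q_mul hp hq hq0
        (norm_mul_lt_one (hb1 k) hy.le)]
      ring
    rw [seed, Finset.prod_congr rfl fun k _ => e k, Finset.prod_mul_distrib, num, thetaProd]
    ring
  refine torusMean_congr fun x y w hx hy hw hxyw => ?_
  have n0 : ∀ z : ℂ, ‖z‖ = 1 → z ≠ 0 := fun z hz => norm_ne_zero_iff.1 (by rw [hz]; norm_num)
  have ni : ∀ z : ℂ, ‖z‖ = 1 → ‖z⁻¹‖ = 1 := fun z hz => by rw [norm_inv, hz, inv_one]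
  -- both sides are sums over the Weyl group, matched term by term
  have main : ∀ x y w : ℂ, ‖x‖ = 1 → ‖y‖ = 1 → ‖w‖ = 1 →
      (∏ k, shortGamma p q (b k) x y w) * deltaTheta q x y w * altNum p q b x y w =
      seed p q b x y w + seed p q b y x w + seed p q b x w y + seed p q b w x y +
        seed p q b y w x + seed p q b w y x := by
    intro x y w hx hy hw
    have s12 : ∀ x y w, ∏ k, shortGamma p q (b k) y x w = ∏ k, shortGamma p q (b k) x y w :=
      fun x y w => Finset.prod_congr rfl fun k _ => shortGamma_swap12 _ _ _ _ _ _
    have s23 : ∀ x y w, ∏ k, shortGamma p q (b k) x w y = ∏ k, shortGamma p q (b k) x y w :=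
      fun x y w => Finset.prod_congr rfl fun k _ => shortGamma_swap23 _ _ _ _ _ _
    have hx0 := n0 x hx
    have hy0 := n0 y hy
    have hw0 := n0 w hw
    rw [key x y w hx hy hw, key y x w hy hx hw, key x w y hx hw hy, key w x y hw hx hy,
      key y w x hy hw hx, key w y x hw hy hx,
      s12 y w x, s12 x w y, s23 y x w, s12 x y w, s23 x y w,
      deltaTheta_swap12 hq hy0 hw0 hx0, deltaTheta_swap12 hq hx0 hw0 hy0,
      deltaTheta_swap23 hq hy0 hx0 hw0, deltaTheta_swap12 hq hx0 hy0 hw0,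
      deltaTheta_swap23 hq hx0 hy0 hw0, altNum]
    ring
  rw [← main x y w hx hy hw, ← main _ _ _ (ni x hx) (ni y hy) (ni w hw),
    Finset.prod_congr rfl fun k _ => shortGamma_inv p q (b k) x y w,
    deltaTheta_inv hq (n0 x hx) (n0 y hy) (n0 w hw) hxyw, symNum]
  ring

lemma shortGamma_q_mul (hp : ‖p‖ < 1) (hq : ‖q‖ < 1) (hq0 : q ≠ 0) {u x y w : ℂ} (hu : ‖u‖ < 1)
    (hx : ‖x‖ = 1) (hy : ‖y‖ = 1) (hw : ‖w‖ = 1) :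
    shortGamma p q (q * u) x y w = shortTheta p u x y w * shortGamma p q u x y w := by
  have e : ∀ z : ℂ, ‖z‖ = 1 → ellGamma p q (q * u * z) = theta p (u * z) * ellGamma p q (u * z) :=
    fun z hz => by rw [mul_assoc, ellGamma_q_mul hp hq hq0 (norm_mul_lt_one hu hz.le)]
  have ni : ∀ z : ℂ, ‖z‖ = 1 → ‖z⁻¹‖ = 1 := fun z hz => by rw [norm_inv, hz, inv_one]
  rw [shortGamma, e x hx, e y hy, e w hw, e _ (ni x hx), e _ (ni y hy), e _ (ni w hw), shortGamma,
    shortTheta]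
  ring

lemma prod_shortGamma_update (hp : ‖p‖ < 1) (hq : ‖q‖ < 1) (hq0 : q ≠ 0) {b : Fin 5 → ℂ} {i : Fin 5}
    (hb1 : ‖b i‖ < 1) {x y w : ℂ}
    (hx : ‖x‖ = 1) (hy : ‖y‖ = 1) (hw : ‖w‖ = 1) :
    ∏ k, shortGamma p q (Function.update b i (q * b i) k) x y w
      = shortTheta p (b i) x y w * ∏ k, shortGamma p q (b k) x y w := by
  rw [← Finset.mul_prod_erase _ _ (Finset.mem_univ i), ← Finset.mul_prod_erase _ (fun k =>
    shortGamma p q (b k) x y w) (Finset.mem_univ i), Function.update_self,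
    shortGamma_q_mul hp hq hq0 hb1 hx hy hw, mul_assoc]
  congr 2
  refine Finset.prod_congr rfl fun k hk => ?_
  rw [Function.update_of_ne (Finset.ne_of_mem_erase hk)]

/-- The `q`-difference equation of the integral, for generic parameters: it compares the effect
of `b 0 ↦ q b 0` with that of `b 1 ↦ q b 1`. -/
theorem torusMean_kernel_update (hp : ‖p‖ < 1) (hp0 : p ≠ 0) (hq : ‖q‖ < 1) (hq0 : q ≠ 0)
    {b : Fin 5 → ℂ} (hb0 : ∀ k, b k ≠ 0) (hb1 : ∀ k, ‖b k‖ < 1) (hβ : q * (∏ k, b k) ^ 2 = p)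
    (hg : IsGenericPair p q (b 0) (b 1) (b 2)) :
    ratioFactor p q (b 0) (b 2) (b 3) (b 4) *
        torusMean (kernel p q (Function.update b 1 (q * b 1)))
      = ratioFactor p q (b 1) (b 2) (b 3) (b 4) *
        torusMean (kernel p q (Function.update b 0 (q * b 0))) := by
  have hu0 : ∀ i k, Function.update b i (q * b i) k ≠ 0 := by
    intro i k
    rcases eq_or_ne k i with rfl | h
    · rw [Function.update_self]; exact mul_ne_zero hq0 (hb0 k)
    · rw [Function.update_of_ne h]; exact hb0 k
  have hu1 : ∀ i k, ‖Function.update b i (q * b i) k‖ < 1 := by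
    intro i k
    rcases eq_or_ne k i with rfl | h
    · rw [Function.update_self]; exact norm_mul_lt_one hq (hb1 k).le
    · rw [Function.update_of_ne h]; exact hb1 k
  have hc := fun i => continuous_onTorus_kernel hp hq (hu0 i) (hu1 i)
  have hβ0 : ∏ k, b k ≠ 0 := Finset.prod_ne_zero_iff.2 fun k _ => hb0 k
  have h0 := hb0 0
  have h1 := hb0 1
  have key : ∀ H0 H1 : ℂ, torusMean (fun x y w =>
      H0 * kernel p q (Function.update b 1 (q * b 1)) x y w -
        H1 * kernel p q (Function.update b 0 (q * b 0)) x y w) =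
      H0 * torusMean (kernel p q (Function.update b 1 (q * b 1))) -
        H1 * torusMean (kernel p q (Function.update b 0 (q * b 0))) := by
    intro H0 H1
    rw [torusMean_sub (F := fun x y w => H0 * kernel p q (Function.update b 1 (q * b 1)) x y w)
      (G := fun x y w => H1 * kernel p q (Function.update b 0 (q * b 0)) x y w)
      ((hc 1).const_mul H0) ((hc 0).const_mul H1), torusMean_const_mul, torusMean_const_mul]
  rw [← sub_eq_zero, ← key]
  have hs := torusMean_symNum (p := p) hp hq hq0 hb0 hb1
  have hs2 : torusMean (fun x y w => (b 0 * b 1 * ∏ k, b k) *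
      (theta p (b 1 * (b 0)⁻¹) * theta p ((∏ k, b k) * (b 1)⁻¹)) *
      ((∏ k, shortGamma p q (b k) x y w) * deltaTheta q x y w * symNum p q b x y w)) = 0 := by
    rw [torusMean_const_mul, hs, mul_zero]
  rw [← hs2]
  refine torusMean_congr fun x y w hx hy hw hxyw => ?_
  have n0 : ∀ z : ℂ, ‖z‖ = 1 → z ≠ 0 := fun z hz => norm_ne_zero_iff.1 (by rw [hz]; norm_num)
  have id := symNum_eq hp hp0 hq0 hb0 hβ hg (n0 x hx) (n0 y hy)
  rw [← eq_inv_of_mul_eq_one_right hxyw] at id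
  rw [kernel, kernel, prod_shortGamma_update hp hq hq0 (hb1 1) hx hy hw,
    prod_shortGamma_update hp hq hq0 (hb1 0) hx hy hw]
  have hm : (b 0 * b 1 * ∏ k, b k) * (b 0 * b 1 * ∏ k, b k)⁻¹ = 1 :=
    mul_inv_cancel₀ (by positivity)
  generalize (b 0 * b 1 * ∏ k, b k)⁻¹ = B' at *
  generalize b 0 * b 1 * ∏ k, b k = B at *
  linear_combination (-B * ((∏ k, shortGamma p q (b k) x y w) * deltaTheta q x y w)) * id -
    (∏ k, shortGamma p q (b k) x y w) * deltaTheta q x y w * deltaTheta p x y w *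
    (ratioFactor p q (b 0) (b 2) (b 3) (b 4) * shortTheta p (b 1) x y w -
      ratioFactor p q (b 1) (b 2) (b 3) (b 4) * shortTheta p (b 0) x y w) * hm

end EllipticG2

namespace EllipticG2

/-! ### The `q`-difference equation of the product side -/

variable {p q : ℂ}

lemma subsetGamma_two (p q : ℂ) (a : Fin 5 → ℂ) : subsetGamma p q a 2 =
    ellGamma p q (a 0 * a 1) * ellGamma p q (a 0 * a 2) * ellGamma p q (a 0 * a 3) *
    ellGamma p q (a 0 * a 4) * ellGamma p q (a 1 * a 2) * ellGamma p q (a 1 * a 3) *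
    ellGamma p q (a 1 * a 4) * ellGamma p q (a 2 * a 3) * ellGamma p q (a 2 * a 4) *
    ellGamma p q (a 3 * a 4) := by
  have h : Finset.powersetCard 2 (Finset.univ : Finset (Fin 5)) =
    {{0, 1}, {0, 2}, {0, 3}, {0, 4}, {1, 2}, {1, 3}, {1, 4}, {2, 3}, {2, 4}, {3, 4}} := by decide
  have i : ∀ (i : Fin 5) (s : Finset (Fin 5)), i ∉ s → ∏ k ∈ insert i s, a k = a i * ∏ k ∈ s, a k :=
    fun i s h => Finset.prod_insert h
  rw [subsetGamma, h]
  repeat rw [Finset.prod_insert (by decide)]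
  simp (disch := decide) only [i, Finset.prod_singleton, mul_assoc]

lemma subsetGamma_three (p q : ℂ) (a : Fin 5 → ℂ) : subsetGamma p q a 3 =
    ellGamma p q (a 0 * a 1 * a 2) * ellGamma p q (a 0 * a 1 * a 3) *
    ellGamma p q (a 0 * a 1 * a 4) * ellGamma p q (a 0 * a 2 * a 3) *
    ellGamma p q (a 0 * a 2 * a 4) * ellGamma p q (a 0 * a 3 * a 4) *
    ellGamma p q (a 1 * a 2 * a 3) * ellGamma p q (a 1 * a 2 * a 4) *
    ellGamma p q (a 1 * a 3 * a 4) * ellGamma p q (a 2 * a 3 * a 4) := by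
  have h : Finset.powersetCard 3 (Finset.univ : Finset (Fin 5)) =
    {{0, 1, 2}, {0, 1, 3}, {0, 1, 4}, {0, 2, 3}, {0, 2, 4}, {0, 3, 4}, {1, 2, 3}, {1, 2, 4},
      {1, 3, 4}, {2, 3, 4}} := by decide
  have i : ∀ (i : Fin 5) (s : Finset (Fin 5)), i ∉ s → ∏ k ∈ insert i s, a k = a i * ∏ k ∈ s, a k :=
    fun i s h => Finset.prod_insert h
  rw [subsetGamma, h]
  repeat rw [Finset.prod_insert (by decide)]
  simp (disch := decide) only [i, Finset.prod_singleton, mul_assoc]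

lemma subsetGamma_four (p q : ℂ) (a : Fin 5 → ℂ) : subsetGamma p q a 4 =
    ellGamma p q (a 0 * a 1 * a 2 * a 3) * ellGamma p q (a 0 * a 1 * a 2 * a 4) *
    ellGamma p q (a 0 * a 1 * a 3 * a 4) * ellGamma p q (a 0 * a 2 * a 3 * a 4) *
    ellGamma p q (a 1 * a 2 * a 3 * a 4) := by
  have h : Finset.powersetCard 4 (Finset.univ : Finset (Fin 5)) =
    {{0, 1, 2, 3}, {0, 1, 2, 4}, {0, 1, 3, 4}, {0, 2, 3, 4}, {1, 2, 3, 4}} := by decide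
  have i : ∀ (i : Fin 5) (s : Finset (Fin 5)), i ∉ s → ∏ k ∈ insert i s, a k = a i * ∏ k ∈ s, a k :=
    fun i s h => Finset.prod_insert h
  rw [subsetGamma, h]
  repeat rw [Finset.prod_insert (by decide)]
  simp (disch := decide) only [i, Finset.prod_singleton, mul_assoc]

lemma subsetGamma_comp_equiv (p q : ℂ) (a : Fin 5 → ℂ) (σ : Equiv.Perm (Fin 5)) (m : ℕ) :
    subsetGamma p q (a ∘ σ) m = subsetGamma p q a m := by
  unfold subsetGamma
  refine Finset.prod_bij (fun s _ => s.map σ.toEmbedding) ?_ ?_ ?_ ?_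
  · intro s hs
    simpa using hs
  · intro s _ t _ h
    exact Finset.map_injective _ h
  · intro s hs
    refine ⟨s.map σ.symm.toEmbedding, by simpa using hs, ?_⟩
    ext i; simp
  · intro s _
    rw [Finset.prod_map]
    rfl

lemma productJ_comp_equiv (p q : ℂ) (a : Fin 5 → ℂ) (σ : Equiv.Perm (Fin 5)) :
    productJ p q (a ∘ σ) = productJ p q a := by
  unfold productJ
  rw [subsetGamma_comp_equiv, subsetGamma_comp_equiv, subsetGamma_comp_equiv]
  congr 3
  exact Equiv.prod_comp σ fun i => ellGamma p q (a i ^ 2) / ellGamma p q (a i)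

lemma kernel_comp_equiv (p q : ℂ) (a : Fin 5 → ℂ) (σ : Equiv.Perm (Fin 5)) :
    kernel p q (a ∘ σ) = kernel p q a := by
  funext x y w
  unfold kernel
  congr 1
  exact Equiv.prod_comp σ fun i => shortGamma p q (a i) x y w

lemma theta_ne_zero (hp : ‖p‖ < 1) (hp0 : p ≠ 0) {u : ℂ} (h1 : ‖p‖ < ‖u‖) (h2 : ‖u‖ < 1) :
    theta p u ≠ 0 := by
  intro h
  have hpp := norm_pos_iff.2 hp0
  obtain ⟨k, rfl⟩ := theta_eq_zero hp (norm_pos_iff.1 (hpp.trans h1)) h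
  rw [norm_zpow] at h1 h2
  have a1 : (k : ℤ) < 1 := (zpow_lt_zpow_iff_right_of_lt_one₀ hpp hp).1 (by rwa [zpow_one])
  have a2 : (0 : ℤ) < k := (zpow_lt_zpow_iff_right_of_lt_one₀ hpp hp).1 (by rwa [zpow_zero])
  omega

lemma norm_prod_subset {b : Fin 5 → ℂ} (hb1 : ∀ k, ‖b k‖ < 1)
    (s : Finset (Fin 5)) (hs : s.Nonempty) :
    ‖∏ k, b k‖ ≤ ‖∏ k ∈ s, b k‖ ∧ ‖∏ k ∈ s, b k‖ < 1 := by
  constructor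
  · rw [← Finset.prod_mul_prod_compl s b, norm_mul]
    refine mul_le_of_le_one_right (norm_nonneg _) ?_
    rw [norm_prod]
    exact Finset.prod_le_one (fun _ _ => norm_nonneg _) fun i _ => (hb1 i).le
  · obtain ⟨i, hi⟩ := hs
    rw [norm_prod, ← Finset.mul_prod_erase s _ hi]
    refine lt_of_le_of_lt (mul_le_of_le_one_right (norm_nonneg _) ?_) (hb1 i)
    exact Finset.prod_le_one (fun _ _ => norm_nonneg _) fun i _ => (hb1 i).le

/-- `J(q b 0, b 1, …)` and `J(b 0, q b 1, …)` are in the ratio of the two ratio factors. -/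
lemma productJ_update (hp : ‖p‖ < 1) (hq : ‖q‖ < 1) (hq0 : q ≠ 0) {b : Fin 5 → ℂ}
    (hb1 : ∀ k, ‖b k‖ < 1) :
    ratioFactor p q (b 0) (b 2) (b 3) (b 4) * productJ p q (Function.update b 1 (q * b 1))
      = ratioFactor p q (b 1) (b 2) (b 3) (b 4) * productJ p q (Function.update b 0 (q * b 0)) := by
  have M : ∀ {u v : ℂ}, ‖u‖ < 1 → ‖v‖ < 1 → ‖u * v‖ < 1 := fun h1 h2 => norm_mul_lt_one h1 h2.le
  have S : ∀ u : ℂ, ‖u‖ < 1 → ellGamma p q ((q * u) ^ 2) / ellGamma p q (q * u) =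
      theta p (u * u) * theta p (q * (u * u)) * (theta p u)⁻¹ *
        (ellGamma p q (u ^ 2) / ellGamma p q u) := by
    intro u hu
    rw [show (q * u) ^ 2 = q * (q * (u * u)) by ring, ellGamma_q_mul hp hq hq0 (M hq (M hu hu)),
      ellGamma_q_mul hp hq hq0 (M hu hu), ellGamma_q_mul hp hq hq0 hu, sq, div_eq_mul_inv, mul_inv,
      div_eq_mul_inv]
    ring
  have Q := fun {u : ℂ} (hu : ‖u‖ < 1) => ellGamma_q_mul hp hq hq0 hu
  have n0 := hb1 0
  have n1 := hb1 1
  have n2 := hb1 2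
  have n3 := hb1 3
  have n4 := hb1 4
  simp only [productJ, subsetGamma_two, subsetGamma_three, subsetGamma_four, Fin.prod_univ_five]
  have u00 : Function.update b 0 (q * b 0) 0 = q * b 0 := Function.update_self ..
  have u11 : Function.update b 1 (q * b 1) 1 = q * b 1 := Function.update_self ..
  have u0 : ∀ k, k ≠ 0 → Function.update b 0 (q * b 0) k = b k := fun k h =>
    Function.update_of_ne h ..
  have u1 : ∀ k, k ≠ 1 → Function.update b 1 (q * b 1) k = b k := fun k h =>
    Function.update_of_ne h ..
  rw [u00, u11, u0 1 (by decide), u0 2 (by decide), u0 3 (by decide), u0 4 (by decide),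
    u1 0 (by decide), u1 2 (by decide), u1 3 (by decide), u1 4 (by decide), S _ n0, S _ n1]
  simp only [ratioFactor]
  generalize b 0 = a at *
  generalize b 1 = c at *
  generalize b 2 = d at *
  generalize b 3 = e at *
  generalize b 4 = f at *
  simp only [mul_left_comm a q, mul_assoc q]
  rw [Q (M n0 n1), Q (M n0 n2), Q (M n0 n3), Q (M n0 n4), Q (M n1 n2), Q (M n1 n3), Q (M n1 n4),
    Q (M (M n0 n1) n2), Q (M (M n0 n1) n3), Q (M (M n0 n1) n4), Q (M (M n0 n2) n3),
    Q (M (M n0 n2) n4), Q (M (M n0 n3) n4), Q (M (M n1 n2) n3), Q (M (M n1 n2) n4),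
    Q (M (M n1 n3) n4), Q (M (M (M n0 n1) n2) n3), Q (M (M (M n0 n1) n2) n4),
    Q (M (M (M n0 n1) n3) n4), Q (M (M (M n0 n2) n3) n4), Q (M (M (M n1 n2) n3) n4)]
  ring

/-- The parameters at which the `q`-difference equation is applied. -/
structure IsShiftable (p q : ℂ) (b : Fin 5 → ℂ) : Prop where
  ne_zero : ∀ k, b k ≠ 0
  norm_lt : ∀ k, ‖b k‖ < 1
  balanced : q * (∏ k, b k) ^ 2 = p

lemma IsShiftable.ratioFactor_ne_zero (hp : ‖p‖ < 1) (hp0 : p ≠ 0) (hq : ‖q‖ < 1)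
    (hq0 : q ≠ 0) {b : Fin 5 → ℂ} (hb : IsShiftable p q b) :
    ratioFactor p q (b 0) (b 2) (b 3) (b 4) ≠ 0 := by
  have hβ := congrArg norm hb.balanced
  rw [norm_mul, norm_pow] at hβ
  have hpp := norm_pos_iff.2 hp0
  have hqq := norm_pos_iff.2 hq0
  have hβ1 := (norm_prod_subset hb.norm_lt Finset.univ Finset.univ_nonempty).2
  have hβ0 : 0 < ‖∏ k, b k‖ := norm_pos_iff.2 (Finset.prod_ne_zero_iff.2 fun k _ => hb.ne_zero k)
  have key : ∀ s : Finset (Fin 5), s.Nonempty → theta p (∏ k ∈ s, b k) ≠ 0 := by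
    intro s hs
    obtain ⟨h1, h2⟩ := norm_prod_subset hb.norm_lt s hs
    refine EllipticG2.theta_ne_zero hp hp0 (lt_of_lt_of_le ?_ h1) h2
    nlinarith
  have hb0 : ‖∏ k, b k‖ < ‖b 0‖ := by
    have h := norm_prod_subset hb.norm_lt ({1, 2, 3, 4} : Finset (Fin 5)) (by simp)
    rw [← Finset.mul_prod_erase _ _ (Finset.mem_univ 0), norm_mul]
    exact mul_lt_of_lt_one_right (norm_pos_iff.2 (hb.ne_zero 0)) h.2
  have n0 := hb.norm_lt 0
  have e0 : ‖∏ k, b k‖ ^ 2 < ‖b 0‖ * ‖b 0‖ := by nlinarith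
  have e1 : ‖b 0‖ * ‖b 0‖ < 1 := by nlinarith
  have t0 := key {0} (by simp)
  have t1 := key {0, 2} (by simp)
  have t2 := key {0, 3} (by simp)
  have t3 := key {0, 4} (by simp)
  have t4 := key {0, 2, 3} (by simp)
  have t5 := key {0, 2, 4} (by simp)
  have t6 := key {0, 3, 4} (by simp)
  have t7 := key {0, 2, 3, 4} (by simp)
  have i : ∀ (i : Fin 5) (s : Finset (Fin 5)), i ∉ s → ∏ k ∈ insert i s, b k = b i * ∏ k ∈ s, b k :=
    fun i s h => Finset.prod_insert h
  simp (disch := decide) only [i, Finset.prod_singleton] at t0 t1 t2 t3 t4 t5 t6 t7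
  simp only [← mul_assoc] at t4 t5 t6 t7
  have t8 : theta p (b 0 * b 0) ≠ 0 :=
    EllipticG2.theta_ne_zero hp hp0 (by rw [norm_mul]; nlinarith) (by rwa [norm_mul])
  have t9 : theta p (q * (b 0 * b 0)) ≠ 0 :=
    EllipticG2.theta_ne_zero hp hp0 (by rw [norm_mul, norm_mul]; nlinarith)
      (by rw [norm_mul, norm_mul]; nlinarith)
  unfold ratioFactor
  positivity

end EllipticG2

namespace EllipticG2

/-! ### Admissible parameters and holomorphy -/

open MeasureTheory

variable {p q : ℂ}

/-- The parameters of the integral: inside the unit disc, and balanced. -/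
structure IsAdmissible (p q : ℂ) (a : Fin 5 → ℂ) : Prop where
  ne_zero : ∀ k, a k ≠ 0
  norm_lt : ∀ k, ‖a k‖ < 1
  balanced : (∏ k, a k) ^ 2 = p * q

lemma ellGamma_ne_zero_of_norm (hp : ‖p‖ < 1) (hq : ‖q‖ < 1) {u : ℂ} (h1 : ‖p * q‖ < ‖u‖)
    (h2 : ‖u‖ < 1) : ellGamma p q u ≠ 0 := by
  refine ellGamma_ne_zero (pqPoch_ne_zero hp hq ?_) (pqPoch_ne_zero hp hq h2)
  rw [norm_mul, norm_inv, ← div_eq_mul_inv]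
  exact (div_lt_one ((norm_nonneg _).trans_lt h1)).2 h1

lemma IsAdmissible.norm_subset {a : Fin 5 → ℂ}
    (ha : IsAdmissible p q a) (s : Finset (Fin 5)) (hs : s.Nonempty) :
    ‖p * q‖ < ‖∏ k ∈ s, a k‖ ∧ ‖∏ k ∈ s, a k‖ < 1 := by
  obtain ⟨h1, h2⟩ := norm_prod_subset ha.norm_lt s hs
  refine ⟨?_, h2⟩
  have h3 := (norm_prod_subset ha.norm_lt Finset.univ Finset.univ_nonempty).2
  have h4 := congrArg norm ha.balanced
  rw [norm_pow] at h4
  have h5 : 0 < ‖∏ k, a k‖ := norm_pos_iff.2 (Finset.prod_ne_zero_iff.2 fun k _ => ha.ne_zero k)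
  nlinarith

lemma IsAdmissible.norm_sq {a : Fin 5 → ℂ} (ha : IsAdmissible p q a) (i : Fin 5) :
    ‖p * q‖ < ‖a i ^ 2‖ ∧ ‖a i ^ 2‖ < 1 := by
  have h4 := congrArg norm ha.balanced
  have h0 := norm_pos_iff.2 (ha.ne_zero i)
  have h1 := ha.norm_lt i
  have h : ‖∏ k ∈ Finset.univ.erase i, a k‖ < 1 :=
    (norm_prod_subset ha.norm_lt _ (by simp [← Finset.card_pos])).2
  rw [← Finset.mul_prod_erase _ _ (Finset.mem_univ i), norm_pow, norm_mul] at h4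
  rw [← h4, norm_pow]
  constructor
  · have : ‖a i‖ * ‖∏ k ∈ Finset.univ.erase i, a k‖ < ‖a i‖ := mul_lt_of_lt_one_right h0 h
    exact pow_lt_pow_left₀ this (by positivity) two_ne_zero
  · nlinarith

lemma IsAdmissible.ellGamma_ne_zero (hp : ‖p‖ < 1) (hq : ‖q‖ < 1) {a : Fin 5 → ℂ}
    (ha : IsAdmissible p q a) (i : Fin 5) : ellGamma p q (a i) ≠ 0 := by
  have := ha.norm_subset {i} (by simp)
  rw [Finset.prod_singleton] at this
  exact ellGamma_ne_zero_of_norm hp hq this.1 this.2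

/-- All arguments of the gamma functions in `J` have modulus between `|pq|` and `1`, where `Γ` has
neither zeros nor poles. -/
lemma productJ_ne_zero (hp : ‖p‖ < 1) (hq : ‖q‖ < 1) {a : Fin 5 → ℂ} (ha : IsAdmissible p q a) :
    productJ p q a ≠ 0 := by
  have key : ∀ m : ℕ, m ≠ 0 → subsetGamma p q a m ≠ 0 := by
    intro m hm
    refine Finset.prod_ne_zero_iff.2 fun s hs => ?_
    have hne : s.Nonempty := by
      rw [← Finset.card_pos, (Finset.mem_powersetCard.1 hs).2]; omega
    have := ha.norm_subset s hne
    exact ellGamma_ne_zero_of_norm hp hq this.1 this.2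
  refine mul_ne_zero (mul_ne_zero (mul_ne_zero ?_ (key 2 (by norm_num))) (key 3 (by norm_num)))
    (key 4 (by norm_num))
  refine Finset.prod_ne_zero_iff.2 fun i _ => div_ne_zero ?_ (ha.ellGamma_ne_zero hp hq i)
  exact ellGamma_ne_zero_of_norm hp hq (ha.norm_sq i).1 (ha.norm_sq i).2

lemma differentiableAt_prod {V ι : Type*} [NormedAddCommGroup V] [NormedSpace ℂ V] {f : ι → V → ℂ}
    {v : V} (s : Finset ι) (h : ∀ i ∈ s, DifferentiableAt ℂ (f i) v) :
    DifferentiableAt ℂ (fun v => ∏ i ∈ s, f i v) v := by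
  classical
  induction s using Finset.induction_on with
  | empty => simp
  | insert i s hi ih =>
    simp only [Finset.prod_insert hi]
    exact (h i (Finset.mem_insert_self i s)).mul
      (ih fun j hj => h j (Finset.mem_insert_of_mem hj))

lemma differentiableAt_subsetGamma (hp : ‖p‖ < 1) (hq : ‖q‖ < 1) {V : Type*}
    [NormedAddCommGroup V] [NormedSpace ℂ V] {a : V → Fin 5 → ℂ} {v : V}
    (ha : IsAdmissible p q (a v)) (hd : ∀ k, DifferentiableAt ℂ (fun v => a v k) v) {m : ℕ}
    (hm : m ≠ 0) : DifferentiableAt ℂ (fun v => subsetGamma p q (a v) m) v := by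
  unfold subsetGamma
  refine differentiableAt_prod _ fun s hs => ?_
  have hne : s.Nonempty := by
    rw [← Finset.card_pos, (Finset.mem_powersetCard.1 hs).2]; omega
  exact DifferentiableAt.ellGamma hp hq (differentiableAt_prod _ fun k _ => hd k)
    (Finset.prod_ne_zero_iff.2 fun k _ => ha.ne_zero k) (ha.norm_subset s hne).2

lemma differentiableAt_productJ (hp : ‖p‖ < 1) (hq : ‖q‖ < 1) {V : Type*} [NormedAddCommGroup V]
    [NormedSpace ℂ V] {a : V → Fin 5 → ℂ} {v : V} (ha : IsAdmissible p q (a v))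
    (hd : ∀ k, DifferentiableAt ℂ (fun v => a v k) v) :
    DifferentiableAt ℂ (fun v => productJ p q (a v)) v := by
  have k2 := differentiableAt_subsetGamma hp hq ha hd two_ne_zero
  have k3 := differentiableAt_subsetGamma hp hq ha hd three_ne_zero
  have k4 := differentiableAt_subsetGamma hp hq ha hd four_ne_zero
  have k1 : DifferentiableAt ℂ
      (fun v => ∏ i, ellGamma p q (a v i ^ 2) / ellGamma p q (a v i)) v := by
    refine differentiableAt_prod _ fun i _ => ?_
    have e1 := DifferentiableAt.ellGamma hp hq ((hd i).fun_pow 2) (pow_ne_zero 2 (ha.ne_zero i))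
      (ha.norm_sq i).2
    have e2 := DifferentiableAt.ellGamma hp hq (hd i) (ha.ne_zero i) (ha.norm_lt i)
    simp only [div_eq_mul_inv]
    exact e1.fun_mul (e2.fun_inv (ha.ellGamma_ne_zero hp hq i))
  exact ((k1.fun_mul k2).fun_mul k3).fun_mul k4

/-- The mean over the torus of a function holomorphic in a parameter is holomorphic. -/
theorem differentiableAt_torusMean {F : ℂ → ℂ → ℂ → ℂ → ℂ} {U : Set ℂ} (hU : IsOpen U) {z₀ : ℂ}
    (hz₀ : z₀ ∈ U) (h : ∀ z ∈ U, ∀ x y w : ℂ, ‖x‖ = 1 → ‖y‖ = 1 → ‖w‖ = 1 → DifferentiableAt ℂ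
      (fun v : ℂ × ℂ × ℂ × ℂ => F v.1 v.2.1 v.2.2.1 v.2.2.2) (z, x, y, w)) :
    DifferentiableAt ℂ (fun z => torusMean (F z)) z₀ := by
  have hw : ∀ x y : ℂ, ‖x‖ = 1 → ‖y‖ = 1 → x * y ≠ 0 ∧ ‖(x * y)⁻¹‖ = 1 := fun x y hx hy => by
    have : ‖x * y‖ = 1 := by rw [norm_mul, hx, hy, one_mul]
    exact ⟨norm_ne_zero_iff.1 (by rw [this]; norm_num), by rw [norm_inv, this, inv_one]⟩
  have hjoint : ∀ z ∈ U, ∀ x y : ℂ, ‖x‖ = 1 → ‖y‖ = 1 →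
      ContinuousAt (fun v : ℂ × ℂ × ℂ => F v.1 v.2.1 v.2.2 (v.2.1 * v.2.2)⁻¹) (z, x, y) := by
    intro z hz x y hx hy
    have hwxy := hw x y hx hy
    refine ContinuousAt.comp (g := fun v : ℂ × ℂ × ℂ × ℂ => F v.1 v.2.1 v.2.2.1 v.2.2.2)
      (f := fun v : ℂ × ℂ × ℂ => (v.1, v.2.1, v.2.2, (v.2.1 * v.2.2)⁻¹))
      (h z hz x y _ hx hy hwxy.2).continuousAt ?_
    have : ContinuousAt (fun v : ℂ × ℂ × ℂ => (v.2.1 * v.2.2)⁻¹) (z, x, y) :=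
      ContinuousAt.inv₀ (by fun_prop) hwxy.1
    fun_prop
  have hcont : ∀ z ∈ U, Continuous (onTorus (F z)) := by
    intro z hz
    refine continuous_onTorus fun x y hx hy => ?_
    exact ContinuousAt.comp (g := fun v : ℂ × ℂ × ℂ => F v.1 v.2.1 v.2.2 (v.2.1 * v.2.2)⁻¹)
      (f := fun v : ℂ × ℂ => (z, v.1, v.2)) (hjoint z hz x y hx hy) (by fun_prop)
  have hdiff : ∀ z ∈ U, ∀ t, DifferentiableAt ℂ (fun z => onTorus (F z) t) z := by
    intro z hz t
    have hwxy := hw _ _ (norm_circleMap t.1) (norm_circleMap t.2)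
    exact DifferentiableAt.comp (g := fun v : ℂ × ℂ × ℂ × ℂ => F v.1 v.2.1 v.2.2.1 v.2.2.2)
      (f := fun z => (z, _, _, _)) z
      (h z hz _ _ _ (norm_circleMap t.1) (norm_circleMap t.2) hwxy.2)
      (differentiableAt_id.prodMk (differentiableAt_const _))
  obtain ⟨r, hr, hrU⟩ := Metric.nhds_basis_closedBall.mem_iff.1 (hU.mem_nhds hz₀)
  obtain ⟨C, hC⟩ := ((isCompact_closedBall z₀ r).prod ((isCompact_sphere (0 : ℂ) 1).prod
    (isCompact_sphere (0 : ℂ) 1))).exists_bound_of_continuousOn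
    (f := fun v : ℂ × ℂ × ℂ => F v.1 v.2.1 v.2.2 (v.2.1 * v.2.2)⁻¹) fun v hv =>
      (hjoint v.1 (hrU hv.1) v.2.1 v.2.2 (by simpa using hv.2.1)
        (by simpa using hv.2.2)).continuousWithinAt
  have hC' : ∀ z ∈ Metric.closedBall z₀ r, ∀ t, ‖onTorus (F z) t‖ ≤ C := fun z hz t =>
    hC (z, circleMap 0 1 t.1, circleMap 0 1 t.2) ⟨hz, by simp, by simp⟩
  have hr2 : 0 < r / 2 := by positivity
  have hsub : ∀ z ∈ Metric.ball z₀ (r / 2), Metric.closedBall z (r / 2) ⊆ Metric.closedBall z₀ r :=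
    fun z hz => Metric.closedBall_subset_closedBall' (by rw [Metric.mem_ball] at hz; linarith)
  have hz₀r : z₀ ∈ Metric.ball z₀ (r / 2) := Metric.mem_ball_self hr2
  have hmem : ∀ z ∈ Metric.ball z₀ (r / 2), z ∈ U := fun z hz =>
    hrU (hsub z hz (Metric.mem_closedBall_self hr2.le))
  -- the derivative is measurable as a limit of difference quotients
  have hmeas : AEStronglyMeasurable (fun t => deriv (fun z => onTorus (F z) t) z₀)
      (angleMeasure.prod angleMeasure) := by
    let u : ℕ → ℂ := fun n => z₀ + ((r / 2 / (n + 2) : ℝ) : ℂ)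
    have hu1 : ∀ n, u n ∈ U := fun n => by
      refine hmem _ ?_
      rw [Metric.mem_ball, dist_eq_norm, add_sub_cancel_left, Complex.norm_real, Real.norm_eq_abs,
        abs_of_pos (by positivity)]
      exact div_lt_self hr2 (by linarith [(Nat.cast_nonneg n : (0 : ℝ) ≤ n)])
    have hu2 : Tendsto u atTop (𝓝[≠] z₀) := by
      refine tendsto_nhdsWithin_iff.2 ⟨?_, Eventually.of_forall fun n => ?_⟩
      · have h1 : Tendsto (fun n : ℕ => r / 2 / ((n : ℝ) + 2)) atTop (𝓝 0) :=
          Tendsto.div_atTop tendsto_const_nhds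
            (tendsto_atTop_add_const_right _ _ tendsto_natCast_atTop_atTop)
        have h2 := ((Complex.continuous_ofReal.tendsto 0).comp h1).const_add z₀
        rwa [Complex.ofReal_zero, add_zero] at h2
      · have : ((r / 2 / (n + 2) : ℝ) : ℂ) ≠ 0 := by
          rw [Complex.ofReal_ne_zero]; positivity
        simpa [u] using this
    refine aestronglyMeasurable_of_tendsto_ae atTop
      (f := fun n t => slope (fun z => onTorus (F z) t) z₀ (u n)) (fun n => ?_)
      (Eventually.of_forall fun t => ?_)
    · have := ((hcont _ (hu1 n)).sub (hcont _ hz₀)).const_smul (u n - z₀)⁻¹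
      exact this.aestronglyMeasurable
    · exact ((hdiff z₀ hz₀ t).hasDerivAt.tendsto_slope).comp hu2
  refine (hasDerivAt_integral_of_dominated_loc_of_deriv_le (F := fun z t => onTorus (F z) t)
    (F' := fun z t => deriv (fun z => onTorus (F z) t) z) (bound := fun _ => C / (r / 2))
    (Metric.ball_mem_nhds z₀ hr2) ?_ ?_ hmeas ?_ ?_ ?_).2.differentiableAt
  · filter_upwards [hU.mem_nhds hz₀] with z hz using (hcont z hz).aestronglyMeasurable
  · exact integrable_of_continuous (hcont z₀ hz₀)
  · refine Eventually.of_forall fun t z hz => ?_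
    refine Complex.norm_deriv_le_of_forall_mem_sphere_norm_le hr2 ?_ fun ζ hζ =>
      hC' ζ (hsub z hz (Metric.sphere_subset_closedBall hζ)) t
    refine DifferentiableOn.diffContOnCl fun ζ hζ => ?_
    rw [closure_ball z hr2.ne'] at hζ
    exact (hdiff ζ (hrU (hsub z hz hζ)) t).differentiableWithinAt
  · exact integrable_const _
  · exact Eventually.of_forall fun t z hz => (hdiff z (hmem z hz) t).hasDerivAt

lemma differentiableAt_torusMean_kernel (hp : ‖p‖ < 1) (hq : ‖q‖ < 1) {a : ℂ → Fin 5 → ℂ}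
    {U : Set ℂ} (hU : IsOpen U) {z₀ : ℂ} (hz₀ : z₀ ∈ U)
    (hd : ∀ z ∈ U, ∀ k, DifferentiableAt ℂ (fun z => a z k) z) (h0 : ∀ z ∈ U, ∀ k, a z k ≠ 0)
    (h1 : ∀ z ∈ U, ∀ k, ‖a z k‖ < 1) :
    DifferentiableAt ℂ (fun z => torusMean (kernel p q (a z))) z₀ := by
  refine differentiableAt_torusMean hU hz₀ fun z hz x y w hx hy hw => ?_
  exact differentiableAt_kernel hp hq (a := fun v : ℂ × ℂ × ℂ × ℂ => a v.1)
    (fun k => DifferentiableAt.comp (g := fun z => a z k) _ (hd z hz k) differentiableAt_fst)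
    (by fun_prop) (by fun_prop) (by fun_prop) (h0 z hz) (h1 z hz) hx hy hw

end EllipticG2

namespace EllipticG2

/-! ### From generic to arbitrary parameters -/

open MeasureTheory

variable {p q : ℂ}

/-- A holomorphic curve through `b` with constant product, along which the moduli of the first three
parameters are generic. -/
noncomputable def spread (b : Fin 5 → ℂ) (s : ℂ) : Fin 5 → ℂ :=
  ![b 0 * Complex.exp s, b 1 * Complex.exp (s ^ 2), b 2 * Complex.exp (s ^ 3),
    b 3 * Complex.exp (-(s + s ^ 2 + s ^ 3)), b 4]

lemma spread_zero (b : Fin 5 → ℂ) : spread b 0 = b := by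
  funext k
  fin_cases k <;> simp [spread]

lemma spread_ne_zero {b : Fin 5 → ℂ} (hb : ∀ k, b k ≠ 0) (s : ℂ) (k : Fin 5) :
    spread b s k ≠ 0 := by
  fin_cases k <;> simp [spread, hb]

lemma prod_spread (b : Fin 5 → ℂ) (s : ℂ) : ∏ k, spread b s k = ∏ k, b k := by
  have h : Complex.exp s * Complex.exp (s ^ 2) * Complex.exp (s ^ 3) *
      Complex.exp (-(s + s ^ 2 + s ^ 3)) = 1 := by
    rw [← Complex.exp_add, ← Complex.exp_add, ← Complex.exp_add, add_neg_cancel, Complex.exp_zero]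
  simp only [Fin.prod_univ_five, spread, Matrix.cons_val]
  linear_combination (b 0 * b 1 * b 2 * b 3 * b 4) * h

lemma differentiable_spread (b : Fin 5 → ℂ) (k : Fin 5) :
    Differentiable ℂ fun s => spread b s k := by
  fin_cases k <;> simp only [spread, Matrix.cons_val, Fin.reduceFinMk, Fin.zero_eta,
    Fin.mk_one, Fin.isValue] <;> fun_prop

lemma cubic_coeff_eq_zero {c₁ c₂ c₃ c₀ : ℝ} (h : Polynomial.C c₃ * Polynomial.X ^ 3 +
    Polynomial.C c₂ * Polynomial.X ^ 2 + Polynomial.C c₁ * Polynomial.X + Polynomial.C c₀ = 0) :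
    c₁ = 0 ∧ c₂ = 0 ∧ c₃ = 0 := by
  have h1 := congrArg (fun f => Polynomial.coeff f 1) h
  have h2 := congrArg (fun f => Polynomial.coeff f 2) h
  have h3 := congrArg (fun f => Polynomial.coeff f 3) h
  simp [Polynomial.coeff_C, Polynomial.coeff_X_pow] at h1 h2 h3
  exact ⟨h1, h2, h3⟩

/-- The real parameters at which the moduli are not generic are roots of countably many nonzero
polynomials of degree at most three. -/
lemma exists_dense_spread {b : Fin 5 → ℂ} (hb : ∀ k, b k ≠ 0) : ∃ D : Set ℝ, Dense D ∧
    ∀ s ∈ D, IsGenericPair p q (spread b s 0) (spread b s 1) (spread b s 2) := by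
  let P : ℤ × ℤ × ℤ × ℤ × ℤ → Polynomial ℝ := fun n =>
    Polynomial.C (n.2.2.1 : ℝ) * Polynomial.X ^ 3 + Polynomial.C (n.2.1 : ℝ) * Polynomial.X ^ 2 +
      Polynomial.C (n.1 : ℝ) * Polynomial.X + Polynomial.C (n.1 * Real.log ‖b 0‖ +
      n.2.1 * Real.log ‖b 1‖ + n.2.2.1 * Real.log ‖b 2‖ - n.2.2.2.1 * Real.log ‖p‖ -
      n.2.2.2.2 * Real.log ‖q‖)
  refine ⟨(⋃ n : {n : ℤ × ℤ × ℤ × ℤ × ℤ // P n ≠ 0}, {x | (P n).IsRoot x})ᶜ,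
    Set.Countable.dense_compl ℝ (Set.countable_iUnion fun n =>
      (Polynomial.finite_setOfPred_isRoot n.2).countable), ?_⟩
  intro s hs i j l k m h
  have hlog : ∀ (u : ℂ) (r : ℝ), u ≠ 0 → Real.log ‖u * Complex.exp r‖ = Real.log ‖u‖ + r := by
    intro u r hu
    rw [norm_mul, Complex.norm_exp, Complex.ofReal_re,
      Real.log_mul (norm_ne_zero_iff.2 hu) (Real.exp_pos r).ne', Real.log_exp]
  have h0 := hlog (b 0) s (hb 0)
  have h1 := hlog (b 1) (s ^ 2) (hb 1)
  have h2 := hlog (b 2) (s ^ 3) (hb 2)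
  push_cast at h1 h2
  simp only [spread, Matrix.cons_val] at h
  rw [h0, h1, h2] at h
  have hz : P (i, j, l, k, m) = 0 := by
    by_contra hP
    refine hs (Set.mem_iUnion.2 ⟨⟨_, hP⟩, ?_⟩)
    simp only [Set.mem_ofPred_eq, Polynomial.IsRoot, P, Polynomial.eval_add, Polynomial.eval_mul,
      Polynomial.eval_C, Polynomial.eval_pow, Polynomial.eval_X]
    linear_combination h
  obtain ⟨c1, c2, c3⟩ := cubic_coeff_eq_zero hz
  exact ⟨by exact_mod_cast c1, by exact_mod_cast c2, by exact_mod_cast c3⟩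

lemma prod_update (b : Fin 5 → ℂ) (i : Fin 5) (q : ℂ) :
    ∏ k, Function.update b i (q * b i) k = q * ∏ k, b k := by
  rw [Finset.prod_update_of_mem (Finset.mem_univ i), mul_assoc, Finset.sdiff_singleton_eq_erase,
    Finset.mul_prod_erase _ _ (Finset.mem_univ i)]

lemma IsShiftable.update (hq : ‖q‖ < 1) (hq0 : q ≠ 0) {b : Fin 5 → ℂ} (hb : IsShiftable p q b)
    (i : Fin 5) : IsAdmissible p q (Function.update b i (q * b i)) where
  ne_zero k := by
    rcases eq_or_ne k i with rfl | h
    · rw [Function.update_self]; exact mul_ne_zero hq0 (hb.ne_zero k)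
    · rw [Function.update_of_ne h]; exact hb.ne_zero k
  norm_lt k := by
    rcases eq_or_ne k i with rfl | h
    · rw [Function.update_self]; exact norm_mul_lt_one hq (hb.norm_lt k).le
    · rw [Function.update_of_ne h]; exact hb.norm_lt k
  balanced := by
    rw [prod_update, ← hb.balanced]; ring

/-- The quotient of the integral by the product side takes the same value after `b 0 ↦ q b 0` as
after `b 1 ↦ q b 1`. -/
lemma torusMean_mul_productJ_update (hp : ‖p‖ < 1) (hp0 : p ≠ 0) (hq : ‖q‖ < 1) (hq0 : q ≠ 0)
    {b : Fin 5 → ℂ} (hb : IsShiftable p q b) :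
    torusMean (kernel p q (Function.update b 1 (q * b 1))) *
        productJ p q (Function.update b 0 (q * b 0))
      = torusMean (kernel p q (Function.update b 0 (q * b 0))) *
        productJ p q (Function.update b 1 (q * b 1)) := by
  let T : Fin 5 → ℂ → Fin 5 → ℂ := fun i s => Function.update (spread b s) i (q * spread b s i)
  let f : ℂ → ℂ := fun s => torusMean (kernel p q (T 1 s)) * productJ p q (T 0 s) -
    torusMean (kernel p q (T 0 s)) * productJ p q (T 1 s)
  let U : Set ℂ := {s | ∀ k, ‖spread b s k‖ < 1}
  have hU : IsOpen U := by
    simp only [U, Set.ofPred_forall]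
    exact isOpen_iInter_of_finite fun k =>
      isOpen_lt (differentiable_spread b k).continuous.norm continuous_const
  have h0U : (0 : ℂ) ∈ U := fun k => by rw [spread_zero]; exact hb.norm_lt k
  have hs : ∀ s ∈ U, IsShiftable p q (spread b s) := fun s hs =>
    ⟨spread_ne_zero hb.ne_zero s, hs, by rw [prod_spread]; exact hb.balanced⟩
  have hT : ∀ i, ∀ s ∈ U, IsAdmissible p q (T i s) := fun i s hsU => (hs s hsU).update hq hq0 i
  have hTd : ∀ i k s, DifferentiableAt ℂ (fun s => T i s k) s := by
    intro i k s
    simp only [T]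
    rcases eq_or_ne k i with rfl | h
    · simp only [Function.update_self]
      exact ((differentiable_spread b k) s).const_mul q
    · simp only [Function.update_of_ne h]
      exact (differentiable_spread b k) s
  have hTI : ∀ i, DifferentiableAt ℂ (fun s => torusMean (kernel p q (T i s))) 0 := fun i =>
    differentiableAt_torusMean_kernel hp hq hU h0U (fun s _ k => hTd i k s)
      (fun s hs => (hT i s hs).ne_zero) (fun s hs => (hT i s hs).norm_lt)
  have hTJ : ∀ i, DifferentiableAt ℂ (fun s => productJ p q (T i s)) 0 := fun i =>
    differentiableAt_productJ hp hq (hT i 0 h0U) fun k => hTd i k 0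
  have hf : ContinuousAt f 0 :=
    (((hTI 1).fun_mul (hTJ 0)).fun_sub ((hTI 0).fun_mul (hTJ 1))).continuousAt
  -- the identity holds at the generic points, which are dense, hence at `0` by continuity
  have main : f 0 = 0 := by
    by_contra hne
    obtain ⟨D, hD, hDg⟩ := exists_dense_spread (p := p) (q := q) hb.ne_zero
    have e1 : ∀ᶠ s in 𝓝 (0 : ℂ), f s ≠ 0 ∧ s ∈ U :=
      (hf.eventually_ne hne).and (hU.mem_nhds h0U)
    have e2 : ∀ᶠ s : ℝ in 𝓝 0, f s ≠ 0 ∧ (s : ℂ) ∈ U := by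
      have := Complex.continuous_ofReal.tendsto 0
      rw [Complex.ofReal_zero] at this
      exact this.eventually e1
    obtain ⟨s, hsD, hs1, hs2⟩ : ∃ s ∈ D, f s ≠ 0 ∧ (s : ℂ) ∈ U := by
      obtain ⟨s, h1, h2⟩ := mem_closure_iff_nhds.1 (hD 0) _ e2
      exact ⟨s, h2, h1⟩
    refine hs1 ?_
    have hsh := hs _ hs2
    have a1 := torusMean_kernel_update hp hp0 hq hq0 hsh.ne_zero hsh.norm_lt hsh.balanced (hDg s hsD)
    have a2 := productJ_update (p := p) hp hq hq0 hsh.norm_lt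
    have a3 := hsh.ratioFactor_ne_zero hp hp0 hq hq0
    simp only [f, T]
    refine mul_left_cancel₀ a3 ?_
    linear_combination productJ p q (Function.update (spread b s) 0 (q * spread b s 0)) * a1 -
      torusMean (kernel p q (Function.update (spread b s) 0 (q * spread b s 0))) * a2
  simp only [f, T, spread_zero] at main
  exact sub_eq_zero.1 main

/-- The quotient of the integral by the product side. -/
noncomputable def ratioIJ (p q : ℂ) (a : Fin 5 → ℂ) : ℂ :=
  torusMean (kernel p q a) / productJ p q a

/-- Both sides are symmetric in the parameters, so that the comparison of `b 0` with `b 1` gives the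
comparison of any `b i` with `b 4`. -/
lemma ratioIJ_update (hp : ‖p‖ < 1) (hp0 : p ≠ 0) (hq : ‖q‖ < 1) (hq0 : q ≠ 0)
    {b : Fin 5 → ℂ} (hb : IsShiftable p q b) {i : Fin 5} (hi : i ≠ 4) :
    ratioIJ p q (Function.update b i (q * b i)) = ratioIJ p q (Function.update b 4 (q * b 4)) := by
  obtain ⟨σ, h0, h1⟩ : ∃ σ : Equiv.Perm (Fin 5), σ 0 = 4 ∧ σ 1 = i := by
    refine ⟨Equiv.swap 0 4 * Equiv.swap 1 (if i = 0 then 4 else i), ?_⟩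
    revert i
    decide
  have hσ : IsShiftable p q (b ∘ σ) := ⟨fun k => hb.ne_zero _, fun k => hb.norm_lt _, by
    rw [← hb.balanced]; congr 2; exact Equiv.prod_comp σ b⟩
  have key : ∀ k, Function.update (b ∘ σ) k (q * (b ∘ σ) k)
      = Function.update b (σ k) (q * b (σ k)) ∘ σ := by
    intro k
    rw [Function.update_comp_equiv, Equiv.symm_apply_apply]; rfl
  have h := torusMean_mul_productJ_update hp hp0 hq hq0 hσ
  rw [key, key, h0, h1, kernel_comp_equiv, kernel_comp_equiv, productJ_comp_equiv,
    productJ_comp_equiv] at h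
  rw [ratioIJ, ratioIJ, div_eq_div_iff (productJ_ne_zero hp hq (hb.update hq hq0 i))
    (productJ_ne_zero hp hq (hb.update hq hq0 4)), h]

end EllipticG2

namespace EllipticG2

/-! ### Constancy of the quotient -/

open MeasureTheory

variable {p q : ℂ}

/-- A holomorphic function on an annulus that is wider than `|q|` and on which the function is
invariant under `z ↦ q z` is constant, by the maximum principle. -/
theorem eq_of_q_periodic (hq : ‖q‖ < 1) (hq0 : q ≠ 0) {ρ : ℝ} (hρ0 : 0 < ρ) (hρ : ρ < ‖q‖)
    {h : ℂ → ℂ} (hd : ∀ z, ρ < ‖z‖ → ‖z‖ < 1 → DifferentiableAt ℂ h z)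
    (hper : ∀ z, ‖z‖ < 1 → ρ < ‖q * z‖ → h (q * z) = h z) {z w : ℂ} (hz1 : ρ < ‖z‖) (hz2 : ‖z‖ < 1)
    (hw1 : ρ < ‖w‖) (hw2 : ‖w‖ < 1) : h z = h w := by
  have hqq := norm_pos_iff.2 hq0
  have hpow : ∀ (n : ℕ) (z : ℂ), ‖z‖ < 1 → ρ < ‖q ^ n * z‖ → h (q ^ n * z) = h z := by
    intro n
    induction n with
    | zero => intro z _ _; simp
    | succ n ih =>
      intro z h1 h2
      have h3 : ρ < ‖q ^ n * z‖ := by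
        refine h2.trans_le ?_
        rw [pow_succ', mul_assoc, norm_mul]
        exact mul_le_of_le_one_left (norm_nonneg _) hq.le
      have h4 : ‖q ^ n * z‖ < 1 := by
        rw [norm_mul, norm_pow]
        exact (mul_le_of_le_one_left (norm_nonneg _) (pow_le_one₀ hqq.le hq.le)).trans_lt h1
      rw [pow_succ', mul_assoc] at h2 ⊢
      rw [hper _ h4 h2, ih z h1 h3]
  -- a radius `r < 1` with `ρ < ‖q‖ * r`
  obtain ⟨r, hr1, hr2⟩ := exists_between ((div_lt_one hqq).2 hρ)
  have hr0 : 0 < r := (div_pos hρ0 hqq).trans hr1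
  rw [div_lt_iff₀ hqq, mul_comm] at hr1
  have hK : IsCompact {z : ℂ | ‖q‖ * r ≤ ‖z‖ ∧ ‖z‖ ≤ r} := by
    refine (isCompact_closedBall (0 : ℂ) r).of_isClosed_subset
      ((isClosed_le continuous_const continuous_norm).inter
        (isClosed_le continuous_norm continuous_const)) fun z hz => ?_
    simpa using hz.2
  have hKne : {z : ℂ | ‖q‖ * r ≤ ‖z‖ ∧ ‖z‖ ≤ r}.Nonempty :=
    ⟨(r : ℂ), by
      rw [Set.mem_ofPred_eq, Complex.norm_real, Real.norm_eq_abs, abs_of_pos hr0]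
      exact ⟨mul_le_of_le_one_left hr0.le hq.le, le_rfl⟩⟩
  obtain ⟨z₀, hz₀, hmax⟩ := hK.exists_isMaxOn hKne (f := fun z => ‖h z‖) fun z hz =>
    (hd z (hr1.trans_le hz.1) (hz.2.trans_lt hr2)).continuousAt.norm.continuousWithinAt
  have hmax' : ∀ z, ρ < ‖z‖ → ‖z‖ < 1 → ‖h z‖ ≤ ‖h z₀‖ := by
    intro z h1 h2
    obtain ⟨n, hn1, hn2⟩ := exists_mem_Ioc_zpow (x := ‖z‖ / r) (y := ‖q‖⁻¹)
      (div_pos (hρ0.trans h1) hr0) ((one_lt_inv₀ hqq).2 hq)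
    rw [inv_zpow, lt_div_iff₀ hr0] at hn1
    rw [inv_zpow, div_le_iff₀ hr0] at hn2
    have hb1 : ‖q‖ * r ≤ ‖q ^ (n + 1) * z‖ := by
      rw [norm_mul, norm_zpow, zpow_add_one₀ hqq.ne', mul_right_comm, mul_comm]
      refine mul_le_mul_of_nonneg_right ?_ hqq.le
      rw [inv_mul_eq_div, div_lt_iff₀' (zpow_pos hqq n)] at hn1
      exact hn1.le
    have hb2 : ‖q ^ (n + 1) * z‖ ≤ r := by
      rw [norm_mul, norm_zpow]
      rwa [inv_mul_eq_div, le_div_iff₀' (zpow_pos hqq _)] at hn2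
    have he : h (q ^ (n + 1) * z) = h z := by
      generalize n + 1 = m at hb1 hb2
      have hm0 := zpow_ne_zero m hq0
      rcases Int.eq_nat_or_neg m with ⟨k, rfl | rfl⟩
      · rw [zpow_natCast] at hb1 ⊢
        exact hpow k z h2 (hr1.trans_le hb1)
      · rw [zpow_neg, zpow_natCast] at hb1 hb2 ⊢
        have e := hpow k ((q ^ k)⁻¹ * z) (hb2.trans_lt hr2)
        rw [mul_inv_cancel_left₀ (pow_ne_zero k hq0)] at e
        exact (e h1).symm
    rw [← he]
    exact hmax ⟨hb1, hb2⟩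
  -- in the logarithmic coordinate the annulus is a strip, which is convex
  let S : Set ℂ := {u | Real.log ρ < u.re} ∩ {u | u.re < 0}
  have hSo : IsOpen S := (isOpen_lt continuous_const Complex.continuous_re).inter
    (isOpen_lt Complex.continuous_re continuous_const)
  have hSc : Convex ℝ S := (convex_halfSpace_re_gt _).inter (convex_halfSpace_re_lt _)
  have hexp : ∀ u ∈ S, ρ < ‖Complex.exp u‖ ∧ ‖Complex.exp u‖ < 1 := by
    intro u hu
    rw [Complex.norm_exp]
    exact ⟨(Real.log_lt_iff_lt_exp hρ0).1 hu.1, (Real.exp_lt_exp.2 hu.2).trans_eq Real.exp_zero⟩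
  have hlog : ∀ z : ℂ, ρ < ‖z‖ → ‖z‖ < 1 → Complex.log z ∈ S ∧ Complex.exp (Complex.log z) = z := by
    intro z h1 h2
    have hz0 : 0 < ‖z‖ := hρ0.trans h1
    refine ⟨⟨?_, ?_⟩, Complex.exp_log (norm_pos_iff.1 hz0)⟩
    · rw [Set.mem_ofPred_eq, Complex.log_re]; exact Real.log_lt_log hρ0 h1
    · rw [Set.mem_ofPred_eq, Complex.log_re]; exact Real.log_neg hz0 h2
  have hz₀1 : ρ < ‖z₀‖ := hr1.trans_le hz₀.1
  have hz₀2 : ‖z₀‖ < 1 := hz₀.2.trans_lt hr2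
  have hconst := Complex.eqOn_of_isPreconnected_of_isMaxOn_norm (f := fun u => h (Complex.exp u))
    hSc.isPreconnected hSo (fun u hu => ((hd _ (hexp u hu).1 (hexp u hu).2).comp u
      Complex.differentiable_exp.differentiableAt).differentiableWithinAt)
    (hlog z₀ hz₀1 hz₀2).1 (fun u hu => by
      simp only [Set.mem_ofPred_eq, Function.comp, (hlog z₀ hz₀1 hz₀2).2]
      exact hmax' _ (hexp u hu).1 (hexp u hu).2)
  have e1 := hconst (hlog z hz1 hz2).1
  have e2 := hconst (hlog w hw1 hw2).1
  simp only [(hlog z hz1 hz2).2, (hlog w hw1 hw2).2, Function.const] at e1 e2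
  rw [e1, e2]

lemma norm_of_sq_eq {c : ℂ} (hc : c ^ 2 = p * q) : ‖c‖ = √‖p‖ * √‖q‖ := by
  rw [← Real.sqrt_mul (norm_nonneg p), ← norm_mul, ← hc, norm_pow, Real.sqrt_sq (norm_nonneg c)]

lemma prod_withLast {c : ℂ} {a : Fin 4 → ℂ} (ha : ∀ i, a i ≠ 0) : ∏ k, withLast c a k = c := by
  have h0 := ha 0
  have h1 := ha 1
  have h2 := ha 2
  have h3 := ha 3
  simp only [Fin.prod_univ_five, withLast, Matrix.cons_val]
  field_simp

lemma withLast_castSucc (c : ℂ) (a : Fin 4 → ℂ) (i : Fin 4) : withLast c a i.castSucc = a i := by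
  fin_cases i <;> rfl

lemma withLast_four (c : ℂ) (a : Fin 4 → ℂ) : withLast c a 4 = c / ∏ i, a i := by
  rw [Fin.prod_univ_four]; rfl

lemma forall_fin_five {P : Fin 5 → Prop} (h1 : ∀ i : Fin 4, P i.castSucc) (h2 : P 4) : ∀ k, P k :=
  fun k => Fin.lastCases h2 h1 k

lemma isAdmissible_withLast {c : ℂ} (hc : c ^ 2 = p * q) (hc0 : c ≠ 0) {a : Fin 4 → ℂ}
    (ha : a ∈ domainU0 p q) : IsAdmissible p q (withLast c a) where
  ne_zero := forall_fin_five (fun i => by rw [withLast_castSucc]; exact ha.1 i)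
    (by rw [withLast_four]; exact div_ne_zero hc0 (Finset.prod_ne_zero_iff.2 fun i _ => ha.1 i))
  norm_lt := forall_fin_five (fun i => by rw [withLast_castSucc]; exact ha.2.1 i) (by
    rw [withLast_four, norm_div, norm_of_sq_eq hc]
    exact (div_lt_one (norm_pos_iff.2 (Finset.prod_ne_zero_iff.2 fun i _ => ha.1 i))).2 ha.2.2)
  balanced := by rw [prod_withLast ha.1, hc]

/-- The quotient of the two sides of the evaluation is invariant under `a i ↦ q a i`. -/
lemma ratioIJ_withLast_update (hp : ‖p‖ < 1) (hp0 : p ≠ 0) (hq : ‖q‖ < 1) (hq0 : q ≠ 0) {c : ℂ}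
    (hc : c ^ 2 = p * q) {a : Fin 4 → ℂ} {i : Fin 4} (ha : a ∈ domainU0 p q)
    (ha' : Function.update a i (q * a i) ∈ domainU0 p q) :
    ratioIJ p q (withLast c (Function.update a i (q * a i))) = ratioIJ p q (withLast c a) := by
  have hc0 : c ≠ 0 := by
    rintro rfl
    exact mul_ne_zero hp0 hq0 (by rw [← hc]; simp)
  have hA := isAdmissible_withLast hc hc0 ha
  have hA' := isAdmissible_withLast hc hc0 ha'
  have hprod : ∏ j, Function.update a i (q * a i) j = q * ∏ j, a j := by
    rw [Finset.prod_update_of_mem (Finset.mem_univ i), mul_assoc, Finset.sdiff_singleton_eq_erase,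
      Finset.mul_prod_erase _ _ (Finset.mem_univ i)]
  have hP : ∏ j, a j ≠ 0 := Finset.prod_ne_zero_iff.2 fun i _ => ha.1 i
  let b : Fin 5 → ℂ := Function.update (withLast c a) 4 (c / (q * ∏ j, a j))
  have hne : ∀ j : Fin 4, j.castSucc ≠ (4 : Fin 5) := fun j => (Fin.castSucc_lt_last j).ne
  have hb4 : b 4 = c / (q * ∏ j, a j) := Function.update_self ..
  have hbj : ∀ j : Fin 4, b j.castSucc = a j := fun j => by
    simp only [b]
    rw [Function.update_of_ne (hne j), withLast_castSucc]
  have e4 : Function.update b 4 (q * b 4) = withLast c a := by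
    funext k
    revert k
    refine forall_fin_five (fun j => ?_) ?_
    · rw [Function.update_of_ne (hne j), hbj, withLast_castSucc]
    · rw [Function.update_self, hb4, withLast_four]; field_simp
  have ei : Function.update b i.castSucc (q * b i.castSucc)
      = withLast c (Function.update a i (q * a i)) := by
    funext k
    revert k
    refine forall_fin_five (fun j => ?_) ?_
    · rw [withLast_castSucc, hbj]
      rcases eq_or_ne j i with rfl | h
      · rw [Function.update_self, Function.update_self]
      · rw [Function.update_of_ne h, Function.update_of_ne
          (fun h' => h (Fin.castSucc_injective _ h')), hbj]
    · rw [Function.update_of_ne (hne i).symm, hb4, withLast_four, hprod]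
  have hsh : IsShiftable p q b := by
    refine ⟨forall_fin_five (fun j => ?_) ?_, forall_fin_five (fun j => ?_) ?_, ?_⟩
    · rw [hbj]; exact ha.1 j
    · rw [hb4]; exact div_ne_zero hc0 (mul_ne_zero hq0 hP)
    · rw [hbj]; exact ha.2.1 j
    · have := hA'.norm_lt 4
      rwa [withLast_four, hprod, ← hb4] at this
    · have h1 : q * ∏ k, b k = c := by rw [← prod_update b 4 q, e4, prod_withLast ha.1]
      refine mul_left_cancel₀ hq0 ?_
      rw [mul_comm q p, ← hc, ← h1]; ring
  rw [← ei, ← e4]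
  exact ratioIJ_update hp hp0 hq hq0 hsh (hne i)

lemma update_mem_domainU0_iff {a : Fin 4 → ℂ} (ha : a ∈ domainU0 p q) (i : Fin 4) (z : ℂ) :
    Function.update a i z ∈ domainU0 p q ↔
      z ≠ 0 ∧ ‖z‖ < 1 ∧ √‖p‖ * √‖q‖ < ‖z‖ * ‖∏ j ∈ Finset.univ.erase i, a j‖ := by
  have hprod : ∏ j, Function.update a i z j = z * ∏ j ∈ Finset.univ.erase i, a j := by
    rw [Finset.prod_update_of_mem (Finset.mem_univ i), Finset.sdiff_singleton_eq_erase]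
  constructor
  · intro h
    have h1 := h.1 i
    have h2 := h.2.1 i
    have h3 := h.2.2
    rw [Function.update_self] at h1 h2
    rw [hprod, norm_mul] at h3
    exact ⟨h1, h2, h3⟩
  · rintro ⟨h1, h2, h3⟩
    refine ⟨fun j => ?_, fun j => ?_, by rw [hprod, norm_mul]; exact h3⟩
    · rcases eq_or_ne j i with rfl | h
      · rwa [Function.update_self]
      · rw [Function.update_of_ne h]; exact ha.1 j
    · rcases eq_or_ne j i with rfl | h
      · rwa [Function.update_self]
      · rw [Function.update_of_ne h]; exact ha.2.1 j

/-- The quotient of the two sides does not change when the parameter of smallest modulus moves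
inside its annulus: by `‖p‖ < ‖q‖ ^ 9` that annulus is wider than `‖q‖`. -/
lemma ratioIJ_eq_of_update (hp : ‖p‖ < 1) (hp0 : p ≠ 0) (hq : ‖q‖ < 1) (hq0 : q ≠ 0)
    (hpq : ‖p‖ < ‖q‖ ^ 9) {c : ℂ} (hc : c ^ 2 = p * q) {a : Fin 4 → ℂ} {i : Fin 4}
    (ha : a ∈ domainU0 p q) (hmin : ∀ j, ‖a i‖ ≤ ‖a j‖) {z : ℂ}
    (hz : Function.update a i z ∈ domainU0 p q) :
    ratioIJ p q (withLast c (Function.update a i z)) = ratioIJ p q (withLast c a) := by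
  have hc0 : c ≠ 0 := by
    rintro rfl
    exact mul_ne_zero hp0 hq0 (by rw [← hc]; simp)
  have hpp := norm_pos_iff.2 hp0
  have hqq := norm_pos_iff.2 hq0
  set s := √‖p‖ * √‖q‖ with hs
  set R := ‖∏ j ∈ Finset.univ.erase i, a j‖ with hR
  have hs0 : 0 < s := mul_pos (Real.sqrt_pos.2 hpp) (Real.sqrt_pos.2 hqq)
  have hR0 : 0 < R := norm_pos_iff.2 (Finset.prod_ne_zero_iff.2 fun j _ => ha.1 j)
  have hai := norm_pos_iff.2 (ha.1 i)
  have hsR : s < ‖a i‖ * R := by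
    have := ha.2.2
    rwa [← Finset.mul_prod_erase _ _ (Finset.mem_univ i), norm_mul] at this
  have hs5 : s < ‖q‖ ^ 5 := by
    refine lt_of_pow_lt_pow_left₀ 2 (by positivity) ?_
    rw [hs, mul_pow, Real.sq_sqrt hpp.le, Real.sq_sqrt hqq.le]
    calc ‖p‖ * ‖q‖ < ‖q‖ ^ 9 * ‖q‖ := mul_lt_mul_of_pos_right hpq hqq
      _ = (‖q‖ ^ 5) ^ 2 := by ring
  have hRa : ‖a i‖ ^ 3 ≤ R := by
    rw [hR, norm_prod]
    calc ‖a i‖ ^ 3 = ∏ j ∈ Finset.univ.erase i, ‖a i‖ := by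
          rw [Finset.prod_const, Finset.card_erase_of_mem (Finset.mem_univ i)]; rfl
      _ ≤ _ := Finset.prod_le_prod (fun _ _ => norm_nonneg _) fun j _ => hmin j
  have hρ : s / R < ‖q‖ := by
    -- `R ^ 4 ≥ (‖a i‖ R) ^ 3 > s ^ 3`
    have h1 : s ^ 3 < R ^ 4 :=
      calc s ^ 3 < (‖a i‖ * R) ^ 3 := pow_lt_pow_left₀ hsR hs0.le three_ne_zero
        _ = ‖a i‖ ^ 3 * R ^ 3 := by ring
        _ ≤ R * R ^ 3 := by gcongr
        _ = R ^ 4 := by ring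
    refine lt_of_pow_lt_pow_left₀ 4 hqq.le ?_
    rw [div_pow, div_lt_iff₀ (by positivity)]
    calc s ^ 4 = s * s ^ 3 := by ring
      _ < ‖q‖ ^ 5 * R ^ 4 := mul_lt_mul hs5 h1.le (by positivity) (by positivity)
      _ ≤ ‖q‖ ^ 4 * R ^ 4 := by
        gcongr ?_ * _
        exact pow_le_pow_of_le_one hqq.le hq.le (by norm_num)
  have hmem : ∀ z, s / R < ‖z‖ → ‖z‖ < 1 → Function.update a i z ∈ domainU0 p q := by
    intro z h1 h2
    refine (update_mem_domainU0_iff ha i z).2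
      ⟨norm_pos_iff.1 ((div_pos hs0 hR0).trans h1), h2, ?_⟩
    rwa [div_lt_iff₀ hR0] at h1
  have hdu : ∀ (z : ℂ) (j : Fin 4), DifferentiableAt ℂ (fun z => Function.update a i z j) z := by
    intro z j
    rcases eq_or_ne j i with rfl | h
    · simp only [Function.update_self]; fun_prop
    · simp only [Function.update_of_ne h]; fun_prop
  have key := eq_of_q_periodic hq hq0 (div_pos hs0 hR0) hρ
    (h := fun z => ratioIJ p q (withLast c (Function.update a i z))) (fun z h1 h2 => ?_)
    (fun z h1 h2 => ?_) (z := z) (w := a i) ?_ ?_ ?_ ?_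
  · simpa only [Function.update_eq_self] using key
  · let U : Set ℂ := {z | s / R < ‖z‖} ∩ {z | ‖z‖ < 1}
    have hU : IsOpen U := (isOpen_lt continuous_const continuous_norm).inter
      (isOpen_lt continuous_norm continuous_const)
    have hadm : ∀ z ∈ U, IsAdmissible p q (withLast c (Function.update a i z)) := fun z hz =>
      isAdmissible_withLast hc hc0 (hmem z hz.1 hz.2)
    have hdw : ∀ z ∈ U, ∀ k, DifferentiableAt ℂ
        (fun z => withLast c (Function.update a i z) k) z := by
      intro z hz
      refine forall_fin_five (fun j => ?_) ?_
      · simp only [withLast_castSucc]; exact hdu z j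
      · simp only [withLast_four, div_eq_mul_inv]
        exact ((differentiableAt_prod _ fun j _ => hdu z j).fun_inv
          (Finset.prod_ne_zero_iff.2 fun j _ => (hmem z hz.1 hz.2).1 j)).const_mul c
    have hzU : z ∈ U := ⟨h1, h2⟩
    simp only [ratioIJ, div_eq_mul_inv]
    exact (differentiableAt_torusMean_kernel hp hq hU hzU hdw (fun z hz => (hadm z hz).ne_zero)
      fun z hz => (hadm z hz).norm_lt).fun_mul
      ((differentiableAt_productJ (a := fun z => withLast c (Function.update a i z)) hp hq
        (hadm z hzU) (hdw z hzU)).fun_inv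
        (productJ_ne_zero hp hq (hadm z hzU)))
  · have h3 : s / R < ‖z‖ := h2.trans_le (by
      rw [norm_mul]; exact mul_le_of_le_one_left (norm_nonneg _) hq.le)
    have e := ratioIJ_withLast_update (i := i) hp hp0 hq hq0 hc (hmem z h3 h1) (by
      rw [Function.update_self, Function.update_idem]
      exact hmem _ h2 (norm_mul_lt_one hq h1.le))
    rwa [Function.update_self, Function.update_idem] at e
  · rw [div_lt_iff₀ hR0]; exact ((update_mem_domainU0_iff ha i z).1 hz).2.2
  · exact ((update_mem_domainU0_iff ha i z).1 hz).2.1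
  · rwa [div_lt_iff₀ hR0]
  · exact ha.2.1 i

/-- The quotient can be computed at equal parameters `t`: the coordinate of smallest modulus is
moved to `t`, and the number of remaining coordinates decreases. -/
lemma ratioIJ_eq_const (hp : ‖p‖ < 1) (hp0 : p ≠ 0) (hq : ‖q‖ < 1) (hq0 : q ≠ 0)
    (hpq : ‖p‖ < ‖q‖ ^ 9) {c : ℂ} (hc : c ^ 2 = p * q) {t : ℝ} (ht0 : 0 < t) (ht : t < 1) (n : ℕ) :
    ∀ a ∈ domainU0 p q, (∀ j, a j = t ∨ ‖a j‖ < t) →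
      (Finset.univ.filter fun j => a j ≠ t).card = n →
      ratioIJ p q (withLast c a) = ratioIJ p q (withLast c fun _ => (t : ℂ)) := by
  have htn : ‖(t : ℂ)‖ = t := by rw [Complex.norm_real, Real.norm_eq_abs, abs_of_pos ht0]
  induction n with
  | zero =>
    intro a ha h hcard
    rw [Finset.card_eq_zero, Finset.filter_eq_empty_iff] at hcard
    congr 2
    funext j
    exact not_not.1 (hcard (Finset.mem_univ j))
  | succ n ih =>
    intro a ha h hcard
    obtain ⟨i, hi⟩ := Finite.exists_min fun j => ‖a j‖
    have hit : a i ≠ t := by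
      intro hit
      obtain ⟨j, hj⟩ : (Finset.univ.filter fun j => a j ≠ t).Nonempty :=
        Finset.card_pos.1 (by omega)
      have hj' := (Finset.mem_filter.1 hj).2
      have h1 := (h j).resolve_left hj'
      have h2 := hi j
      rw [hit, htn] at h2
      exact h2.not_gt h1
    have hlt := (h i).resolve_left hit
    have hmem : Function.update a i (t : ℂ) ∈ domainU0 p q := by
      refine (update_mem_domainU0_iff ha i _).2 ⟨by exact_mod_cast ht0.ne', by rwa [htn], ?_⟩
      have := ((update_mem_domainU0_iff ha i (a i)).1 (by rwa [Function.update_eq_self])).2.2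
      rw [htn]
      exact this.trans_le (mul_le_mul_of_nonneg_right hlt.le (norm_nonneg _))
    rw [← ratioIJ_eq_of_update hp hp0 hq hq0 hpq hc ha hi hmem]
    refine ih _ hmem (fun j => ?_) ?_
    · rcases eq_or_ne j i with rfl | hj
      · rw [Function.update_self]; exact Or.inl rfl
      · rw [Function.update_of_ne hj]; exact h j
    · have : (Finset.univ.filter fun j => Function.update a i (t : ℂ) j ≠ t)
          = (Finset.univ.filter fun j => a j ≠ t).erase i := by
        ext j
        rcases eq_or_ne j i with rfl | hj
        · simp
        · simp [hj]
      rw [this, Finset.card_erase_of_mem (by simpa using hit), hcard]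
      rfl

/-- The quotient of the two sides of the evaluation is constant on `U₀`. -/
theorem ratioIJ_withLast_eq (hp : ‖p‖ < 1) (hp0 : p ≠ 0) (hq : ‖q‖ < 1) (hq0 : q ≠ 0)
    (hpq : ‖p‖ < ‖q‖ ^ 9) {c : ℂ} (hc : c ^ 2 = p * q) {a a' : Fin 4 → ℂ} (ha : a ∈ domainU0 p q)
    (ha' : a' ∈ domainU0 p q) : ratioIJ p q (withLast c a) = ratioIJ p q (withLast c a') := by
  obtain ⟨i, hi⟩ := Finite.exists_max fun j => ‖a j‖
  obtain ⟨i', hi'⟩ := Finite.exists_max fun j => ‖a' j‖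
  obtain ⟨t, ht, ht1⟩ := exists_between (max_lt (ha.2.1 i) (ha'.2.1 i'))
  rw [max_lt_iff] at ht
  have ht0 : 0 < t := (norm_nonneg _).trans_lt ht.1
  rw [ratioIJ_eq_const hp hp0 hq hq0 hpq hc ht0 ht1 _ a ha
      (fun j => Or.inr ((hi j).trans_lt ht.1)) rfl,
    ratioIJ_eq_const hp hp0 hq hq0 hpq hc ht0 ht1 _ a' ha'
      (fun j => Or.inr ((hi' j).trans_lt ht.2)) rfl]

end EllipticG2

namespace EllipticG2

/-! ### Means of geometric series and of poles -/

open MeasureTheory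

lemma one_sub_ne_zero {u : ℂ} (h : ‖u‖ < 1) : 1 - u ≠ 0 := by
  intro h0
  rw [← sub_eq_zero.1 h0, norm_one] at h
  exact lt_irrefl _ h

/-- The constant term of a product of two geometric series, by Cauchy's integral formula. -/
lemma circleAverage_geometric {A B : ℂ} (hA : ‖A‖ < 1) (hB : ‖B‖ < 1) :
    Real.circleAverage (fun z => (1 - A * z)⁻¹ * (1 - B * z⁻¹)⁻¹) 0 1 = (1 - A * B)⁻¹ := by
  rw [Real.circleAverage_eq_circleIntegral one_ne_zero]
  have h := Complex.circleIntegral_sub_inv_smul_of_differentiable_on_off_countable (w := B) (c := 0)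
    (R := 1) (f := fun z => (1 - A * z)⁻¹) Set.countable_empty (by simpa using hB) ?_ ?_
  · rw [← mul_inv_cancel_left₀ (a := 2 * (π : ℂ) * Complex.I) (by simp [Real.pi_ne_zero])
      ((1 - A * B)⁻¹), mul_left_comm]
    simp only [smul_eq_mul] at h
    rw [← h, smul_eq_mul]
    congr 1
    refine circleIntegral.integral_congr zero_le_one fun z hz => ?_
    have hz1 : ‖z‖ = 1 := by simpa using hz
    have hz0 : z ≠ 0 := norm_ne_zero_iff.1 (by rw [hz1]; norm_num)
    have e : z - B = z * (1 - B * z⁻¹) := by field_simp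
    simp only [sub_zero, smul_eq_mul]
    rw [e, mul_inv]
    ring
  · refine ContinuousOn.inv₀ (by fun_prop) fun z hz => one_sub_ne_zero ?_
    exact norm_mul_lt_one hA (by simpa using hz)
  · intro z hz
    refine DifferentiableAt.inv (by fun_prop) (one_sub_ne_zero ?_)
    exact norm_mul_lt_one hA (by simpa using (Metric.ball_subset_closedBall hz.1))

/-- The mean of a product of three geometric series over the torus. -/
lemma torusMean_geometric {A B C : ℂ} (hA : ‖A‖ < 1) (hB : ‖B‖ < 1) (hC : ‖C‖ < 1) :
    Continuous (onTorus fun x y w => (1 - A * x)⁻¹ * (1 - B * y)⁻¹ * (1 - C * w)⁻¹) ∧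
    torusMean (fun x y w => (1 - A * x)⁻¹ * (1 - B * y)⁻¹ * (1 - C * w)⁻¹)
      = (1 - A * B * C)⁻¹ := by
  have hc : Continuous (onTorus fun x y w => (1 - A * x)⁻¹ * (1 - B * y)⁻¹ * (1 - C * w)⁻¹) := by
    refine continuous_onTorus_of_differentiableAt fun z h1 h2 w hw hw1 => ?_
    have k1 : DifferentiableAt ℂ (fun z : ℂ × ℂ => (1 - A * z.1)⁻¹) z :=
      DifferentiableAt.fun_inv (by fun_prop) (one_sub_ne_zero (norm_mul_lt_one hA h1.le))
    have k2 : DifferentiableAt ℂ (fun z : ℂ × ℂ => (1 - B * z.2)⁻¹) z :=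
      DifferentiableAt.fun_inv (by fun_prop) (one_sub_ne_zero (norm_mul_lt_one hB h2.le))
    have k3 : DifferentiableAt ℂ (fun z : ℂ × ℂ => (1 - C * w z)⁻¹) z :=
      DifferentiableAt.fun_inv (by fun_prop) (one_sub_ne_zero (norm_mul_lt_one hC hw1.le))
    exact (k1.mul k2).mul k3
  refine ⟨hc, ?_⟩
  rw [torusMean_eq_circleAverage hc]
  have hBC : ‖B * C‖ < 1 := norm_mul_lt_one hB hC.le
  have inner : ∀ x : ℂ, ‖x‖ = 1 → Real.circleAverage (fun y =>
      (1 - A * x)⁻¹ * (1 - B * y)⁻¹ * (1 - C * (x * y)⁻¹)⁻¹) 0 1 =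
      (1 - A * x)⁻¹ * (1 - B * C * x⁻¹)⁻¹ := by
    intro x hx
    have hCx : ‖C * x⁻¹‖ < 1 := norm_mul_lt_one hC (by rw [norm_inv, hx, inv_one])
    have h := circleAverage_geometric hB hCx
    have e : (fun y => (1 - A * x)⁻¹ * (1 - B * y)⁻¹ * (1 - C * (x * y)⁻¹)⁻¹) = fun y =>
        (1 - A * x)⁻¹ • ((1 - B * y)⁻¹ * (1 - C * x⁻¹ * y⁻¹)⁻¹) := by
      funext y
      rw [smul_eq_mul, mul_inv x y, mul_assoc, mul_assoc C]
    rw [e, Real.circleAverage_fun_smul, h, smul_eq_mul, mul_assoc B]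
  rw [Real.circleAverage_congr_sphere (f₂ := fun x => (1 - A * x)⁻¹ * (1 - B * C * x⁻¹)⁻¹)
    fun x hx => inner x (by simpa using hx), circleAverage_geometric hA hBC, mul_assoc A]

/-- The mean of `1 / |1 - r z|` over the unit circle. -/
noncomputable def poleMean (r : ℝ) : ℝ := Real.circleAverage (fun z : ℂ => ‖1 - r * z‖⁻¹) 0 1

lemma one_sub_le_norm {r : ℝ} (hr : 0 ≤ r) {z : ℂ} (hz : ‖z‖ = 1) : 1 - r ≤ ‖1 - r * z‖ := by
  have := norm_sub_norm_le (1 : ℂ) (r * z)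
  rwa [norm_one, norm_mul, hz, mul_one, Complex.norm_real, Real.norm_eq_abs, abs_of_nonneg hr]
    at this

lemma norm_sub_one_le {r : ℝ} (hr : 0 ≤ r) (hr1 : r ≤ 1) {z : ℂ} (hz : ‖z‖ = 1) :
    ‖z - 1‖ ≤ 2 * ‖1 - r * z‖ := by
  have h1 := one_sub_le_norm hr hz
  have h2 : z - 1 = ((1 - r : ℝ) : ℂ) * z - (1 - r * z) := by push_cast; ring
  rw [h2]
  refine (norm_sub_le _ _).trans ?_
  rw [norm_mul, hz, mul_one, Complex.norm_real, Real.norm_eq_abs, abs_of_nonneg (by linarith)]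
  linarith

lemma le_norm_circleMap_sub_one {θ : ℝ} (h0 : 0 ≤ θ) (h1 : θ ≤ 2 * π) :
    min θ (2 * π - θ) / 4 ≤ ‖circleMap 0 1 θ - 1‖ := by
  have hpi := Real.pi_le_four
  have hpi3 := Real.pi_gt_three
  have e : ‖circleMap 0 1 θ - 1‖ = ‖2 * Real.sin (θ / 2)‖ := by
    have := Complex.norm_exp_I_mul_ofReal_sub_one θ
    rw [← this, circleMap, mul_comm Complex.I]; simp
  rw [e, Real.norm_eq_abs]
  refine le_trans ?_ (le_abs_self _)
  rcases le_total θ π with h | h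
  · have := Real.mul_le_sin (x := θ / 2) (by linarith) (by linarith)
    have h2 : 2 / π * (θ / 2) = θ / π := by ring
    have h3 : θ / 4 ≤ θ / π := by gcongr
    have h4 := min_le_left θ (2 * π - θ)
    rw [h2] at this
    nlinarith [div_nonneg h0 Real.pi_pos.le]
  · have := Real.mul_le_sin (x := π - θ / 2) (by linarith) (by linarith)
    rw [Real.sin_pi_sub] at this
    have h2 : 2 / π * (π - θ / 2) = (2 * π - θ) / π := by field_simp
    have h3 : (2 * π - θ) / 4 ≤ (2 * π - θ) / π := by
      gcongr
    have h4 := min_le_right θ (2 * π - θ)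
    rw [h2] at this
    have h5 : 0 ≤ (2 * π - θ) / π := div_nonneg (by linarith) Real.pi_pos.le
    linarith

/-- The mean of a simple pole grows more slowly than `(1 - r) ^ (-1/2)`: the integrand
`√(1 - r) / |1 - r z|` is at most `|1 - r z| ^ (-1/2)`, which is
dominated by an integrable function. -/
lemma tendsto_poleMean : Tendsto (fun r : ℝ => √(1 - r) * poleMean r) (𝓝[<] 1) (𝓝 0) := by
  have key : Tendsto (fun r : ℝ => ∫ θ in (0)..2 * π, √(1 - r) * ‖1 - r * circleMap 0 1 θ‖⁻¹)
      (𝓝[<] 1) (𝓝 (∫ θ in (0)..2 * π, (0 : ℝ))) := by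
    have hr : ∀ᶠ r : ℝ in 𝓝[<] 1, 0 < r ∧ r < 1 := by
      filter_upwards [Ioo_mem_nhdsLT (zero_lt_one' ℝ)] with r hr using hr
    have hne : ∀ᵐ θ : ℝ, θ ≠ 2 * π := by simp [ae_iff, measure_singleton]
    have hI : IntervalIntegrable (fun θ : ℝ => θ ^ (-(1 / 2) : ℝ)) volume 0 (2 * π) :=
      intervalIntegral.intervalIntegrable_rpow' (by norm_num)
    refine intervalIntegral.tendsto_integral_filter_of_dominated_convergence
      (fun θ => 3 * (θ ^ (-(1 / 2) : ℝ) + (2 * π - θ) ^ (-(1 / 2) : ℝ))) ?_ ?_ ?_ ?_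
    · refine Eventually.of_forall fun r => Measurable.aestronglyMeasurable ?_
      exact measurable_const.mul (by fun_prop)
    · filter_upwards [hr] with r hr
      filter_upwards [hne] with θ hθ1 hθ
      rw [Set.uIoc_of_le (by positivity)] at hθ
      have h1 : 0 < θ := hθ.1
      have h2 : 0 < 2 * π - θ := sub_pos.2 (lt_of_le_of_ne hθ.2 hθ1)
      have hm : 0 < min θ (2 * π - θ) := lt_min h1 h2
      have hz := norm_circleMap θ
      have d1 := one_sub_le_norm hr.1.le hz
      have d2 : min θ (2 * π - θ) / 8 ≤ ‖1 - r * circleMap 0 1 θ‖ := by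
        have := norm_sub_one_le hr.1.le hr.2.le hz
        have := le_norm_circleMap_sub_one h1.le hθ.2
        linarith
      generalize ‖1 - r * circleMap 0 1 θ‖ = d at d1 d2
      have hd : 0 < d := lt_of_lt_of_le (by positivity) d2
      have e1 : √(1 - r) * d⁻¹ ≤ (√d)⁻¹ := by
        calc √(1 - r) * d⁻¹ ≤ √d * d⁻¹ := by gcongr
          _ = (√d)⁻¹ := by rw [← div_eq_mul_inv, Real.sqrt_div_self']; simp
      have e2 : (√d)⁻¹ ≤ 3 * (√(min θ (2 * π - θ)))⁻¹ := by
        rw [← div_eq_mul_inv, le_div_iff₀ (Real.sqrt_pos.2 hm), inv_mul_le_iff₀ (Real.sqrt_pos.2 hd)]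
        calc √(min θ (2 * π - θ)) ≤ √(d * 3 ^ 2) := Real.sqrt_le_sqrt (by linarith)
          _ = √d * 3 := by rw [Real.sqrt_mul hd.le, Real.sqrt_sq (by norm_num)]
      have e3 : ∀ t : ℝ, 0 < t → t ^ (-(1 / 2) : ℝ) = (√t)⁻¹ := fun t ht => by
        rw [Real.rpow_neg ht.le, Real.sqrt_eq_rpow]
      rw [Real.norm_of_nonneg (by positivity), e3 _ h1, e3 _ h2]
      refine e1.trans (e2.trans ?_)
      gcongr
      rcases min_choice θ (2 * π - θ) with h | h <;> rw [h]
      · exact le_add_of_nonneg_right (by positivity)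
      · exact le_add_of_nonneg_left (by positivity)
    · refine (hI.add ?_).const_mul 3
      simpa using (hI.comp_sub_left (2 * π)).symm
    · filter_upwards [hne] with θ hθ1 hθ
      rw [Set.uIoc_of_le (by positivity)] at hθ
      have hm : 0 < min θ (2 * π - θ) := lt_min hθ.1 (sub_pos.2 (lt_of_le_of_ne hθ.2 hθ1))
      have h4 := le_norm_circleMap_sub_one hθ.1.le hθ.2
      have h5 : ‖1 - ((1 : ℝ) : ℂ) * circleMap 0 1 θ‖ ≠ 0 := by
        rw [Complex.ofReal_one, one_mul, norm_sub_rev]; linarith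
      have hc : ContinuousAt (fun r : ℝ => √(1 - r) * ‖1 - r * circleMap 0 1 θ‖⁻¹) 1 := by
        refine ContinuousAt.mul (by fun_prop) (ContinuousAt.inv₀ (by fun_prop) h5)
      have := hc.tendsto
      rw [sub_self, Real.sqrt_zero, zero_mul] at this
      exact this.mono_left nhdsWithin_le_nhds
  have := key.const_mul (2 * π)⁻¹
  simp only [intervalIntegral.integral_zero, mul_zero, intervalIntegral.integral_const_mul] at this
  refine this.congr fun r => ?_
  rw [poleMean, Real.circleAverage_def, smul_eq_mul]
  ring

end EllipticG2

namespace EllipticG2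

open MeasureTheory

/-! ### Residue at a triple of poles on the torus -/

/-- A holomorphic function on a compact set is Lipschitz at each point, uniformly over the set: near
the point by differentiability, away from it by boundedness. -/
lemma exists_norm_sub_le_mul {V : Type*} [NormedAddCommGroup V] [NormedSpace ℂ V] {K : Set V}
    (hK : IsCompact K) {f : V → ℂ} (hf : ∀ v ∈ K, DifferentiableAt ℂ f v) {v₀ : V} (hv₀ : v₀ ∈ K) :
    ∃ C, 0 ≤ C ∧ ∀ v ∈ K, ‖f v - f v₀‖ ≤ C * ‖v - v₀‖ := by
  obtain ⟨c, hc0, hc⟩ := (hf v₀ hv₀).isBigO_sub.exists_nonneg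
  obtain ⟨ε, hε, h⟩ := Metric.eventually_nhds_iff.1 hc.bound
  obtain ⟨M, hM⟩ := hK.exists_bound_of_continuousOn
    fun v hv => (hf v hv).continuousAt.continuousWithinAt
  have hM0 : 0 ≤ M := (norm_nonneg _).trans (hM v₀ hv₀)
  refine ⟨max c (2 * M / ε), le_max_of_le_left hc0, fun v hv => ?_⟩
  rcases lt_or_ge (dist v v₀) ε with hd | hd
  · exact (h hd).trans (by gcongr; exact le_max_left _ _)
  · rw [dist_eq_norm] at hd
    calc ‖f v - f v₀‖ ≤ ‖f v‖ + ‖f v₀‖ := norm_sub_le _ _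
      _ ≤ 2 * M / ε * ε := by
        rw [div_mul_cancel₀ _ hε.ne']; linarith [hM v hv, hM v₀ hv₀]
      _ ≤ max c (2 * M / ε) * ‖v - v₀‖ := by gcongr; exact le_max_right _ _

/-- The three products of two of the pole factors `1 / |1 - r β x|`, `1 / |1 - r γ y|`,
`1 / |1 - r δ w|`, summed. -/
noncomputable def pairSum (β γ δ : ℂ) (r : ℝ) (x y w : ℂ) : ℝ :=
  ‖1 - r * (β * x)‖⁻¹ * ‖1 - r * (γ * y)‖⁻¹ + ‖1 - r * (β * x)‖⁻¹ * ‖1 - r * (δ * w)‖⁻¹ +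
    ‖1 - r * (γ * y)‖⁻¹ * ‖1 - r * (δ * w)‖⁻¹

section bounds

variable {β γ δ : ℂ} {r : ℝ}

lemma norm_pole_pos (hβ : ‖β‖ = 1) (hr : 0 ≤ r) (hr1 : r < 1) {x : ℂ} (hx : ‖x‖ = 1) :
    0 < ‖1 - r * (β * x)‖ :=
  (sub_pos.2 hr1).trans_le (one_sub_le_norm hr (by rw [norm_mul, hβ, hx, one_mul]))

lemma circleAverage_pole (hβ : ‖β‖ = 1) (r : ℝ) :
    Real.circleAverage (fun z : ℂ => ‖1 - r * (β * z)‖⁻¹) 0 1 = poleMean r :=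
  circleAverage_mul_left (fun z : ℂ => ‖1 - r * z‖⁻¹) hβ

lemma torusMean_pole_mul_pole (hβ : ‖β‖ = 1) (hγ : ‖γ‖ = 1) (hr : 0 ≤ r) (hr1 : r < 1) :
    Continuous (onTorus fun x y _ => ‖1 - r * (β * x)‖⁻¹ * ‖1 - r * (γ * y)‖⁻¹) ∧
    torusMean (fun x y _ => ‖1 - r * (β * x)‖⁻¹ * ‖1 - r * (γ * y)‖⁻¹) = poleMean r ^ 2 := by
  have hc : Continuous (onTorus fun x y _ => ‖1 - r * (β * x)‖⁻¹ * ‖1 - r * (γ * y)‖⁻¹) := by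
    refine continuous_onTorus fun x y hx hy => ?_
    have h1 : ContinuousAt (fun z : ℂ × ℂ => ‖1 - r * (β * z.1)‖) (x, y) := by fun_prop
    have h2 : ContinuousAt (fun z : ℂ × ℂ => ‖1 - r * (γ * z.2)‖) (x, y) := by fun_prop
    exact (h1.inv₀ (norm_pole_pos hβ hr hr1 hx).ne').mul (h2.inv₀ (norm_pole_pos hγ hr hr1 hy).ne')
  refine ⟨hc, ?_⟩
  rw [torusMean_eq_circleAverage hc]
  have e : ∀ x : ℂ, Real.circleAverage (fun y : ℂ => ‖1 - r * (β * x)‖⁻¹ * ‖1 - r * (γ * y)‖⁻¹) 0 1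
      = poleMean r • ‖1 - r * (β * x)‖⁻¹ := fun x => by
    have := Real.circleAverage_fun_smul (a := ‖1 - r * (β * x)‖⁻¹)
      (f := fun y : ℂ => ‖1 - r * (γ * y)‖⁻¹) (c := 0) (R := 1)
    rwa [circleAverage_pole hγ, smul_eq_mul, mul_comm _ (poleMean r)] at this
  simp_rw [e]
  rw [Real.circleAverage_fun_smul, circleAverage_pole hβ, smul_eq_mul, sq]

lemma torusMean_pairSum (hβ : ‖β‖ = 1) (hγ : ‖γ‖ = 1) (hδ : ‖δ‖ = 1) (hr : 0 ≤ r) (hr1 : r < 1) :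
    Continuous (onTorus (pairSum β γ δ r)) ∧
      torusMean (pairSum β γ δ r) = 3 * poleMean r ^ 2 := by
  obtain ⟨c1, m1⟩ := torusMean_pole_mul_pole hβ hγ hr hr1
  obtain ⟨c2, m2⟩ := torusMean_pole_mul_pole hβ hδ hr hr1
  obtain ⟨c3, m3⟩ := torusMean_pole_mul_pole hγ hδ hr hr1
  have c2' := continuous_onTorus_swap23 c2
  have m2' := torusMean_swap23 c2
  have m3' := (torusMean_swap12 _).trans (torusMean_swap23 c3)
  have c3' := continuous_onTorus_swap12 (continuous_onTorus_swap23 c3)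
  have c12 : Continuous (onTorus fun x y w => ‖1 - r * (β * x)‖⁻¹ * ‖1 - r * (γ * y)‖⁻¹ +
      ‖1 - r * (β * x)‖⁻¹ * ‖1 - r * (δ * w)‖⁻¹) := c1.add c2'
  refine ⟨c12.add c3', ?_⟩
  have h12 := torusMean_add c1 c2'
  have h123 := torusMean_add c12 c3'
  refine h123.trans ?_
  rw [m3', h12, m2', m1, m2, m3]
  ring

lemma tendsto_one_sub_cube_mul_poleMean_sq :
    Tendsto (fun r : ℝ => (1 - r ^ 3) * (3 * poleMean r ^ 2)) (𝓝[<] 1) (𝓝 0) := by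
  have h := (tendsto_poleMean.pow 2).const_mul 9
  rw [zero_pow two_ne_zero, mul_zero] at h
  refine squeeze_zero' ?_ ?_ h
  all_goals
    filter_upwards [Ioo_mem_nhdsLT (zero_lt_one' ℝ)] with r hr
    have hr3 : r ^ 3 ≤ 1 := pow_le_one₀ hr.1.le hr.2.le
  · have := sub_nonneg.2 hr3
    positivity
  · rw [mul_pow, Real.sq_sqrt (sub_nonneg.2 hr.2.le)]
    have : 1 - r ^ 3 ≤ 3 * (1 - r) := by
      nlinarith [mul_nonneg (sub_nonneg.2 hr.2.le) (mul_nonneg (sub_nonneg.2 hr.2.le)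
        (by linarith [hr.1] : (0:ℝ) ≤ r + 2))]
    nlinarith [sq_nonneg (poleMean r)]

/-- A family dominated by `pairSum` is too small to contribute to the limit. -/
lemma tendsto_torusMean_of_le_pairSum {F : ℝ → ℂ → ℂ → ℂ → ℂ} (hβ : ‖β‖ = 1) (hγ : ‖γ‖ = 1)
    (hδ : ‖δ‖ = 1) {C : ℝ} (h : ∀ᶠ r : ℝ in 𝓝[<] 1, ∀ x y w : ℂ, ‖x‖ = 1 → ‖y‖ = 1 → ‖w‖ = 1 →
      x * y * w = 1 → ‖F r x y w‖ ≤ C * pairSum β γ δ r x y w) :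
    Tendsto (fun r : ℝ => (1 - (r : ℂ) ^ 3) * torusMean (F r)) (𝓝[<] 1) (𝓝 0) := by
  have hl := tendsto_one_sub_cube_mul_poleMean_sq.const_mul C
  rw [mul_zero] at hl
  refine squeeze_zero_norm' ?_ hl
  filter_upwards [h, Ioo_mem_nhdsLT (zero_lt_one' ℝ)] with r h hr
  obtain ⟨hc, hm⟩ := torusMean_pairSum hβ hγ hδ hr.1.le hr.2
  have hr3 : r ^ 3 ≤ 1 := pow_le_one₀ hr.1.le hr.2.le
  have e : ‖1 - (r : ℂ) ^ 3‖ = 1 - r ^ 3 := by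
    rw [← Complex.ofReal_pow, ← Complex.ofReal_one, ← Complex.ofReal_sub, Complex.norm_real,
      Real.norm_of_nonneg (sub_nonneg.2 hr3)]
  have hle := norm_torusMean_le (F := F r) (G := fun x y w => C * pairSum β γ δ r x y w)
    (continuous_const.mul hc) fun t => h _ _ _ (norm_circleMap _) (norm_circleMap _)
      (by rw [norm_inv, norm_mul, norm_circleMap, norm_circleMap]; norm_num)
      (mul_inv_cancel₀ (mul_ne_zero (circleMap_ne_zero _) (circleMap_ne_zero _)))
  have e2 : torusMean (fun x y w => C * pairSum β γ δ r x y w) = C * torusMean (pairSum β γ δ r) :=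
    integral_const_mul C (onTorus (pairSum β γ δ r))
  rw [e2, hm] at hle
  rw [norm_mul, e]
  calc _ ≤ (1 - r ^ 3) * (C * (3 * poleMean r ^ 2)) := by
        gcongr
    _ = _ := by ring

lemma inv_mul_inv_mul_inv_mul_add {a b c : ℝ} (ha : 0 < a) (hb : 0 < b) (hc : 0 < c) :
    a⁻¹ * b⁻¹ * c⁻¹ * (a + b + c) = a⁻¹ * b⁻¹ + a⁻¹ * c⁻¹ + b⁻¹ * c⁻¹ := by
  field_simp
  ring

/-- On `x y w = 1` the three factors cannot all be small unless `β γ δ = 1`. -/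
lemma norm_one_sub_le (hβ : ‖β‖ = 1) (hγ : ‖γ‖ = 1) (hr : 0 ≤ r) (hr1 : r ≤ 1)
    {x y w : ℂ} (hx : ‖x‖ = 1) (hy : ‖y‖ = 1) (hxyw : x * y * w = 1) :
    ‖1 - (r : ℂ) ^ 3 * (β * γ * δ)‖ ≤
      ‖1 - r * (β * x)‖ + ‖1 - r * (γ * y)‖ + ‖1 - r * (δ * w)‖ := by
  have e : 1 - (r : ℂ) ^ 3 * (β * γ * δ) = (1 - r * (β * x)) + r * (β * x) * (1 - r * (γ * y)) +
      (r * (β * x)) * (r * (γ * y)) * (1 - r * (δ * w)) := by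
    linear_combination (r : ℂ) ^ 3 * (β * γ * δ) * hxyw
  have n : ∀ {b z : ℂ}, ‖b‖ = 1 → ‖z‖ = 1 → ‖(r : ℂ) * (b * z)‖ ≤ 1 := fun hb hz => by
    rw [norm_mul, norm_mul, hb, hz, Complex.norm_real, Real.norm_of_nonneg hr]; linarith
  have n1 := n hβ hx
  have n2 := n hγ hy
  rw [e]
  refine norm_add₃_le.trans ?_
  rw [norm_mul _ (1 - r * (γ * y)), norm_mul _ (1 - r * (δ * w)), norm_mul ((r : ℂ) * (β * x))]
  have h1 : ‖(r : ℂ) * (β * x)‖ * ‖1 - r * (γ * y)‖ ≤ 1 * ‖1 - r * (γ * y)‖ := by gcongr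
  have h2 : ‖(r : ℂ) * (β * x)‖ * ‖(r : ℂ) * (γ * y)‖ * ‖1 - r * (δ * w)‖ ≤
      1 * 1 * ‖1 - r * (δ * w)‖ := by gcongr
  linarith

/-- A triple of poles that do not meet on the torus does not contribute to the limit. -/
lemma tendsto_torusMean_of_ne {F : ℝ → ℂ → ℂ → ℂ → ℂ} (hβ : ‖β‖ = 1) (hγ : ‖γ‖ = 1)
    (hδ : ‖δ‖ = 1) (hne : β * γ * δ ≠ 1) {C : ℝ}
    (h : ∀ᶠ r : ℝ in 𝓝[<] 1, ∀ x y w : ℂ, ‖x‖ = 1 → ‖y‖ = 1 → ‖w‖ = 1 → x * y * w = 1 →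
      ‖F r x y w‖ ≤ C * (‖1 - r * (β * x)‖⁻¹ * ‖1 - r * (γ * y)‖⁻¹ * ‖1 - r * (δ * w)‖⁻¹)) :
    Tendsto (fun r : ℝ => (1 - (r : ℂ) ^ 3) * torusMean (F r)) (𝓝[<] 1) (𝓝 0) := by
  have hpos : 0 < ‖1 - β * γ * δ‖ := norm_pos_iff.2 (sub_ne_zero.2 hne.symm)
  have hev : ∀ᶠ r : ℝ in 𝓝[<] 1, ‖1 - β * γ * δ‖ / 2 < ‖1 - (r : ℂ) ^ 3 * (β * γ * δ)‖ := by
    have : ContinuousAt (fun r : ℝ => ‖1 - (r : ℂ) ^ 3 * (β * γ * δ)‖) 1 := by fun_prop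
    refine (this.tendsto.eventually (lt_mem_nhds ?_)).filter_mono nhdsWithin_le_nhds
    rw [Complex.ofReal_one, one_pow, one_mul]
    linarith
  refine tendsto_torusMean_of_le_pairSum (C := |C| * (2 / ‖1 - β * γ * δ‖)) hβ hγ hδ ?_
  filter_upwards [h, hev, Ioo_mem_nhdsLT (zero_lt_one' ℝ)] with r h hev hr x y w hx hy hw hxyw
  have d1 := norm_pole_pos hβ hr.1.le hr.2 hx
  have d2 := norm_pole_pos hγ hr.1.le hr.2 hy
  have d3 := norm_pole_pos hδ hr.1.le hr.2 hw
  have hle := norm_one_sub_le (δ := δ) hβ hγ hr.1.le hr.2.le hx hy hxyw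
  refine (h x y w hx hy hw hxyw).trans ?_
  rw [pairSum, ← inv_mul_inv_mul_inv_mul_add d1 d2 d3, mul_assoc |C|]
  generalize ‖1 - r * (β * x)‖ = a at *
  generalize ‖1 - r * (γ * y)‖ = b at *
  generalize ‖1 - r * (δ * w)‖ = c at *
  have h1 : 1 ≤ 2 / ‖1 - β * γ * δ‖ * (a + b + c) := by
    rw [div_mul_eq_mul_div, le_div_iff₀ hpos]; linarith
  calc C * (a⁻¹ * b⁻¹ * c⁻¹) ≤ |C| * (a⁻¹ * b⁻¹ * c⁻¹) * 1 := by
        rw [mul_one]; gcongr; exact le_abs_self C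
    _ ≤ |C| * (a⁻¹ * b⁻¹ * c⁻¹) * (2 / ‖1 - β * γ * δ‖ * (a + b + c)) := by gcongr
    _ = _ := by ring

end bounds

/-- The product of the segment `[ρ, 1]` and three unit circles. -/
def polycircle (ρ : ℝ) : Set (ℂ × ℂ × ℂ × ℂ) :=
  (Complex.ofReal '' Set.Icc ρ 1) ×ˢ Metric.sphere 0 1 ×ˢ Metric.sphere 0 1 ×ˢ Metric.sphere 0 1

lemma isCompact_polycircle (ρ : ℝ) : IsCompact (polycircle ρ) :=
  (isCompact_Icc.image Complex.continuous_ofReal).prod ((isCompact_sphere 0 1).prod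
    ((isCompact_sphere 0 1).prod (isCompact_sphere 0 1)))

lemma mem_polycircle {ρ r : ℝ} {x y w : ℂ} (h0 : ρ ≤ r) (h1 : r ≤ 1) (hx : ‖x‖ = 1) (hy : ‖y‖ = 1)
    (hw : ‖w‖ = 1) : ((r : ℂ), x, y, w) ∈ polycircle ρ :=
  ⟨⟨r, ⟨h0, h1⟩, rfl⟩, by simpa using hx, by simpa using hy, by simpa using hw⟩

lemma continuous_onTorus_of_polycircle {ρ r : ℝ} (h0 : ρ ≤ r) (h1 : r ≤ 1)
    {f : ℂ × ℂ × ℂ × ℂ → ℂ} (hf : ∀ v ∈ polycircle ρ, DifferentiableAt ℂ f v) :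
    Continuous (onTorus fun x y w => f (r, x, y, w)) :=
  continuous_onTorus_of_differentiableAt fun z hz1 hz2 w hw hw1 =>
    DifferentiableAt.comp (g := f) (f := fun z : ℂ × ℂ => ((r : ℂ), z.1, z.2, w z)) z
      (hf _ (mem_polycircle h0 h1 hz1 hz2 hw1))
      ((differentiableAt_const _).prodMk (differentiableAt_fst.prodMk
        (differentiableAt_snd.prodMk hw)))

/-- Three poles that meet at a point of the torus contribute the value of the remaining factor
there. -/
theorem tendsto_torusMean_of_eq {β γ δ : ℂ} (hβ : ‖β‖ = 1) (hγ : ‖γ‖ = 1) (hδ : ‖δ‖ = 1)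
    (hprod : β * γ * δ = 1) {ρ : ℝ} (hρ : ρ < 1) {f : ℂ × ℂ × ℂ × ℂ → ℂ}
    (hf : ∀ v ∈ polycircle ρ, DifferentiableAt ℂ f v) :
    Tendsto (fun r : ℝ => (1 - (r : ℂ) ^ 3) * torusMean fun x y w => f (r, x, y, w) *
      ((1 - r * (β * x))⁻¹ * (1 - r * (γ * y))⁻¹ * (1 - r * (δ * w))⁻¹)) (𝓝[<] 1)
      (𝓝 (f (1, β⁻¹, γ⁻¹, δ⁻¹))) := by
  have hv₀ : ((1 : ℂ), β⁻¹, γ⁻¹, δ⁻¹) ∈ polycircle ρ := by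
    have := mem_polycircle (x := β⁻¹) (y := γ⁻¹) (w := δ⁻¹) hρ.le le_rfl
      (by rw [norm_inv, hβ, inv_one]) (by rw [norm_inv, hγ, inv_one]) (by rw [norm_inv, hδ, inv_one])
    rwa [Complex.ofReal_one] at this
  obtain ⟨C, hC0, hC⟩ := exists_norm_sub_le_mul (isCompact_polycircle ρ) hf hv₀
  have hr : ∀ᶠ r : ℝ in 𝓝[<] 1, (0 < r ∧ r < 1) ∧ ρ ≤ r := by
    filter_upwards [Ioo_mem_nhdsLT (zero_lt_one' ℝ), Ioo_mem_nhdsLT hρ] with r h1 h2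
    exact ⟨h1, h2.1.le⟩
  have hsmall := tendsto_torusMean_of_le_pairSum (F := fun r x y w =>
      (f (r, x, y, w) - f (1, β⁻¹, γ⁻¹, δ⁻¹)) *
      ((1 - r * (β * x))⁻¹ * (1 - r * (γ * y))⁻¹ * (1 - r * (δ * w))⁻¹)) (C := C * 2) hβ hγ hδ ?_
  · have := hsmall.add_const (f (1, β⁻¹, γ⁻¹, δ⁻¹))
    rw [zero_add] at this
    refine this.congr' ?_
    filter_upwards [hr] with r ⟨⟨h0, h1⟩, h2⟩
    have hlt : ∀ {b : ℂ}, ‖b‖ = 1 → ‖(r : ℂ) * b‖ < 1 := fun hb => by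
      rwa [norm_mul, hb, mul_one, Complex.norm_real, Real.norm_of_nonneg h0.le]
    obtain ⟨hg, hm⟩ := torusMean_geometric (hlt hβ) (hlt hγ) (hlt hδ)
    simp only [mul_assoc] at hg hm
    have hfc := continuous_onTorus_of_polycircle h2 h1.le hf
    have hadd := torusMean_add (F := fun x y w => (f (r, x, y, w) - f (1, β⁻¹, γ⁻¹, δ⁻¹)) *
        ((1 - r * (β * x))⁻¹ * ((1 - r * (γ * y))⁻¹ * (1 - r * (δ * w))⁻¹)))
      (G := fun x y w => f (1, β⁻¹, γ⁻¹, δ⁻¹) *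
        ((1 - r * (β * x))⁻¹ * ((1 - r * (γ * y))⁻¹ * (1 - r * (δ * w))⁻¹)))
      ((hfc.sub continuous_const).mul hg) (continuous_const.mul hg)
    rw [torusMean_const_mul, hm] at hadd
    have e : (r : ℂ) * (β * (r * (γ * (r * δ)))) = (r : ℂ) ^ 3 := by
      linear_combination (r : ℂ) ^ 3 * hprod
    have hne : 1 - (r : ℂ) ^ 3 ≠ 0 := one_sub_ne_zero (by
      rw [norm_pow, Complex.norm_real, Real.norm_of_nonneg h0.le]
      exact pow_lt_one₀ h0.le h1 three_ne_zero)
    simp only [← add_mul, sub_add_cancel] at hadd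
    simp only [mul_assoc]
    rw [hadd, e, mul_add, ← mul_assoc, mul_comm _ (f _), mul_assoc (f _), mul_inv_cancel₀ hne,
      mul_one]
  · filter_upwards [hr] with r ⟨⟨h0, h1⟩, h2⟩ x y w hx hy hw hxyw
    have d1 := norm_pole_pos hβ h0.le h1 hx
    have d2 := norm_pole_pos hγ h0.le h1 hy
    have d3 := norm_pole_pos hδ h0.le h1 hw
    have hd : ∀ {b z : ℂ}, ‖b‖ = 1 → ‖z‖ = 1 → ‖z - b⁻¹‖ ≤ 2 * ‖1 - r * (b * z)‖ := by
      intro b z hb hz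
      have hb0 : b ≠ 0 := norm_ne_zero_iff.1 (by rw [hb]; norm_num)
      have := norm_sub_one_le h0.le h1.le (z := b * z) (by rw [norm_mul, hb, hz, one_mul])
      rwa [show b * z - 1 = b * (z - b⁻¹) by field_simp, norm_mul, hb, one_mul] at this
    have k1 := hd hβ hx
    have k2 := hd hγ hy
    have k3 := hd hδ hw
    have k0 : ‖(r : ℂ) - 1‖ ≤ ‖1 - r * (β * x)‖ := by
      rw [← Complex.ofReal_one, ← Complex.ofReal_sub, Complex.norm_real, norm_sub_rev,
        Real.norm_of_nonneg (by linarith), Complex.ofReal_one]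
      exact one_sub_le_norm h0.le (by rw [norm_mul, hβ, hx, one_mul])
    have hdist : ‖((r : ℂ), x, y, w) - (1, β⁻¹, γ⁻¹, δ⁻¹)‖ ≤
        2 * (‖1 - r * (β * x)‖ + ‖1 - r * (γ * y)‖ + ‖1 - r * (δ * w)‖) := by
      simp only [Prod.mk_sub_mk, Prod.norm_mk]
      refine max_le ?_ (max_le ?_ (max_le ?_ ?_)) <;> linarith
    rw [norm_mul, norm_mul, norm_mul, norm_inv, norm_inv, norm_inv, pairSum,
      ← inv_mul_inv_mul_inv_mul_add d1 d2 d3]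
    calc _ ≤ C * (2 * (‖1 - r * (β * x)‖ + ‖1 - r * (γ * y)‖ + ‖1 - r * (δ * w)‖)) *
          (‖1 - r * (β * x)‖⁻¹ * ‖1 - r * (γ * y)‖⁻¹ * ‖1 - r * (δ * w)‖⁻¹) := by
          gcongr
          exact (hC _ (mem_polycircle h2 h1.le hx hy hw)).trans (by gcongr)
      _ = _ := by ring

end EllipticG2

namespace EllipticG2

open MeasureTheory

/-! ### Separating the poles -/

/-- The point `(β_{(k, b)})⁻¹` is the limit as `r → 1` of the pole of `1 / poleDen α (r, z) (k, b)`;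
here `β_{(k, true)} = α k` and `β_{(k, false)} = (α k)⁻¹`. -/
noncomputable def poleCoeff (α : Fin 3 → ℂ) (i : Fin 3 × Bool) : ℂ :=
  if i.2 then α i.1 else (α i.1)⁻¹

/-- The monomial `α k z` or `α k z⁻¹`. -/
noncomputable def poleMonomial (α : Fin 3 → ℂ) (z : ℂ) (i : Fin 3 × Bool) : ℂ :=
  α i.1 * if i.2 then z else z⁻¹

/-- The factors `1 - r α k z` and `1 - r α k z⁻¹` of the denominator. -/
noncomputable def poleDen (α : Fin 3 → ℂ) (v : ℂ × ℂ) (i : Fin 3 × Bool) : ℂ :=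
  1 - v.1 * poleMonomial α v.2 i

/-- The complex conjugate of `poleDen` for real `r` and `|α k| = |z| = 1`, in a holomorphic form. -/
noncomputable def poleDenConj (α : Fin 3 → ℂ) (v : ℂ × ℂ) (i : Fin 3 × Bool) : ℂ :=
  1 - v.1 * (poleMonomial α v.2 i)⁻¹

/-- The weights that split the product of the six `1 / poleDen` into a sum of the six. -/
noncomputable def poleWeight (α : Fin 3 → ℂ) (v : ℂ × ℂ) (i : Fin 3 × Bool) : ℂ :=
  (∏ j ∈ Finset.univ.erase i, poleDenConj α v j) /
    ∑ l, ∏ j ∈ Finset.univ.erase l, (poleDen α v j * poleDenConj α v j)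

section poles

variable {α : Fin 3 → ℂ} {r : ℝ} {z : ℂ}

lemma norm_poleMonomial (hα : ∀ k, ‖α k‖ = 1) (hz : ‖z‖ = 1) (i : Fin 3 × Bool) :
    ‖poleMonomial α z i‖ = 1 := by
  obtain ⟨k, b⟩ := i
  cases b <;> simp [poleMonomial, hα, hz]

lemma norm_poleCoeff (hα : ∀ k, ‖α k‖ = 1) (i : Fin 3 × Bool) : ‖poleCoeff α i‖ = 1 := by
  obtain ⟨k, b⟩ := i
  cases b <;> simp [poleCoeff, hα]

lemma poleMonomial_eq_one_iff (hα : ∀ k, ‖α k‖ = 1) (hz : ‖z‖ = 1) (i : Fin 3 × Bool) :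
    poleMonomial α z i = 1 ↔ z = (poleCoeff α i)⁻¹ := by
  have n0 : ∀ z : ℂ, ‖z‖ = 1 → z ≠ 0 := fun z hz => norm_ne_zero_iff.1 (by rw [hz]; norm_num)
  have hz0 := n0 _ hz
  have h0 := n0 _ (hα i.1)
  obtain ⟨k, b⟩ := i
  cases b
  · simp only [poleMonomial, poleCoeff, Bool.false_eq_true, if_false, inv_inv, ← div_eq_mul_inv]
    rw [div_eq_one_iff_eq hz0, eq_comm]
  · simp only [poleMonomial, poleCoeff, if_true]
    rw [mul_comm, mul_eq_one_iff_eq_inv₀ h0]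

lemma poleDenConj_eq (hα : ∀ k, ‖α k‖ = 1) (hz : ‖z‖ = 1) (i : Fin 3 × Bool) :
    poleDenConj α (r, z) i = (starRingEnd ℂ) (poleDen α (r, z) i) := by
  simp only [poleDenConj, poleDen, map_sub, map_one, map_mul, Complex.conj_ofReal]
  rw [Complex.inv_eq_conj (norm_poleMonomial hα hz i)]

lemma norm_poleDen (hα : ∀ k, ‖α k‖ = 1) (hz : ‖z‖ = 1) (i : Fin 3 × Bool) :
    ‖poleDen α (r, z) i‖ = ‖1 - r * (poleCoeff α i * z)‖ := by
  obtain ⟨k, b⟩ := i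
  cases b
  · rw [← Complex.norm_conj, ← poleDenConj_eq hα hz]
    simp [poleDenConj, poleMonomial, poleCoeff, mul_comm]
  · simp [poleDen, poleMonomial, poleCoeff]

lemma poleDen_ne_zero (hα : ∀ k, ‖α k‖ = 1) (hr : 0 ≤ r) (hz : ‖z‖ = 1) {i : Fin 3 × Bool}
    (h : r < 1 ∨ z ≠ (poleCoeff α i)⁻¹) (hr1 : r ≤ 1) : poleDen α (r, z) i ≠ 0 := by
  intro h0
  rcases hr1.lt_or_eq with hlt | rfl
  · refine one_sub_ne_zero (u := (r : ℂ) * poleMonomial α z i) ?_ h0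
    rwa [norm_mul, norm_poleMonomial hα hz, mul_one, Complex.norm_real, Real.norm_of_nonneg hr]
  · rcases h with h | h
    · exact lt_irrefl _ h
    · rw [poleDen, Complex.ofReal_one, one_mul, sub_eq_zero] at h0
      exact h ((poleMonomial_eq_one_iff hα hz i).1 h0.symm)

/-- The normalizing sum of the weights has nonnegative terms on the circle, and does not vanish
because no two poles coincide. -/
lemma sum_poleDen_ne_zero (hα : ∀ k, ‖α k‖ = 1) (hinj : Function.Injective (poleCoeff α))
    (hr : 0 ≤ r) (hr1 : r ≤ 1) (hz : ‖z‖ = 1) :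
    ∑ l, ∏ j ∈ Finset.univ.erase l, (poleDen α (r, z) j * poleDenConj α (r, z) j) ≠ 0 := by
  have e : ∀ j, poleDen α (r, z) j * poleDenConj α (r, z) j =
      ((‖poleDen α (r, z) j‖ ^ 2 : ℝ) : ℂ) := fun j => by
    rw [poleDenConj_eq hα hz, Complex.mul_conj, Complex.normSq_eq_norm_sq]
  simp_rw [e, ← Complex.ofReal_prod, ← Complex.ofReal_sum]
  rw [Complex.ofReal_ne_zero]
  refine (Finset.sum_pos' (fun l _ => Finset.prod_nonneg fun j _ => by positivity) ?_).ne'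
  -- at most one of the factors vanishes, and leaving it out gives a positive term
  obtain ⟨l, hl⟩ : ∃ l, ∀ j ≠ l, poleDen α (r, z) j ≠ 0 := by
    by_cases h : ∃ l, z = (poleCoeff α l)⁻¹
    · obtain ⟨l, hl⟩ := h
      exact ⟨l, fun j hj => poleDen_ne_zero hα hr hz (Or.inr fun h => hj (hinj (inv_injective
        (h.symm.trans hl)))) hr1⟩
    · push Not at h
      exact ⟨0, fun j _ => poleDen_ne_zero hα hr hz (Or.inr (h j)) hr1⟩
  refine ⟨l, Finset.mem_univ _, Finset.prod_pos fun j hj => ?_⟩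
  have := norm_pos_iff.2 (hl j (Finset.ne_of_mem_erase hj))
  positivity

/-- The weights split the product of the six poles in one variable into a sum of single poles, with
coefficients that stay regular as `r → 1`. -/
lemma sum_poleWeight (hα : ∀ k, ‖α k‖ = 1) (hinj : Function.Injective (poleCoeff α))
    (hr : 0 ≤ r) (hr1 : r < 1) (hz : ‖z‖ = 1) :
    ∑ i, poleWeight α (r, z) i * (poleDen α (r, z) i)⁻¹ = ∏ i, (poleDen α (r, z) i)⁻¹ := by
  have hD := sum_poleDen_ne_zero hα hinj hr hr1.le hz
  have hne : ∀ i, poleDen α (r, z) i ≠ 0 := fun i => poleDen_ne_zero hα hr hz (Or.inl hr1) hr1.le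
  simp only [poleWeight, div_mul_eq_mul_div, ← Finset.sum_div]
  rw [div_eq_iff hD, Finset.mul_sum]
  refine Finset.sum_congr rfl fun i _ => ?_
  rw [Finset.prod_mul_distrib, ← Finset.mul_prod_erase _ _ (Finset.mem_univ i)]
  have : (∏ j ∈ Finset.univ.erase i, (poleDen α (r, z) j)⁻¹) *
      ∏ j ∈ Finset.univ.erase i, poleDen α (r, z) j = 1 := by
    rw [← Finset.prod_mul_distrib]
    exact Finset.prod_eq_one fun j _ => inv_mul_cancel₀ (hne j)
  linear_combination (-(poleDen α (r, z) i)⁻¹ * ∏ j ∈ Finset.univ.erase i, poleDenConj α (r, z) j) *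
    this

lemma poleWeight_at_pole (hα : ∀ k, ‖α k‖ = 1) (hinj : Function.Injective (poleCoeff α))
    (i : Fin 3 × Bool) : poleWeight α (1, (poleCoeff α i)⁻¹) i =
      ∏ j ∈ Finset.univ.erase i, (poleDen α (1, (poleCoeff α i)⁻¹) j)⁻¹ := by
  have hz : ‖(poleCoeff α i)⁻¹‖ = 1 := by rw [norm_inv, norm_poleCoeff hα, inv_one]
  have h0 : poleDen α (1, (poleCoeff α i)⁻¹) i = 0 := by
    rw [poleDen, (poleMonomial_eq_one_iff hα hz i).2 rfl]
    simp
  have hD := sum_poleDen_ne_zero (r := 1) hα hinj zero_le_one le_rfl hz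
  rw [Complex.ofReal_one] at hD
  rw [poleWeight]
  rw [Finset.sum_eq_single i (fun l _ hl => Finset.prod_eq_zero
    (Finset.mem_erase.2 ⟨hl.symm, Finset.mem_univ i⟩) (by rw [h0, zero_mul])) (by simp)] at hD ⊢
  rw [Finset.prod_mul_distrib] at hD ⊢
  rw [div_eq_iff hD, Finset.prod_inv_distrib, inv_mul_cancel_left₀ (left_ne_zero_of_mul hD)]

lemma differentiableAt_poleMonomial (hz : z ≠ 0) (i : Fin 3 × Bool) :
    DifferentiableAt ℂ (fun z => poleMonomial α z i) z := by
  obtain ⟨k, b⟩ := i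
  cases b
  · simp only [poleMonomial, Bool.false_eq_true, if_false]
    exact (differentiableAt_const _).mul (differentiableAt_inv hz)
  · simp only [poleMonomial, if_true]
    fun_prop

lemma differentiableAt_poleWeight (hα : ∀ k, ‖α k‖ = 1) (hinj : Function.Injective (poleCoeff α))
    (hr : 0 ≤ r) (hr1 : r ≤ 1) (hz : ‖z‖ = 1) (i : Fin 3 × Bool) :
    DifferentiableAt ℂ (fun v => poleWeight α v i) ((r : ℂ), z) := by
  have hz0 : z ≠ 0 := norm_ne_zero_iff.1 (by rw [hz]; norm_num)
  have hm : ∀ j, DifferentiableAt ℂ (fun v : ℂ × ℂ => poleMonomial α v.2 j) ((r : ℂ), z) :=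
    fun j => DifferentiableAt.comp (g := fun z => poleMonomial α z j) (f := Prod.snd) _
      (differentiableAt_poleMonomial hz0 j) differentiableAt_snd
  have h1 : ∀ j, DifferentiableAt ℂ (fun v => poleDen α v j) ((r : ℂ), z) := fun j =>
    (differentiableAt_const _).sub (differentiableAt_fst.mul (hm j))
  have h2 : ∀ j, DifferentiableAt ℂ (fun v => poleDenConj α v j) ((r : ℂ), z) := fun j =>
    (differentiableAt_const _).sub (differentiableAt_fst.mul ((hm j).fun_inv (by
      rw [← norm_ne_zero_iff, norm_poleMonomial hα hz]; norm_num)))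
  have hD : DifferentiableAt ℂ (fun v => ∑ l, ∏ j ∈ Finset.univ.erase l,
      (poleDen α v j * poleDenConj α v j)) ((r : ℂ), z) :=
    DifferentiableAt.fun_sum fun l _ => differentiableAt_prod _ fun j _ => (h1 j).mul (h2 j)
  simp only [poleWeight, div_eq_mul_inv]
  exact (differentiableAt_prod _ fun j _ => h2 j).mul
    (hD.fun_inv (sum_poleDen_ne_zero hα hinj hr hr1 hz))

end poles

end EllipticG2

namespace EllipticG2

/-! ### Summing over the poles -/

open MeasureTheory

/-- Triples of poles of the three variables that meet on the torus `x y w = 1`. -/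
def IsResonant (i j l : Fin 3 × Bool) : Prop :=
  (i.2 = j.2 ∧ j.2 = l.2) ∧ i.1 ≠ j.1 ∧ i.1 ≠ l.1 ∧ j.1 ≠ l.1

instance (i j l : Fin 3 × Bool) : Decidable (IsResonant i j l) := by
  unfold IsResonant; infer_instance

/-- The resonant triples are as many as the elements of the Weyl group of `G₂`. -/
lemma card_isResonant : (Finset.univ.filter fun t : (Fin 3 × Bool) × (Fin 3 × Bool) × (Fin 3 × Bool) =>
    IsResonant t.1 t.2.1 t.2.2).card = 12 := by decide +kernel

lemma prod_of_distinct {M : Type*} [CommMonoid M] (f : Fin 3 → M) {i j l : Fin 3} (h1 : i ≠ j)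
    (h2 : i ≠ l) (h3 : j ≠ l) : f i * f j * f l = f 0 * f 1 * f 2 := by
  have e : ({i, j, l} : Finset (Fin 3)) = Finset.univ := by
    rw [← Finset.card_eq_iff_eq_univ, Finset.card_insert_of_notMem (by simp [h1, h2]),
      Finset.card_insert_of_notMem (by simpa using h3), Finset.card_singleton]
    rfl
  rw [← Fin.prod_univ_three, ← e, Finset.prod_insert (by simp [h1, h2]),
    Finset.prod_insert (by simpa using h3), Finset.prod_singleton, mul_assoc]

section

variable {α : Fin 3 → ℂ} {ρ : ℝ} {f : ℂ × ℂ × ℂ × ℂ → ℂ}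

/-- The summand that has one pole in each variable. -/
noncomputable def polarTerm (α : Fin 3 → ℂ) (f : ℂ × ℂ × ℂ × ℂ → ℂ) (i j l : Fin 3 × Bool) (r : ℝ)
    (x y w : ℂ) : ℂ :=
  f (r, x, y, w) * ((poleDen α (r, x) i)⁻¹ * (poleDen α (r, y) j)⁻¹ * (poleDen α (r, w) l)⁻¹)

lemma continuous_polarTerm (hα : ∀ k, ‖α k‖ = 1) (hf : ∀ v ∈ polycircle ρ, DifferentiableAt ℂ f v)
    {r : ℝ} (h0 : 0 ≤ r) (h1 : r < 1) (h2 : ρ ≤ r) (i j l : Fin 3 × Bool) :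
    Continuous (onTorus (polarTerm α f i j l r)) := by
  have hd : ∀ (i : Fin 3 × Bool) {V : Type} [NormedAddCommGroup V] [NormedSpace ℂ V] {z : V → ℂ}
      {v : V}, DifferentiableAt ℂ z v → ‖z v‖ = 1 →
      DifferentiableAt ℂ (fun v => (poleDen α (r, z v) i)⁻¹) v := by
    intro i V _ _ z v hz hz1
    refine DifferentiableAt.fun_inv ?_ (poleDen_ne_zero hα h0 hz1 (Or.inl h1) h1.le)
    refine (differentiableAt_const _).sub ((differentiableAt_const _).mul ?_)
    exact DifferentiableAt.comp (g := fun z => poleMonomial α z i) (f := z) _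
      (differentiableAt_poleMonomial (norm_ne_zero_iff.1 (by rw [hz1]; norm_num)) i) hz
  refine (continuous_onTorus_of_polycircle h2 h1.le hf).mul
    (continuous_onTorus_of_differentiableAt (F := fun x y w => (poleDen α (r, x) i)⁻¹ *
      (poleDen α (r, y) j)⁻¹ * (poleDen α (r, w) l)⁻¹) fun z hz1 hz2 w hw hw1 => ?_)
  exact ((hd i differentiableAt_fst hz1).mul (hd j differentiableAt_snd hz2)).mul (hd l hw hw1)

/-- The contribution of one triple of poles. -/
lemma tendsto_polarTerm (hα : ∀ k, ‖α k‖ = 1) (hprod : α 0 * α 1 * α 2 = 1) (hρ : ρ < 1)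
    (hf : ∀ v ∈ polycircle ρ, DifferentiableAt ℂ f v) (i j l : Fin 3 × Bool)
    (hres : poleCoeff α i * poleCoeff α j * poleCoeff α l = 1 → IsResonant i j l) :
    Tendsto (fun r : ℝ => (1 - (r : ℂ) ^ 3) * torusMean (polarTerm α f i j l r)) (𝓝[<] 1)
      (𝓝 (if IsResonant i j l then
        f (1, (poleCoeff α i)⁻¹, (poleCoeff α j)⁻¹, (poleCoeff α l)⁻¹) else 0)) := by
  have hr : ∀ᶠ r : ℝ in 𝓝[<] 1, (0 < r ∧ r < 1) ∧ ρ ≤ r := by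
    filter_upwards [Ioo_mem_nhdsLT (zero_lt_one' ℝ), Ioo_mem_nhdsLT hρ] with r h1 h2
    exact ⟨h1, h2.1.le⟩
  split_ifs with hR
  · obtain ⟨k₁, b⟩ := i
    obtain ⟨k₂, b₂⟩ := j
    obtain ⟨k₃, b₃⟩ := l
    obtain ⟨⟨rfl, rfl⟩, h1, h2, h3⟩ := hR
    have hp : α k₁ * α k₂ * α k₃ = 1 := (prod_of_distinct α h1 h2 h3).trans hprod
    cases b
    · -- inversion of the torus turns these poles into those of the other kind
      have hinv : ∀ v ∈ polycircle ρ, DifferentiableAt ℂ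
          (fun v : ℂ × ℂ × ℂ × ℂ => f (v.1, v.2.1⁻¹, v.2.2.1⁻¹, v.2.2.2⁻¹)) v := by
        rintro ⟨s, x, y, w⟩ ⟨⟨t, ht, hts⟩, hx, hy, hw⟩
        simp only [mem_sphere_zero_iff_norm] at hx hy hw hts
        subst hts
        have n0 : ∀ z : ℂ, ‖z‖ = 1 → z ≠ 0 := fun z hz => norm_ne_zero_iff.1 (by rw [hz]; norm_num)
        have n1 : ∀ z : ℂ, ‖z‖ = 1 → ‖z⁻¹‖ = 1 := fun z hz => by rw [norm_inv, hz, inv_one]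
        refine DifferentiableAt.comp (g := f)
          (f := fun v : ℂ × ℂ × ℂ × ℂ => (v.1, v.2.1⁻¹, v.2.2.1⁻¹, v.2.2.2⁻¹)) _
          (hf _ (mem_polycircle ht.1 ht.2 (n1 _ hx) (n1 _ hy) (n1 _ hw))) ?_
        refine differentiableAt_fst.prodMk (DifferentiableAt.prodMk ?_ (DifferentiableAt.prodMk ?_ ?_))
        · exact DifferentiableAt.fun_inv (by fun_prop) (n0 _ hx)
        · exact DifferentiableAt.fun_inv (by fun_prop) (n0 _ hy)
        · exact DifferentiableAt.fun_inv (by fun_prop) (n0 _ hw)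
      have h := tendsto_torusMean_of_eq (hα k₁) (hα k₂) (hα k₃) hp hρ hinv
      refine h.congr' ?_
      filter_upwards [hr] with r hr
      have hc := continuous_polarTerm hα hf hr.1.1.le hr.1.2 hr.2 (k₁, false) (k₂, false) (k₃, false)
      rw [← torusMean_inv hc]
      simp only [polarTerm, poleDen, poleMonomial, Bool.false_eq_true, if_false, inv_inv]
    · exact tendsto_torusMean_of_eq (hα k₁) (hα k₂) (hα k₃) hp hρ hf
  · obtain ⟨C, hC⟩ := (isCompact_polycircle ρ).exists_bound_of_continuousOn
      fun v hv => (hf v hv).continuousAt.continuousWithinAt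
    refine tendsto_torusMean_of_ne (norm_poleCoeff hα i) (norm_poleCoeff hα j) (norm_poleCoeff hα l)
      (fun h => hR (hres h)) (C := C) ?_
    filter_upwards [hr] with r ⟨⟨h0, h1⟩, h2⟩ x y w hx hy hw _
    rw [polarTerm, norm_mul, norm_mul, norm_mul, norm_inv, norm_inv, norm_inv, norm_poleDen hα hx,
      norm_poleDen hα hy, norm_poleDen hα hw]
    gcongr
    exact hC _ (mem_polycircle h2 h1.le hx hy hw)

end

/-- The value of the product of the five regular factors `1 / poleDen` at a pole. -/
noncomputable def poleResidue (α : Fin 3 → ℂ) (k : Fin 3) : ℂ :=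
  ∏ j ∈ Finset.univ.erase (k, true), (poleDen α (1, (α k)⁻¹) j)⁻¹

lemma poleWeight_at_pole_eq {α : Fin 3 → ℂ} (hα : ∀ k, ‖α k‖ = 1)
    (hinj : Function.Injective (poleCoeff α)) (i : Fin 3 × Bool) :
    poleWeight α (1, (poleCoeff α i)⁻¹) i = poleResidue α i.1 := by
  rw [poleWeight_at_pole hα hinj, poleResidue]
  obtain ⟨k, b⟩ := i
  cases b
  · refine Finset.prod_nbij' (fun j => (j.1, !j.2)) (fun j => (j.1, !j.2)) ?_ ?_ ?_ ?_ ?_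
    · simp [Prod.ext_iff]
    · simp [Prod.ext_iff]
    · simp
    · simp
    · rintro ⟨m, b⟩ _
      cases b <;> simp [poleDen, poleMonomial, poleCoeff]
  · rfl

lemma sum_mul_sum_mul_sum {ι : Type*} [Fintype ι] (a b c : ι → ℂ) :
    (∑ i, a i) * (∑ i, b i) * ∑ i, c i = ∑ t : ι × ι × ι, a t.1 * b t.2.1 * c t.2.2 := by
  simp only [Fintype.sum_prod_type, mul_assoc, ← Finset.mul_sum, ← Finset.sum_mul]

/-- The asymptotics of the mean over the torus of a function with six poles in each variable, as the
poles approach the torus. -/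
theorem tendsto_torusMean_poles {α : Fin 3 → ℂ} (hα : ∀ k, ‖α k‖ = 1)
    (hinj : Function.Injective (poleCoeff α)) (hprod : α 0 * α 1 * α 2 = 1)
    (hres : ∀ i j l, poleCoeff α i * poleCoeff α j * poleCoeff α l = 1 → IsResonant i j l)
    {ρ : ℝ} (hρ0 : 0 ≤ ρ) (hρ : ρ < 1) {f : ℂ × ℂ × ℂ × ℂ → ℂ}
    (hf : ∀ v ∈ polycircle ρ, DifferentiableAt ℂ f v) {κ : ℂ}
    (hκ : ∀ i j l, IsResonant i j l →
      f (1, (poleCoeff α i)⁻¹, (poleCoeff α j)⁻¹, (poleCoeff α l)⁻¹) = κ) :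
    Tendsto (fun r : ℝ => (1 - (r : ℂ) ^ 3) * torusMean fun x y w => f (r, x, y, w) *
      ((∏ i, (poleDen α (r, x) i)⁻¹) * (∏ i, (poleDen α (r, y) i)⁻¹) *
        ∏ i, (poleDen α (r, w) i)⁻¹)) (𝓝[<] 1)
      (𝓝 (12 * (κ * (poleResidue α 0 * poleResidue α 1 * poleResidue α 2)))) := by
  let g : (Fin 3 × Bool) × (Fin 3 × Bool) × (Fin 3 × Bool) → ℂ × ℂ × ℂ × ℂ → ℂ := fun t v =>
    f v * (poleWeight α (v.1, v.2.1) t.1 * poleWeight α (v.1, v.2.2.1) t.2.1 *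
      poleWeight α (v.1, v.2.2.2) t.2.2)
  have hg : ∀ t, ∀ v ∈ polycircle ρ, DifferentiableAt ℂ (g t) v := by
    rintro t ⟨s, x, y, w⟩ hv
    have hfv := hf _ hv
    obtain ⟨⟨r, hr, hrs⟩, hx, hy, hw⟩ := hv
    simp only [mem_sphere_zero_iff_norm] at hx hy hw hrs
    subst hrs
    have hd : ∀ (z : ℂ × ℂ × ℂ × ℂ → ℂ) (i : Fin 3 × Bool), DifferentiableAt ℂ z ((r : ℂ), x, y, w) →
        ‖z ((r : ℂ), x, y, w)‖ = 1 → DifferentiableAt ℂ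
        (fun v : ℂ × ℂ × ℂ × ℂ => poleWeight α (v.1, z v) i) ((r : ℂ), x, y, w) :=
      fun z i hz hz1 => DifferentiableAt.comp (g := fun v : ℂ × ℂ => poleWeight α v i)
        (f := fun v : ℂ × ℂ × ℂ × ℂ => (v.1, z v)) _
        (differentiableAt_poleWeight hα hinj (hρ0.trans hr.1) hr.2 hz1 i)
        (differentiableAt_fst.prodMk hz)
    exact hfv.mul (((hd (fun v => v.2.1) t.1 (by fun_prop) hx).mul
      (hd (fun v => v.2.2.1) t.2.1 (by fun_prop) hy)).mul
      (hd (fun v => v.2.2.2) t.2.2 (by fun_prop) hw))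
  have hsum := tendsto_finsetSum Finset.univ fun t (_ : t ∈ Finset.univ) =>
    tendsto_polarTerm hα hprod hρ (hg t) t.1 t.2.1 t.2.2 (hres _ _ _)
  have hlim : (∑ t : (Fin 3 × Bool) × (Fin 3 × Bool) × (Fin 3 × Bool),
      if IsResonant t.1 t.2.1 t.2.2 then
        g t (1, (poleCoeff α t.1)⁻¹, (poleCoeff α t.2.1)⁻¹, (poleCoeff α t.2.2)⁻¹) else 0) =
      12 * (κ * (poleResidue α 0 * poleResidue α 1 * poleResidue α 2)) := by
    rw [← Finset.sum_filter]
    have : ∀ t ∈ Finset.univ.filter fun t : (Fin 3 × Bool) × (Fin 3 × Bool) × (Fin 3 × Bool) =>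
        IsResonant t.1 t.2.1 t.2.2,
        g t (1, (poleCoeff α t.1)⁻¹, (poleCoeff α t.2.1)⁻¹, (poleCoeff α t.2.2)⁻¹) =
        κ * (poleResidue α 0 * poleResidue α 1 * poleResidue α 2) := by
      intro t ht
      have hR := (Finset.mem_filter.1 ht).2
      simp only [g]
      rw [hκ _ _ _ hR, poleWeight_at_pole_eq hα hinj, poleWeight_at_pole_eq hα hinj,
        poleWeight_at_pole_eq hα hinj, prod_of_distinct _ hR.2.1 hR.2.2.1 hR.2.2.2]
    rw [Finset.sum_congr rfl this, Finset.sum_const, card_isResonant, nsmul_eq_mul]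
    norm_num
  rw [hlim] at hsum
  refine hsum.congr' ?_
  filter_upwards [Ioo_mem_nhdsLT (zero_lt_one' ℝ), Ioo_mem_nhdsLT hρ] with r h1 h2
  have hi : ∀ t : (Fin 3 × Bool) × (Fin 3 × Bool) × (Fin 3 × Bool), Integrable
      (onTorus (polarTerm α (g t) t.1 t.2.1 t.2.2 r)) (angleMeasure.prod angleMeasure) := fun t =>
    integrable_of_continuous (continuous_polarTerm hα (hg t) h1.1.le h1.2 h2.1.le _ _ _)
  have e : ∑ t : (Fin 3 × Bool) × (Fin 3 × Bool) × (Fin 3 × Bool),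
      torusMean (polarTerm α (g t) t.1 t.2.1 t.2.2 r) = torusMean fun x y w =>
        ∑ t : (Fin 3 × Bool) × (Fin 3 × Bool) × (Fin 3 × Bool),
          polarTerm α (g t) t.1 t.2.1 t.2.2 r x y w :=
    (integral_finsetSum _ fun t _ => hi t).symm
  rw [← Finset.mul_sum, e]
  congr 1
  refine torusMean_congr fun x y w hx hy hw _ => ?_
  rw [← sum_poleWeight hα hinj h1.1.le h1.2 hx, ← sum_poleWeight hα hinj h1.1.le h1.2 hy,
    ← sum_poleWeight hα hinj h1.1.le h1.2 hw, sum_mul_sum_mul_sum, Finset.mul_sum]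
  refine Finset.sum_congr rfl fun t _ => ?_
  simp only [polarTerm, g]
  ring

end EllipticG2

namespace EllipticG2

open MeasureTheory

/-! ### The degeneration of both sides -/

variable {p q : ℂ} {α : Fin 3 → ℂ} {d : ℂ}

/-- Parameters of which three approach the unit circle as `r → 1`, with product independent
of `r`. -/
noncomputable def poleParam (α : Fin 3 → ℂ) (d r : ℂ) : Fin 5 → ℂ :=
  ![r * α 0, r * α 1, r * α 2, d, d / r ^ 3]

/-- The part of `∏ k, Γ(r α k z) Γ(r α k z⁻¹)` that stays holomorphic as `r → 1`. -/
noncomputable def regProd (p q : ℂ) (α : Fin 3 → ℂ) (v : ℂ × ℂ) : ℂ :=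
  ∏ i, regGamma p q (v.1 * poleMonomial α v.2 i)

/-- The part of the integrand at `poleParam α d r` that stays holomorphic as `r → 1`. -/
noncomputable def regKernel (p q : ℂ) (α : Fin 3 → ℂ) (d : ℂ) (v : ℂ × ℂ × ℂ × ℂ) : ℂ :=
  regProd p q α (v.1, v.2.1) * regProd p q α (v.1, v.2.2.1) * regProd p q α (v.1, v.2.2.2) *
    (shortGamma p q d v.2.1 v.2.2.1 v.2.2.2 * shortGamma p q (d / v.1 ^ 3) v.2.1 v.2.2.1 v.2.2.2) *
    (deltaTheta p v.2.1 v.2.2.1 v.2.2.2 * deltaTheta q v.2.1 v.2.2.1 v.2.2.2)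

lemma prod_ellGamma_poleMonomial (hp : ‖p‖ < 1) (hq : ‖q‖ < 1) (α : Fin 3 → ℂ) (r z : ℂ) :
    ∏ i, ellGamma p q (r * poleMonomial α z i) =
      regProd p q α (r, z) * ∏ i, (poleDen α (r, z) i)⁻¹ := by
  rw [regProd, ← Finset.prod_mul_distrib]
  exact Finset.prod_congr rfl fun i _ => ellGamma_eq_regGamma hp hq _

lemma kernel_poleParam (hp : ‖p‖ < 1) (hq : ‖q‖ < 1) (α : Fin 3 → ℂ) (d r x y w : ℂ) :
    kernel p q (poleParam α d r) x y w = regKernel p q α d (r, x, y, w) *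
      ((∏ i, (poleDen α (r, x) i)⁻¹) * (∏ i, (poleDen α (r, y) i)⁻¹) *
        ∏ i, (poleDen α (r, w) i)⁻¹) := by
  have e : (∏ k, shortGamma p q (poleParam α d r k) x y w) =
      (∏ i, ellGamma p q (r * poleMonomial α x i)) * (∏ i, ellGamma p q (r * poleMonomial α y i)) *
      (∏ i, ellGamma p q (r * poleMonomial α w i)) *
      (shortGamma p q d x y w * shortGamma p q (d / r ^ 3) x y w) := by
    simp only [Fin.prod_univ_five, Fintype.prod_prod_type, Fin.prod_univ_three, Fintype.prod_bool,
      poleParam, Matrix.cons_val, shortGamma, poleMonomial, if_true, Bool.false_eq_true, if_false,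
      mul_assoc r]
    ring
  rw [kernel, e]
  simp only [prod_ellGamma_poleMonomial hp hq, regKernel]
  ring

lemma differentiableAt_regKernel (hp : ‖p‖ < 1) (hq : ‖q‖ < 1) (hα : ∀ k, ‖α k‖ = 1) (hd0 : d ≠ 0)
    (hd1 : ‖d‖ < 1) {ρ : ℝ} (hρ0 : 0 < ρ) (hρ : ‖d‖ < ρ ^ 3) :
    ∀ v ∈ polycircle ρ, DifferentiableAt ℂ (regKernel p q α d) v := by
  rintro ⟨s, x, y, w⟩ ⟨⟨r, hr, hrs⟩, hx, hy, hw⟩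
  simp only [mem_sphere_zero_iff_norm] at hx hy hw hrs
  subst hrs
  have n0 : ∀ z : ℂ, ‖z‖ = 1 → z ≠ 0 := fun z hz => norm_ne_zero_iff.1 (by rw [hz]; norm_num)
  have hr0 : 0 < r := hρ0.trans_le hr.1
  have hrC : (r : ℂ) ≠ 0 := Complex.ofReal_ne_zero.2 hr0.ne'
  have hrn : ‖(r : ℂ)‖ = r := by rw [Complex.norm_real, Real.norm_of_nonneg hr0.le]
  have hreg : ∀ z : ℂ × ℂ × ℂ × ℂ → ℂ, DifferentiableAt ℂ z ((r : ℂ), x, y, w) →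
      ‖z ((r : ℂ), x, y, w)‖ = 1 → DifferentiableAt ℂ
      (fun v : ℂ × ℂ × ℂ × ℂ => regProd p q α (v.1, z v)) ((r : ℂ), x, y, w) := by
    intro z hz hz1
    refine differentiableAt_prod _ fun i _ => ?_
    have hm := norm_poleMonomial hα hz1 i
    have hmd : DifferentiableAt ℂ (fun v => poleMonomial α (z v) i) ((r : ℂ), x, y, w) :=
      DifferentiableAt.comp (g := fun z => poleMonomial α z i) (f := z) _
        (differentiableAt_poleMonomial (n0 _ hz1) i) hz
    exact DifferentiableAt.comp (g := regGamma p q)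
      (f := fun v : ℂ × ℂ × ℂ × ℂ => v.1 * poleMonomial α (z v) i) _
      (differentiableAt_regGamma hp hq (mul_ne_zero hrC (n0 _ hm))
        (by rw [norm_mul, hm, hrn, mul_one]; exact hr.2)) (differentiableAt_fst.mul hmd)
  have dx : DifferentiableAt ℂ (fun v : ℂ × ℂ × ℂ × ℂ => v.2.1) ((r : ℂ), x, y, w) := by fun_prop
  have dy : DifferentiableAt ℂ (fun v : ℂ × ℂ × ℂ × ℂ => v.2.2.1) ((r : ℂ), x, y, w) := by fun_prop
  have dw : DifferentiableAt ℂ (fun v : ℂ × ℂ × ℂ × ℂ => v.2.2.2) ((r : ℂ), x, y, w) := by fun_prop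
  have dd : DifferentiableAt ℂ (fun v : ℂ × ℂ × ℂ × ℂ => d / v.1 ^ 3) ((r : ℂ), x, y, w) := by
    simp only [div_eq_mul_inv]
    exact (differentiableAt_const _).mul ((differentiableAt_fst.fun_pow 3).fun_inv
      (pow_ne_zero 3 hrC))
  have hdr : ‖d / (r : ℂ) ^ 3‖ < 1 := by
    rw [norm_div, norm_pow, hrn, div_lt_one (by positivity)]
    exact hρ.trans_le (by gcongr; exact hr.1)
  have s1 := differentiableAt_shortGamma (p := p) (q := q) hp hq (differentiableAt_const d)
    dx dy dw hd0 hd1 hx hy hw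
  have s2 := differentiableAt_shortGamma (p := p) (q := q) hp hq dd dx dy dw
    (div_ne_zero hd0 (pow_ne_zero 3 hrC)) hdr
    hx hy hw
  have t1 := differentiableAt_deltaTheta hp dx dy dw (n0 _ hx) (n0 _ hy) (n0 _ hw)
  have t2 := differentiableAt_deltaTheta hq dx dy dw (n0 _ hx) (n0 _ hy) (n0 _ hw)
  exact ((((hreg _ dx hx).mul (hreg _ dy hy)).mul (hreg _ dw hw)).mul (s1.mul s2)).mul (t1.mul t2)

lemma regProd_inv (p q : ℂ) (α : Fin 3 → ℂ) (r z : ℂ) :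
    regProd p q α (r, z⁻¹) = regProd p q α (r, z) := by
  simp only [regProd, Fintype.prod_prod_type, Fintype.prod_bool, poleMonomial, if_true,
    Bool.false_eq_true, if_false, inv_inv]
  exact Finset.prod_congr rfl fun k _ => mul_comm _ _

lemma regKernel_swap12 (hp : ‖p‖ < 1) (hq : ‖q‖ < 1) {x y w : ℂ} (hx : x ≠ 0) (hy : y ≠ 0)
    (hw : w ≠ 0) (r : ℂ) : regKernel p q α d (r, y, x, w) = regKernel p q α d (r, x, y, w) := by
  simp only [regKernel]
  rw [deltaTheta_swap12 hp hx hy hw, deltaTheta_swap12 hq hx hy hw, shortGamma_swap12 p q d x y w,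
    shortGamma_swap12 p q (d / r ^ 3) x y w]
  ring

lemma regKernel_swap23 (hp : ‖p‖ < 1) (hq : ‖q‖ < 1) {x y w : ℂ} (hx : x ≠ 0) (hy : y ≠ 0)
    (hw : w ≠ 0) (r : ℂ) : regKernel p q α d (r, x, w, y) = regKernel p q α d (r, x, y, w) := by
  simp only [regKernel]
  rw [deltaTheta_swap23 hp hx hy hw, deltaTheta_swap23 hq hx hy hw, shortGamma_swap23 p q d x y w,
    shortGamma_swap23 p q (d / r ^ 3) x y w]
  ring

lemma regKernel_inv (hp : ‖p‖ < 1) (hq : ‖q‖ < 1) {x y w : ℂ} (hx : x ≠ 0) (hy : y ≠ 0)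
    (hw : w ≠ 0) (hxyw : x * y * w = 1) (r : ℂ) :
    regKernel p q α d (r, x⁻¹, y⁻¹, w⁻¹) = regKernel p q α d (r, x, y, w) := by
  simp only [regKernel]
  rw [deltaTheta_inv hp hx hy hw hxyw, deltaTheta_inv hq hx hy hw hxyw, shortGamma_inv,
    shortGamma_inv, regProd_inv, regProd_inv, regProd_inv]

lemma eq_of_distinct {S : Fin 3 → Fin 3 → Fin 3 → ℂ} (s12 : ∀ i j l, S j i l = S i j l)
    (s23 : ∀ i j l, S i l j = S i j l) :
    ∀ {i j l : Fin 3}, i ≠ j → i ≠ l → j ≠ l → S i j l = S 0 1 2 := by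
  have e1 := s12 0 1 2
  have e2 := s23 0 1 2
  have e3 := (s12 0 2 1).trans e2
  have e4 := (s23 1 0 2).trans e1
  have e5 := (s12 1 2 0).trans e4
  intro i j l h1 h2 h3
  fin_cases i <;> fin_cases j <;> fin_cases l <;> first | assumption | rfl | simp at h1 h2 h3

lemma regKernel_of_distinct (hp : ‖p‖ < 1) (hq : ‖q‖ < 1) {z : Fin 3 → ℂ} (hz : ∀ k, z k ≠ 0) (r : ℂ)
    {i j l : Fin 3} (h1 : i ≠ j) (h2 : i ≠ l) (h3 : j ≠ l) :
    regKernel p q α d (r, z i, z j, z l) = regKernel p q α d (r, z 0, z 1, z 2) :=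
  eq_of_distinct (S := fun i j l => regKernel p q α d (r, z i, z j, z l))
    (fun i j l => regKernel_swap12 hp hq (hz i) (hz j) (hz l) r)
    (fun i j l => regKernel_swap23 hp hq (hz i) (hz j) (hz l) r) h1 h2 h3

/-- The limit of the mean over the torus in terms of the residue at one point. -/
lemma tendsto_torusMean_kernel (hp : ‖p‖ < 1) (hq : ‖q‖ < 1) (hα : ∀ k, ‖α k‖ = 1)
    (hinj : Function.Injective (poleCoeff α)) (hprod : α 0 * α 1 * α 2 = 1)
    (hres : ∀ i j l, poleCoeff α i * poleCoeff α j * poleCoeff α l = 1 → IsResonant i j l)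
    (hd0 : d ≠ 0) (hd1 : ‖d‖ < 1) :
    Tendsto (fun r : ℝ => (1 - (r : ℂ) ^ 3) * torusMean (kernel p q (poleParam α d r))) (𝓝[<] 1)
      (𝓝 (12 * (regKernel p q α d (1, (α 0)⁻¹, (α 1)⁻¹, (α 2)⁻¹) *
        (poleResidue α 0 * poleResidue α 1 * poleResidue α 2)))) := by
  have h0 : ∀ k, α k ≠ 0 := fun k => norm_ne_zero_iff.1 (by rw [hα]; norm_num)
  obtain ⟨ρ, hρ, hρ1⟩ : ∃ ρ : ℝ, ‖d‖ < ρ ^ 3 ∧ 0 < ρ ∧ ρ < 1 := by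
    have hc : ContinuousAt (fun ρ : ℝ => ρ ^ 3) 1 := by fun_prop
    have h1 := (hc.tendsto.eventually (lt_mem_nhds (by simpa using hd1))).filter_mono
      (nhdsWithin_le_nhds (s := Set.Iio 1))
    exact (h1.and (Ioo_mem_nhdsLT (zero_lt_one' ℝ))).exists
  have key := tendsto_torusMean_poles hα hinj hprod hres hρ1.1.le hρ1.2
    (differentiableAt_regKernel (q := q) hp hq hα hd0 hd1 hρ1.1 hρ)
    (κ := regKernel p q α d (1, (α 0)⁻¹, (α 1)⁻¹, (α 2)⁻¹)) ?_
  · refine key.congr fun r => ?_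
    congr 2
    funext x y w
    rw [kernel_poleParam hp hq]
  · rintro ⟨i, b⟩ ⟨j, b₂⟩ ⟨l, b₃⟩ ⟨⟨rfl, rfl⟩, h1, h2, h3⟩
    have hinv := regKernel_of_distinct (α := α) (d := d) hp hq (z := fun k => (α k)⁻¹)
      (fun k => inv_ne_zero (h0 k)) 1
      h1 h2 h3
    cases b
    · rw [← hinv, ← regKernel_inv hp hq (inv_ne_zero (h0 i)) (inv_ne_zero (h0 j))
        (inv_ne_zero (h0 l))]
      · simp [poleCoeff]
      · rw [← mul_inv, ← mul_inv, prod_of_distinct α h1 h2 h3, hprod, inv_one]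
    · simpa [poleCoeff] using hinv

end EllipticG2

namespace EllipticG2

/-! ### The limits of both sides -/

open MeasureTheory

variable {p q : ℂ} {α : Fin 3 → ℂ} {d : ℂ}

lemma pqPoch_ne_zero_of_norm_le (hp : ‖p‖ < 1) (hq : ‖q‖ < 1) {u : ℂ} (hu : ‖u‖ ≤ 1) (h1 : u ≠ 1) :
    pqPoch u p q ≠ 0 := by
  rw [pqPoch_step_left hp hq, qPoch_step hq]
  exact mul_ne_zero (mul_ne_zero (sub_ne_zero.2 h1.symm) (qPoch_ne_zero hq (norm_mul_lt_one hq hu)))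
    (pqPoch_ne_zero hp hq (norm_mul_lt_one hp hu))

lemma ellGamma_ne_zero_of_norm_eq_one (hp : ‖p‖ < 1) (hq : ‖q‖ < 1) {u : ℂ} (hu : ‖u‖ = 1)
    (h1 : u ≠ 1) : ellGamma p q u ≠ 0 :=
  ellGamma_ne_zero (pqPoch_ne_zero hp hq (norm_mul_lt_one (norm_mul_lt_one hp hq.le)
    (by rw [norm_inv, hu, inv_one]))) (pqPoch_ne_zero_of_norm_le hp hq hu.le h1)

/-- On the torus the Weyl denominator is the product of `1 / Γ` over all roots. -/
lemma deltaTheta_mul_deltaTheta (hp : ‖p‖ < 1) (hq : ‖q‖ < 1) {x y w : ℂ} (hx : ‖x‖ = 1)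
    (hy : ‖y‖ = 1) (hw : ‖w‖ = 1) (hxyw : x * y * w = 1) :
    deltaTheta p x y w * deltaTheta q x y w =
      (ellGamma p q x * ellGamma p q x⁻¹ * (ellGamma p q y * ellGamma p q y⁻¹) *
        (ellGamma p q w * ellGamma p q w⁻¹) *
        (ellGamma p q (x * y⁻¹) * ellGamma p q (y * x⁻¹) *
        (ellGamma p q (x * w⁻¹) * ellGamma p q (w * x⁻¹)) *
        (ellGamma p q (y * w⁻¹) * ellGamma p q (w * y⁻¹))))⁻¹ := by
  have n0 : ∀ z : ℂ, ‖z‖ = 1 → z ≠ 0 := fun z hz => norm_ne_zero_iff.1 (by rw [hz]; norm_num)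
  have R : ∀ u : ℂ, ‖u‖ = 1 → (ellGamma p q u * ellGamma p q u⁻¹)⁻¹
      = theta p u * (-u⁻¹ * theta q u) := by
    intro u hu
    have hpq : ‖p * q‖ < 1 := norm_mul_lt_one hp hq.le
    rw [inv_ellGamma_mul_inv hp hq
      (pqPoch_ne_zero hp hq (norm_mul_lt_one hpq (by rw [norm_inv, hu, inv_one])))
      (pqPoch_ne_zero hp hq (norm_mul_lt_one hpq hu.le)), theta_inv hq (n0 _ hu)]
  have R2 : ∀ u v : ℂ, ‖u‖ = 1 → ‖v‖ = 1 → (ellGamma p q (u * v⁻¹) * ellGamma p q (v * u⁻¹))⁻¹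
      = theta p (u * v⁻¹) * (-(u * v⁻¹)⁻¹ * theta q (u * v⁻¹)) := fun u v hu hv => by
    rw [← R _ (by rw [norm_mul, norm_inv, hu, hv]; norm_num), mul_inv u, inv_inv, mul_comm v]
  simp only [mul_inv] at R R2 ⊢
  simp only [R x hx, R y hy, R w hw, R2 x y hx hy, R2 x w hx hw, R2 y w hy hw]
  have hx0 := n0 _ hx
  have hy0 := n0 _ hy
  have hw0 := n0 _ hw
  have hm : x⁻¹ * y⁻¹ * w⁻¹ * (x⁻¹ * y⁻¹⁻¹) * (x⁻¹ * w⁻¹⁻¹) * (y⁻¹ * w⁻¹⁻¹) =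
      (w * x⁻¹) * (w * x⁻¹) := by
    rw [← mul_inv x y, ← mul_inv, hxyw, inv_one]
    field_simp
  rw [deltaTheta, deltaTheta]
  linear_combination (-theta p x * theta p y * theta p w *
    (theta p (x * y⁻¹) * theta p (x * w⁻¹) * theta p (y * w⁻¹)) * (theta q x * theta q y *
    theta q w * (theta q (x * y⁻¹) * theta q (x * w⁻¹) * theta q (y * w⁻¹)))) * hm

lemma prod_erase_pole_zero {M : Type*} [CommMonoid M] (f : Fin 3 × Bool → M) :
    ∏ j ∈ Finset.univ.erase ((0 : Fin 3), true), f j =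
      f (0, false) * (f (1, true) * f (1, false)) * (f (2, true) * f (2, false)) := by
  rw [show Finset.univ.erase ((0 : Fin 3), true) =
    {(0, false), (1, true), (1, false), (2, true), (2, false)} from by decide]
  repeat rw [Finset.prod_insert (by decide)]
  rw [Finset.prod_singleton]
  simp only [mul_assoc]

lemma prod_erase_pole_one {M : Type*} [CommMonoid M] (f : Fin 3 × Bool → M) :
    ∏ j ∈ Finset.univ.erase ((1 : Fin 3), true), f j =
      f (1, false) * (f (0, true) * f (0, false)) * (f (2, true) * f (2, false)) := by
  rw [show Finset.univ.erase ((1 : Fin 3), true) =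
    {(1, false), (0, true), (0, false), (2, true), (2, false)} from by decide]
  repeat rw [Finset.prod_insert (by decide)]
  rw [Finset.prod_singleton]
  simp only [mul_assoc]

lemma prod_erase_pole_two {M : Type*} [CommMonoid M] (f : Fin 3 × Bool → M) :
    ∏ j ∈ Finset.univ.erase ((2 : Fin 3), true), f j =
      f (2, false) * (f (0, true) * f (0, false)) * (f (1, true) * f (1, false)) := by
  rw [show Finset.univ.erase ((2 : Fin 3), true) =
    {(2, false), (0, true), (0, false), (1, true), (1, false)} from by decide]
  repeat rw [Finset.prod_insert (by decide)]
  rw [Finset.prod_singleton]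
  simp only [mul_assoc]

lemma regProd_mul_poleResidue (hp : ‖p‖ < 1) (hq : ‖q‖ < 1) (hα : ∀ k, ‖α k‖ = 1) (k : Fin 3) :
    regProd p q α (1, (α k)⁻¹) * poleResidue α k = regGamma p q 1 *
      ∏ j ∈ Finset.univ.erase (k, true), ellGamma p q (poleMonomial α (α k)⁻¹ j) := by
  have h0 : α k ≠ 0 := norm_ne_zero_iff.1 (by rw [hα]; norm_num)
  have e : poleMonomial α (α k)⁻¹ (k, true) = 1 := by simp [poleMonomial, h0]
  rw [regProd, poleResidue, ← Finset.mul_prod_erase _ _ (Finset.mem_univ (k, true)), mul_assoc,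
    ← Finset.prod_mul_distrib]
  simp only [e, one_mul, poleDen, ← ellGamma_eq_regGamma hp hq]

/-- The value that both degenerations have in common. -/
noncomputable def degenerateValue (p q : ℂ) (α : Fin 3 → ℂ) (d : ℂ) : ℂ :=
  ∏ k, ellGamma p q (α k ^ 2) * ellGamma p q (α k)⁻¹ / ellGamma p q (α k) *
    (ellGamma p q (d * α k) * ellGamma p q (d * (α k)⁻¹)) ^ 2

/-- The residue of the integrand at `(x, y, w) = (α 0, α 1, α 2)⁻¹`. -/
lemma regKernel_mul_poleResidue (hp : ‖p‖ < 1) (hq : ‖q‖ < 1) (hα : ∀ k, ‖α k‖ = 1)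
    (hinj : Function.Injective (poleCoeff α)) (hα1 : ∀ k, α k ≠ 1) (hprod : α 0 * α 1 * α 2 = 1) :
    regKernel p q α d (1, (α 0)⁻¹, (α 1)⁻¹, (α 2)⁻¹) *
        (poleResidue α 0 * poleResidue α 1 * poleResidue α 2) =
      regGamma p q 1 ^ 3 * degenerateValue p q α d := by
  have h0 : ∀ k, α k ≠ 0 := fun k => norm_ne_zero_iff.1 (by rw [hα]; norm_num)
  have n1 : ∀ k, ‖(α k)⁻¹‖ = 1 := fun k => by rw [norm_inv, hα, inv_one]
  have hA : ∀ k, ellGamma p q (α k) ≠ 0 := fun k =>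
    ellGamma_ne_zero_of_norm_eq_one hp hq (hα k) (hα1 k)
  have hB : ∀ k, ellGamma p q (α k)⁻¹ ≠ 0 := fun k =>
    ellGamma_ne_zero_of_norm_eq_one hp hq (n1 k) (inv_ne_one.2 (hα1 k))
  have hL : ∀ k m, k ≠ m → ellGamma p q (α k * (α m)⁻¹) ≠ 0 := fun k m hkm =>
    ellGamma_ne_zero_of_norm_eq_one hp hq (by rw [norm_mul, hα, n1, one_mul]) fun h => by
      have := @hinj (k, true) (m, true)
        (by simpa [poleCoeff] using (mul_inv_eq_one₀ (h0 m)).1 h)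
      exact hkm (congrArg Prod.fst this)
  have hδ := deltaTheta_mul_deltaTheta hp hq (n1 0) (n1 1) (n1 2)
    (by rw [← mul_inv, ← mul_inv, hprod, inv_one])
  have r0 := regProd_mul_poleResidue hp hq hα 0
  have r1 := regProd_mul_poleResidue hp hq hα 1
  have r2 := regProd_mul_poleResidue hp hq hα 2
  rw [prod_erase_pole_zero] at r0
  rw [prod_erase_pole_one] at r1
  rw [prod_erase_pole_two] at r2
  simp only [poleMonomial, if_true, Bool.false_eq_true, if_false, inv_inv] at r0 r1 r2
  simp only [inv_inv] at hδ
  have q01 : α 0 * α 1 = (α 2)⁻¹ := eq_inv_of_mul_eq_one_left hprod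
  have q02 : α 0 * α 2 = (α 1)⁻¹ := eq_inv_of_mul_eq_one_left (by linear_combination hprod)
  have q12 : α 1 * α 2 = (α 0)⁻¹ := eq_inv_of_mul_eq_one_left (by linear_combination hprod)
  rw [mul_comm (α 1) (α 0), mul_comm (α 2) (α 0)] at r0
  rw [mul_comm (α 2) (α 1)] at r1
  rw [← sq, q01, q02] at r0
  rw [← sq, q01, q12] at r1
  rw [← sq, q02, q12] at r2
  rw [regKernel]
  simp only [one_pow, div_one]
  rw [hδ, shortGamma, inv_inv, inv_inv, inv_inv, degenerateValue, Fin.prod_univ_three]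
  rw [mul_comm (α 0)⁻¹ (α 1), mul_comm (α 1)⁻¹ (α 0), mul_comm (α 0)⁻¹ (α 2), mul_comm (α 2)⁻¹ (α 0),
    mul_comm (α 1)⁻¹ (α 2), mul_comm (α 2)⁻¹ (α 1)]
  clear hδ
  have l01 := hL 0 1 (by decide)
  have l02 := hL 0 2 (by decide)
  have l12 := hL 1 2 (by decide)
  have l10 := hL 1 0 (by decide)
  have l20 := hL 2 0 (by decide)
  have l21 := hL 2 1 (by decide)
  have A0 := hA 0
  have A1 := hA 1
  have A2 := hA 2
  have B0 := hB 0
  have B1 := hB 1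
  have B2 := hB 2
  generalize regProd p q α (1, (α 0)⁻¹) = R0 at *
  generalize regProd p q α (1, (α 1)⁻¹) = R1 at *
  generalize regProd p q α (1, (α 2)⁻¹) = R2 at *
  generalize poleResidue α 0 = P0 at *
  generalize poleResidue α 1 = P1 at *
  generalize poleResidue α 2 = P2 at *
  generalize ellGamma p q (α 0 * (α 1)⁻¹) = L01 at *
  generalize ellGamma p q (α 0 * (α 2)⁻¹) = L02 at *
  generalize ellGamma p q (α 1 * (α 2)⁻¹) = L12 at *
  generalize ellGamma p q (α 1 * (α 0)⁻¹) = L10 at *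
  generalize ellGamma p q (α 2 * (α 0)⁻¹) = L20 at *
  generalize ellGamma p q (α 2 * (α 1)⁻¹) = L21 at *
  generalize ellGamma p q (α 0) = a0 at *
  generalize ellGamma p q (α 1) = a1 at *
  generalize ellGamma p q (α 2) = a2 at *
  generalize ellGamma p q (α 0)⁻¹ = b0 at *
  generalize ellGamma p q (α 1)⁻¹ = b1 at *
  generalize ellGamma p q (α 2)⁻¹ = b2 at *
  generalize regGamma p q 1 = G at *
  generalize ellGamma p q (d * α 0) = D0
  generalize ellGamma p q (d * α 1) = D1
  generalize ellGamma p q (d * α 2) = D2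
  generalize ellGamma p q (d * (α 0)⁻¹) = E0
  generalize ellGamma p q (d * (α 1)⁻¹) = E1
  generalize ellGamma p q (d * (α 2)⁻¹) = E2
  generalize hX : (b0 * a0 * (b1 * a1) * (b2 * a2) * (L10 * L01 * (L20 * L02) * (L21 * L12)))⁻¹ = X
  have e : R0 * P0 * (R1 * P1) * (R2 * P2) * X = G ^ 3 *
      (ellGamma p q (α 0 ^ 2) * b0 / a0 * (ellGamma p q (α 1 ^ 2) * b1 / a1) *
      (ellGamma p q (α 2 ^ 2) * b2 / a2)) := by
    rw [r0, r1, r2, ← hX]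
    field_simp
  linear_combination (E0 * D0 * (E1 * D1) * (E2 * D2)) ^ 2 * e

/-- The reflection formula `Γ(u) Γ(pq / u) = 1` at its fixed point. -/
lemma ellGamma_eq_one_of_sq_eq (hp : ‖p‖ < 1) (hq : ‖q‖ < 1) {c : ℂ} (hc : c ^ 2 = p * q)
    (hc0 : c ≠ 0) (hc1 : ‖c‖ < 1) : ellGamma p q c = 1 := by
  have e : p * q * c⁻¹ = c := by rw [← hc]; field_simp
  rw [ellGamma, e, div_self (pqPoch_ne_zero hp hq hc1)]

/-- The product side without the factor `Γ(a₀ a₁ a₂)`. -/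
noncomputable def regProductJ (p q : ℂ) (a : Fin 5 → ℂ) : ℂ :=
  (∏ i, ellGamma p q (a i ^ 2) / ellGamma p q (a i)) * subsetGamma p q a 2 *
    (ellGamma p q (a 0 * a 1 * a 3) *
    ellGamma p q (a 0 * a 1 * a 4) * ellGamma p q (a 0 * a 2 * a 3) *
    ellGamma p q (a 0 * a 2 * a 4) * ellGamma p q (a 0 * a 3 * a 4) *
    ellGamma p q (a 1 * a 2 * a 3) * ellGamma p q (a 1 * a 2 * a 4) *
    ellGamma p q (a 1 * a 3 * a 4) * ellGamma p q (a 2 * a 3 * a 4)) * subsetGamma p q a 4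

lemma productJ_eq_regProductJ (p q : ℂ) (a : Fin 5 → ℂ) :
    productJ p q a = ellGamma p q (a 0 * a 1 * a 2) * regProductJ p q a := by
  rw [productJ, regProductJ, subsetGamma_three]
  ring

lemma poleParam_one (α : Fin 3 → ℂ) (d : ℂ) : poleParam α d 1 = ![α 0, α 1, α 2, d, d] := by
  simp [poleParam]

lemma continuousAt_poleParam (α : Fin 3 → ℂ) (d : ℂ) (k : Fin 5) :
    ContinuousAt (fun r : ℝ => poleParam α d r k) 1 := by
  have h : ContinuousAt (fun r : ℝ => d / (r : ℂ) ^ 3) 1 :=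
    continuousAt_const.div (by fun_prop) (by simp)
  have h' : ∀ k, ContinuousAt (fun r : ℝ => (r : ℂ) * α k) 1 := fun k => by fun_prop
  fin_cases k
  · exact h' 0
  · exact h' 1
  · exact h' 2
  · exact continuousAt_const
  · exact h

/-- The hypotheses on the phases `α k` under which both sides can be evaluated in the limit: the
poles in one variable are distinct, and poles of the three variables meet on the torus only for the
triples that the product condition forces. -/
structure IsPolePhase (α : Fin 3 → ℂ) : Prop where
  norm_eq : ∀ k, ‖α k‖ = 1
  prod_eq : α 0 * α 1 * α 2 = 1
  injective : Function.Injective (poleCoeff α)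
  ne_one : ∀ k, α k ≠ 1
  resonant : ∀ i j l, poleCoeff α i * poleCoeff α j * poleCoeff α l = 1 → IsResonant i j l

lemma IsPolePhase.mul_ne_one (h : IsPolePhase α) (k m : Fin 3) : α k * α m ≠ 1 := by
  intro he
  have := @IsPolePhase.injective α h (k, true) (m, false)
    (by simpa [poleCoeff] using eq_inv_of_mul_eq_one_left he)
  exact absurd (congrArg Prod.snd this) (by simp)

lemma continuousAt_regProductJ (hp : ‖p‖ < 1) (hq : ‖q‖ < 1) {a : Fin 5 → ℝ → ℂ} {t : ℝ}
    (hc : ∀ k, ContinuousAt (a k) t) (h0 : ∀ k, a k t ≠ 0) (h1 : ∀ k, ‖a k t‖ ≤ 1)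
    (h3 : ‖a 3 t‖ < 1) (h4 : ‖a 4 t‖ < 1) (hsq : ∀ k, a k t ^ 2 ≠ 1)
    (h01 : a 0 t * a 1 t ≠ 1) (h02 : a 0 t * a 2 t ≠ 1) (h12 : a 1 t * a 2 t ≠ 1)
    (hΓ : ∀ k, ellGamma p q (a k t) ≠ 0) :
    ContinuousAt (fun r : ℝ => regProductJ p q fun k => a k r) t := by
  have hlt : ∀ {u v : ℂ}, ‖u‖ ≤ 1 → ‖v‖ < 1 → ‖u * v‖ < 1 := fun {u v} hu hv => by
    rw [mul_comm]; exact norm_mul_lt_one hv hu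
  have hle : ∀ {u v : ℂ}, ‖u‖ ≤ 1 → ‖v‖ ≤ 1 → ‖u * v‖ ≤ 1 := fun {u v} hu hv => by
    rw [norm_mul]; exact mul_le_one₀ hu (norm_nonneg _) hv
  have h3' : ∀ {u : ℂ}, ‖u‖ ≤ 1 → ‖u * a 3 t‖ < 1 := fun hu => hlt hu h3
  have h4' : ∀ {u : ℂ}, ‖u‖ ≤ 1 → ‖u * a 4 t‖ < 1 := fun hu => hlt hu h4
  have G1 : ∀ {u : ℝ → ℂ}, ContinuousAt u t → u t ≠ 0 → ‖u t‖ ≤ 1 → u t ≠ 1 →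
      ContinuousAt (fun r => ellGamma p q (u r)) t := fun {u} hu h1 h2 h3 =>
    ContinuousAt.comp (g := ellGamma p q) (differentiableAt_ellGamma hp hq h1
      (pqPoch_ne_zero_of_norm_le hp hq h2 h3)).continuousAt hu
  have G' : ∀ {u : ℝ → ℂ}, ContinuousAt u t → u t ≠ 0 → ‖u t‖ < 1 →
      ContinuousAt (fun r => ellGamma p q (u r)) t := fun hu h1 h2 =>
    G1 hu h1 h2.le (by rintro h; rw [h, norm_one] at h2; exact lt_irrefl _ h2)
  have hm : ∀ {u : ℝ → ℂ} (k : Fin 5), ContinuousAt u t ∧ u t ≠ 0 →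
      ContinuousAt (fun r => u r * a k r) t ∧ u t * a k t ≠ 0 := fun k hu =>
    ⟨hu.1.mul (hc k), mul_ne_zero hu.2 (h0 k)⟩
  have m1 : ∀ k, ContinuousAt (fun r => a k r) t ∧ a k t ≠ 0 := fun k => ⟨hc k, h0 k⟩
  have T : ∀ {u : ℝ → ℂ} (k : Fin 5), ContinuousAt u t ∧ u t ≠ 0 → ‖u t‖ ≤ 1 → ‖a k t‖ < 1 →
      ContinuousAt (fun r => ellGamma p q (u r * a k r)) t := fun k hu h1 hk =>
    G' (hm k hu).1 (hm k hu).2 (hlt h1 hk)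
  have hdiv : ContinuousAt (fun r => ∏ i, ellGamma p q (a i r ^ 2) / ellGamma p q (a i r)) t := by
    refine tendsto_finsetProd _ fun i _ => ContinuousAt.div ?_ ?_ (hΓ i)
    · exact G1 ((hc i).pow 2) (pow_ne_zero 2 (h0 i))
        (by rw [norm_pow]; exact pow_le_one₀ (norm_nonneg _) (h1 i)) (hsq i)
    · refine G1 (hc i) (h0 i) (h1 i) fun h => hsq i (by rw [h, one_pow])
  have two : ContinuousAt (fun r => subsetGamma p q (fun k => a k r) 2) t := by
    simp only [subsetGamma_two]
    exact (((((((((G1 (hm 1 (m1 0)).1 (hm 1 (m1 0)).2 (hle (h1 0) (h1 1)) h01).mul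
      (G1 (hm 2 (m1 0)).1 (hm 2 (m1 0)).2 (hle (h1 0) (h1 2)) h02)).mul
      (T 3 (m1 0) (h1 0) h3)).mul (T 4 (m1 0) (h1 0) h4)).mul
      (G1 (hm 2 (m1 1)).1 (hm 2 (m1 1)).2 (hle (h1 1) (h1 2)) h12)).mul
      (T 3 (m1 1) (h1 1) h3)).mul (T 4 (m1 1) (h1 1) h4)).mul
      (T 3 (m1 2) (h1 2) h3)).mul (T 4 (m1 2) (h1 2) h4)).mul (T 4 (m1 3) (h1 3) h4)
  have n2 : ∀ i j, ‖a i t * a j t‖ ≤ 1 := fun i j => hle (h1 i) (h1 j)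
  have m2 : ∀ i j, ContinuousAt (fun r => a i r * a j r) t ∧ a i t * a j t ≠ 0 :=
    fun i j => hm j (m1 i)
  have n3 : ∀ i j k, ‖a i t * a j t * a k t‖ ≤ 1 := fun i j k => hle (n2 i j) (h1 k)
  have m3 : ∀ i j k, ContinuousAt (fun r => a i r * a j r * a k r) t ∧ a i t * a j t * a k t ≠ 0 :=
    fun i j k => hm k (m2 i j)
  have four : ContinuousAt (fun r => subsetGamma p q (fun k => a k r) 4) t := by
    simp only [subsetGamma_four]
    exact ((((T 3 (m3 0 1 2) (n3 0 1 2) h3).mul (T 4 (m3 0 1 2) (n3 0 1 2) h4)).mul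
      (T 4 (m3 0 1 3) (n3 0 1 3) h4)).mul (T 4 (m3 0 2 3) (n3 0 2 3) h4)).mul
      (T 4 (m3 1 2 3) (n3 1 2 3) h4)
  exact ((hdiv.mul two).mul (((((((((T 3 (m2 0 1) (n2 0 1) h3).mul (T 4 (m2 0 1) (n2 0 1) h4)).mul
    (T 3 (m2 0 2) (n2 0 2) h3)).mul (T 4 (m2 0 2) (n2 0 2) h4)).mul
    (T 4 (m2 0 3) (n2 0 3) h4)).mul (T 3 (m2 1 2) (n2 1 2) h3)).mul
    (T 4 (m2 1 2) (n2 1 2) h4)).mul (T 4 (m2 1 3) (n2 1 3) h4)).mul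
    (T 4 (m2 2 3) (n2 2 3) h4))).mul four

lemma ellGamma_param_ne_zero (hp : ‖p‖ < 1) (hq : ‖q‖ < 1) (hd0 : d ≠ 0) (hd1 : ‖d‖ < 1)
    (hd : (d ^ 2) ^ 2 = p * q) : ellGamma p q d ≠ 0 := by
  refine ellGamma_ne_zero (pqPoch_ne_zero hp hq ?_) (pqPoch_ne_zero hp hq hd1)
  rw [← hd, show (d ^ 2) ^ 2 * d⁻¹ = d ^ 3 by field_simp, norm_pow]
  exact pow_lt_one₀ (norm_nonneg _) hd1 three_ne_zero

lemma regProductJ_poleParam_one (hp : ‖p‖ < 1) (hq : ‖q‖ < 1) (h : IsPolePhase α) (hd0 : d ≠ 0)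
    (hd1 : ‖d‖ < 1) (hd : (d ^ 2) ^ 2 = p * q) :
    regProductJ p q (poleParam α d 1) = degenerateValue p q α d := by
  have h0 : ∀ k, α k ≠ 0 := fun k => norm_ne_zero_iff.1 (by rw [h.norm_eq]; norm_num)
  have hd2 : ‖d ^ 2‖ < 1 := by
    rw [norm_pow]; exact pow_lt_one₀ (norm_nonneg _) hd1 two_ne_zero
  have hΓ2 : ellGamma p q (d ^ 2) = 1 := ellGamma_eq_one_of_sq_eq hp hq hd (pow_ne_zero 2 hd0) hd2
  have hΓd := ellGamma_param_ne_zero hp hq hd0 hd1 hd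
  have hpq0 : p * q ≠ 0 := hd ▸ pow_ne_zero 2 (pow_ne_zero 2 hd0)
  have refl : ∀ k, ellGamma p q (α k * d ^ 2) * ellGamma p q ((α k)⁻¹ * d ^ 2) = 1 := by
    intro k
    have e : (α k)⁻¹ * d ^ 2 = p * q * (α k * d ^ 2)⁻¹ := by
      rw [← hd]; field_simp
    have n : ‖(α k)⁻¹ * d ^ 2‖ < 1 := by
      rw [norm_mul, norm_inv, h.norm_eq, inv_one, one_mul]; exact hd2
    have h1 := pqPoch_ne_zero hp hq n
    rw [e] at h1 ⊢
    exact ellGamma_reflect hpq0 h1 (pqPoch_ne_zero hp hq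
      (by rw [norm_mul, h.norm_eq, one_mul]; exact hd2))
  have q01 : α 0 * α 1 = (α 2)⁻¹ := eq_inv_of_mul_eq_one_left h.prod_eq
  have q02 : α 0 * α 2 = (α 1)⁻¹ := eq_inv_of_mul_eq_one_left (by linear_combination h.prod_eq)
  have q12 : α 1 * α 2 = (α 0)⁻¹ := eq_inv_of_mul_eq_one_left (by linear_combination h.prod_eq)
  have f0 := refl 0
  have f1 := refl 1
  have f2 := refl 2
  rw [poleParam_one, regProductJ, subsetGamma_two, subsetGamma_four, Fin.prod_univ_five,
    degenerateValue, Fin.prod_univ_three]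
  simp only [Matrix.cons_val]
  rw [h.prod_eq, q01, q02, q12]
  simp only [one_mul, mul_assoc _ d d, ← sq d]
  rw [hΓ2, mul_comm d (α 0), mul_comm d (α 1), mul_comm d (α 2), mul_comm d (α 0)⁻¹,
    mul_comm d (α 1)⁻¹, mul_comm d (α 2)⁻¹]
  generalize ellGamma p q d = Gd at *
  generalize ellGamma p q (α 0 * d ^ 2) = x0 at *
  generalize ellGamma p q (α 1 * d ^ 2) = x1 at *
  generalize ellGamma p q (α 2 * d ^ 2) = x2 at *
  generalize ellGamma p q ((α 0)⁻¹ * d ^ 2) = y0 at *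
  generalize ellGamma p q ((α 1)⁻¹ * d ^ 2) = y1 at *
  generalize ellGamma p q ((α 2)⁻¹ * d ^ 2) = y2 at *
  have e : 1 / Gd * (1 / Gd) * (Gd * Gd * y2 * y1 * y0) * (x0 * x1 * x2) = 1 := by
    have : 1 / Gd * Gd = 1 := one_div_mul_cancel hΓd
    linear_combination (x0 * y0) * (x1 * y1) * (x2 * y2) * (1 + 1 / Gd * Gd) * this +
      f0 + (x0 * y0) * f1 + (x0 * y0) * (x1 * y1) * f2
  linear_combination (ellGamma p q (α 0 ^ 2) * ellGamma p q (α 0)⁻¹ / ellGamma p q (α 0) *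
      (ellGamma p q (α 0 * d) * ellGamma p q ((α 0)⁻¹ * d)) ^ 2 *
    (ellGamma p q (α 1 ^ 2) * ellGamma p q (α 1)⁻¹ / ellGamma p q (α 1) *
      (ellGamma p q (α 1 * d) * ellGamma p q ((α 1)⁻¹ * d)) ^ 2) *
    (ellGamma p q (α 2 ^ 2) * ellGamma p q (α 2)⁻¹ / ellGamma p q (α 2) *
      (ellGamma p q (α 2 * d) * ellGamma p q ((α 2)⁻¹ * d)) ^ 2)) * e

lemma degenerateValue_ne_zero (hp : ‖p‖ < 1) (hq : ‖q‖ < 1) (h : IsPolePhase α) (hd0 : d ≠ 0)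
    (hd1 : ‖d‖ < 1) (hd : (d ^ 2) ^ 2 = p * q) : degenerateValue p q α d ≠ 0 := by
  have n1 : ∀ k, ‖(α k)⁻¹‖ = 1 := fun k => by rw [norm_inv, h.norm_eq, inv_one]
  have hd4 : ‖p * q‖ < ‖d‖ := by
    rw [← hd, ← pow_mul, norm_pow]
    exact pow_lt_self_of_lt_one₀ (norm_pos_iff.2 hd0) hd1 (by norm_num)
  have key : ∀ {u : ℂ}, ‖u‖ = 1 → ellGamma p q (d * u) ≠ 0 := fun {u} hu =>
    ellGamma_ne_zero_of_norm hp hq (by rwa [norm_mul d, hu, mul_one])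
      (by rwa [norm_mul, hu, mul_one])
  have key1 := fun {u : ℂ} => ellGamma_ne_zero_of_norm_eq_one (u := u) hp hq
  refine Finset.prod_ne_zero_iff.2 fun k _ => mul_ne_zero (div_ne_zero (mul_ne_zero ?_ ?_) ?_)
    (pow_ne_zero 2 (mul_ne_zero (key (h.norm_eq k)) (key (n1 k))))
  · exact key1 (by rw [norm_pow, h.norm_eq, one_pow]) (by rw [sq]; exact h.mul_ne_one k k)
  · exact key1 (n1 k) (inv_ne_one.2 (h.ne_one k))
  · exact key1 (h.norm_eq k) (h.ne_one k)

/-- The product side blows up only through `Γ(a₀ a₁ a₂) = Γ(r³)`. The balancing condition makes the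
remaining factors cancel, down to the value that also occurs in the residue of the integrand. -/
lemma tendsto_productJ (hp : ‖p‖ < 1) (hq : ‖q‖ < 1) (h : IsPolePhase α) (hd0 : d ≠ 0)
    (hd1 : ‖d‖ < 1) (hd : (d ^ 2) ^ 2 = p * q) :
    Tendsto (fun r : ℝ => (1 - (r : ℂ) ^ 3) * productJ p q (poleParam α d r)) (𝓝[<] 1)
      (𝓝 (regGamma p q 1 * degenerateValue p q α d)) := by
  have h0 : ∀ k, α k ≠ 0 := fun k => norm_ne_zero_iff.1 (by rw [h.norm_eq]; norm_num)
  have c1 : ContinuousAt (fun r : ℝ => regProductJ p q (poleParam α d r)) 1 := by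
    refine continuousAt_regProductJ (a := fun k (r : ℝ) => poleParam α d r k) hp hq
      (continuousAt_poleParam α d) ?_ ?_ ?_ ?_ ?_ ?_ ?_ ?_ ?_
    all_goals simp only [Complex.ofReal_one, poleParam_one]
    · intro k; fin_cases k
      exacts [h0 0, h0 1, h0 2, hd0, hd0]
    · intro k; fin_cases k
      exacts [(h.norm_eq 0).le, (h.norm_eq 1).le, (h.norm_eq 2).le, hd1.le, hd1.le]
    · exact hd1
    · exact hd1
    · have hd2 : d ^ 2 ≠ 1 := fun he => by
        have : ‖d ^ 2‖ < 1 := by rw [norm_pow]; exact pow_lt_one₀ (norm_nonneg _) hd1 two_ne_zero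
        rw [he, norm_one] at this
        exact lt_irrefl _ this
      have hs : ∀ k, α k ^ 2 ≠ 1 := fun k => by rw [sq]; exact h.mul_ne_one k k
      intro k; fin_cases k
      exacts [hs 0, hs 1, hs 2, hd2, hd2]
    · exact h.mul_ne_one 0 1
    · exact h.mul_ne_one 0 2
    · exact h.mul_ne_one 1 2
    · have key := fun k => ellGamma_ne_zero_of_norm_eq_one hp hq (h.norm_eq k) (h.ne_one k)
      have keyd := ellGamma_param_ne_zero hp hq hd0 hd1 hd
      intro k; fin_cases k
      exacts [key 0, key 1, key 2, keyd, keyd]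
  have c2 : ContinuousAt (fun r : ℝ => regGamma p q ((r : ℂ) ^ 3)) 1 := by
    refine ContinuousAt.comp (g := regGamma p q) ?_ (by fun_prop)
    rw [Complex.ofReal_one, one_pow]
    exact (differentiableAt_regGamma hp hq one_ne_zero norm_one.le).continuousAt
  have hl := ((c2.mul c1).tendsto).mono_left (nhdsWithin_le_nhds (s := Set.Iio 1))
  rw [Pi.mul_apply, Complex.ofReal_one, one_pow,
    regProductJ_poleParam_one hp hq h hd0 hd1 hd] at hl
  refine hl.congr' ?_
  filter_upwards [Ioo_mem_nhdsLT (zero_lt_one' ℝ)] with r hr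
  have hne : 1 - (r : ℂ) ^ 3 ≠ 0 := one_sub_ne_zero (by
    rw [norm_pow, Complex.norm_real, Real.norm_of_nonneg hr.1.le]
    exact pow_lt_one₀ hr.1.le hr.2 three_ne_zero)
  have e : poleParam α d r 0 * poleParam α d r 1 * poleParam α d r 2 = (r : ℂ) ^ 3 := by
    simp only [poleParam, Matrix.cons_val]
    linear_combination (r : ℂ) ^ 3 * h.prod_eq
  rw [Pi.mul_apply, productJ_eq_regProductJ, e, ellGamma_eq_regGamma hp hq]
  field_simp

end EllipticG2

namespace EllipticG2

open MeasureTheory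

variable {p q : ℂ}

/-! ### The constant -/

/-- `poleCoeff α i = ζ ^ phaseExponent i` for the phases `ζ, ζ³, ζ⁹`, where `ζ ^ 13 = 1`. -/
def phaseExponent (i : Fin 3 × Bool) : ℕ :=
  if i.2 then ![1, 3, 9] i.1 else ![12, 10, 4] i.1

/-- Three of the residues `±1, ±3, ±9` add up to `0` modulo `13` only as `±(1 + 3 + 9)`. -/
lemma phaseExponent_resonant : ∀ i j l : Fin 3 × Bool,
    (phaseExponent i + phaseExponent j + phaseExponent l) % 13 = 0 → IsResonant i j l := by
  decide +kernel

lemma exists_isPolePhase : ∃ α, IsPolePhase α := by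
  have hζ := Complex.isPrimitiveRoot_exp 13 (by norm_num)
  generalize Complex.exp (2 * π * Complex.I / (13 : ℕ)) = ζ at hζ
  have hζ0 : ζ ≠ 0 := hζ.ne_zero (by norm_num)
  have hn : ‖ζ‖ = 1 := hζ.norm'_eq_one (by norm_num)
  have hc : ∀ i, poleCoeff ![ζ, ζ ^ 3, ζ ^ 9] i = ζ ^ phaseExponent i := by
    have h13 := hζ.pow_eq_one
    have hi : ∀ {m n : ℕ}, m + n = 13 → (ζ ^ m)⁻¹ = ζ ^ n := fun h =>
      inv_eq_of_mul_eq_one_right (by rw [← pow_add, h, h13])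
    rintro ⟨k, b⟩
    fin_cases k <;> cases b
    · simpa [poleCoeff, phaseExponent] using hi (m := 1) (n := 12) rfl
    · simp [poleCoeff, phaseExponent]
    · simpa [poleCoeff, phaseExponent] using hi (m := 3) (n := 10) rfl
    · simp [poleCoeff, phaseExponent]
    · simpa [poleCoeff, phaseExponent] using hi (m := 9) (n := 4) rfl
    · simp [poleCoeff, phaseExponent]
  refine ⟨![ζ, ζ ^ 3, ζ ^ 9], ?_, ?_, ?_, ?_, ?_⟩
  · intro k; fin_cases k <;> simp [hn]
  · simp only [Matrix.cons_val]
    rw [← hζ.pow_eq_one]; ring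
  · intro i j h
    rw [hc, hc] at h
    have hlt : ∀ i, phaseExponent i < 13 := by decide
    have := hζ.pow_inj (hlt i) (hlt j) h
    clear h
    revert i j
    decide +kernel
  · intro k
    have h1 : ∀ n : ℕ, ¬ 13 ∣ n → ζ ^ n ≠ 1 := fun n hn h => hn ((hζ.pow_eq_one_iff_dvd n).1 h)
    fin_cases k
    · simpa using h1 1 (by norm_num)
    · simpa using h1 3 (by norm_num)
    · simpa using h1 9 (by norm_num)
  · intro i j l h
    rw [hc, hc, hc, ← pow_add, ← pow_add, hζ.pow_eq_one_iff_dvd] at h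
    exact phaseExponent_resonant i j l (Nat.mod_eq_zero_of_dvd h)

/-- The value of the quotient is read off at parameters `r α₀, r α₁, r α₂, d, d / r³` with `d² = c`
in the limit `r → 1`. With the common factor removed, the integral contributes
`12 (regGamma p q 1) ^ 3` and the product side `regGamma p q 1`. -/
theorem ratioIJ_withLast (hp : ‖p‖ < 1) (hp0 : p ≠ 0) (hq : ‖q‖ < 1) (hq0 : q ≠ 0)
    (hpq : ‖p‖ < ‖q‖ ^ 9) {c : ℂ} (hc : c ^ 2 = p * q) {a : Fin 4 → ℂ} (ha : a ∈ domainU0 p q) :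
    ratioIJ p q (withLast c a) = 12 / (qPoch p p ^ 2 * qPoch q q ^ 2) := by
  obtain ⟨α, h⟩ := exists_isPolePhase
  obtain ⟨d, hd⟩ := IsAlgClosed.exists_pow_nat_eq c two_pos
  have hc0 : c ≠ 0 := by
    rintro rfl
    exact mul_ne_zero hp0 hq0 (by rw [← hc]; norm_num)
  have hd0 : d ≠ 0 := by
    rintro rfl
    exact hc0 (by rw [← hd]; norm_num)
  have hd4 : (d ^ 2) ^ 2 = p * q := by rw [hd, hc]
  have hd1 : ‖d‖ < 1 := by
    have h1 : ‖d‖ ^ 4 < 1 := by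
      rw [← norm_pow, show d ^ 4 = (d ^ 2) ^ 2 by ring, hd4]
      exact norm_mul_lt_one hp hq.le
    exact lt_of_not_ge fun h => h1.not_ge (one_le_pow₀ h)
  have h0 : ∀ k, α k ≠ 0 := fun k => norm_ne_zero_iff.1 (by rw [h.norm_eq]; norm_num)
  have hV := degenerateValue_ne_zero hp hq h hd0 hd1 hd4
  have hG : regGamma p q 1 ≠ 0 := by
    rw [regGamma_one hp hq]
    exact inv_ne_zero (mul_ne_zero (qPoch_ne_zero hp hp) (qPoch_ne_zero hq hq))
  have hI := tendsto_torusMean_kernel hp hq h.norm_eq h.injective h.prod_eq h.resonant hd0 hd1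
  rw [regKernel_mul_poleResidue hp hq h.norm_eq h.injective h.ne_one h.prod_eq] at hI
  have hlim := hI.div (tendsto_productJ hp hq h hd0 hd1 hd4) (mul_ne_zero hG hV)
  have hr3 : ∀ᶠ r : ℝ in 𝓝[<] 1, ‖d‖ < r ^ 3 := by
    have hcont : ContinuousAt (fun ρ : ℝ => ρ ^ 3) 1 := by fun_prop
    exact (hcont.tendsto.eventually (lt_mem_nhds (by simpa using hd1))).filter_mono
      nhdsWithin_le_nhds
  have hconst := hlim.congr' (f₂ := fun _ => ratioIJ p q (withLast c a)) ?_
  · rw [tendsto_nhds_unique tendsto_const_nhds hconst, regGamma_one hp hq]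
    have hG' := (inv_ne_zero (mul_ne_zero (qPoch_ne_zero hp hp) (qPoch_ne_zero hq hq)))
    have hp' := qPoch_ne_zero hp hp
    have hq' := qPoch_ne_zero hq hq
    field_simp
  · filter_upwards [hr3, Ioo_mem_nhdsLT (zero_lt_one' ℝ)] with r hr3 hr
    have hne : 1 - (r : ℂ) ^ 3 ≠ 0 := one_sub_ne_zero (by
      rw [norm_pow, Complex.norm_real, Real.norm_of_nonneg hr.1.le]
      exact pow_lt_one₀ hr.1.le hr.2 three_ne_zero)
    have hrC : (r : ℂ) ≠ 0 := Complex.ofReal_ne_zero.2 hr.1.ne'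
    have hrn : ‖(r : ℂ)‖ = r := by rw [Complex.norm_real, Real.norm_of_nonneg hr.1.le]
    have hprod : (r : ℂ) * α 0 * (r * α 1) * (r * α 2) * d = r ^ 3 * d := by
      linear_combination (r : ℂ) ^ 3 * d * h.prod_eq
    have e : poleParam α d r = withLast c ![r * α 0, r * α 1, r * α 2, d] := by
      simp only [poleParam, withLast, Matrix.cons_val]
      rw [hprod, ← hd, sq, mul_div_mul_right _ _ hd0]
    have hmem : ![(r : ℂ) * α 0, r * α 1, r * α 2, d] ∈ domainU0 p q := by
      refine ⟨?_, ?_, ?_⟩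
      · intro i; fin_cases i
        exacts [mul_ne_zero hrC (h0 0), mul_ne_zero hrC (h0 1), mul_ne_zero hrC (h0 2), hd0]
      · have hlt : ∀ k, ‖(r : ℂ) * α k‖ < 1 := fun k => by
          rw [norm_mul, h.norm_eq, hrn, mul_one]; exact hr.2
        intro i; fin_cases i
        exacts [hlt 0, hlt 1, hlt 2, hd1]
      · rw [← norm_of_sq_eq hc, Fin.prod_univ_four]
        simp only [Matrix.cons_val]
        rw [hprod, ← hd, norm_pow, norm_mul, norm_pow, hrn, sq]
        exact mul_lt_mul_of_pos_right hr3 (norm_pos_iff.2 hd0)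
    rw [Pi.div_apply, mul_div_mul_left _ _ hne, e]
    exact ratioIJ_withLast_eq hp hp0 hq hq0 hpq hc hmem ha

end EllipticG2

namespace EllipticG2

variable {p q : ℂ}

/-! ### Meromorphic continuation -/

lemma isOpen_torusC4 : IsOpen torusC4 := by
  have : torusC4 = ⋂ i : Fin 4, {a : Fin 4 → ℂ | a i ≠ 0} := by
    ext a; simp [torusC4]
  rw [this]
  exact isOpen_iInter_of_finite fun i => isOpen_ne_fun (continuous_apply i) continuous_const

/-- On every ray of the torus `(ℂ*)⁴` the function `u` vanishes at countably many points only. -/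
def HasCountableZeros (u : (Fin 4 → ℂ) → ℂ) : Prop :=
  ∀ a ∈ torusC4, {s : ℝ | 0 < s ∧ u (fun i => s * a i) = 0}.Countable

lemma HasCountableZeros.mul {u v : (Fin 4 → ℂ) → ℂ} (hu : HasCountableZeros u)
    (hv : HasCountableZeros v) : HasCountableZeros fun a => u a * v a := fun a ha =>
  ((hu a ha).union (hv a ha)).mono fun _ hs =>
    (mul_eq_zero.1 hs.2).imp (fun h => ⟨hs.1, h⟩) fun h => ⟨hs.1, h⟩

lemma HasCountableZeros.prod {ι : Type*} {u : ι → (Fin 4 → ℂ) → ℂ} {t : Finset ι}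
    (hu : ∀ i ∈ t, HasCountableZeros (u i)) : HasCountableZeros fun a => ∏ i ∈ t, u i a := fun a ha =>
  (t.countable_toSet.biUnion fun i hi => hu i hi a ha).mono fun _ hs => by
    obtain ⟨i, hi, h⟩ := Finset.prod_eq_zero_iff.1 hs.2
    exact Set.mem_biUnion hi ⟨hs.1, h⟩

lemma HasCountableZeros.subset_closure {u : (Fin 4 → ℂ) → ℂ} (hu : HasCountableZeros u) :
    torusC4 ⊆ closure {a | a ∈ torusC4 ∧ u a ≠ 0} := by
  intro a ha
  have hd := (hu a ha).dense_compl ℝ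
  have h1 : (1 : ℝ) ∈ closure (Set.Ioi 0 ∩ {s : ℝ | 0 < s ∧ u (fun i => s * a i) = 0}ᶜ) :=
    (hd.open_subset_closure_inter isOpen_Ioi) (Set.mem_Ioi.2 zero_lt_one)
  have hc : Continuous fun (s : ℝ) (i : Fin 4) => (s : ℂ) * a i := by fun_prop
  have h2 := map_mem_closure hc h1 (t := {a | a ∈ torusC4 ∧ u a ≠ 0}) fun s hs =>
    ⟨fun i => mul_ne_zero (Complex.ofReal_ne_zero.2 (ne_of_gt hs.1)) (ha i),
      fun h => hs.2 ⟨hs.1, h⟩⟩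
  simpa using h2

lemma countable_pqPoch_zeros (hp : ‖p‖ < 1) (hq : ‖q‖ < 1) {k : ℤ} (hk : k ≠ 0)
    {v : ℂ} : {s : ℝ | 0 < s ∧ pqPoch ((s : ℂ) ^ k * v) p q = 0}.Countable := by
  refine (Set.countable_iUnion fun m : ℕ × ℕ => Set.Subsingleton.countable
    (s := {s : ℝ | 0 < s ∧ p ^ m.1 * q ^ m.2 * ((s : ℂ) ^ k * v) = 1}) ?_).mono ?_
  · rintro s ⟨hs, hs1⟩ t ⟨ht, ht1⟩
    have h0 : p ^ m.1 * q ^ m.2 * v ≠ 0 := by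
      intro h
      refine zero_ne_one (α := ℂ) ?_
      rw [← hs1]
      linear_combination (-(s : ℂ) ^ k) * h
    have e : (s : ℂ) ^ k = (t : ℂ) ^ k := mul_right_cancel₀ h0 (by linear_combination hs1 - ht1)
    exact (zpow_left_inj₀ hs.le ht.le hk).1 (by exact_mod_cast e)
  · rintro s ⟨hs, h⟩
    obtain ⟨m, hm⟩ := (pqPoch_eq_zero_iff hp hq).1 h
    exact Set.mem_iUnion.2 ⟨m, hs, hm⟩

/-- A product of powers of `a 0, …, a 3` of nonzero total degree, up to a constant factor. -/
structure IsMonomial (u : (Fin 4 → ℂ) → ℂ) (k : ℤ) : Prop where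
  ne_zero : ∀ a ∈ torusC4, u a ≠ 0
  differentiableAt : ∀ a ∈ torusC4, DifferentiableAt ℂ u a
  scale : ∀ (s : ℝ) (a : Fin 4 → ℂ), 0 < s → u (fun i => s * a i) = (s : ℂ) ^ k * u a

lemma IsMonomial.mul {u v : (Fin 4 → ℂ) → ℂ} {k m : ℤ} (hu : IsMonomial u k) (hv : IsMonomial v m) :
    IsMonomial (fun a => u a * v a) (k + m) where
  ne_zero a ha := mul_ne_zero (hu.ne_zero a ha) (hv.ne_zero a ha)
  differentiableAt a ha := (hu.differentiableAt a ha).mul (hv.differentiableAt a ha)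
  scale s a hs := by
    rw [hu.scale s a hs, hv.scale s a hs, zpow_add₀ (Complex.ofReal_ne_zero.2 hs.ne')]
    ring

lemma IsMonomial.const {c : ℂ} (hc : c ≠ 0) : IsMonomial (fun _ => c) 0 where
  ne_zero _ _ := hc
  differentiableAt _ _ := differentiableAt_const _
  scale s a hs := by simp

lemma IsMonomial.inv {u : (Fin 4 → ℂ) → ℂ} {k : ℤ} (hu : IsMonomial u k) :
    IsMonomial (fun a => (u a)⁻¹) (-k) where
  ne_zero a ha := inv_ne_zero (hu.ne_zero a ha)
  differentiableAt a ha := (hu.differentiableAt a ha).fun_inv (hu.ne_zero a ha)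
  scale s a hs := by rw [hu.scale s a hs, mul_inv, zpow_neg]

lemma IsMonomial.prod {ι : Type*} {u : ι → (Fin 4 → ℂ) → ℂ} {k : ι → ℤ}
    (hu : ∀ i, IsMonomial (u i) (k i)) (t : Finset ι) :
    IsMonomial (fun a => ∏ i ∈ t, u i a) (∑ i ∈ t, k i) := by
  classical
  induction t using Finset.induction_on with
  | empty => simpa using IsMonomial.const one_ne_zero
  | insert i s hi ih => simpa only [Finset.prod_insert hi, Finset.sum_insert hi] using (hu i).mul ih

lemma IsMonomial.hasCountableZeros (hp : ‖p‖ < 1) (hq : ‖q‖ < 1) {u : (Fin 4 → ℂ) → ℂ} {k : ℤ}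
    (hu : IsMonomial u k) (hk : k ≠ 0) : HasCountableZeros fun a => pqPoch (u a) p q := by
  refine fun a _ => (countable_pqPoch_zeros hp hq hk (v := u a)).mono ?_
  rintro s ⟨hs, h⟩
  exact ⟨hs, by rw [← hu.scale s a hs]; exact h⟩

lemma IsMonomial.differentiableAt_pqPoch (hp : ‖p‖ < 1) (hq : ‖q‖ < 1) {u : (Fin 4 → ℂ) → ℂ} {k : ℤ}
    (hu : IsMonomial u k) {a : Fin 4 → ℂ} (ha : a ∈ torusC4) :
    DifferentiableAt ℂ (fun a => pqPoch (u a) p q) a :=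
  DifferentiableAt.comp (g := fun u => pqPoch u p q) (f := u) a (differentiable_pqPoch hp hq (u a))
    (hu.differentiableAt a ha)

/-- The degrees of the components of `withLast c a` in `a`. -/
def lastDegree (k : Fin 5) : ℤ := if k = 4 then -4 else 1

lemma isMonomial_withLast {c : ℂ} (hc : c ≠ 0) (k : Fin 5) :
    IsMonomial (fun a => withLast c a k) (lastDegree k) := by
  have h1 : ∀ i : Fin 4, IsMonomial (fun a => a i) 1 := fun i =>
    ⟨fun a ha => ha i, fun a _ => by fun_prop, fun s a _ => by rw [zpow_one]⟩
  have h4 : IsMonomial (fun a => c * (∏ i : Fin 4, a i)⁻¹) (-4) := by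
    simpa using (IsMonomial.const hc).mul (IsMonomial.prod h1 Finset.univ).inv
  refine forall_fin_five (P := fun k => IsMonomial (fun a => withLast c a k) (lastDegree k))
    (fun i => ?_) ?_ k
  · have e : lastDegree i.castSucc = 1 := by revert i; decide
    simp only [withLast_castSucc, e]
    exact h1 i
  · simp only [withLast_four, div_eq_mul_inv]
    exact h4

/-- A product of at least one and at most four of the parameters is not homogeneous of degree `0`,
since the last parameter has degree `-4`. -/
lemma sum_lastDegree_ne_zero : ∀ s : Finset (Fin 5), s.card ≠ 0 → s.card ≠ 5 →
    ∑ k ∈ s, lastDegree k ≠ 0 := by decide +kernel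

/-- The product side continues to a meromorphic function of `(a 0, …, a 3)` on `(ℂ*)⁴`. -/
theorem isMeromorphicOn_productJ (hp : ‖p‖ < 1) (hp0 : p ≠ 0) (hq : ‖q‖ < 1) (hq0 : q ≠ 0) {c : ℂ}
    (hc : c ≠ 0) (b : ℂ) :
    IsMeromorphicOn (fun a => b * productJ p q (withLast c a)) torusC4 := by
  have hpq := IsMonomial.const (mul_ne_zero hp0 hq0)
  have h1 := isMonomial_withLast hc
  have h2 : ∀ i, IsMonomial (fun a => withLast c a i ^ 2) (2 * lastDegree i) := fun i => by
    simpa only [sq, two_mul] using (h1 i).mul (h1 i)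
  have hS := IsMonomial.prod h1
  have hdeg : ∀ i, lastDegree i ≠ 0 := by decide
  have hdS : ∀ m, m ≠ 0 → m ≠ 5 → ∀ s ∈ Finset.powersetCard m (Finset.univ : Finset (Fin 5)),
      ∑ k ∈ s, lastDegree k ≠ 0 := fun m h0 h5 s hs => by
    have := (Finset.mem_powersetCard.1 hs).2
    exact sum_lastDegree_ne_zero s (by omega) (by omega)
  have diff : ∀ {u : (Fin 4 → ℂ) → ℂ} {k : ℤ} (_ : IsMonomial u k) {a : Fin 4 → ℂ}
      (_ : a ∈ torusC4), DifferentiableAt ℂ (fun a => pqPoch (u a) p q) a ∧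
        DifferentiableAt ℂ (fun a => pqPoch (p * q * (u a)⁻¹) p q) a := fun hu a ha =>
    ⟨hu.differentiableAt_pqPoch hp hq ha, (hpq.mul hu.inv).differentiableAt_pqPoch hp hq ha⟩
  have cz : ∀ m, m ≠ 0 → m ≠ 5 → HasCountableZeros fun a =>
      ∏ s ∈ Finset.powersetCard m (Finset.univ : Finset (Fin 5)),
        pqPoch (∏ i ∈ s, withLast c a i) p q := fun m h0 h5 =>
    HasCountableZeros.prod fun s hs => (hS s).hasCountableZeros hp hq (hdS m h0 h5 s hs)
  refine fun x hx => ⟨torusC4, isOpen_torusC4, hx, fun a => b *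
    ((∏ i, pqPoch (p * q * (withLast c a i ^ 2)⁻¹) p q * pqPoch (withLast c a i) p q) *
    (∏ s ∈ Finset.powersetCard 2 (Finset.univ : Finset (Fin 5)),
      pqPoch (p * q * (∏ i ∈ s, withLast c a i)⁻¹) p q) *
    (∏ s ∈ Finset.powersetCard 3 (Finset.univ : Finset (Fin 5)),
      pqPoch (p * q * (∏ i ∈ s, withLast c a i)⁻¹) p q) *
    ∏ s ∈ Finset.powersetCard 4 (Finset.univ : Finset (Fin 5)),
      pqPoch (p * q * (∏ i ∈ s, withLast c a i)⁻¹) p q), fun a =>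
    (∏ i, pqPoch (withLast c a i ^ 2) p q * pqPoch (p * q * (withLast c a i)⁻¹) p q) *
    (∏ s ∈ Finset.powersetCard 2 (Finset.univ : Finset (Fin 5)),
      pqPoch (∏ i ∈ s, withLast c a i) p q) *
    (∏ s ∈ Finset.powersetCard 3 (Finset.univ : Finset (Fin 5)),
      pqPoch (∏ i ∈ s, withLast c a i) p q) *
    ∏ s ∈ Finset.powersetCard 4 (Finset.univ : Finset (Fin 5)),
      pqPoch (∏ i ∈ s, withLast c a i) p q, ?_, ?_, ?_, ?_⟩
  · intro a ha
    refine DifferentiableAt.differentiableWithinAt ?_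
    have d := fun m => differentiableAt_prod (Finset.powersetCard m (Finset.univ : Finset (Fin 5)))
      fun s _ => (diff (hS s) ha).2
    exact (differentiableAt_const b).mul ((((differentiableAt_prod _ fun i _ =>
      (diff (h2 i) ha).2.mul (diff (h1 i) ha).1).mul (d 2)).mul (d 3)).mul (d 4))
  · intro a ha
    refine DifferentiableAt.differentiableWithinAt ?_
    have d := fun m => differentiableAt_prod (Finset.powersetCard m (Finset.univ : Finset (Fin 5)))
      fun s _ => (diff (hS s) ha).1
    exact (((differentiableAt_prod _ fun i _ =>
      (diff (h2 i) ha).1.mul (diff (h1 i) ha).2).mul (d 2)).mul (d 3)).mul (d 4)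
  · refine HasCountableZeros.subset_closure (((HasCountableZeros.mul
      (HasCountableZeros.prod fun i _ => HasCountableZeros.mul ?_ ?_)
      (cz 2 (by decide) (by decide))).mul (cz 3 (by decide) (by decide))).mul
      (cz 4 (by decide) (by decide)))
    · exact (h2 i).hasCountableZeros hp hq (mul_ne_zero two_ne_zero (hdeg i))
    · exact (hpq.mul (h1 i).inv).hasCountableZeros hp hq (by simpa using hdeg i)
  · intro a _ _
    simp only [productJ, subsetGamma, ellGamma, div_div_div_eq, Finset.prod_div_distrib,
      div_mul_div_comm]
    ring

end EllipticG2

theorem theorem4p2 (p q : ℂ) (hp0 : p ≠ 0) (hp1 : ‖p‖ < 1) (hq0 : q ≠ 0) (hq1 : ‖q‖ < 1)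
    (hpq : ‖p‖ < ‖q‖ ^ 9) :
    ∃ b : ℂ, b = 12 / (EllipticG2.qPoch p p ^ 2 * EllipticG2.qPoch q q ^ 2) ∧
      ∀ c : ℂ, c ^ 2 = p * q →
        (∀ a ∈ EllipticG2.domainU0 p q,
          TorusIntegrable (EllipticG2.density p q (EllipticG2.withLast c a)) 0 1) ∧
        DifferentiableOn ℂ (fun a => EllipticG2.integralI p q (EllipticG2.withLast c a))
          (EllipticG2.domainU0 p q) ∧
        (∀ a ∈ EllipticG2.domainU0 p q,
          EllipticG2.integralI p q (EllipticG2.withLast c a) =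
            b * EllipticG2.productJ p q (EllipticG2.withLast c a)) ∧
        ∃ F : (Fin 4 → ℂ) → ℂ, EllipticG2.IsMeromorphicOn F EllipticG2.torusC4 ∧
          ∀ a ∈ EllipticG2.domainU0 p q,
            F a = EllipticG2.integralI p q (EllipticG2.withLast c a) := by
  refine ⟨_, rfl, fun c hc => ?_⟩
  have hc0 : c ≠ 0 := by
    rintro rfl
    exact mul_ne_zero hp0 hq0 (by rw [← hc]; norm_num)
  have hadm := fun (a : Fin 4 → ℂ) (ha : a ∈ EllipticG2.domainU0 p q) =>
    EllipticG2.isAdmissible_withLast hc hc0 ha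
  have hI := fun (a : Fin 4 → ℂ) (ha : a ∈ EllipticG2.domainU0 p q) =>
    EllipticG2.integralI_eq hp1 hq1 (hadm a ha).ne_zero (hadm a ha).norm_lt
  have heq : ∀ a ∈ EllipticG2.domainU0 p q,
      EllipticG2.integralI p q (EllipticG2.withLast c a) =
        12 / (EllipticG2.qPoch p p ^ 2 * EllipticG2.qPoch q q ^ 2) *
          EllipticG2.productJ p q (EllipticG2.withLast c a) := fun a ha => by
    have h := EllipticG2.ratioIJ_withLast hp1 hp0 hq1 hq0 hpq hc ha
    rw [EllipticG2.ratioIJ, div_eq_iff (EllipticG2.productJ_ne_zero hp1 hq1 (hadm a ha))] at h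
    rw [(hI a ha).2, h]
  refine ⟨fun a ha => (hI a ha).1, ?_, heq, _,
    EllipticG2.isMeromorphicOn_productJ hp1 hp0 hq1 hq0 hc0 _, fun a ha => (heq a ha).symm⟩
  refine DifferentiableOn.congr (fun a ha => DifferentiableAt.differentiableWithinAt ?_) heq
  exact (differentiableAt_const _).mul (EllipticG2.differentiableAt_productJ hp1 hq1 (hadm a ha)
    fun k => (EllipticG2.isMonomial_withLast hc0 k).differentiableAt a ha.1)
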